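/- **Diagrams.** A *cup diagram* is a partition of $\mathbb Z+\tfrac12$ into blocks of size at most $2$, finitely many of size $2$ (*cups*; the singletons are *rays*), such that if $\{i,j\}$ is a cup and $i<k<j$, then $k$ belongs to a cup $\{k,k'\}$ with $i<k'<j$. The *cap diagram* $\overline\lambda$ of a cup diagram $\underline\lambda$ is its mirror image in a horizontal axis shifted one to the right. A *crossingless matching* $t$ is a cap diagram drawn underneath a cup diagram, whose rays are joined by an order-preserving bijection so that outside a finite strip there are only vertical lines; $t^i$ denotes the one with one cap and one cup, both joining $i-\frac12$ and $i+\frac12$. Let $t^\ddagger$ be the horizontal mirror image of $t$ shifted one to the right, so $(t^i)^\ddagger=t^{i+1}$. For cup diagrams $\underline\lambda,\underline\mu$ and a finite sequence $\boldsymbol t=t_k\cdots t_1$ of crossingless matchings, the diagram $\underline\lambda\boldsymbol t\overline\mu$ is obtained by stacking from bottom to top. If $\underline\lambda$ has $k$ cups, the lower ends of its rays are redrawn, preserving the order and keeping far-out rays vertical, so as to avoid exactly $-k-\frac12,\dots,k-\frac32$; if $\overline\mu$ has $l$ caps, the upper ends of its rays are redrawn so as to avoid exactly $-l+\frac12,\dots,l-\frac12$.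 A line is *non-propagating* if both its ends are at the bottom or both at the top. The diagram is *orientable* if it contains no circle and every non-propagating line has one end on each side of the gap (centred at $-1$ at the bottom and at $0$ at the top; if the gap is empty, the sides are those of its centre). **Algebras and bimodules.** Let $\hat G_{\boldsymbol t}$ be the complex vector space with basis the orientable diagrams $\underline\lambda\boldsymbol t\overline\mu$, and let $K=\hat G_\emptyset$. The product $(\underline\lambda\boldsymbol u\overline\mu)(\underline{\mu'}\boldsymbol t\overline\nu)$ is $0$ if $\mu\ne\mu'$. If $\mu=\mu'$, draw the first diagram underneath the second, joining the rays of $\overline\mu$ to those of $\underline\mu$ in the order-preserving way (vertical far out), and remove the cups of $\underline\mu$ together with the corresponding caps of $\overline\mu$ one at a time (an outer cup before the cups inside it), the free points of the middle section being joined again in the order-preserving way after each step. The product is $\underline\lambda\boldsymbol u\boldsymbol t\overline\nu$ if all diagrams occurring in this process are orientable, and $0$ otherwise. Put $e_\lambda=\underline\lambda\overline\lambda$. For $n\ge0$ let $e\hat G_{\boldsymbol t}e$ be the span of the orientable diagrams with exactly $n$ cups in $\underline\lambda$ and $n$ caps in $\overline\mu$, let $\mathbb I_{\boldsymbol t}\subseteq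 e\hat G_{\boldsymbol t}e$ be the span of those containing a non-propagating line, and put $G_{\boldsymbol t}=e\hat G_{\boldsymbol t}e/\mathbb I_{\boldsymbol t}$ and $K_n=G_\emptyset=eKe/\mathbb I_\emptyset$. Modules $M$ are left modules compatible with the locally unital structure, $M=\bigoplus_\lambda e_\lambda M$ (over all cup diagrams for $K$, over those with $n$ cups for $K_n$). **Theorem.** With these products $K$ and $K_n$ are associative algebras, locally unital with orthogonal idempotents $e_\lambda$, and $\hat G_{\boldsymbol t}$ and $G_{\boldsymbol t}$ are well-defined bimodules over $K$ and $K_n$ respectively, so that for every crossingless matching $t$ there are functors $\hat\theta_t=\hat G_t\otimes_K\_$ on $K$-modules and $\theta_t=G_t\otimes_{K_n}\_$ on $K_n$-modules; write $\hat\theta_i=\hat\theta_{t^i}$ and $\theta_i=\theta_{t^i}$. Moreover: 1. For every crossingless matching $t$, $\hat\theta_{t^\ddagger}$ is left adjoint to $\hat\theta_t$ on $K$-modules. In particular $\hat\theta_{i+1}$ is left adjoint to $\hat\theta_i$ for all $i\in\mathbb Z$. 2. For every $n\ge 0$ and every crossingless matching $t$, $\theta_{t^\ddagger}$ is left adjoint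 to $\theta_t$ on $K_n$-modules. In particular $\theta_{i+1}$ is left adjoint to $\theta_i$ for all $i\in\mathbb Z$. Furthermore $\theta_t$ maps finite-dimensional modules to finite-dimensional modules, so the adjunction restricts to finite-dimensional $K_n$-modules. -/

import Mathlib

open CategoryTheory
open scoped TensorProduct

universe u

/-! ## Cup diagrams

The integer `p` stands for the half-integer position `p + 1/2`. -/

/-- A cup diagram: a partition of `ℤ + 1/2` into subsets of size at most two, finitely many of
size two, without crossings and without rays below cups.  It is recorded by the involution
exchanging the two elements of each block of size two and fixing the blocks of size one (rays). -/
@[ext]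
structure CupDiagram where
  partner : ℤ → ℤ
  partner_partner : ∀ p, partner (partner p) = p
  finite_moved : {p | partner p ≠ p}.Finite
  nested : ∀ p k, p < k → k < partner p →
    partner k ≠ k ∧ p < partner k ∧ partner k < partner p

namespace CupDiagram

/-- The set of endpoints of cups. -/
noncomputable def endpoints (c : CupDiagram) : Finset ℤ := c.finite_moved.toFinset

/-- The number of cups. -/
noncomputable def numCups (c : CupDiagram) : ℕ :=
  (c.endpoints.filter fun p => p < c.partner p).card

/-- The position `p` carries a vertical ray. -/
def IsRay (c : CupDiagram) (p : ℤ) : Prop := c.partner p = p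

/-- The order-preserving numbering of the rays by `ℤ` which is the identity far to the left.
(Far to the right it is `p ↦ p - 2 * c.numCups`.) -/
noncomputable def rayIndex (c : CupDiagram) (p : ℤ) : ℤ :=
  p - ((c.endpoints.filter fun q => q < p).card : ℤ)

/-- The translate of all arcs by one to the right. The cap diagram attached to the cup diagram `c`
is the mirror image of `c` in a horizontal axis, shifted one to the right; hence its caps occupy the
positions of the arcs of `c.shift`. -/
def shift (c : CupDiagram) : CupDiagram where
  partner p := c.partner (p - 1) + 1
  partner_partner p := by simp [c.partner_partner]
  finite_moved := by
    refine (c.finite_moved.image fun p => p + 1).subset ?_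
    intro p hp
    refine ⟨p - 1, ?_, by simp⟩
    intro h
    exact hp (by simp only [h]; ring)
  nested p k h1 h2 := by
    have := c.nested (p - 1) (k - 1) (by omega) (by omega)
    refine ⟨fun h => this.1 (by omega), by omega, by omega⟩

/-- Keep only the cups whose left endpoint is at a position `≥ x`. -/
def tail (c : CupDiagram) (x : ℤ) : CupDiagram where
  partner p := if x ≤ p ∧ x ≤ c.partner p then c.partner p else p
  partner_partner p := by
    by_cases h : x ≤ p ∧ x ≤ c.partner p
    · rw [if_pos h, if_pos (by rw [c.partner_partner]; exact h.symm), c.partner_partner]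
    · rw [if_neg h, if_neg h]
  finite_moved := by
    refine c.finite_moved.subset ?_
    intro p hp h
    apply hp
    simp only [h, ite_self]
  nested p k h1 h2 := by
    by_cases h : x ≤ p ∧ x ≤ c.partner p
    · rw [if_pos h] at h2 ⊢
      have := c.nested p k h1 h2
      rw [if_pos (by omega)]
      exact this
    · rw [if_neg h] at h2
      omega

theorem mem_endpoints (c : CupDiagram) (p : ℤ) : p ∈ c.endpoints ↔ c.partner p ≠ p := by
  simp [endpoints]

theorem numCups_shift (c : CupDiagram) : c.shift.numCups = c.numCups := by
  unfold numCups
  refine Finset.card_bij' (fun p _ => p - 1) (fun p _ => p + 1) ?_ ?_ ?_ ?_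
  · intro p hp
    rw [Finset.mem_filter, mem_endpoints] at hp ⊢
    have h : c.shift.partner p = c.partner (p - 1) + 1 := rfl
    rw [h] at hp
    exact ⟨fun h' => hp.1 (by omega), by omega⟩
  · intro p hp
    rw [Finset.mem_filter, mem_endpoints] at hp ⊢
    have h : c.shift.partner (p + 1) = c.partner p + 1 := by
      change c.partner (p + 1 - 1) + 1 = _
      rw [add_sub_cancel_right]
    rw [h]
    exact ⟨fun h' => hp.1 (by omega), by omega⟩
  · intro p _; ring
  · intro p _; ring

/-- Redraw a cup diagram with `k` cups such that the lower ends of its rays avoid exactly the `2k`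
positions `-k-1/2, …, k-3/2`, preserving the order and keeping rays far out vertical.
`BottomLeft c p` says that the ray at `p` then ends to the left of this gap. -/
def BottomLeft (c : CupDiagram) (p : ℤ) : Prop := c.rayIndex p < -(c.numCups : ℤ) - 1

/-- Redraw the cap diagram of `c` with `k` caps such that the upper ends of its rays avoid exactly
the `2k` positions `-k+1/2, …, k-1/2`. `TopLeft c p` says that the ray of this cap diagram at `p`
then ends to the left of this gap. -/
def TopLeft (c : CupDiagram) (p : ℤ) : Prop := c.shift.rayIndex p < -(c.numCups : ℤ)

end CupDiagram

/-! ## Crossingless matchings and generalized circle diagrams -/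

/-- A crossingless matching: caps at the bottom line (the arcs of `bot`), cups at the top line (the
arcs of `top`), and rays joined by the order-preserving bijection that is vertical far out. Such a
bijection exists exactly when the numbers of caps and cups agree. -/
@[ext]
structure Matching where
  bot : CupDiagram
  top : CupDiagram
  numCups_eq : bot.numCups = top.numCups

namespace Matching

/-- The ray at the bottom position `p` is joined to the ray at the top position `q`. -/
def Joins (t : Matching) (p q : ℤ) : Prop :=
  t.bot.IsRay p ∧ t.top.IsRay q ∧ t.bot.rayIndex p = t.top.rayIndex q

/-- The horizontal mirror image of `t` (bottom and top exchanged), shifted one to the right. -/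
def ddagger (t : Matching) : Matching where
  bot := t.top.shift
  top := t.bot.shift
  numCups_eq := by rw [CupDiagram.numCups_shift, CupDiagram.numCups_shift, t.numCups_eq]

end Matching

/-- The cup diagram with a single cup, joining `i - 1/2` and `i + 1/2`. -/
def singleCup (i : ℤ) : CupDiagram where
  partner p := if p = i - 1 then i else if p = i then i - 1 else p
  partner_partner p := by
    split_ifs <;> omega
  finite_moved := by
    refine (Set.toFinite {i - 1, i}).subset ?_
    intro p hp
    simp only [Set.mem_insert_iff, Set.mem_singleton_iff]
    by_contra h
    push Not at h
    exact hp (by simp [h.1, h.2])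
  nested p k h1 h2 := by
    exfalso
    split_ifs at h2 <;> omega

/-- The special crossingless matching `t^i`, with one cap and one cup, both joining `i - 1/2` and
`i + 1/2`. -/
def specialMatching (i : ℤ) : Matching where
  bot := singleCup i
  top := singleCup i
  numCups_eq := rfl

/-- The generalized circle diagram `a t_k ⋯ t_1 b̄`, where `ts = [t_k, …, t_1]` is listed from bottom
to top and `b̄` is the cap diagram of `b`. Its vertices are the positions `(l, p)` on the horizontal
lines `l = 0, …, ts.length`; `Strand` lists the pieces of curves between them. -/
inductive Strand (a : CupDiagram) (ts : List Matching) (b : CupDiagram) : ℕ × ℤ → ℕ × ℤ → Prop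
  | cup (p : ℤ) : Strand a ts b (0, p) (0, a.partner p)
  | cap (p : ℤ) : Strand a ts b (ts.length, p) (ts.length, b.shift.partner p)
  | layerCap (i : ℕ) (t : Matching) (h : ts[i]? = some t) (p : ℤ) :
      Strand a ts b (i, p) (i, t.bot.partner p)
  | layerCup (i : ℕ) (t : Matching) (h : ts[i]? = some t) (p : ℤ) :
      Strand a ts b (i + 1, p) (i + 1, t.top.partner p)
  | layerLine (i : ℕ) (t : Matching) (h : ts[i]? = some t) (p q : ℤ) (hpq : t.Joins p q) :
      Strand a ts b (i, p) (i + 1, q)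

/-- Two vertices lie on the same connected component (line or circle). -/
def SameLine (a : CupDiagram) (ts : List Matching) (b : CupDiagram) : ℕ × ℤ → ℕ × ℤ → Prop :=
  Relation.EqvGen (Strand a ts b)

/-- `p` and `q` are the two ends of a non-propagating line ending at the bottom. -/
def NonPropBottom (a : CupDiagram) (ts : List Matching) (b : CupDiagram) (p q : ℤ) : Prop :=
  a.IsRay p ∧ a.IsRay q ∧ p ≠ q ∧ SameLine a ts b (0, p) (0, q)

/-- `p` and `q` are the two ends of a non-propagating line ending at the top. -/
def NonPropTop (a : CupDiagram) (ts : List Matching) (b : CupDiagram) (p q : ℤ) : Prop :=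
  b.shift.IsRay p ∧ b.shift.IsRay q ∧ p ≠ q ∧ SameLine a ts b (ts.length, p) (ts.length, q)

/-- There is a non-propagating line. -/
def HasNonPropagating (a : CupDiagram) (ts : List Matching) (b : CupDiagram) : Prop :=
  (∃ p q, NonPropBottom a ts b p q) ∨ ∃ p q, NonPropTop a ts b p q

/-- Orientability: there is no circle (every component contains a ray going to the bottom or to the
top), and every non-propagating line has one end on each side. -/
structure Orientable (a : CupDiagram) (ts : List Matching) (b : CupDiagram) : Prop where
  no_circle : ∀ l ≤ ts.length, ∀ p : ℤ,
    (∃ q, a.IsRay q ∧ SameLine a ts b (l, p) (0, q)) ∨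
      ∃ q, b.shift.IsRay q ∧ SameLine a ts b (l, p) (ts.length, q)
  bottom : ∀ p q, NonPropBottom a ts b p q → (a.BottomLeft p ↔ ¬ a.BottomLeft q)
  top : ∀ p q, NonPropTop a ts b p q → (b.TopLeft p ↔ ¬ b.TopLeft q)

/-! ## Surgery -/

/-- The middle section between the cap diagram of `m` (below) and the cup diagram `m` (above) after
the surgeries at all cups with left endpoint `< x` have been performed. A surgery at a cup deletes
this cup and the corresponding cap, and afterwards the free points are again joined in the
order-preserving way. So for small `x` this is the full middle section, and for large `x` it consists
of vertical lines. Increasing `x` performs the surgeries from left to right, in particular an outer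
cup before the cups nested in it. -/
noncomputable def surgeryStage (m : CupDiagram) (x : ℤ) : Matching where
  bot := (m.tail x).shift
  top := m.tail x
  numCups_eq := CupDiagram.numCups_shift _

/-- The formal vector space in which a pair `(a, b)` stands for a diagram `a t b̄`. -/
abbrev DiagramSpace : Type := CupDiagram × CupDiagram →₀ ℂ

noncomputable instance : AddCommGroup DiagramSpace := Finsupp.instAddCommGroup

open Classical in
/-- The product `(a us b̄)(c ts d̄)` of basis vectors: zero unless `b = c`, zero if some intermediate
diagram of the surgery is not orientable, and otherwise the final diagram `a us ts d̄`. -/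
noncomputable def surgeryBasis (us ts : List Matching) (x y : CupDiagram × CupDiagram) :
    DiagramSpace :=
  if x.2 = y.1 ∧ (∀ s : ℤ, Orientable x.1 (us ++ surgeryStage x.2 s :: ts) y.2) ∧
      Orientable x.1 (us ++ ts) y.2
  then Finsupp.single (x.1, y.2) 1 else 0

/-- The bilinear extension of `surgeryBasis`. -/
noncomputable def surgery (us ts : List Matching) :
    DiagramSpace →ₗ[ℂ] DiagramSpace →ₗ[ℂ] DiagramSpace :=
  Finsupp.linearCombination ℂ fun x =>
    Finsupp.linearCombination ℂ fun y => surgeryBasis us ts x y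

/-- The space `Ĝ_t` with basis the orientable diagrams `a ts b̄`. For `ts = []` this is the Khovanov
algebra `K` of type `P`, as a vector space. -/
noncomputable def GHat (ts : List Matching) : Submodule ℂ DiagramSpace :=
  Finsupp.supported ℂ ℂ {x | Orientable x.1 ts x.2}

/-- The truncation `e Ĝ_t e` to diagrams with exactly `n` cups in the cup diagram and `n` caps in the
cap diagram. -/
noncomputable def GTrunc (n : ℕ) (ts : List Matching) : Submodule ℂ DiagramSpace :=
  Finsupp.supported ℂ ℂ {x | Orientable x.1 ts x.2 ∧ x.1.numCups = n ∧ x.2.numCups = n}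

/-- The subspace `I_t` of `e Ĝ_t e` spanned by the diagrams with a non-propagating line. -/
noncomputable def INonProp (n : ℕ) (ts : List Matching) : Submodule ℂ DiagramSpace :=
  Finsupp.supported ℂ ℂ {x | (Orientable x.1 ts x.2 ∧ x.1.numCups = n ∧ x.2.numCups = n) ∧
    HasNonPropagating x.1 ts x.2}

/-- The quotient `G_t = e Ĝ_t e / I_t`. For `ts = []` this is `K_n = e K e / I_n`. -/
abbrev GQuot (n : ℕ) (ts : List Matching) : Type :=
  ↥(GTrunc n ts) ⧸ (INonProp n ts).submoduleOf (GTrunc n ts)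

theorem surgery_mem_of {us ts : List Matching} {P Q R : Set (CupDiagram × CupDiagram)}
    (h : ∀ x ∈ P, ∀ y ∈ Q, surgeryBasis us ts x y ∈ Finsupp.supported ℂ ℂ R)
    {x y : DiagramSpace} (hx : x ∈ Finsupp.supported ℂ ℂ P) (hy : y ∈ Finsupp.supported ℂ ℂ Q) :
    surgery us ts x y ∈ Finsupp.supported ℂ ℂ R := by
  rw [surgery, Finsupp.linearCombination_apply, Finsupp.sum, LinearMap.sum_apply]
  refine Submodule.sum_mem _ fun i hi => ?_
  rw [LinearMap.smul_apply, Finsupp.linearCombination_apply, Finsupp.sum]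
  refine Submodule.smul_mem _ _ (Submodule.sum_mem _ fun j hj => Submodule.smul_mem _ _ ?_)
  exact h i (hx hi) j (hy hj)

theorem surgery_mem_GHat {us ts rs : List Matching} (hr : us ++ ts = rs) {x y : DiagramSpace}
    (hx : x ∈ GHat us) (hy : y ∈ GHat ts) : surgery us ts x y ∈ GHat rs := by
  refine surgery_mem_of (fun i _ j _ => ?_) hx hy
  unfold surgeryBasis
  split_ifs with h
  · exact Finsupp.single_mem_supported ℂ _ (hr ▸ h.2.2)
  · exact Submodule.zero_mem _

theorem surgery_mem_GTrunc {n : ℕ} {us ts rs : List Matching} (hr : us ++ ts = rs)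
    {x y : DiagramSpace} (hx : x ∈ GTrunc n us) (hy : y ∈ GTrunc n ts) :
    surgery us ts x y ∈ GTrunc n rs := by
  refine surgery_mem_of (fun i hi j hj => ?_) hx hy
  unfold surgeryBasis
  split_ifs with h
  · exact Finsupp.single_mem_supported ℂ _ ⟨hr ▸ h.2.2, hi.2.1, hj.2.2⟩
  · exact Submodule.zero_mem _

theorem GTrunc_le_GHat (n : ℕ) (ts : List Matching) : GTrunc n ts ≤ GHat ts :=
  Finsupp.supported_mono fun _ h => h.1

/-- The diagram `a b̄` as a vector. For `a = b = l` this is the idempotent `e_l`. -/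
noncomputable def diag (a b : CupDiagram) : DiagramSpace := Finsupp.single (a, b) 1

/-- The facts which make the above multiplication turn `K` into a locally unital associative algebra
with orthogonal idempotents `e_l`, every `Ĝ_t` into a `K`-`K`-bimodule, and every `I_t` into a
subbimodule of `e Ĝ_t e` containing `I_n (e Ĝ_t e)` and `(e Ĝ_t e) I_n`. -/
structure SurgeryWellDefined : Prop where
  idem_orientable : ∀ a, Orientable a [] a
  idem_mul : ∀ (ts : List Matching) a b, Orientable a ts b →
    surgery [] ts (diag a a) (diag a b) = diag a b
  mul_idem : ∀ (ts : List Matching) a b, Orientable a ts b →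
    surgery ts [] (diag a b) (diag b b) = diag a b
  assoc_left : ∀ (ts : List Matching), ∀ x ∈ GHat [], ∀ y ∈ GHat [], ∀ z ∈ GHat ts,
    surgery [] ts (surgery [] [] x y) z = surgery [] ts x (surgery [] ts y z)
  assoc_mid : ∀ (ts : List Matching), ∀ x ∈ GHat [], ∀ y ∈ GHat ts, ∀ z ∈ GHat [],
    surgery ts [] (surgery [] ts x y) z = surgery [] ts x (surgery ts [] y z)
  assoc_right : ∀ (ts : List Matching), ∀ x ∈ GHat ts, ∀ y ∈ GHat [], ∀ z ∈ GHat [],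
    surgery ts [] (surgery ts [] x y) z = surgery ts [] x (surgery [] [] y z)
  ideal_left : ∀ (n : ℕ) (ts : List Matching), ∀ x ∈ GTrunc n [], ∀ y ∈ GTrunc n ts,
    x ∈ INonProp n [] ∨ y ∈ INonProp n ts → surgery [] ts x y ∈ INonProp n ts
  ideal_right : ∀ (n : ℕ) (ts : List Matching), ∀ x ∈ GTrunc n ts, ∀ y ∈ GTrunc n [],
    x ∈ INonProp n ts ∨ y ∈ INonProp n [] → surgery ts [] x y ∈ INonProp n ts

/-! ## Locally unital algebras, their modules and bimodules, and tensor functors -/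

/-- A locally unital associative algebra structure on `A`: orthogonal idempotents `e i` with
`A = ⨁ e_i A e_j`. (The sum is automatically direct.) -/
structure LocUnitalAlgebra (ι A : Type) [AddCommGroup A] [Module ℂ A] where
  mul : A →ₗ[ℂ] A →ₗ[ℂ] A
  e : ι → A
  mul_assoc : ∀ a b c, mul (mul a b) c = mul a (mul b c)
  e_mul_self : ∀ i, mul (e i) (e i) = e i
  e_mul_ne : ∀ i j, i ≠ j → mul (e i) (e j) = 0
  complete : ⨆ (i : ι) (j : ι), LinearMap.range (mul (e i) ∘ₗ mul.flip (e j)) = ⊤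

section LocUnital

variable {ι A : Type} [AddCommGroup A] [Module ℂ A]

/-- A left module `M` compatible with the locally unital structure, `M = ⨁ e_i M`. -/
structure LUModule (R : LocUnitalAlgebra ι A) : Type (u + 1) where
  carrier : Type u
  [addCommGroup : AddCommGroup carrier]
  [module : Module ℂ carrier]
  act : A →ₗ[ℂ] carrier →ₗ[ℂ] carrier
  act_mul : ∀ a b m, act (R.mul a b) m = act a (act b m)
  unital : ⨆ i : ι, LinearMap.range (act (R.e i)) = ⊤

attribute [instance] LUModule.addCommGroup LUModule.module

variable {R : LocUnitalAlgebra ι A}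

/-- The sum `M = ∑ e_i M` is direct. -/
theorem LUModule.isInternal [DecidableEq ι] (M : LUModule.{u} R) :
    DirectSum.IsInternal fun i => LinearMap.range (M.act (R.e i)) := by
  rw [DirectSum.isInternal_submodule_iff_iSupIndep_and_iSup_eq_top]
  refine ⟨fun i => ?_, M.unital⟩
  rw [Submodule.disjoint_def]
  rintro x ⟨m, rfl⟩ hx
  have h0 : ⨆ j, ⨆ (_ : j ≠ i), LinearMap.range (M.act (R.e j)) ≤
      LinearMap.ker (M.act (R.e i)) := by
    refine iSup₂_le fun j hj => ?_
    rintro _ ⟨y, rfl⟩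
    rw [LinearMap.mem_ker, ← M.act_mul, R.e_mul_ne i j hj.symm]
    simp
  have h1 := h0 hx
  rwa [LinearMap.mem_ker, ← M.act_mul, R.e_mul_self] at h1

/-- Homomorphisms of modules. -/
@[ext]
structure LUModule.Hom (M N : LUModule.{u} R) where
  toLin : M.carrier →ₗ[ℂ] N.carrier
  map_act : ∀ a m, toLin (M.act a m) = N.act a (toLin m)

/-- The category of locally unital left modules. -/
instance LUModule.category : Category (LUModule.{u} R) where
  Hom M N := LUModule.Hom M N
  id M := ⟨LinearMap.id, fun _ _ => rfl⟩
  comp f g := ⟨g.toLin ∘ₗ f.toLin, fun a m => by simp [f.map_act, g.map_act]⟩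

/-- A bimodule `G`, locally unital on the left (`right a g` is `g · a`). -/
structure LUBimodule (R : LocUnitalAlgebra ι A) (G : Type) [AddCommGroup G] [Module ℂ G] where
  left : A →ₗ[ℂ] G →ₗ[ℂ] G
  right : A →ₗ[ℂ] G →ₗ[ℂ] G
  left_mul : ∀ a b g, left (R.mul a b) g = left a (left b g)
  right_mul : ∀ a b g, right (R.mul a b) g = right b (right a g)
  left_right : ∀ a b g, right b (left a g) = left a (right b g)
  left_unital : ⨆ i : ι, LinearMap.range (left (R.e i)) = ⊤
  right_unital : ⨆ i : ι, LinearMap.range (right (R.e i)) = ⊤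

variable {G : Type} [AddCommGroup G] [Module ℂ G]

namespace LUBimodule

/-- The relations `g a ⊗ m - g ⊗ a m` defining the tensor product over the algebra. -/
noncomputable def balanced (B : LUBimodule R G) (M : LUModule.{u} R) :
    Submodule ℂ (G ⊗[ℂ] M.carrier) :=
  Submodule.span ℂ {z | ∃ a g m, z = B.right a g ⊗ₜ[ℂ] m - g ⊗ₜ[ℂ] M.act a m}

/-- The underlying space of the tensor product over the algebra. -/
abbrev TensorCarrier (B : LUBimodule R G) (M : LUModule.{u} R) : Type u :=
  (G ⊗[ℂ] M.carrier) ⧸ B.balanced M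

theorem balanced_le_left (B : LUBimodule R G) (M : LUModule.{u} R) (a : A) :
    B.balanced M ≤ (B.balanced M).comap ((B.left a).rTensor M.carrier) := by
  refine Submodule.span_le.2 ?_
  rintro _ ⟨b, g, m, rfl⟩
  refine Submodule.subset_span ⟨b, B.left a g, m, ?_⟩
  simp [B.left_right]

/-- The left action on the tensor product. -/
noncomputable def tensorAct (B : LUBimodule R G) (M : LUModule.{u} R) :
    A →ₗ[ℂ] B.TensorCarrier M →ₗ[ℂ] B.TensorCarrier M where
  toFun a := (B.balanced M).mapQ (B.balanced M) ((B.left a).rTensor M.carrier)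
    (B.balanced_le_left M a)
  map_add' a b := by
    refine Submodule.linearMap_qext _ (TensorProduct.ext' fun g m => ?_)
    simp
  map_smul' c a := by
    refine Submodule.linearMap_qext _ (TensorProduct.ext' fun g m => ?_)
    simp [TensorProduct.smul_tmul', ← Submodule.Quotient.mk_smul]

theorem tensorAct_mk (B : LUBimodule R G) (M : LUModule.{u} R) (a : A) (g : G) (m : M.carrier) :
    B.tensorAct M a (Submodule.Quotient.mk (g ⊗ₜ[ℂ] m)) =
      Submodule.Quotient.mk (B.left a g ⊗ₜ[ℂ] m) := rfl

/-- The module `G ⊗_R M`. -/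
noncomputable def tensorObj (B : LUBimodule R G) (M : LUModule.{u} R) : LUModule.{u} R where
  carrier := B.TensorCarrier M
  act := B.tensorAct M
  act_mul a b z := by
    have : B.tensorAct M (R.mul a b) = B.tensorAct M a ∘ₗ B.tensorAct M b := by
      refine Submodule.linearMap_qext _ (TensorProduct.ext' fun g m => ?_)
      simp [tensorAct_mk, B.left_mul]
    rw [this, LinearMap.comp_apply]
  unital := by
    rw [eq_top_iff]
    rintro z -
    obtain ⟨w, rfl⟩ := Submodule.Quotient.mk_surjective _ z
    induction w with
    | zero => exact Submodule.zero_mem _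
    | add x y hx hy => exact Submodule.add_mem _ hx hy
    | tmul g m =>
      have hg : g ∈ ⨆ i : ι, LinearMap.range (B.left (R.e i)) := by
        rw [B.left_unital]; trivial
      let f : G →ₗ[ℂ] B.TensorCarrier M :=
        (B.balanced M).mkQ ∘ₗ (TensorProduct.mk ℂ G M.carrier).flip m
      have hle : ⨆ i : ι, LinearMap.range (B.left (R.e i)) ≤
          (⨆ i : ι, LinearMap.range (B.tensorAct M (R.e i))).comap f := by
        refine iSup_le fun i => ?_
        rintro _ ⟨g', rfl⟩
        exact Submodule.mem_iSup_of_mem i ⟨Submodule.Quotient.mk (g' ⊗ₜ[ℂ] m), rfl⟩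
      exact hle hg

theorem balanced_le_map (B : LUBimodule R G) {M N : LUModule.{u} R} (f : LUModule.Hom M N) :
    B.balanced M ≤ (B.balanced N).comap (f.toLin.lTensor G) := by
  refine Submodule.span_le.2 ?_
  rintro _ ⟨b, g, m, rfl⟩
  refine Submodule.subset_span ⟨b, g, f.toLin m, ?_⟩
  simp [f.map_act]

/-- The map `G ⊗_R f`. -/
noncomputable def tensorMap (B : LUBimodule R G) {M N : LUModule.{u} R} (f : LUModule.Hom M N) :
    LUModule.Hom (B.tensorObj M) (B.tensorObj N) where
  toLin := (B.balanced M).mapQ (B.balanced N) (f.toLin.lTensor G) (B.balanced_le_map f)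
  map_act a z := by
    have : (B.balanced M).mapQ (B.balanced N) (f.toLin.lTensor G) (B.balanced_le_map f) ∘ₗ
        B.tensorAct M a = B.tensorAct N a ∘ₗ
          (B.balanced M).mapQ (B.balanced N) (f.toLin.lTensor G) (B.balanced_le_map f) :=
      Submodule.linearMap_qext _ (TensorProduct.ext' fun g m => rfl)
    exact LinearMap.congr_fun this z

/-- The functor `G ⊗_R _` on locally unital modules. -/
noncomputable def tensorFunctor (B : LUBimodule R G) : LUModule.{u} R ⥤ LUModule.{u} R where
  obj M := B.tensorObj M
  map f := B.tensorMap f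
  map_id M := by
    refine LUModule.Hom.ext ?_
    exact Submodule.linearMap_qext _ (TensorProduct.ext' fun g m => rfl)
  map_comp f g := by
    refine LUModule.Hom.ext ?_
    exact Submodule.linearMap_qext _ (TensorProduct.ext' fun g m => rfl)

end LUBimodule

end LocUnital

/-! ## The algebras `K` and `K_n`, geometric bimodules and projective functors -/

section Bilinear

variable {V : Type} [AddCommGroup V] [Module ℂ V]

/-- Restriction of a bilinear map to submodules. -/
noncomputable def restrictBilin (B : V →ₗ[ℂ] V →ₗ[ℂ] V) (P Q R : Submodule ℂ V)
    (h : ∀ x ∈ P, ∀ y ∈ Q, B x y ∈ R) : P →ₗ[ℂ] Q →ₗ[ℂ] R :=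
  LinearMap.mk₂ ℂ (fun x y => ⟨B x y, h x x.2 y y.2⟩)
    (fun x x' y => Subtype.ext (by simp)) (fun c x y => Subtype.ext (by simp))
    (fun x y y' => Subtype.ext (by simp)) (fun c x y => Subtype.ext (by simp))

/-- The bilinear map induced on quotients of submodules. -/
noncomputable def quotBilin (B : V →ₗ[ℂ] V →ₗ[ℂ] V) (P Q R P' Q' R' : Submodule ℂ V)
    (h : ∀ x ∈ P, ∀ y ∈ Q, B x y ∈ R)
    (h' : ∀ x ∈ P, ∀ y ∈ Q, x ∈ P' ∨ y ∈ Q' → B x y ∈ R') :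
    (P ⧸ P'.submoduleOf P) →ₗ[ℂ] (Q ⧸ Q'.submoduleOf Q) →ₗ[ℂ] (R ⧸ R'.submoduleOf R) :=
  (P'.submoduleOf P).liftQ
    { toFun := fun x => (Q'.submoduleOf Q).mapQ (R'.submoduleOf R) (restrictBilin B P Q R h x)
        fun y hy => h' x x.2 y y.2 (Or.inr hy)
      map_add' := fun x x' => by
        refine Submodule.linearMap_qext _ (LinearMap.ext fun y => ?_)
        exact congrArg Submodule.Quotient.mk
          (LinearMap.congr_fun (map_add (restrictBilin B P Q R h) x x') y)
      map_smul' := fun c x => by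
        refine Submodule.linearMap_qext _ (LinearMap.ext fun y => ?_)
        exact congrArg Submodule.Quotient.mk
          (LinearMap.congr_fun (map_smul (restrictBilin B P Q R h) c x) y) }
    (fun x hx => by
      rw [LinearMap.mem_ker]
      refine Submodule.linearMap_qext _ (LinearMap.ext fun y => ?_)
      exact (Submodule.Quotient.mk_eq_zero _).2 (h' x x.2 y y.2 (Or.inl hx)))

end Bilinear

theorem eq_top_of_diag_mem {s : Set (CupDiagram × CupDiagram)} {W : Submodule ℂ DiagramSpace}
    (hW : W = Finsupp.supported ℂ ℂ s) (S : Submodule ℂ ↥W)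
    (h : ∀ (a b : CupDiagram), (a, b) ∈ s → ∀ hd : diag a b ∈ W, (⟨diag a b, hd⟩ : ↥W) ∈ S) :
    S = ⊤ := by
  rw [eq_top_iff]
  rintro ⟨x, hx⟩ -
  have key : W ≤ S.map W.subtype := by
    refine hW.le.trans ?_
    refine (Finsupp.supported_eq_span_single ℂ s).le.trans (Submodule.span_le.2 ?_)
    rintro _ ⟨⟨a, b⟩, hab, rfl⟩
    have hd : diag a b ∈ W := by
      rw [hW]; exact Finsupp.single_mem_supported ℂ _ hab
    exact ⟨_, h a b hab hd, rfl⟩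
  obtain ⟨y, hy, hyx⟩ := key hx
  have : y = ⟨x, hx⟩ := Subtype.ext hyx
  rwa [← this]

theorem surgery_diag (us ts : List Matching) (a b c d : CupDiagram) :
    surgery us ts (diag a b) (diag c d) = surgeryBasis us ts (a, b) (c, d) := by
  simp [surgery, diag]

theorem surgery_diag_ne (us ts : List Matching) (a b c d : CupDiagram) (h : b ≠ c) :
    surgery us ts (diag a b) (diag c d) = 0 := by
  rw [surgery_diag, surgeryBasis, if_neg fun h' => h h'.1]

/-- The Khovanov algebra `K` of type `P`. -/
noncomputable def khovanovAlgebra (h : SurgeryWellDefined) :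
    LocUnitalAlgebra CupDiagram ↥(GHat []) where
  mul := restrictBilin (surgery [] []) (GHat []) (GHat []) (GHat [])
    fun _ hx _ hy => surgery_mem_GHat rfl hx hy
  e l := ⟨diag l l, Finsupp.single_mem_supported ℂ _ (h.idem_orientable l)⟩
  mul_assoc x y z := Subtype.ext (h.assoc_left [] x x.2 y y.2 z z.2)
  e_mul_self l := Subtype.ext (h.idem_mul [] l l (h.idem_orientable l))
  e_mul_ne i j hij := Subtype.ext (surgery_diag_ne [] [] i i j j hij)
  complete := by
    refine eq_top_of_diag_mem (W := GHat _) rfl _ fun a b hab hd => ?_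
    refine Submodule.mem_iSup_of_mem a (Submodule.mem_iSup_of_mem b ⟨⟨diag a b, hd⟩, ?_⟩)
    refine Subtype.ext ?_
    change surgery [] [] (diag a a) (surgery [] [] (diag a b) (diag b b)) = diag a b
    rw [h.mul_idem [] a b hab, h.idem_mul [] a b hab]

/-- The `K`-`K`-bimodule `Ĝ_t`. -/
noncomputable def geomBimoduleHat (h : SurgeryWellDefined) (ts : List Matching) :
    LUBimodule (khovanovAlgebra h) ↥(GHat ts) where
  left := restrictBilin (surgery [] ts) (GHat []) (GHat ts) (GHat ts)
    fun _ hx _ hy => surgery_mem_GHat rfl hx hy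
  right := (restrictBilin (surgery ts []) (GHat ts) (GHat []) (GHat ts)
    fun _ hx _ hy => surgery_mem_GHat (List.append_nil ts) hx hy).flip
  left_mul a b g := Subtype.ext (h.assoc_left ts a a.2 b b.2 g g.2)
  right_mul a b g := Subtype.ext (h.assoc_right ts g g.2 a a.2 b b.2).symm
  left_right a b g := Subtype.ext (h.assoc_mid ts a a.2 g g.2 b b.2)
  left_unital := by
    refine eq_top_of_diag_mem (W := GHat _) rfl _ fun a b hab hd => ?_
    exact Submodule.mem_iSup_of_mem a ⟨⟨diag a b, hd⟩, Subtype.ext (h.idem_mul ts a b hab)⟩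
  right_unital := by
    refine eq_top_of_diag_mem (W := GHat _) rfl _ fun a b hab hd => ?_
    exact Submodule.mem_iSup_of_mem b ⟨⟨diag a b, hd⟩, Subtype.ext (h.mul_idem ts a b hab)⟩

/-- The functor `θ̂_t = Ĝ_t ⊗_K _` on `K`-modules. -/
noncomputable def thetaHat (h : SurgeryWellDefined) (t : Matching) :
    LUModule.{u} (khovanovAlgebra h) ⥤ LUModule.{u} (khovanovAlgebra h) :=
  (geomBimoduleHat h [t]).tensorFunctor

theorem diag_mem_GTrunc (h : SurgeryWellDefined) {n : ℕ} {l : CupDiagram} (hl : l.numCups = n) :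
    diag l l ∈ GTrunc n [] :=
  Finsupp.single_mem_supported ℂ _ ⟨h.idem_orientable l, hl, hl⟩

theorem eq_top_of_mk_diag_mem {n : ℕ} {ts : List Matching} (S : Submodule ℂ (GQuot n ts))
    (h : ∀ (a b : CupDiagram), (Orientable a ts b ∧ a.numCups = n ∧ b.numCups = n) →
      ∀ hd : diag a b ∈ GTrunc n ts,
        (Submodule.Quotient.mk (⟨diag a b, hd⟩ : ↥(GTrunc n ts)) : GQuot n ts) ∈ S) :
    S = ⊤ := by
  have key : S.comap ((INonProp n ts).submoduleOf (GTrunc n ts)).mkQ = ⊤ :=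
    eq_top_of_diag_mem rfl _ h
  rw [eq_top_iff]
  rintro z -
  obtain ⟨w, rfl⟩ := Submodule.Quotient.mk_surjective _ z
  exact key.ge (Submodule.mem_top (x := w))

/-- The algebra `K_n = e K e / I_n`. -/
noncomputable def khovanovQuotient (h : SurgeryWellDefined) (n : ℕ) :
    LocUnitalAlgebra {l : CupDiagram // l.numCups = n} (GQuot n []) where
  mul := quotBilin (surgery [] []) (GTrunc n []) (GTrunc n []) (GTrunc n [])
    (INonProp n []) (INonProp n []) (INonProp n [])
    (fun _ hx _ hy => surgery_mem_GTrunc rfl hx hy) (h.ideal_left n [])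
  e l := Submodule.Quotient.mk ⟨diag l.1 l.1, diag_mem_GTrunc h l.2⟩
  mul_assoc x y z := by
    obtain ⟨x, rfl⟩ := Submodule.Quotient.mk_surjective _ x
    obtain ⟨y, rfl⟩ := Submodule.Quotient.mk_surjective _ y
    obtain ⟨z, rfl⟩ := Submodule.Quotient.mk_surjective _ z
    exact congrArg Submodule.Quotient.mk (Subtype.ext (h.assoc_left [] x (GTrunc_le_GHat n _ x.2)
      y (GTrunc_le_GHat n _ y.2) z (GTrunc_le_GHat n _ z.2)))
  e_mul_self l := congrArg Submodule.Quotient.mk (Subtype.ext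
    (h.idem_mul [] l.1 l.1 (h.idem_orientable l.1)))
  e_mul_ne i j hij := congrArg Submodule.Quotient.mk (Subtype.ext
    (surgery_diag_ne [] [] i.1 i.1 j.1 j.1 fun h' => hij (Subtype.ext h')))
  complete := by
    refine eq_top_of_mk_diag_mem _ fun a b hab hd => ?_
    refine Submodule.mem_iSup_of_mem ⟨a, hab.2.1⟩ (Submodule.mem_iSup_of_mem ⟨b, hab.2.2⟩
      ⟨Submodule.Quotient.mk ⟨diag a b, hd⟩, congrArg Submodule.Quotient.mk (Subtype.ext ?_)⟩)
    change surgery [] [] (diag a a) (surgery [] [] (diag a b) (diag b b)) = diag a b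
    rw [h.mul_idem [] a b hab.1, h.idem_mul [] a b hab.1]

/-- The `K_n`-`K_n`-bimodule `G_t = e Ĝ_t e / I_t`. -/
noncomputable def geomBimodule (h : SurgeryWellDefined) (n : ℕ) (ts : List Matching) :
    LUBimodule (khovanovQuotient h n) (GQuot n ts) where
  left := quotBilin (surgery [] ts) (GTrunc n []) (GTrunc n ts) (GTrunc n ts)
    (INonProp n []) (INonProp n ts) (INonProp n ts)
    (fun _ hx _ hy => surgery_mem_GTrunc rfl hx hy) (h.ideal_left n ts)
  right := (quotBilin (surgery ts []) (GTrunc n ts) (GTrunc n []) (GTrunc n ts)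
    (INonProp n ts) (INonProp n []) (INonProp n ts)
    (fun _ hx _ hy => surgery_mem_GTrunc (List.append_nil ts) hx hy) (h.ideal_right n ts)).flip
  left_mul a b g := by
    obtain ⟨a, rfl⟩ := Submodule.Quotient.mk_surjective _ a
    obtain ⟨b, rfl⟩ := Submodule.Quotient.mk_surjective _ b
    obtain ⟨g, rfl⟩ := Submodule.Quotient.mk_surjective _ g
    exact congrArg Submodule.Quotient.mk (Subtype.ext (h.assoc_left ts a (GTrunc_le_GHat n _ a.2)
      b (GTrunc_le_GHat n _ b.2) g (GTrunc_le_GHat n _ g.2)))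
  right_mul a b g := by
    obtain ⟨a, rfl⟩ := Submodule.Quotient.mk_surjective _ a
    obtain ⟨b, rfl⟩ := Submodule.Quotient.mk_surjective _ b
    obtain ⟨g, rfl⟩ := Submodule.Quotient.mk_surjective _ g
    exact congrArg Submodule.Quotient.mk (Subtype.ext (h.assoc_right ts g (GTrunc_le_GHat n _ g.2)
      a (GTrunc_le_GHat n _ a.2) b (GTrunc_le_GHat n _ b.2)).symm)
  left_right a b g := by
    obtain ⟨a, rfl⟩ := Submodule.Quotient.mk_surjective _ a
    obtain ⟨b, rfl⟩ := Submodule.Quotient.mk_surjective _ b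
    obtain ⟨g, rfl⟩ := Submodule.Quotient.mk_surjective _ g
    exact congrArg Submodule.Quotient.mk (Subtype.ext (h.assoc_mid ts a (GTrunc_le_GHat n _ a.2)
      g (GTrunc_le_GHat n _ g.2) b (GTrunc_le_GHat n _ b.2)))
  left_unital := by
    refine eq_top_of_mk_diag_mem _ fun a b hab hd => ?_
    exact Submodule.mem_iSup_of_mem ⟨a, hab.2.1⟩ ⟨Submodule.Quotient.mk ⟨diag a b, hd⟩,
      congrArg Submodule.Quotient.mk (Subtype.ext (h.idem_mul ts a b hab.1))⟩
  right_unital := by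
    refine eq_top_of_mk_diag_mem _ fun a b hab hd => ?_
    exact Submodule.mem_iSup_of_mem ⟨b, hab.2.2⟩ ⟨Submodule.Quotient.mk ⟨diag a b, hd⟩,
      congrArg Submodule.Quotient.mk (Subtype.ext (h.mul_idem ts a b hab.1))⟩

/-- The projective functor `θ_t = G_t ⊗_{K_n} _` on `K_n`-modules. -/
noncomputable def theta (h : SurgeryWellDefined) (n : ℕ) (t : Matching) :
    LUModule.{u} (khovanovQuotient h n) ⥤ LUModule.{u} (khovanovQuotient h n) :=
  (geomBimodule h n [t]).tensorFunctor

/-! Close a diagram `a ts b̄` by nested caps below and nested cups above, placed in the prescribed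
gaps (the matchings `a.lower` and `b.upper`). The closed diagram is a product in the monoid `TL` of
crossingless matchings with a zero, where a product containing a circle is zero. By `orientable_iff`
the diagram is orientable exactly when this product is some `sigma N`, that is, N nested caps below
N nested cups. Straightening zigzags gives `lower_mul_upper` and `sigma_mul_sigma`, so orientability
and the unit laws become computations in `TL`.

The middle section during a surgery at `b` is an element `stage b s` of `TL`, running from `b.upper
* b.lower` for small s to 1 for large s. Consecutive stages are equal or differ by turning three
parallel strands by one sixth of a full turn (`HexM`). The central fact is `square`: if A₀, A₁ and
B₀, B₁ are two such pairs at different places of a product and the choices (A₀, B₀) and (A₁, B₁)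
both give some `sigma N`, then (A₀, B₁) does so if and only if (A₁, B₀) does. Both bracketings of a
triple product amount to the same condition, orientability on the whole grid of pairs of stages,
because that grid can be filled square by square from two adjacent edges (`surgeryGood_left_iff`,
`surgeryGood_right_iff`). This is associativity.

To prove `square`, elements `sigma N` are recognised by closing them with pairs of rotated rainbows
and asking for a single circle (`test_of_sigma`, `sigma_of_tests`). A closed stack of layers is cut
into its even and its odd layers; along a serpentine order of the points these form two noncrossing
matchings of a finite set. Contracting arcs not involved in the two rotations preserves the number
of circles and leads to at most six points, where the claim is a finite check (`Hex.square`,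
`Hex.terminal`).

The number N does not decrease under surgery (`sigma_le_of_hexM`), and a non-propagating line exists
exactly when N exceeds the number of cups or the number of caps (`hasNonPropagating_iff`). Hence the
diagrams with non-propagating lines span subbimodules of the truncations.

For the adjunctions, suppose that `t` drawn on top of the cup diagram `b` gives a cup diagram `b'`
(`Moves t b b'`). Then e_b Ĝ_t is e_{b'} K and Ĝ_{t‡} e_b is K e_{b'}; if there is no such `b'`,
both spaces vanish. Multiplication in K defines a pairing of Ĝ_{t‡} with Ĝ_t, and the diagrams `b
b̄'` and `b' b̄` define the coevaluation. Everything is formal except that the pairing is balanced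
over K (`pairing_bal`). There both sides are governed by the same family, which opens vertical lines
to `t t‡` by surgeries run backwards, and the grid argument applies again. The data form a
`DualPair`, which yields the adjunction of tensor functors and descends to the quotients. Finally
`θ_t` preserves finite dimension because for a fixed `b` only finitely many diagrams `a t b̄` with n
cups and n caps have no non-propagating line. -/

set_option linter.unusedVariables false
set_option linter.unusedSectionVars false
set_option linter.unusedSimpArgs false

/-! ## Noncrossing matchings of a linearly ordered set -/

section Noncrossing

/-- The cyclic order attached to a linear order. -/
def Cyc {V : Type*} [LinearOrder V] (a b c : V) : Prop :=
  (a < b ∧ b < c) ∨ (b < c ∧ c < a) ∨ (c < a ∧ a < b)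

instance {V : Type*} [LinearOrder V] (a b c : V) : Decidable (Cyc a b c) := by
  unfold Cyc; infer_instance

variable {V : Type*} [LinearOrder V]

theorem Cyc.rotate {a b c : V} : Cyc a b c → Cyc b c a := by
  unfold Cyc; grind

theorem Cyc.not_swap {a b c : V} : Cyc a b c → ¬ Cyc c b a := by
  unfold Cyc; grind

theorem cyc_or_swap {a b c : V} (hab : a ≠ b) (hbc : b ≠ c) (hac : a ≠ c) :
    Cyc a b c ∨ Cyc c b a := by
  unfold Cyc; grind

theorem Cyc.ne {a b c : V} : Cyc a b c → a ≠ b ∧ b ≠ c ∧ a ≠ c := by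
  unfold Cyc; grind

/-- A noncrossing perfect matching of the set `S`. -/
structure NC (S : Set V) (x : V → V) : Prop where
  mem : ∀ p ∈ S, x p ∈ S
  inv : ∀ p ∈ S, x (x p) = p
  ne : ∀ p ∈ S, x p ≠ p
  cross : ∀ p ∈ S, ∀ q ∈ S, Cyc p q (x p) → Cyc p (x q) (x p)

/-- The function `f` is constant on the arcs of `x`. -/
def ArcInv (f : V → Prop) (x : V → V) (S : Set V) : Prop := ∀ z ∈ S, f (x z) = f z

/-- The points `p` and `q` of `S` are neighbours. -/
def Nbr (S : Set V) (p q : V) : Prop := (∀ s ∈ S, ¬ Cyc p s q) ∨ ∀ s ∈ S, ¬ Cyc q s p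

theorem Nbr.symm {S : Set V} {p q : V} (h : Nbr S p q) : Nbr S q p := Or.symm h

/-- Join the partners of `p` and `q`. -/
def contract (x : V → V) (p q : V) : V → V := fun z =>
  if z = x p then x q else if z = x q then x p else x z

theorem NC.inj {S : Set V} {x : V → V} (h : NC S x) {p q : V} (hp : p ∈ S) (hq : q ∈ S)
    (e : x p = x q) : p = q := by
  rw [← h.inv p hp, e, h.inv q hq]

/-- No point of S separates the neighbours p and q on one side, so their two arcs can be fused along
the boundary without meeting any other arc. -/
theorem NC.contract {S : Set V} {x : V → V} (h : NC S x) {p q : V} (hp : p ∈ S) (hq : q ∈ S)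
    (hpq : p ≠ q) (hx : x p ≠ q) (hn : Nbr S p q) : NC (S \ {p, q}) (contract x p q) := by
  have m := h.mem
  have i := h.inv
  have n := h.ne
  have i1 := i p hp
  have i2 := i q hq
  have hx' : x q ≠ p := fun e => hx (by rw [← e, i2])
  have hne : x p ≠ x q := fun e => hpq (h.inj hp hq e)
  have case : ∀ z ∈ S \ {p, q}, (z = x p ∧ _root_.contract x p q z = x q) ∨
      (z = x q ∧ _root_.contract x p q z = x p) ∨
      (z ≠ x p ∧ z ≠ x q ∧ _root_.contract x p q z = x z ∧ x z ≠ p ∧ x z ≠ q) := by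
    intro z hz
    have e1 : x z = p → z = x p := fun e => by rw [← e, i z hz.1]
    have e2 : x z = q → z = x q := fun e => by rw [← e, i z hz.1]
    unfold _root_.contract
    grind
  have memp : x p ∈ S \ {p, q} := ⟨m p hp, by simp [n p hp, hx]⟩
  have memq : x q ∈ S \ {p, q} := ⟨m q hq, by simp [n q hq, hx']⟩
  refine ⟨?_, ?_, ?_, ?_⟩
  · intro z hz
    rcases case z hz with ⟨e, e'⟩ | ⟨e, e'⟩ | ⟨e1, e2, e', e3, e4⟩
    · rw [e']; exact memq
    · rw [e']; exact memp
    · rw [e']; exact ⟨m z hz.1, by simp [e3, e4]⟩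
  · intro z hz
    rcases case z hz with ⟨e, e'⟩ | ⟨e, e'⟩ | ⟨e1, e2, e', e3, e4⟩
    · rw [e', e]; unfold _root_.contract; grind
    · rw [e', e]; unfold _root_.contract; grind
    · rw [e']; unfold _root_.contract
      rw [if_neg fun e => hz.2 (by simp [h.inj hz.1 hp e]),
        if_neg fun e => hz.2 (by simp [h.inj hz.1 hq e]), i z hz.1]
  · intro z hz
    rcases case z hz with ⟨e, e'⟩ | ⟨e, e'⟩ | ⟨e1, e2, e', e3, e4⟩
    · rw [e', e]; exact hne.symm
    · rw [e', e]; exact hne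
    · rw [e']; exact n z hz.1
  · intro u hu v hv
    have cr : ∀ a ∈ S, ∀ b ∈ S, Cyc a b (x a) ↔ Cyc a (x b) (x a) := fun a ha b hb =>
      ⟨h.cross a ha b hb, fun hc => by simpa [i b hb] using h.cross a ha (x b) (m b hb) hc⟩
    have hu2 : u ≠ p ∧ u ≠ q := by simpa using hu.2
    have hv2 : v ≠ p ∧ v ≠ q := by simpa using hv.2
    have c1 := cr p hp v hv.1
    have c2 := cr q hq v hv.1
    have c3 := cr p hp q hq
    have c4 := cr u hu.1 v hv.1
    have c5 := cr u hu.1 p hp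
    have c6 := cr u hu.1 q hq
    -- The neighbour condition is needed only at the six points that occur; what remains is a
    -- statement about finitely many points in cyclic order.
    have ad : (¬ Cyc p u q ∧ ¬ Cyc p v q ∧ ¬ Cyc p (x p) q ∧ ¬ Cyc p (x q) q ∧ ¬ Cyc p (x v) q ∧
        ¬ Cyc p (x u) q) ∨ (¬ Cyc q u p ∧ ¬ Cyc q v p ∧ ¬ Cyc q (x p) p ∧ ¬ Cyc q (x q) p ∧
        ¬ Cyc q (x v) p ∧ ¬ Cyc q (x u) p) := by
      rcases hn with hn | hn
      · exact Or.inl ⟨hn _ hu.1, hn _ hv.1, hn _ (m _ hp), hn _ (m _ hq), hn _ (m _ hv.1),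
          hn _ (m _ hu.1)⟩
      · exact Or.inr ⟨hn _ hu.1, hn _ hv.1, hn _ (m _ hp), hn _ (m _ hq), hn _ (m _ hv.1),
          hn _ (m _ hu.1)⟩
    have nu := n u hu.1
    have nv := n v hv.1
    have np := n p hp
    have nq := n q hq
    rcases case u hu with ⟨e, e'⟩ | ⟨e, e'⟩ | ⟨e1, e2, e', e3, e4⟩ <;>
    rcases case v hv with ⟨d, d'⟩ | ⟨d, d'⟩ | ⟨d1, d2, d', d3, d4⟩ <;> rw [e', d']
    · rw [d, e]; unfold Cyc; grind
    · rw [d, e]; unfold Cyc; grind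
    · rw [e]; clear c4 c5 c6; unfold Cyc at *; grind
    · rw [d, e]; unfold Cyc; grind
    · rw [d, e]; unfold Cyc; grind
    · rw [e]; clear c4 c5 c6; unfold Cyc at *; grind
    · rw [d]; clear c1 c2 c3 c4; unfold Cyc at *; grind
    · rw [d]; clear c1 c2 c3 c4; unfold Cyc at *; grind
    · exact c4.1

theorem contract_comm {S : Set V} {x : V → V} (h : NC S x) {p q : V} (hp : p ∈ S) (hq : q ∈ S) :
    contract x p q = contract x q p := by
  funext z
  unfold contract
  split_ifs with h1 h2 <;> simp_all

theorem ArcInv.contract {S : Set V} {x : V → V} (h : NC S x) {p q : V} (hp : p ∈ S) (hq : q ∈ S)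
    {f : V → Prop} (hf : ArcInv f x S) (e : f p = f q) :
    ArcInv f (contract x p q) (S \ {p, q}) := by
  intro z hz
  have := hf p hp
  have := hf q hq
  have := hf z hz.1
  unfold _root_.contract
  split_ifs <;> simp_all

/-- The fused arc joins `x p` and `x q`, so f has a single value there, and this value is the only
possible one at the removed points p and q. -/
theorem ArcInv.of_contract {S : Set V} {x : V → V} (h : NC S x) {p q : V} (hp : p ∈ S) (hq : q ∈ S)
    (hpq : p ≠ q) (hx : x p ≠ q) {f : V → Prop} (hf : ArcInv f (_root_.contract x p q) (S \ {p, q})) :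
    ∃ g : V → Prop, (∀ z, z ≠ p → z ≠ q → g z = f z) ∧ g p = g q ∧ ArcInv g x S := by
  have i1 := h.inv p hp
  have i2 := h.inv q hq
  have hx' : x q ≠ p := fun e => hx (by rw [← e, i2])
  have n1 := h.ne p hp
  have n2 := h.ne q hq
  have key : f (x q) = f (x p) := by
    have := hf (x p) ⟨h.mem p hp, by simp [n1, hx]⟩
    simpa [_root_.contract] using this
  refine ⟨fun z => if z = p ∨ z = q then f (x p) else f z, ?_, by simp, ?_⟩
  · intro z h1 h2; simp [h1, h2]
  · intro z hz
    by_cases e1 : z = p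
    · subst e1; simp [n1, hx]
    by_cases e2 : z = q
    · subst e2; simp [n2, hx', key]
    have := hf z ⟨hz, by simp [e1, e2]⟩
    by_cases e3 : z = x p
    · subst e3; simp [i1, n1, hx]
    by_cases e4 : z = x q
    · subst e4; simp [i2, n2, hx', key]
    have e5 : x z ≠ p := fun e => e3 (by rw [← e, h.inv z hz])
    have e6 : x z ≠ q := fun e => e4 (by rw [← e, h.inv z hz])
    simp only [_root_.contract, if_neg e3, if_neg e4] at this
    simp [e1, e2, e5, e6, this]

theorem NC.restrict {S : Set V} {x : V → V} (h : NC S x) {p : V} (hp : p ∈ S) :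
    NC (S \ {p, x p}) x := by
  refine ⟨fun z hz => ⟨h.mem z hz.1, ?_⟩, fun z hz => h.inv z hz.1, fun z hz => h.ne z hz.1,
    fun a ha b hb => h.cross a ha.1 b hb.1⟩
  have := hz.2
  simp only [Set.mem_insert_iff, Set.mem_singleton_iff, not_or] at this ⊢
  exact ⟨fun e => this.2 (by rw [← e, h.inv z hz.1]), fun e => this.1 (h.inj hz.1 hp e)⟩

/-- Contraction of a finite noncrossing matching `τ` of `T`, no point of `S \ T` lying below an arc
of `τ`, if no circle arises. -/
theorem exists_contraction {n : ℕ} : ∀ {S : Set V} {T : Finset V} {x τ : V → V}, T.card = n →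
    NC S x → ↑T ⊆ S → NC (↑T : Set V) τ →
    (∀ p ∈ T, ∀ s ∈ S, p < s → s < τ p → s ∈ T) →
    (∀ f : V → Prop, ArcInv f x S → ArcInv f τ ↑T → (∀ z ∈ S \ ↑T, f z = False) →
      ∀ z ∈ S, f z = False) →
    ∃ y, NC (S \ ↑T) y ∧
      (∀ f : V → Prop, ArcInv f x S → ArcInv f τ ↑T → ArcInv f y (S \ ↑T)) ∧
      ∀ f : V → Prop, ArcInv f y (S \ ↑T) →
        ∃ g : V → Prop, (∀ z ∉ T, g z = f z) ∧ ArcInv g x S ∧ ArcInv g τ ↑T := by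
  induction n using Nat.strong_induction_on with
  | _ n ih =>
  intro S T x τ hn hx hTS hτ hbel hcirc
  rcases T.eq_empty_or_nonempty with rfl | hne
  · refine ⟨x, by simpa using hx, fun f hf _ => by simpa using hf, fun f hf => ⟨f, fun _ _ => rfl,
      by simpa using hf, fun z hz => by simp at hz⟩⟩
  -- an innermost arc
  obtain ⟨p, hpT, hp1, hp2⟩ : ∃ p ∈ T, p < τ p ∧ ∀ s ∈ T, ¬ (p < s ∧ s < τ p) := by
    have hne' : (T.filter fun p => p < τ p).Nonempty := by
      obtain ⟨a, ha⟩ := hne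
      rcases lt_or_gt_of_ne (hτ.ne a ha) with h | h
      · exact ⟨τ a, by simpa [hτ.inv a ha, h] using hτ.mem a ha⟩
      · exact ⟨a, by simpa [h] using ha⟩
    obtain ⟨p, hp, hmin⟩ := Finset.exists_min_image _
      (fun p => (T.filter fun s => p < s ∧ s < τ p).card) hne'
    rw [Finset.mem_filter] at hp
    refine ⟨p, hp.1, hp.2, fun s hs hlt => ?_⟩
    have hτs : p < τ s ∧ τ s < τ p := by
      have := hτ.cross p hp.1 s hs (Or.inl hlt)
      have := hp.2
      unfold Cyc at *
      grind
    have key : ∀ a ∈ T, p < a → a < τ a → τ a < τ p → False := by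
      intro a ha h1 h2 h3
      have := hmin a (by simp [ha, h2])
      refine absurd this (not_le.2 (Finset.card_lt_card ?_))
      rw [Finset.ssubset_iff_of_subset]
      · refine ⟨a, ?_, by simp⟩
        simp only [Finset.mem_filter]
        exact ⟨ha, h1, h2.trans h3⟩
      · intro z hz
        simp only [Finset.mem_filter] at hz ⊢
        exact ⟨hz.1, h1.trans hz.2.1, hz.2.2.trans h3⟩
    rcases lt_or_gt_of_ne (hτ.ne s hs) with h | h
    · exact key (τ s) (hτ.mem s hs) hτs.1 (by rwa [hτ.inv s hs]) (by rw [hτ.inv s hs]; exact hlt.2)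
    · exact key s hs hlt.1 h hτs.2
  set q := τ p with hq
  have hqT : q ∈ T := hτ.mem p hpT
  have hpS := hTS hpT
  have hqS := hTS hqT
  have hpq : p ≠ q := hp1.ne
  have hτq : τ q = p := hτ.inv p hpT
  have hnbr : Nbr S p q := by
    left
    intro s hs hc
    have hlt : p < s ∧ s < q := by unfold Cyc at hc; grind
    exact hp2 s (hbel p hpT s hs hlt.1 hlt.2) hlt
  -- Otherwise the arcs of x and τ between p and q form a circle, and the indicator of {p, q}
  -- violates `hcirc`.
  have hxpq : x p ≠ q := by
    intro e
    have e' : x q = p := by rw [← e, hx.inv p hpS]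
    have := hcirc (fun z => z = p ∨ z = q) ?_ ?_ ?_ p hpS
    · simp at this
    · intro z hz
      have : x z = p ↔ z = q := ⟨fun h => by rw [← hx.inv z hz, h, e], fun h => by rw [h, e']⟩
      have : x z = q ↔ z = p := ⟨fun h => by rw [← hx.inv z hz, h, e'], fun h => by rw [h, e]⟩
      simp only [eq_iff_iff]; tauto
    · intro z hz
      have : τ z = p ↔ z = q := ⟨fun h => by rw [← hτ.inv z hz, h], fun h => by rw [h, hτq]⟩
      have : τ z = q ↔ z = p := ⟨fun h => by rw [← hτ.inv z hz, h, hτq], fun h => by rw [h]⟩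
      simp only [eq_iff_iff]; tauto
    · intro z hz
      simp only [eq_iff_iff, iff_false, not_or]
      exact ⟨fun e => hz.2 (e ▸ hpT), fun e => hz.2 (e ▸ hqT)⟩
  set T' : Finset V := (T.erase p).erase q with hT'
  have hT'c : (↑T' : Set V) = ↑T \ {p, q} := by
    ext z; simp [hT']; tauto
  have hS'T' : (S \ {p, q}) \ (↑T' : Set V) = S \ ↑T := by
    rw [hT'c]; ext z
    simp only [Set.mem_sdiff, Set.mem_insert_iff, Set.mem_singleton_iff, Finset.mem_coe]
    constructor
    · rintro ⟨⟨a, b⟩, c⟩; exact ⟨a, fun h => c ⟨h, b⟩⟩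
    · rintro ⟨a, b⟩
      exact ⟨⟨a, by rintro (rfl | rfl) <;> contradiction⟩, fun h => b h.1⟩
  have hx1 := hx.contract hpS hqS hpq hxpq hnbr
  have hcard : T'.card < n := by
    rw [← hn]
    exact (Finset.card_erase_le).trans_lt (Finset.card_erase_lt_of_mem hpT)
  have hτ1 : NC (↑T' : Set V) τ := by rw [hT'c]; exact hτ.restrict hpT
  have hbel1 : ∀ p' ∈ T', ∀ s ∈ S \ {p, q}, p' < s → s < τ p' → s ∈ T' := by
    intro a ha s hs h3 h4
    have ha' : a ∈ T := Finset.mem_of_mem_erase (Finset.mem_of_mem_erase ha)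
    have := hbel a ha' s hs.1 h3 h4
    have hs2 : s ≠ p ∧ s ≠ q := by simpa using hs.2
    simp [hT', this, hs2.1, hs2.2]
  -- A circle after the contraction comes from a circle before it, since colourings lift back along
  -- the fused arc.
  have hcirc1 : ∀ f : V → Prop, ArcInv f (contract x p q) (S \ {p, q}) → ArcInv f τ ↑T' →
      (∀ z ∈ (S \ {p, q}) \ (↑T' : Set V), f z = False) → ∀ z ∈ S \ {p, q}, f z = False := by
    intro f hf hf' hf0 z hz
    obtain ⟨g', k1, k2, k3⟩ := hf.of_contract hx hpS hqS hpq hxpq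
    have hz2 : z ≠ p ∧ z ≠ q := by simpa using hz.2
    rw [← k1 z hz2.1 hz2.2]
    refine hcirc g' k3 (fun w hw => ?_) (fun w hw => ?_) z hz.1
    · by_cases e1 : w = p
      · rw [e1]; exact k2.symm
      by_cases e2 : w = q
      · rw [e2, hτq]; exact k2
      have hz' : w ∈ T' := by simp [hT', e1, e2]; exact hw
      have hz'' := hτ1.mem w hz'
      rw [hT'c] at hz''
      have e3 : τ w ≠ p ∧ τ w ≠ q := by simpa using hz''.2
      rw [k1 w e1 e2, k1 _ e3.1 e3.2]
      exact hf' w hz'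
    · have a1 : w ≠ p := fun e => hw.2 (e ▸ hpT)
      have a2 : w ≠ q := fun e => hw.2 (e ▸ hqT)
      rw [k1 w a1 a2]
      exact hf0 w (by rw [hS'T']; exact hw)
  obtain ⟨y, hy, h1, h2⟩ := ih _ hcard (S := S \ {p, q}) (T := T') (x := contract x p q) (τ := τ)
    rfl hx1 (by rw [hT'c]; exact Set.sdiff_subset_sdiff_left hTS) hτ1 hbel1 hcirc1
  rw [hS'T'] at hy h1 h2
  refine ⟨y, hy, fun f hf hf' => ?_, fun f hf => ?_⟩
  · refine h1 f (hf.contract hx hpS hqS (hf' p hpT).symm) fun z hz => hf' z ?_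
    rw [hT'c] at hz; exact hz.1
  · obtain ⟨g, hg1, hg2, hg3⟩ := h2 f hf
    obtain ⟨g', k1, k2, k3⟩ := hg2.of_contract hx hpS hqS hpq hxpq
    refine ⟨g', fun z hz => ?_, k3, fun z hz => ?_⟩
    · have a1 : z ≠ p := fun e => hz (e ▸ hpT)
      have a2 : z ≠ q := fun e => hz (e ▸ hqT)
      rw [k1 z a1 a2]
      exact hg1 z fun h => hz (Finset.mem_of_mem_erase (Finset.mem_of_mem_erase h))
    · by_cases e1 : z = p
      · rw [e1]; exact k2.symm
      by_cases e2 : z = q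
      · rw [e2, hτq]; exact k2
      have hz' : z ∈ T' := by simp [hT', e1, e2]; exact hz
      have hz'' := hτ1.mem z hz'
      rw [hT'c] at hz''
      have e3 : τ z ≠ p ∧ τ z ≠ q := by simpa using hz''.2
      rw [k1 z e1 e2, k1 _ e3.1 e3.2]
      exact hg3 z hz'
end Noncrossing

/-! ### Rotations of three parallel arcs and the number of circles -/

section Hexagon

variable {V : Type*} [LinearOrder V]

/-- Every function constant on the arcs of `x` and `w` is constant: the arcs form a single circle. -/
def Conn (S : Set V) (x w : V → V) : Prop :=
  ∀ f : V → Prop, ArcInv f x S → ArcInv f w S → ∀ p ∈ S, ∀ q ∈ S, f p = f q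

theorem Conn.symm {S : Set V} {x w : V → V} (h : Conn S x w) : Conn S w x :=
  fun f h1 h2 => h f h2 h1

theorem conn_comm {S : Set V} {x w : V → V} : Conn S x w ↔ Conn S w x :=
  ⟨Conn.symm, Conn.symm⟩

theorem Conn.congr {S : Set V} {x x' w : V → V} (e : ∀ z ∈ S, x z = x' z) (h : Conn S x w) :
    Conn S x' w :=
  fun f h1 h2 => h f (fun z hz => by rw [e z hz]; exact h1 z hz) h2

/-- Contracting along an arc of w only shortens a circle. The assumption `x p ≠ q` prevents a circle
from disappearing. -/
theorem conn_contract {S : Set V} {x w : V → V} (hx : NC S x) (hw : NC S w) {p q : V} (hp : p ∈ S)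
    (hpq : w p = q) (hxpq : x p ≠ q) :
    Conn S x w ↔ Conn (S \ {p, q}) (contract x p q) w := by
  have hq : q ∈ S := hpq ▸ hw.mem p hp
  have hne : p ≠ q := fun e => hw.ne p hp (hpq.trans e.symm)
  have hwq : w q = p := by rw [← hpq, hw.inv p hp]
  have hr := hw.restrict hp
  rw [hpq] at hr
  constructor
  · intro h f h1 h2 a ha b hb
    obtain ⟨g, g1, g2, g3⟩ := h1.of_contract hx hp hq hne hxpq
    have ha' : a ≠ p ∧ a ≠ q := by simpa using ha.2
    have hb' : b ≠ p ∧ b ≠ q := by simpa using hb.2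
    rw [← g1 a ha'.1 ha'.2, ← g1 b hb'.1 hb'.2]
    refine h g g3 (fun z hz => ?_) a ha.1 b hb.1
    by_cases e1 : z = p
    · rw [e1, hpq]; exact g2.symm
    by_cases e2 : z = q
    · rw [e2, hwq]; exact g2
    have hz' : z ∈ S \ {p, q} := ⟨hz, by simp [e1, e2]⟩
    have h3 : w z ≠ p ∧ w z ≠ q := by simpa using (hr.mem z hz').2
    rw [g1 z e1 e2, g1 _ h3.1 h3.2]
    exact h2 z hz'
  · intro h f h1 h2
    have e : f p = f q := by rw [← hpq]; exact (h2 p hp).symm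
    have key := h f (h1.contract hx hp hq e) (fun z hz => h2 z hz.1)
    have hxq : x q ≠ p := fun e => hxpq (by rw [← e, hx.inv q hq])
    have hxp' : x p ∈ S \ {p, q} := ⟨hx.mem p hp, by simp [hx.ne p hp, hxpq]⟩
    have main : ∀ z ∈ S, f z = f (x p) := by
      intro z hz
      by_cases e1 : z = p
      · rw [e1]; exact (h1 p hp).symm
      by_cases e2 : z = q
      · rw [e2, ← e]; exact (h1 p hp).symm
      exact key z ⟨hz, by simp [e1, e2]⟩ _ hxp'
    intro a ha b hb
    rw [main a ha, main b hb]

/-- The points p and q form a circle of their own, and r lies on another one; the indicator of {p,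
q} tells them apart. -/
theorem not_conn_of_circle {S : Set V} {x w : V → V} (hx : NC S x) (hw : NC S w) {p q r : V}
    (hp : p ∈ S) (hpq : w p = q) (hxpq : x p = q) (hr : r ∈ S) (hrp : r ≠ p) (hrq : r ≠ q) :
    ¬ Conn S x w := by
  intro h
  have hwq : w q = p := by rw [← hpq, hw.inv p hp]
  have hxq : x q = p := by rw [← hxpq, hx.inv p hp]
  have := h (fun z => z = p ∨ z = q) ?_ ?_ p hp r hr
  · simp [hrp, hrq] at this
  · intro z hz
    have : x z = p ↔ z = q := ⟨fun h => by rw [← hx.inv z hz, h, hxpq], fun h => by rw [h, hxq]⟩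
    have : x z = q ↔ z = p := ⟨fun h => by rw [← hx.inv z hz, h, hxq], fun h => by rw [h, hxpq]⟩
    simp only [eq_iff_iff]; tauto
  · intro z hz
    have : w z = p ↔ z = q := ⟨fun h => by rw [← hw.inv z hz, h, hpq], fun h => by rw [h, hwq]⟩
    have : w z = q ↔ z = p := ⟨fun h => by rw [← hw.inv z hz, h, hwq], fun h => by rw [h, hpq]⟩
    simp only [eq_iff_iff]; tauto

/-- The matching `(14)(23)(56)` of six points. -/
def hexA : Fin 6 → Fin 6 := ![3, 2, 1, 0, 5, 4]

/-- The matching `(16)(25)(34)` of six points. -/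
def hexB : Fin 6 → Fin 6 := ![5, 4, 3, 2, 1, 0]

/-- The matchings `u` and `v` of `S` differ by the rotation of three parallel arcs with endpoints
`h 0, …, h 5` by one sixth of a full turn. -/
structure Hex (S : Set V) (u v : V → V) (h : Fin 6 → V) : Prop where
  mem : ∀ i, h i ∈ S
  left : ∀ i, u (h i) = h (hexA i)
  right : ∀ i, v (h i) = h (hexB i)
  cyc : ∀ i j k, Cyc i j k → Cyc (h i) (h j) (h k)
  other : ∀ z ∈ S, (∀ i, z ≠ h i) → u z = v z

theorem Hex.inj {S : Set V} {u v : V → V} {h : Fin 6 → V} (H : Hex S u v h) {i j : Fin 6}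
    (e : h i = h j) : i = j := by
  by_contra hij
  have key : ∀ i j : Fin 6, i ≠ j → ∃ k, Cyc i j k ∨ Cyc j i k := by decide
  obtain ⟨k, hk | hk⟩ := key i j hij
  · exact (H.cyc i j k hk).ne.1 e
  · exact (H.cyc j i k hk).ne.1 e.symm

theorem Hex.cyc_iff {S : Set V} {u v : V → V} {h : Fin 6 → V} (H : Hex S u v h) {i j k : Fin 6} :
    Cyc (h i) (h j) (h k) ↔ Cyc i j k := by
  refine ⟨fun hc => ?_, H.cyc i j k⟩
  have hn := hc.ne
  rcases cyc_or_swap (a := i) (b := j) (c := k) (fun e => hn.1 (e ▸ rfl)) (fun e => hn.2.1 (e ▸ rfl))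
    (fun e => hn.2.2 (e ▸ rfl)) with h1 | h1
  · exact h1
  · exact absurd hc (H.cyc k j i h1).not_swap

/-- The arc at q belongs to both u and v, so no hexagon arc of either matching crosses it. These
arcs together link the corners in one cycle 0, 3, 2, 1, 4, 5, so all six corners lie on the same
side. -/
theorem Hex.side {S : Set V} {u v : V → V} {h : Fin 6 → V} (H : Hex S u v h) (hu : NC S u)
    (hv : NC S v) {q : V} (hq : q ∈ S) (hqh : ∀ i, q ≠ h i) (i j : Fin 6) :
    Cyc q (h i) (u q) ↔ Cyc q (h j) (u q) := by
  have e := H.other q hq hqh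
  have a : ∀ i, Cyc q (h i) (u q) → Cyc q (h (hexA i)) (u q) := fun i hi => by
    rw [← H.left]; exact hu.cross q hq _ (H.mem i) hi
  have b : ∀ i, Cyc q (h i) (u q) → Cyc q (h (hexB i)) (u q) := fun i hi => by
    rw [← H.right, e]; rw [e] at hi; exact hv.cross q hq _ (H.mem i) hi
  have key : ∀ P : Fin 6 → Prop, (∀ i, P i → P (hexA i)) → (∀ i, P i → P (hexB i)) →
      ∀ i j, P i → P j := by
    intro P a b
    have c0 : P 0 → P 3 := a 0
    have c1 : P 3 → P 2 := b 3
    have c2 : P 2 → P 1 := a 2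
    have c3 : P 1 → P 4 := b 1
    have c4 : P 4 → P 5 := a 4
    have c5 : P 5 → P 0 := b 5
    have hto : ∀ i, P i → P 0 := fun i => match i with
      | 0 => id
      | 1 => c5 ∘ c4 ∘ c3
      | 2 => c5 ∘ c4 ∘ c3 ∘ c2
      | 3 => c5 ∘ c4 ∘ c3 ∘ c2 ∘ c1
      | 4 => c5 ∘ c4
      | 5 => c5
    have hfrom : ∀ i, P 0 → P i := fun i => match i with
      | 0 => id
      | 1 => c2 ∘ c1 ∘ c0
      | 2 => c1 ∘ c0
      | 3 => c0
      | 4 => c3 ∘ c2 ∘ c1 ∘ c0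
      | 5 => c4 ∘ c3 ∘ c2 ∘ c1 ∘ c0
    exact fun i j h => hfrom j (hto i h)
  exact ⟨key _ a b i j, key _ a b j i⟩

/-- Fusing a corner with a neighbouring arc common to both matchings just prolongs the strands at
that corner: the far end of the arc becomes the new corner. -/
theorem Hex.contract_one {S : Set V} {u v : V → V} {h : Fin 6 → V} (H : Hex S u v h) (hu : NC S u)
    (hv : NC S v) {i : Fin 6} {q : V} (hq : q ∈ S) (hqh : ∀ i, q ≠ h i) (hn : Nbr S (h i) q) :
    Hex (S \ {h i, q}) (contract u (h i) q) (contract v (h i) q) (Function.update h i (u q)) := by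
  have e := H.other q hq hqh
  set z := u q with hz
  have hzS : z ∈ S := hu.mem q hq
  have hzq : z ≠ q := hu.ne q hq
  have hzh : ∀ j, z ≠ h j := by
    intro j hj
    have := hu.inv q hq
    rw [← hz, hj, H.left] at this
    exact hqh _ this.symm
  have hA : ∀ j, hexA j ≠ j ∧ hexA (hexA j) = j ∧ hexB j ≠ j ∧ hexB (hexB j) = j := by decide
  -- The new corner z takes the cyclic place of the old one, since by `Hex.side` the arc from q to z
  -- does not separate the corners.
  have claim : ∀ j k, j ≠ i → k ≠ i → Cyc (h i) (h j) (h k) → Cyc z (h j) (h k) := by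
    intro j k hj hk hc
    have s1 := H.side hu hv hq hqh i j
    have s2 := H.side hu hv hq hqh i k
    rw [← hz] at s1 s2
    have n1 := hzh i; have n2 := hzh j; have n3 := hzh k
    have m1 := hqh i; have m2 := hqh j; have m3 := hqh k
    have nb : (¬ Cyc (h i) (h j) q ∧ ¬ Cyc (h i) (h k) q ∧ ¬ Cyc (h i) z q) ∨
        (¬ Cyc q (h j) (h i) ∧ ¬ Cyc q (h k) (h i) ∧ ¬ Cyc q z (h i)) := by
      rcases hn with hn | hn
      · exact Or.inl ⟨hn _ (H.mem j), hn _ (H.mem k), hn _ hzS⟩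
      · exact Or.inr ⟨hn _ (H.mem j), hn _ (H.mem k), hn _ hzS⟩
    unfold Cyc at *
    grind
  have upd : ∀ j, j ≠ i → Function.update h i z j = h j := fun j hj => by
    simp [Function.update, hj]
  have updi : Function.update h i z i = z := by simp
  refine ⟨?_, ?_, ?_, ?_, ?_⟩
  · intro j
    by_cases hj : j = i
    · subst hj; rw [updi]; exact ⟨hzS, by simp [hzq, hzh]⟩
    · rw [upd j hj]
      refine ⟨H.mem j, ?_⟩
      simp only [Set.mem_insert_iff, Set.mem_singleton_iff, not_or]
      exact ⟨fun e => hj (H.inj e), (hqh j).symm⟩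
  · intro j
    by_cases hj : j = i
    · subst hj
      rw [updi, upd _ (hA j).1]
      unfold contract
      rw [if_neg (by rw [H.left]; exact hzh _), if_pos hz, H.left]
    · rw [upd j hj]
      by_cases hj2 : j = hexA i
      · rw [hj2, (hA i).2.1, updi]
        unfold contract
        rw [if_pos (by rw [H.left])]
      · rw [upd _ (fun e => hj2 (by rw [← e, (hA j).2.1]))]
        unfold contract
        rw [if_neg (by rw [H.left]; exact fun e => hj2 (H.inj e)), if_neg (hzh j).symm, H.left]
  · intro j
    by_cases hj : j = i
    · subst hj
      rw [updi, upd _ (hA j).2.2.1]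
      unfold contract
      rw [if_neg (by rw [H.right]; exact hzh _), if_pos e, H.right]
    · rw [upd j hj]
      by_cases hj2 : j = hexB i
      · rw [hj2, (hA i).2.2.2, updi]
        unfold contract
        rw [if_pos (by rw [H.right]), e]
      · rw [upd _ (fun e => hj2 (by rw [← e, (hA j).2.2.2]))]
        unfold contract
        rw [if_neg (by rw [H.right]; exact fun e => hj2 (H.inj e)),
          if_neg (by rw [← e]; exact (hzh j).symm), H.right]
  · intro a b c hc
    have hd := hc.ne
    have hc' := H.cyc a b c hc
    by_cases ha : a = i
    · subst ha
      rw [updi, upd b hd.1.symm, upd c hd.2.2.symm]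
      exact claim b c hd.1.symm hd.2.2.symm hc'
    by_cases hb : b = i
    · subst hb
      rw [updi, upd a hd.1, upd c hd.2.1.symm]
      exact (claim c a hd.2.1.symm hd.1 hc'.rotate).rotate.rotate
    by_cases hcc : c = i
    · subst hcc
      rw [updi, upd a hd.2.2, upd b hd.2.1]
      exact (claim a b hd.2.2 hd.2.1 hc'.rotate.rotate).rotate
    rw [upd a ha, upd b hb, upd c hcc]
    exact hc'
  · intro w hw hwh
    have hw2 : w ≠ h i ∧ w ≠ q := by simpa using hw.2
    have hwz : w ≠ z := by have := hwh i; rwa [updi] at this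
    have hwh' : ∀ j, w ≠ h j := by
      intro j
      by_cases hj : j = i
      · rw [hj]; exact hw2.1
      · have := hwh j; rwa [upd j hj] at this
    unfold contract
    rw [H.left, H.right, if_neg (hwh' _), if_neg (hwh' _), ← e, if_neg hwz, if_neg hwz]
    exact H.other w hw.1 hwh'

/-- The hexagon survives unless both p and q are corners. In that case the contraction destroys the
difference between u and v. -/
theorem Hex.contract {S : Set V} {u v : V → V} {h : Fin 6 → V} (H : Hex S u v h) (hu : NC S u)
    (hv : NC S v) {p q : V} (hp : p ∈ S) (hq : q ∈ S) (hpq : p ≠ q) (hn : Nbr S p q)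
    (hup : u p ≠ q) (hvp : v p ≠ q) :
    (∃ h', Hex (S \ {p, q}) (contract u p q) (contract v p q) h') ∨
      ∀ z ∈ S \ {p, q}, _root_.contract u p q z = _root_.contract v p q z := by
  by_cases hph : ∃ i, p = h i
  · obtain ⟨i, rfl⟩ := hph
    by_cases hqh : ∃ j, q = h j
    · obtain ⟨j, rfl⟩ := hqh
      right
      rw [H.left] at hup
      rw [H.right] at hvp
      have hij : (∀ s, ¬ Cyc i s j) ∨ ∀ s, ¬ Cyc j s i := by
        rcases hn with hn | hn
        · exact Or.inl fun s hs => hn _ (H.mem s) (H.cyc _ _ _ hs)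
        · exact Or.inr fun s hs => hn _ (H.mem s) (H.cyc _ _ _ hs)
      intro z hz
      unfold _root_.contract
      rw [H.left, H.left, H.right, H.right]
      by_cases hzh : ∃ k, z = h k
      · obtain ⟨k, rfl⟩ := hzh
        have hk : k ≠ i ∧ k ≠ j := by
          have : h k ≠ h i ∧ h k ≠ h j := by simpa using hz.2
          exact ⟨fun e => this.1 (e ▸ rfl), fun e => this.2 (e ▸ rfl)⟩
        have hinj : ∀ a b, h a = h b ↔ a = b := fun a b => ⟨H.inj, fun e => e ▸ rfl⟩
        -- Adjacent corners joined by neither matching are {0, 1} or {3, 4}; for these the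
        -- contractions of `hexA` and `hexB` agree.
        have key : ∀ i j k : Fin 6, ((∀ s, ¬ Cyc i s j) ∨ ∀ s, ¬ Cyc j s i) → i ≠ j → hexA i ≠ j →
            hexB i ≠ j → k ≠ i → k ≠ j →
            (if k = hexA i then hexA j else if k = hexA j then hexA i else hexA k) =
              if k = hexB i then hexB j else if k = hexB j then hexB i else hexB k := by
          decide
        have := congrArg h (key i j k hij (fun e => hpq (e ▸ rfl)) (fun e => hup (e ▸ rfl))
          (fun e => hvp (e ▸ rfl)) hk.1 hk.2)
        simp only [hinj, H.left, H.right]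
        simpa only [apply_ite h] using this
      · push Not at hzh
        rw [if_neg (hzh _), if_neg (hzh _), if_neg (hzh _), if_neg (hzh _)]
        exact H.other z hz.1 hzh
    · push Not at hqh
      exact Or.inl ⟨_, H.contract_one hu hv hq hqh hn⟩
  · push Not at hph
    by_cases hqh : ∃ j, q = h j
    · obtain ⟨j, rfl⟩ := hqh
      left
      rw [contract_comm hu hp hq, contract_comm hv hp hq, Set.pair_comm]
      exact ⟨_, H.contract_one hu hv hp hph hn.symm⟩
    · push Not at hqh
      left
      have e1 := H.other p hp hph
      have e2 := H.other q hq hqh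
      have n1 : ∀ i, h i ≠ u p := fun i hi => by
        have := hu.inv p hp; rw [← hi, H.left] at this; exact hph _ this.symm
      have n2 : ∀ i, h i ≠ u q := fun i hi => by
        have := hu.inv q hq; rw [← hi, H.left] at this; exact hqh _ this.symm
      refine ⟨h, fun i => ⟨H.mem i, by simp [(hph i).symm, (hqh i).symm]⟩, fun i => ?_, fun i => ?_,
        H.cyc, fun z hz hzh => ?_⟩
      · unfold _root_.contract
        rw [if_neg (n1 i), if_neg (n2 i), H.left]
      · unfold _root_.contract
        rw [← e1, ← e2, if_neg (n1 i), if_neg (n2 i), H.right]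
      · unfold _root_.contract
        rw [← e1, ← e2, H.other z hz.1 hzh]

/-- Every arc away from the hexagon has all corners on one side. Among the arcs, read from the end
for which they cut off no corner, one cutting off the fewest points cuts off none, because an arc
starting in the region cut off would stay there and cut off fewer. -/
theorem Hex.exists_arc {S : Set V} (hS : S.Finite) {u v : V → V} {h : Fin 6 → V} (H : Hex S u v h)
    (hu : NC S u) (hv : NC S v) (hne : ∃ z ∈ S, ∀ i, z ≠ h i) :
    ∃ p ∈ S, (∀ i, p ≠ h i) ∧ (∀ i, u p ≠ h i) ∧ Nbr S p (u p) := by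
  have huh : ∀ p ∈ S, (∀ i, p ≠ h i) → ∀ i, u p ≠ h i := fun p hp hph i hi => by
    have := hu.inv p hp; rw [hi, H.left] at this; exact hph _ this.symm
  let A : V → Set V := fun p => {s | s ∈ S ∧ Cyc p s (u p)}
  have hAf : ∀ p, (A p).Finite := fun p => hS.subset fun s hs => hs.1
  let N : Set V := {p | p ∈ S ∧ (∀ i, p ≠ h i) ∧ ∀ i, h i ∉ A p}
  have hN : N.Nonempty := by
    obtain ⟨z, hz, hzh⟩ := hne
    by_cases hc : Cyc z (h 0) (u z)
    · refine ⟨u z, hu.mem z hz, huh z hz hzh, fun i hi => ?_⟩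
      have h1 := (H.side hu hv hz hzh 0 i).1 hc
      have h2 := hi.2
      rw [hu.inv z hz] at h2
      exact h1.not_swap h2
    · exact ⟨z, hz, hzh, fun i hi => hc ((H.side hu hv hz hzh 0 i).2 hi.2)⟩
  obtain ⟨p, hp, hmin⟩ := Set.exists_min_image N (fun p => (A p).ncard)
    (hS.subset fun s hs => hs.1) hN
  refine ⟨p, hp.1, hp.2.1, huh p hp.1 hp.2.1, Or.inl fun s hs hc => ?_⟩
  have hcs := hu.cross p hp.1 s hs hc
  have key : ∀ s ∈ S, Cyc p s (u p) → Cyc p s (u s) → Cyc p (u s) (u p) → False := by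
    intro s hs h1 h2 h3
    have hsub : ∀ z, z ∈ A s → z ∈ A p := by
      rintro z ⟨hz, hz'⟩
      refine ⟨hz, ?_⟩
      unfold Cyc at *; grind
    have hss : A s ⊂ A p := by
      refine ⟨hsub, fun hle => ?_⟩
      exact (hle ⟨hs, h1⟩ : s ∈ A s).2.ne.1 rfl
    have hsN : s ∈ N := ⟨hs, fun i hi => hp.2.2 i (hi ▸ ⟨hs, h1⟩), fun i hi => hp.2.2 i (hsub _ hi)⟩
    exact absurd (hmin s hsN) (not_le.2 (Set.ncard_lt_ncard hss (hAf p)))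
  have n1 := hc.ne
  have n2 := hcs.ne
  rcases cyc_or_swap n1.1 (hu.ne s hs).symm n2.1 with h1 | h1
  · exact key s hs hc h1 hcs
  · refine key (u s) (hu.mem s hs) hcs ?_ ?_
    · rw [hu.inv s hs]; exact h1.rotate.rotate
    · rw [hu.inv s hs]; exact hc

theorem Hex.restrict {S : Set V} {u v : V → V} {h : Fin 6 → V} (H : Hex S u v h) {p q : V}
    (hp : ∀ i, p ≠ h i) (hq : ∀ i, q ≠ h i) : Hex (S \ {p, q}) u v h :=
  ⟨fun i => ⟨H.mem i, by simp [(hp i).symm, (hq i).symm]⟩, H.left, H.right, H.cyc,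
    fun z hz => H.other z hz.1⟩

/-- Both hexagons exhaust S, so they differ by a cyclic rotation r. For r = 1, 4 one has u' = v, and
for r = 2, 5 one has v' = u; this contradicts a hypothesis, since a matching paired with itself
gives three circles. For r = 0, 3 one has u' = u and v' = v, and both sides fail for the same
reason. -/
theorem Hex.terminal {S : Set V} {u v u' v' : V → V} {h k : Fin 6 → V} (H : Hex S u v h)
    (K : Hex S u' v' k) (hS : ∀ z ∈ S, ∃ i, z = h i) (hS' : ∀ z ∈ S, ∃ i, z = k i)
    (h1 : Conn S v' u) (h2 : Conn S u' v) : Conn S u' u ↔ Conn S v' v := by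
  choose σ hσ using fun i => hS (k i) (K.mem i)
  choose ρ hρ using fun i => hS' (h i) (H.mem i)
  have hσρ : ∀ i, σ (ρ i) = i := fun i => H.inj (by rw [← hσ, ← hρ])
  have hcyc : ∀ a b c, Cyc a b c ↔ Cyc (σ a) (σ b) (σ c) := fun a b c => by
    rw [← K.cyc_iff, ← H.cyc_iff, hσ, hσ, hσ]
  -- A bijection of the corners preserving the cyclic order maps consecutive corners to consecutive
  -- ones.
  have hstep : ∀ i, σ (i + 1) = σ i + 1 := by
    intro i
    by_contra hne
    have hne' : σ i ≠ σ (i + 1) := fun e => by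
      have f3 : ∀ i : Fin 6, i ≠ i + 1 := by decide
      exact f3 i (K.inj (by rw [hσ, hσ, e]))
    have f1 : ∀ a b : Fin 6, a ≠ b → b ≠ a + 1 → Cyc a (a + 1) b := by decide
    have f2 : ∀ a b : Fin 6, ¬ Cyc a b (a + 1) := by decide
    have := f1 _ _ hne' hne
    rw [← hσρ (σ i + 1), ← hcyc] at this
    exact f2 _ _ this
  have hr : ∀ i, σ i = i + σ 0 := by
    have s0 := hstep 0; have s1 := hstep 1; have s2 := hstep 2; have s3 := hstep 3
    have s4 := hstep 4
    simp only [zero_add] at s0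
    rw [s0] at s1
    rw [show (1 : Fin 6) + 1 = 2 from rfl] at s1
    rw [show (2 : Fin 6) + 1 = 3 from rfl, s1] at s2
    rw [show (3 : Fin 6) + 1 = 4 from rfl, s2] at s3
    rw [show (4 : Fin 6) + 1 = 5 from rfl, s3] at s4
    have key : ∀ r : Fin 6, ∀ i : Fin 6, i = 0 ∧ r = i + r ∨ i = 1 ∧ r + 1 = i + r ∨
      i = 2 ∧ r + 1 + 1 = i + r ∨ i = 3 ∧ r + 1 + 1 + 1 = i + r ∨ i = 4 ∧ r + 1 + 1 + 1 + 1 = i + r ∨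
      i = 5 ∧ r + 1 + 1 + 1 + 1 + 1 = i + r := by decide
    intro i
    rcases key (σ 0) i with ⟨e, h⟩ | ⟨e, h⟩ | ⟨e, h⟩ | ⟨e, h⟩ | ⟨e, h⟩ | ⟨e, h⟩ <;> subst e
    · exact h
    · rw [s0, h]
    · rw [s1, h]
    · rw [s2, h]
    · rw [s3, h]
    · rw [s4, h]
  set r := σ 0
  -- Connectedness is rewritten with Boolean colourings of `Fin 6`, where witnesses of
  -- disconnectedness can be checked by computation.
  have conv : ∀ (x w : V → V) (a b : Fin 6 → Fin 6), (∀ i, x (h i) = h (a i)) →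
      (∀ i, w (h i) = h (b i)) → (Conn S x w ↔ ∀ f : Fin 6 → Bool, (∀ i, f (a i) = f i) →
        (∀ i, f (b i) = f i) → ∀ i, f i = f 0) := by
    intro x w a b hx hw
    constructor
    · intro hc f fa fb i
      have := hc (fun z => ∃ j, z = h j ∧ f j = true) ?_ ?_ (h i) (H.mem i) (h 0) (H.mem 0)
      · have e : ∀ i, (∃ j, h i = h j ∧ f j = true) ↔ f i = true := fun i =>
          ⟨fun ⟨j, e, hj⟩ => by rwa [H.inj e], fun hi => ⟨i, rfl, hi⟩⟩
        rw [e, e] at this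
        exact Bool.eq_iff_iff.2 (iff_of_eq this)
      · intro z hz
        obtain ⟨j, rfl⟩ := hS z hz
        simp only [eq_iff_iff, hx]
        exact ⟨fun ⟨l, e, hl⟩ => ⟨j, rfl, by rw [← fa, H.inj e]; exact hl⟩,
          fun ⟨l, e, hl⟩ => ⟨a j, rfl, by rw [fa, H.inj e]; exact hl⟩⟩
      · intro z hz
        obtain ⟨j, rfl⟩ := hS z hz
        simp only [eq_iff_iff, hw]
        exact ⟨fun ⟨l, e, hl⟩ => ⟨j, rfl, by rw [← fb, H.inj e]; exact hl⟩,
          fun ⟨l, e, hl⟩ => ⟨b j, rfl, by rw [fb, H.inj e]; exact hl⟩⟩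
    · intro hc f fx fw
      classical
      have := hc (fun i => decide (f (h i))) (fun i => by
        have := fx (h i) (H.mem i); rw [hx] at this; simp [this]) (fun i => by
        have := fw (h i) (H.mem i); rw [hw] at this; simp [this])
      have hall : ∀ z ∈ S, f z = f (h 0) := by
        intro z hz
        obtain ⟨j, rfl⟩ := hS z hz
        simpa using this j
      intro p hp q hq
      rw [hall p hp, hall q hq]
  have ku : ∀ i, u' (h i) = h (hexA (i - r) + r) := fun i => by
    have e : h i = k (i - r) := by rw [hσ, hr]; simp
    rw [e, K.left, hσ, hr]
  have kv : ∀ i, v' (h i) = h (hexB (i - r) + r) := fun i => by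
    have e : h i = k (i - r) := by rw [hσ, hr]; simp
    rw [e, K.right, hσ, hr]
  rw [conv _ _ _ _ kv H.left] at h1
  rw [conv _ _ _ _ ku H.right] at h2
  rw [conv _ _ _ _ ku H.left, conv _ _ _ _ kv H.right]
  generalize r = r at *
  have g0 : ∀ a : Fin 6 → Fin 6, (∃ f : Fin 6 → Bool, (∀ i, f (a i) = f i) ∧ ¬ ∀ i, f i = f 0) →
      ¬ ∀ f : Fin 6 → Bool, (∀ i, f (a i) = f i) → (∀ i, f (a i) = f i) → ∀ i, f i = f 0 :=
    fun a ⟨f, h1, h2⟩ h => h2 (h f h1 h1)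
  have fA : ∃ f : Fin 6 → Bool, (∀ i, f (hexA i) = f i) ∧ ¬ ∀ i, f i = f 0 :=
    ⟨![true, false, false, true, false, false], by decide⟩
  have fB : ∃ f : Fin 6 → Bool, (∀ i, f (hexB i) = f i) ∧ ¬ ∀ i, f i = f 0 :=
    ⟨![true, false, false, false, false, true], by decide⟩
  have e0 : ∀ r : Fin 6, r = 0 ∨ r = 1 ∨ r = 2 ∨ r = 3 ∨ r = 4 ∨ r = 5 := by decide
  rcases e0 r with rfl | rfl | rfl | rfl | rfl | rfl
  · have qA : ∀ i, hexA (i - 0) + 0 = hexA i := by decide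
    have qB : ∀ i, hexB (i - 0) + 0 = hexB i := by decide
    simp only [qA, qB]
    exact iff_of_false (g0 _ fA) (g0 _ fB)
  · have q : ∀ i, hexA (i - 1) + 1 = hexB i := by decide
    simp only [q] at h2
    exact absurd h2 (g0 _ fB)
  · have q : ∀ i, hexB (i - 2) + 2 = hexA i := by decide
    simp only [q] at h1
    exact absurd h1 (g0 _ fA)
  · have qA : ∀ i, hexA (i - 3) + 3 = hexA i := by decide
    have qB : ∀ i, hexB (i - 3) + 3 = hexB i := by decide
    simp only [qA, qB]
    exact iff_of_false (g0 _ fA) (g0 _ fB)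
  · have q : ∀ i, hexA (i - 4) + 4 = hexB i := by decide
    simp only [q] at h2
    exact absurd h2 (g0 _ fB)
  · have q : ∀ i, hexB (i - 5) + 5 = hexA i := by decide
    simp only [q] at h1
    exact absurd h1 (g0 _ fA)

/-- Two commuting rotations of arcs in a closed planar diagram. -/
theorem Hex.square {n : ℕ} : ∀ {S : Set V} {w₀ w₁ y₀ y₁ : V → V} {h k : Fin 6 → V}, S.Finite →
    S.ncard = n → NC S w₀ → NC S w₁ → NC S y₀ → NC S y₁ → Hex S w₀ w₁ h → Hex S y₀ y₁ k →
    Conn S y₁ w₀ → Conn S y₀ w₁ → (Conn S y₀ w₀ ↔ Conn S y₁ w₁) := by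
  induction n using Nat.strong_induction_on with
  | _ n ih =>
  -- If some point lies off the first hexagon, an arc common to w₀ and w₁ with neighbouring ends can
  -- be contracted; it is no arc of y₀ or y₁, since otherwise a hypothesis would contain an extra
  -- circle.
  have step : ∀ {S : Set V} {w₀ w₁ y₀ y₁ : V → V} {h k : Fin 6 → V}, S.Finite →
    S.ncard = n → NC S w₀ → NC S w₁ → NC S y₀ → NC S y₁ → Hex S w₀ w₁ h → Hex S y₀ y₁ k →
    (∃ z ∈ S, ∀ i, z ≠ h i) →
    Conn S y₁ w₀ → Conn S y₀ w₁ → (Conn S y₀ w₀ ↔ Conn S y₁ w₁) := by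
    intro S w₀ w₁ y₀ y₁ h k hS hn hw₀ hw₁ hy₀ hy₁ H K hne c1 c2
    obtain ⟨p, hp, hph, hqh, hnb⟩ := H.exists_arc hS hw₀ hw₁ hne
    have e := H.other p hp hph
    set q := w₀ p with hq
    have hqS : q ∈ S := hw₀.mem p hp
    have hpq : p ≠ q := (hw₀.ne p hp).symm
    have z1 : y₁ p ≠ q := fun e' => not_conn_of_circle hy₁ hw₀ hp hq.symm e' (H.mem 0)
      (hph 0).symm (hqh 0).symm c1
    have z0 : y₀ p ≠ q := fun e' => not_conn_of_circle hy₀ hw₁ hp e.symm e' (H.mem 0)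
      (hph 0).symm (hqh 0).symm c2
    rw [conn_contract hy₁ hw₀ hp hq.symm z1] at c1
    rw [conn_contract hy₀ hw₁ hp e.symm z0] at c2
    rw [conn_contract hy₀ hw₀ hp hq.symm z0, conn_contract hy₁ hw₁ hp e.symm z1]
    rcases K.contract hy₀ hy₁ hp hqS hpq hnb z0 z1 with ⟨k', K'⟩ | heq
    · refine ih _ ?_ (hS.subset Set.sdiff_subset) rfl ?_ ?_ (hy₀.contract hp hqS hpq z0 hnb)
        (hy₁.contract hp hqS hpq z1 hnb) (H.restrict hph hqh) K' c1 c2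
      · rw [← hn]
        exact Set.ncard_lt_ncard ⟨Set.sdiff_subset, fun hle => (hle hp).2 (by simp)⟩ hS
      · have := hw₀.restrict hp; rwa [← hq] at this
      · have := hw₁.restrict hp; rwa [← e] at this
    -- The second hexagon has collapsed, so y₀ and y₁ agree and both sides are among the hypotheses.
    · exact iff_of_true (c1.congr fun z hz => (heq z hz).symm) (c2.congr heq)
  intro S w₀ w₁ y₀ y₁ h k hS hn hw₀ hw₁ hy₀ hy₁ H K c1 c2
  by_cases hne : ∃ z ∈ S, ∀ i, z ≠ h i
  · exact step hS hn hw₀ hw₁ hy₀ hy₁ H K hne c1 c2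
  by_cases hne' : ∃ z ∈ S, ∀ i, z ≠ k i
  · rw [conn_comm, conn_comm (x := y₁)]
    exact step hS hn hy₀ hy₁ hw₀ hw₁ K H hne' c2.symm c1.symm
  push Not at hne hne'
  exact H.terminal K hne hne' c1 c2

end Hexagon

/-! ## Rays of cup diagrams -/

namespace CupDiagram

theorem partner_inj (c : CupDiagram) {p q : ℤ} (h : c.partner p = c.partner q) : p = q := by
  rw [← c.partner_partner p, h, c.partner_partner]

/-- Positions strictly between the two ends of a cup. -/
theorem nested_iff (c : CupDiagram) (p k : ℤ) :
    (p < k ∧ k < c.partner p) ↔ (p < c.partner k ∧ c.partner k < c.partner p) := by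
  constructor
  · rintro ⟨h1, h2⟩; exact (c.nested p k h1 h2).2
  · rintro ⟨h1, h2⟩
    have := (c.nested p (c.partner k) h1 h2).2
    rwa [c.partner_partner] at this

theorem ray_not_below (c : CupDiagram) {p k : ℤ} (hk : c.partner k = k) :
    ¬ (p < k ∧ k < c.partner p) := fun h => (c.nested p k h.1 h.2).1 hk

theorem exists_bound (c : CupDiagram) : ∃ W : ℤ, 0 ≤ W ∧ ∀ p, c.partner p ≠ p → -W ≤ p ∧ p < W := by
  obtain ⟨a, ha⟩ := c.finite_moved.bddAbove
  obtain ⟨b, hb⟩ := c.finite_moved.bddBelow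
  refine ⟨|a| + |b| + 1, by positivity, fun p hp => ?_⟩
  have h1 := ha hp
  have h2 := hb hp
  have := le_abs_self a
  have := neg_abs_le b
  have := abs_nonneg a
  have := abs_nonneg b
  constructor <;> omega

theorem card_endpoints (c : CupDiagram) : c.endpoints.card = 2 * c.numCups := by
  have h : c.endpoints.card = (c.endpoints.filter fun p => p < c.partner p).card +
      (c.endpoints.filter fun p => ¬ p < c.partner p).card :=
    (Finset.card_filter_add_card_filter_not _).symm
  have h2 : (c.endpoints.filter fun p => ¬ p < c.partner p).card = c.numCups := by
    refine Finset.card_bij' (fun p _ => c.partner p) (fun p _ => c.partner p) ?_ ?_ ?_ ?_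
    · intro p hp
      rw [Finset.mem_filter, mem_endpoints] at hp ⊢
      rw [c.partner_partner]
      exact ⟨hp.1.symm, by have := hp.1; omega⟩
    · intro p hp
      rw [Finset.mem_filter, mem_endpoints] at hp ⊢
      rw [c.partner_partner]
      exact ⟨hp.1.symm, by have := hp.1; omega⟩
    · intro p _; exact c.partner_partner p
    · intro p _; exact c.partner_partner p
  rw [h, h2]
  unfold numCups
  omega

theorem rayIndex_succ (c : CupDiagram) (p : ℤ) :
    c.rayIndex (p + 1) = c.rayIndex p + if c.partner p = p then 1 else 0 := by
  unfold rayIndex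
  by_cases h : c.partner p = p
  · rw [if_pos h]
    have : (c.endpoints.filter fun q => q < p + 1) = c.endpoints.filter fun q => q < p := by
      ext q
      simp only [Finset.mem_filter, mem_endpoints]
      constructor
      · rintro ⟨a, b⟩
        exact ⟨a, lt_of_le_of_ne (by omega) fun e => a (e ▸ h)⟩
      · rintro ⟨a, b⟩; exact ⟨a, by omega⟩
    rw [this]; ring
  · rw [if_neg h]
    have : (c.endpoints.filter fun q => q < p + 1) =
        insert p (c.endpoints.filter fun q => q < p) := by
      ext q
      simp only [Finset.mem_filter, mem_endpoints, Finset.mem_insert]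
      constructor
      · rintro ⟨a, b⟩
        rcases eq_or_ne q p with e | e
        · exact Or.inl e
        · exact Or.inr ⟨a, by omega⟩
      · rintro (rfl | ⟨a, b⟩)
        · exact ⟨h, by omega⟩
        · exact ⟨a, by omega⟩
    rw [this, Finset.card_insert_of_notMem (by simp)]
    push_cast; ring

theorem rayIndex_of_le (c : CupDiagram) {W p : ℤ} (hW : ∀ q, c.partner q ≠ q → W ≤ q)
    (hp : p ≤ W) : c.rayIndex p = p := by
  unfold rayIndex
  rw [Finset.filter_false_of_mem]
  · simp
  · intro q hq
    rw [mem_endpoints] at hq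
    have := hW q hq
    omega

theorem rayIndex_of_ge (c : CupDiagram) {W p : ℤ} (hW : ∀ q, c.partner q ≠ q → q < W)
    (hp : W ≤ p) : c.rayIndex p = p - 2 * c.numCups := by
  unfold rayIndex
  rw [Finset.filter_true_of_mem]
  · rw [card_endpoints]; push_cast; ring
  · intro q hq
    rw [mem_endpoints] at hq
    have := hW q hq
    omega

theorem rayIndex_mono (c : CupDiagram) : Monotone c.rayIndex := by
  refine monotone_int_of_le_succ fun p => ?_
  rw [rayIndex_succ]
  split_ifs <;> omega

theorem rayIndex_lt (c : CupDiagram) {p q : ℤ} (hp : c.partner p = p) (h : p < q) :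
    c.rayIndex p < c.rayIndex q := by
  have := c.rayIndex_mono (show p + 1 ≤ q by omega)
  rw [rayIndex_succ, if_pos hp] at this
  omega

theorem rayIndex_inj (c : CupDiagram) {p q : ℤ} (hp : c.partner p = p) (hq : c.partner q = q)
    (h : c.rayIndex p = c.rayIndex q) : p = q := by
  rcases lt_trichotomy p q with h1 | h1 | h1
  · have := c.rayIndex_lt hp h1; omega
  · exact h1
  · have := c.rayIndex_lt hq h1; omega

theorem rayIndex_lt_iff (c : CupDiagram) {p q : ℤ} (hp : c.partner p = p) (hq : c.partner q = q) :
    c.rayIndex p < c.rayIndex q ↔ p < q := by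
  refine ⟨fun h => ?_, c.rayIndex_lt hp⟩
  by_contra h'
  have := c.rayIndex_mono (not_lt.1 h')
  omega

/-- The numbering is unbounded in both directions and grows by one exactly when a ray is passed, so
the last position with number at most i is a ray numbered i. -/
theorem exists_ray (c : CupDiagram) (i : ℤ) : ∃ p, c.partner p = p ∧ c.rayIndex p = i := by
  obtain ⟨W, h0, hW⟩ := c.exists_bound
  obtain ⟨p, hp, hmax⟩ : ∃ p, c.rayIndex p ≤ i ∧ ∀ z, c.rayIndex z ≤ i → z ≤ p := by
    refine Int.exists_greatest_of_bdd ⟨max W (i + 2 * c.numCups), fun z hz => ?_⟩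
      ⟨min (-W) i, ?_⟩
    · by_contra h
      rw [not_le, max_lt_iff] at h
      rw [c.rayIndex_of_ge (fun q hq => (hW q hq).2) h.1.le] at hz
      omega
    · rw [c.rayIndex_of_le (fun q hq => (hW q hq).1) (min_le_left _ _)]
      exact min_le_right _ _
  have h1 : ¬ c.rayIndex (p + 1) ≤ i := fun h => by have := hmax _ h; omega
  rw [rayIndex_succ] at h1
  by_cases h : c.partner p = p
  · rw [if_pos h] at h1
    exact ⟨p, h, by omega⟩
  · rw [if_neg h] at h1; omega

/-- The position of the ray with a given index. -/
noncomputable def rayAt (c : CupDiagram) (i : ℤ) : ℤ := (c.exists_ray i).choose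

theorem partner_rayAt (c : CupDiagram) (i : ℤ) : c.partner (c.rayAt i) = c.rayAt i :=
  (c.exists_ray i).choose_spec.1

theorem rayIndex_rayAt (c : CupDiagram) (i : ℤ) : c.rayIndex (c.rayAt i) = i :=
  (c.exists_ray i).choose_spec.2

theorem rayAt_rayIndex (c : CupDiagram) {p : ℤ} (hp : c.partner p = p) :
    c.rayAt (c.rayIndex p) = p :=
  c.rayIndex_inj (c.partner_rayAt _) hp (c.rayIndex_rayAt _)

theorem rayAt_eq (c : CupDiagram) {p i : ℤ} (hp : c.partner p = p) (h : c.rayIndex p = i) :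
    c.rayAt i = p := by rw [← h, c.rayAt_rayIndex hp]

theorem rayAt_lt_iff (c : CupDiagram) {i j : ℤ} : c.rayAt i < c.rayAt j ↔ i < j := by
  rw [← c.rayIndex_lt_iff (c.partner_rayAt _) (c.partner_rayAt _), c.rayIndex_rayAt,
    c.rayIndex_rayAt]

theorem rayAt_of_le (c : CupDiagram) {W i : ℤ} (hW : ∀ q, c.partner q ≠ q → W ≤ q)
    (hi : i < W) : c.rayAt i = i :=
  c.rayAt_eq (by by_contra h; have := hW i h; omega) (c.rayIndex_of_le hW hi.le)

theorem rayAt_of_ge (c : CupDiagram) {W i : ℤ} (hW : ∀ q, c.partner q ≠ q → q < W)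
    (hi : W ≤ i + 2 * c.numCups) : c.rayAt i = i + 2 * c.numCups :=
  c.rayAt_eq (by by_contra h; have := hW _ h; omega) (by rw [c.rayIndex_of_ge hW hi]; ring)

/-- An order preserving surjection between the rays of two cup diagrams which is the identity far to
the left preserves the numbering. -/
theorem rayIndex_eq_of_mono {c d : CupDiagram} (φ : ℤ → ℤ)
    (hφ : ∀ p, c.partner p = p → d.partner (φ p) = φ p)
    (hmono : ∀ p q, c.partner p = p → c.partner q = q → p < q → φ p < φ q)
    (hsurj : ∀ q, d.partner q = q → ∃ p, c.partner p = p ∧ φ p = q)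
    (hleft : ∃ W, ∀ p ≤ W, c.partner p = p → φ p = p) {p : ℤ} (hp : c.partner p = p) :
    d.rayIndex (φ p) = c.rayIndex p := by
  -- Expressed in ray numbers, φ is a strictly increasing surjection of ℤ, hence a translation, and
  -- it is the identity far to the left.
  let g : ℤ → ℤ := fun i => d.rayIndex (φ (c.rayAt i))
  have gm : StrictMono g := fun i j hij =>
    d.rayIndex_lt (hφ _ (c.partner_rayAt i)) (hmono _ _ (c.partner_rayAt i) (c.partner_rayAt j)
      (c.rayAt_lt_iff.2 hij))
  have gs : Function.Surjective g := fun j => by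
    obtain ⟨p, hp, hpj⟩ := hsurj (d.rayAt j) (d.partner_rayAt j)
    exact ⟨c.rayIndex p, by simp only [g, c.rayAt_rayIndex hp, hpj, d.rayIndex_rayAt]⟩
  have g1 : ∀ i, g (i + 1) = g i + 1 := fun i => by
    obtain ⟨j, hj⟩ := gs (g i + 1)
    have h1 : i < j := gm.lt_iff_lt.1 (by omega)
    have h2 : g (i + 1) ≤ g j := gm.monotone (by omega)
    have h3 : g i < g (i + 1) := gm (by omega)
    omega
  have gt : ∀ (n : ℕ) (i : ℤ), g (i + n) = g i + n := by
    intro n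
    induction n with
    | zero => simp
    | succ n ih => intro i; push_cast; rw [← add_assoc, g1, ih]; ring
  obtain ⟨W, hW⟩ := hleft
  obtain ⟨Wc, _, hc⟩ := c.exists_bound
  obtain ⟨Wd, _, hd⟩ := d.exists_bound
  have gl : ∀ i, i ≤ W → i < -Wc → i < -Wd → g i = i := by
    intro i h1 h2 h3
    have hr : c.partner i = i := by by_contra h; have := (hc i h).1; omega
    simp only [g]
    rw [c.rayAt_of_le (fun q hq => (hc q hq).1) h2, hW i h1 hr]
    exact d.rayIndex_of_le (fun q hq => (hd q hq).1) h3.le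
  have gid : ∀ i, g i = i := by
    intro i
    obtain ⟨n, h1, h2, h3⟩ : ∃ n : ℕ, i - n ≤ W ∧ i - n < -Wc ∧ i - n < -Wd :=
      ⟨(i - W).toNat + (i + Wc).toNat + (i + Wd).toNat + 1, by omega, by omega, by omega⟩
    have := gt n (i - n)
    rw [gl _ h1 h2 h3] at this
    simpa using this
  have := gid (c.rayIndex p)
  simpa only [g, c.rayAt_rayIndex hp] using this

theorem shift_partner (c : CupDiagram) (p : ℤ) : c.shift.partner p = c.partner (p - 1) + 1 := rfl

theorem rayIndex_shift (c : CupDiagram) (p : ℤ) : c.shift.rayIndex p = c.rayIndex (p - 1) + 1 := by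
  unfold rayIndex
  have : (c.shift.endpoints.filter fun q => q < p).card =
      (c.endpoints.filter fun q => q < p - 1).card := by
    refine Finset.card_bij' (fun q _ => q - 1) (fun q _ => q + 1) ?_ ?_ ?_ ?_
    · intro q hq
      rw [Finset.mem_filter, mem_endpoints, shift_partner] at hq
      rw [Finset.mem_filter, mem_endpoints]
      exact ⟨fun h => hq.1 (by omega), by omega⟩
    · intro q hq
      rw [Finset.mem_filter, mem_endpoints] at hq
      rw [Finset.mem_filter, mem_endpoints, shift_partner]
      rw [add_sub_cancel_right]
      exact ⟨fun h => hq.1 (by omega), by omega⟩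
    · intro q _; ring
    · intro q _; ring
  rw [this]; ring

end CupDiagram

/-! ## Layers as noncrossing matchings -/

/-- The points of the two boundary lines of a layer. -/
@[ext]
structure Blk where
  hi : Bool
  pos : ℤ

namespace Blk

/-- The bottom line is traversed from left to right and then the top line from right to left. -/
def key (v : Blk) : Bool ×ₗ ℤ := toLex (v.hi, if v.hi then -v.pos else v.pos)

theorem key_inj : Function.Injective key := by
  rintro ⟨a, p⟩ ⟨b, q⟩ h
  have h' := toLex.injective h
  rw [Prod.mk.injEq] at h'
  obtain ⟨h1, h2⟩ := h'
  dsimp only at h1 h2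
  subst h1
  cases a
  · simp at h2; rw [h2]
  · simp at h2; rw [h2]

noncomputable instance : LinearOrder Blk := LinearOrder.lift' key key_inj

theorem lt_def {v w : Blk} : v < w ↔ key v < key w := Iff.rfl

theorem lo_lt_lo {p q : ℤ} : (⟨false, p⟩ : Blk) < ⟨false, q⟩ ↔ p < q := by
  rw [lt_def]; simp [key, Prod.Lex.toLex_lt_toLex]

theorem hi_lt_hi {p q : ℤ} : (⟨true, p⟩ : Blk) < ⟨true, q⟩ ↔ q < p := by
  rw [lt_def]; simp [key, Prod.Lex.toLex_lt_toLex]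

theorem lo_lt_hi {p q : ℤ} : (⟨false, p⟩ : Blk) < ⟨true, q⟩ ↔ True := by
  rw [lt_def]; simp [key, Prod.Lex.toLex_lt_toLex]

theorem hi_lt_lo {p q : ℤ} : (⟨true, p⟩ : Blk) < ⟨false, q⟩ ↔ False := by
  rw [lt_def]; simp [key, Prod.Lex.toLex_lt_toLex]

end Blk

namespace Matching

/-- The other end of the piece of curve of `t` starting at a boundary point. -/
noncomputable def lay (t : Matching) (v : Blk) : Blk :=
  if v.hi then
    if t.top.partner v.pos = v.pos then ⟨false, t.bot.rayAt (t.top.rayIndex v.pos)⟩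
    else ⟨true, t.top.partner v.pos⟩
  else
    if t.bot.partner v.pos = v.pos then ⟨true, t.top.rayAt (t.bot.rayIndex v.pos)⟩
    else ⟨false, t.bot.partner v.pos⟩

theorem lay_lo_arc (t : Matching) {p : ℤ} (h : t.bot.partner p ≠ p) :
    t.lay ⟨false, p⟩ = ⟨false, t.bot.partner p⟩ := by simp [lay, h]

theorem lay_lo_ray (t : Matching) {p : ℤ} (h : t.bot.partner p = p) :
    t.lay ⟨false, p⟩ = ⟨true, t.top.rayAt (t.bot.rayIndex p)⟩ := by simp [lay, h]

theorem lay_hi_arc (t : Matching) {p : ℤ} (h : t.top.partner p ≠ p) :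
    t.lay ⟨true, p⟩ = ⟨true, t.top.partner p⟩ := by simp [lay, h]

theorem lay_hi_ray (t : Matching) {p : ℤ} (h : t.top.partner p = p) :
    t.lay ⟨true, p⟩ = ⟨false, t.bot.rayAt (t.top.rayIndex p)⟩ := by simp [lay, h]

/-- The order on `Blk` runs once around the boundary of the strip. The cases according to the lines
and to arcs or rays use nesting, the absence of rays below arcs, and the monotonicity of the ray
numbering. -/
theorem nc_lay (t : Matching) : NC Set.univ t.lay := by
  refine ⟨fun _ _ => trivial, ?_, ?_, ?_⟩
  · rintro ⟨a, p⟩ -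
    cases a
    · by_cases h : t.bot.partner p = p
      · rw [lay_lo_ray t h, lay_hi_ray t (t.top.partner_rayAt _), t.top.rayIndex_rayAt,
          t.bot.rayAt_rayIndex h]
      · rw [lay_lo_arc t h, lay_lo_arc, t.bot.partner_partner]
        rw [t.bot.partner_partner]; exact Ne.symm h
    · by_cases h : t.top.partner p = p
      · rw [lay_hi_ray t h, lay_lo_ray t (t.bot.partner_rayAt _), t.bot.rayIndex_rayAt,
          t.top.rayAt_rayIndex h]
      · rw [lay_hi_arc t h, lay_hi_arc, t.top.partner_partner]
        rw [t.top.partner_partner]; exact Ne.symm h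
  · rintro ⟨a, p⟩ -
    cases a
    · by_cases h : t.bot.partner p = p
      · rw [lay_lo_ray t h]; intro e; simpa using congrArg Blk.hi e
      · rw [lay_lo_arc t h]; intro e; exact h (congrArg Blk.pos e)
    · by_cases h : t.top.partner p = p
      · rw [lay_hi_ray t h]; intro e; simpa using congrArg Blk.hi e
      · rw [lay_hi_arc t h]; intro e; exact h (congrArg Blk.pos e)
  · rintro ⟨a, p⟩ - ⟨b, k⟩ -
    have n1 := t.bot.nested_iff
    have n2 := t.top.nested_iff
    have r1 := fun {p k} => t.bot.ray_not_below (p := p) (k := k)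
    have r2 := fun {p k} => t.top.ray_not_below (p := p) (k := k)
    have ib := t.bot.partner_partner
    have it := t.top.partner_partner
    have mono1 : ∀ i j, t.top.rayAt i < t.top.rayAt j ↔ i < j := fun i j => t.top.rayAt_lt_iff
    have mono2 : ∀ i j, t.bot.rayAt i < t.bot.rayAt j ↔ i < j := fun i j => t.bot.rayAt_lt_iff
    unfold Cyc
    cases a <;> cases b
    · by_cases h : t.bot.partner p = p <;> by_cases h' : t.bot.partner k = k
      · rw [lay_lo_ray t h, lay_lo_ray t h']
        have m1 := mono1 (t.bot.rayIndex p) (t.bot.rayIndex k)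
        have m2 := t.bot.rayIndex_lt_iff h h'
        simp only [Blk.lo_lt_lo, Blk.hi_lt_hi, Blk.lo_lt_hi, Blk.hi_lt_lo, true_and, and_true, false_and,
          and_false, or_false, false_or]
        omega
      · rw [lay_lo_ray t h, lay_lo_arc t h']
        have : t.bot.partner k ≠ p := fun e => h' (by rw [e, ← h, ← e, ib])
        have := r1 (p := k) h
        have := r1 (p := t.bot.partner k) h
        rw [ib] at this
        simp only [Blk.lo_lt_lo, Blk.hi_lt_hi, Blk.lo_lt_hi, Blk.hi_lt_lo, true_and, and_true, false_and,
          and_false, or_false, false_or]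
        omega
      · rw [lay_lo_arc t h, lay_lo_ray t h']
        have := r1 (p := p) h'
        have := r1 (p := t.bot.partner p) h'
        rw [ib] at this
        simp only [Blk.lo_lt_lo, Blk.hi_lt_hi, Blk.lo_lt_hi, Blk.hi_lt_lo, true_and, and_true, false_and,
          and_false, or_false, false_or]
        omega
      · rw [lay_lo_arc t h, lay_lo_arc t h']
        have := n1 p k
        have := n1 (t.bot.partner p) k
        rw [ib] at this
        simp only [Blk.lo_lt_lo, Blk.hi_lt_hi, Blk.lo_lt_hi, Blk.hi_lt_lo, true_and, and_true, false_and,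
          and_false, or_false, false_or]
        have : k = p ∨ k = t.bot.partner p ∨ (t.bot.partner k ≠ p ∧ t.bot.partner k ≠ t.bot.partner p
          ∧ k ≠ p ∧ k ≠ t.bot.partner p) := by
          by_cases e1 : k = p
          · exact Or.inl e1
          by_cases e2 : k = t.bot.partner p
          · exact Or.inr (Or.inl e2)
          exact Or.inr (Or.inr ⟨fun e => e2 (by rw [← e, ib]),
            fun e => e1 (t.bot.partner_inj e), e1, e2⟩)
        omega
    · by_cases h : t.bot.partner p = p <;> by_cases h' : t.top.partner k = k
      · rw [lay_lo_ray t h, lay_hi_ray t h']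
        have m1 := mono1 (t.bot.rayIndex p) (t.top.rayIndex k)
        have m2 := mono2 (t.bot.rayIndex p) (t.top.rayIndex k)
        rw [t.top.rayAt_rayIndex h'] at m1
        rw [t.bot.rayAt_rayIndex h] at m2
        simp only [Blk.lo_lt_lo, Blk.hi_lt_hi, Blk.lo_lt_hi, Blk.hi_lt_lo, true_and, and_true, false_and,
          and_false, or_false, false_or]
        omega
      · rw [lay_lo_ray t h, lay_hi_arc t h']
        have h2 := t.top.partner_rayAt (t.bot.rayIndex p)
        have := r2 (p := k) h2
        have := r2 (p := t.top.partner k) h2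
        rw [it] at this
        have : t.top.partner k ≠ t.top.rayAt (t.bot.rayIndex p) := fun e => h' (by
          rw [e, ← h2, ← e, it])
        simp only [Blk.lo_lt_lo, Blk.hi_lt_hi, Blk.lo_lt_hi, Blk.hi_lt_lo, true_and, and_true, false_and,
          and_false, or_false, false_or]
        omega
      · rw [lay_lo_arc t h, lay_hi_ray t h']
        have h2 := t.bot.partner_rayAt (t.top.rayIndex k)
        have := r1 (p := p) h2
        have := r1 (p := t.bot.partner p) h2
        rw [ib] at this
        have : t.bot.partner p ≠ t.bot.rayAt (t.top.rayIndex k) := fun e => h (by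
          rw [e, ← h2, ← e, ib])
        have : p ≠ t.bot.rayAt (t.top.rayIndex k) := fun e => h (by rw [e, h2])
        simp only [Blk.lo_lt_lo, Blk.hi_lt_hi, Blk.lo_lt_hi, Blk.hi_lt_lo, true_and, and_true, false_and,
          and_false, or_false, false_or]
        omega
      · rw [lay_lo_arc t h, lay_hi_arc t h']
        simp only [Blk.lo_lt_lo, Blk.hi_lt_hi, Blk.lo_lt_hi, Blk.hi_lt_lo, true_and, and_true, false_and,
          and_false, or_false, false_or]
        omega
    · by_cases h : t.top.partner p = p <;> by_cases h' : t.bot.partner k = k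
      · rw [lay_hi_ray t h, lay_lo_ray t h']
        have m1 := mono1 (t.bot.rayIndex k) (t.top.rayIndex p)
        have m2 := mono2 (t.bot.rayIndex k) (t.top.rayIndex p)
        rw [t.top.rayAt_rayIndex h] at m1
        rw [t.bot.rayAt_rayIndex h'] at m2
        simp only [Blk.lo_lt_lo, Blk.hi_lt_hi, Blk.lo_lt_hi, Blk.hi_lt_lo, true_and, and_true, false_and,
          and_false, or_false, false_or]
        omega
      · rw [lay_hi_ray t h, lay_lo_arc t h']
        have h2 := t.bot.partner_rayAt (t.top.rayIndex p)
        have := r1 (p := k) h2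
        have := r1 (p := t.bot.partner k) h2
        rw [ib] at this
        have : t.bot.partner k ≠ t.bot.rayAt (t.top.rayIndex p) := fun e => h' (by
          rw [e, ← h2, ← e, ib])
        simp only [Blk.lo_lt_lo, Blk.hi_lt_hi, Blk.lo_lt_hi, Blk.hi_lt_lo, true_and, and_true, false_and,
          and_false, or_false, false_or]
        omega
      · rw [lay_hi_arc t h, lay_lo_ray t h']
        have h2 := t.top.partner_rayAt (t.bot.rayIndex k)
        have := r2 (p := p) h2
        have := r2 (p := t.top.partner p) h2
        rw [it] at this
        have : t.top.partner p ≠ t.top.rayAt (t.bot.rayIndex k) := fun e => h (by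
          rw [e, ← h2, ← e, it])
        have : p ≠ t.top.rayAt (t.bot.rayIndex k) := fun e => h (by rw [e, h2])
        simp only [Blk.lo_lt_lo, Blk.hi_lt_hi, Blk.lo_lt_hi, Blk.hi_lt_lo, true_and, and_true, false_and,
          and_false, or_false, false_or]
        omega
      · rw [lay_hi_arc t h, lay_lo_arc t h']
        simp only [Blk.lo_lt_lo, Blk.hi_lt_hi, Blk.lo_lt_hi, Blk.hi_lt_lo, true_and, and_true, false_and,
          and_false, or_false, false_or]
        omega
    · by_cases h : t.top.partner p = p <;> by_cases h' : t.top.partner k = k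
      · rw [lay_hi_ray t h, lay_hi_ray t h']
        have m1 := mono2 (t.top.rayIndex k) (t.top.rayIndex p)
        have m2 := t.top.rayIndex_lt_iff h' h
        simp only [Blk.lo_lt_lo, Blk.hi_lt_hi, Blk.lo_lt_hi, Blk.hi_lt_lo, true_and, and_true, false_and,
          and_false, or_false, false_or]
        omega
      · rw [lay_hi_ray t h, lay_hi_arc t h']
        have := r2 (p := k) h
        have := r2 (p := t.top.partner k) h
        rw [it] at this
        have : t.top.partner k ≠ p := fun e => h' (by rw [e, ← h, ← e, it])
        simp only [Blk.lo_lt_lo, Blk.hi_lt_hi, Blk.lo_lt_hi, Blk.hi_lt_lo, true_and, and_true, false_and,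
          and_false, or_false, false_or]
        omega
      · rw [lay_hi_arc t h, lay_hi_ray t h']
        have := r2 (p := p) h'
        have := r2 (p := t.top.partner p) h'
        rw [it] at this
        simp only [Blk.lo_lt_lo, Blk.hi_lt_hi, Blk.lo_lt_hi, Blk.hi_lt_lo, true_and, and_true, false_and,
          and_false, or_false, false_or]
        omega
      · rw [lay_hi_arc t h, lay_hi_arc t h']
        have := n2 p k
        have := n2 (t.top.partner p) k
        rw [it] at this
        simp only [Blk.lo_lt_lo, Blk.hi_lt_hi, Blk.lo_lt_hi, Blk.hi_lt_lo, true_and, and_true, false_and,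
          and_false, or_false, false_or]
        have : k = p ∨ k = t.top.partner p ∨ (t.top.partner k ≠ p ∧ t.top.partner k ≠ t.top.partner p
          ∧ k ≠ p ∧ k ≠ t.top.partner p) := by
          by_cases e1 : k = p
          · exact Or.inl e1
          by_cases e2 : k = t.top.partner p
          · exact Or.inr (Or.inl e2)
          exact Or.inr (Or.inr ⟨fun e => e2 (by rw [← e, it]),
            fun e => e1 (t.top.partner_inj e), e1, e2⟩)
        omega

end Matching

theorem Blk.lt_lo {v : Blk} {q : ℤ} (h : v < ⟨false, q⟩) : v.hi = false ∧ v.pos < q := by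
  obtain ⟨b, p⟩ := v
  cases b
  · exact ⟨rfl, Blk.lo_lt_lo.1 h⟩
  · exact absurd h (by simp [Blk.hi_lt_lo])

theorem Blk.hi_lt {v : Blk} {q : ℤ} (h : ⟨true, q⟩ < v) : v.hi = true ∧ v.pos < q := by
  obtain ⟨b, p⟩ := v
  cases b
  · exact absurd h (by simp [Blk.hi_lt_lo])
  · exact ⟨rfl, Blk.hi_lt_hi.1 h⟩

theorem Cyc.of_lt {V : Type*} [LinearOrder V] {a b c : V} (h1 : a < b) (h2 : b < c) : Cyc a b c :=
  Or.inl ⟨h1, h2⟩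

theorem Cyc.between {V : Type*} [LinearOrder V] {a b c : V} (h : Cyc a b c) (h2 : a < c) :
    a < b ∧ b < c := by
  unfold Cyc at h; grind

namespace Matching

/-- A noncrossing perfect matching of the boundary of a strip which consists of vertical lines
outside a finite part is a crossingless matching. -/
theorem exists_lay_eq {O : Blk → Blk} (hO : NC Set.univ O)
    (hl : ∃ W, ∀ p, p < W → O ⟨false, p⟩ = ⟨true, p⟩)
    (hr : ∃ W, ∀ p, W < p → O ⟨false, p⟩ = ⟨true, p⟩) : ∃ R : Matching, R.lay = O := by
  obtain ⟨Wl, hl⟩ := hl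
  obtain ⟨Wr, hr⟩ := hr
  have inv := fun v => hO.inv v trivial
  have ne := fun v => hO.ne v trivial
  have cr := fun v w => hO.cross v trivial w trivial
  have cas : ∀ v : Blk, v = ⟨false, v.pos⟩ ∨ v = ⟨true, v.pos⟩ := by
    rintro ⟨b, p⟩; cases b <;> simp
  -- Arcs returning to the bottom line become the caps; a point whose arc goes to the top line
  -- becomes a ray. The cup diagram `c` below treats the top line in the same way.
  let b : CupDiagram :=
    { partner := fun p => if (O ⟨false, p⟩).hi then p else (O ⟨false, p⟩).pos
      partner_partner := fun p => by
        rcases cas (O ⟨false, p⟩) with h | h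
        · have h' := inv ⟨false, p⟩
          generalize (O ⟨false, p⟩).pos = q at h
          rw [h] at h'
          simp [h, h']
        · generalize (O ⟨false, p⟩).pos = q at h
          simp [h]
      finite_moved := by
        refine (Set.finite_Icc Wl Wr).subset fun p hp => ?_
        rw [Set.mem_ofPred_eq] at hp
        by_contra h
        rw [Set.mem_Icc, not_and_or, not_le, not_le] at h
        rcases h with h | h
        · exact hp (by simp [hl p h])
        · exact hp (by simp [hr p h])
      nested := fun p k h1 h2 => by
        rcases cas (O ⟨false, p⟩) with h | h
        · rw [h] at h2 ⊢
          simp only [Bool.false_eq_true, if_false] at h2 ⊢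
          have l1 : (⟨false, p⟩ : Blk) < ⟨false, k⟩ := Blk.lo_lt_lo.2 h1
          have l2 : (⟨false, k⟩ : Blk) < ⟨false, (O ⟨false, p⟩).pos⟩ := Blk.lo_lt_lo.2 h2
          have c := cr ⟨false, p⟩ ⟨false, k⟩ (by rw [h]; exact Cyc.of_lt l1 l2)
          rw [h] at c
          have c' := c.between (l1.trans l2)
          have c2 := Blk.lt_lo c'.2
          rw [if_neg (by simp [c2.1])]
          refine ⟨fun e => ne ⟨false, k⟩ (Blk.ext c2.1 e), ?_, c2.2⟩
          have c1 := c'.1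
          rw [show O ⟨false, k⟩ = ⟨false, (O ⟨false, k⟩).pos⟩ from Blk.ext c2.1 rfl] at c1
          exact Blk.lo_lt_lo.1 c1
        · rw [h] at h2; simp at h2; omega }
  have far : ∀ p, (p < Wl ∨ Wr < p) → O ⟨true, p⟩ = ⟨false, p⟩ := by
    rintro p (h | h)
    · have := inv ⟨false, p⟩; rwa [hl p h] at this
    · have := inv ⟨false, p⟩; rwa [hr p h] at this
  let c : CupDiagram :=
    { partner := fun p => if (O ⟨true, p⟩).hi then (O ⟨true, p⟩).pos else p
      partner_partner := fun p => by
        rcases cas (O ⟨true, p⟩) with h | h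
        · generalize (O ⟨true, p⟩).pos = q at h
          simp [h]
        · have h' := inv ⟨true, p⟩
          generalize (O ⟨true, p⟩).pos = q at h
          rw [h] at h'
          simp [h, h']
      finite_moved := by
        refine (Set.finite_Icc Wl Wr).subset fun p hp => ?_
        rw [Set.mem_ofPred_eq] at hp
        by_contra h
        rw [Set.mem_Icc, not_and_or, not_le, not_le] at h
        exact hp (by simp [far p h])
      nested := fun p k h1 h2 => by
        rcases cas (O ⟨true, p⟩) with h | h
        · rw [h] at h2; simp at h2; omega
        · rw [h] at h2 ⊢
          simp only [if_true] at h2 ⊢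
          have l1 : (⟨true, k⟩ : Blk) < ⟨true, p⟩ := Blk.hi_lt_hi.2 h1
          have l2 : (⟨true, (O ⟨true, p⟩).pos⟩ : Blk) < ⟨true, k⟩ := Blk.hi_lt_hi.2 h2
          have i := inv ⟨true, p⟩
          rw [h] at i
          have c := cr ⟨true, (O ⟨true, p⟩).pos⟩ ⟨true, k⟩ (by rw [i]; exact Cyc.of_lt l2 l1)
          rw [i] at c
          have c' := c.between (l2.trans l1)
          have c2 := Blk.hi_lt c'.1
          rw [if_pos c2.1]
          refine ⟨fun e => ne ⟨true, k⟩ (Blk.ext c2.1 e), ?_, c2.2⟩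
          have c1 := c'.2
          rw [show O ⟨true, k⟩ = ⟨true, (O ⟨true, k⟩).pos⟩ from Blk.ext c2.1 rfl] at c1
          exact Blk.hi_lt_hi.1 c1 }
  have hb : ∀ p, b.partner p = if (O ⟨false, p⟩).hi then p else (O ⟨false, p⟩).pos := fun _ => rfl
  have hc : ∀ p, c.partner p = if (O ⟨true, p⟩).hi then (O ⟨true, p⟩).pos else p := fun _ => rfl
  have rb : ∀ {p}, b.partner p = p → O ⟨false, p⟩ = ⟨true, (O ⟨false, p⟩).pos⟩ := by
    intro p h
    rw [hb] at h
    rcases cas (O ⟨false, p⟩) with h' | h'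
    · rw [h'] at h
      simp at h
      exact absurd (h'.trans (by rw [h])) (ne _)
    · exact h'
  have rc : ∀ {p}, c.partner p = p → O ⟨true, p⟩ = ⟨false, (O ⟨true, p⟩).pos⟩ := by
    intro p h
    rw [hc] at h
    rcases cas (O ⟨true, p⟩) with h' | h'
    · exact h'
    · rw [h'] at h
      simp at h
      exact absurd (h'.trans (by rw [h])) (ne _)
  have bc : ∀ {p}, b.partner p = p → c.partner (O ⟨false, p⟩).pos = (O ⟨false, p⟩).pos := by
    intro p h
    have i := inv ⟨false, p⟩
    rw [rb h] at i
    rw [hc, i]; simp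
  have cb : ∀ {p}, c.partner p = p → b.partner (O ⟨true, p⟩).pos = (O ⟨true, p⟩).pos := by
    intro p h
    have i := inv ⟨true, p⟩
    rw [rc h] at i
    rw [hb, i]; simp
  have idx : ∀ {p}, b.partner p = p → c.rayIndex (O ⟨false, p⟩).pos = b.rayIndex p := by
    intro p hp
    refine CupDiagram.rayIndex_eq_of_mono (fun p => (O ⟨false, p⟩).pos) (fun p h => bc h) ?_ ?_ ?_ hp
    · intro p q hp hq hpq
      have l1 : (⟨false, p⟩ : Blk) < ⟨false, q⟩ := Blk.lo_lt_lo.2 hpq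
      have l2 : (⟨false, q⟩ : Blk) < ⟨true, (O ⟨false, p⟩).pos⟩ := Blk.lo_lt_hi.2 trivial
      have c := cr ⟨false, p⟩ ⟨false, q⟩ (by rw [rb hp]; exact Cyc.of_lt l1 l2)
      rw [rb hp, rb hq] at c
      have := (c.between (l1.trans l2)).2
      rwa [Blk.hi_lt_hi] at this
    · intro q hq
      refine ⟨(O ⟨true, q⟩).pos, cb hq, ?_⟩
      have i := inv ⟨true, q⟩
      rw [rc hq] at i
      rw [i]
    · exact ⟨Wl - 1, fun p hp _ => by rw [hl p (by omega)]⟩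
  -- Far to the right, corresponding rays are at the same position, and their numbers differ from it
  -- by twice the number of arcs.
  have hn : b.numCups = c.numCups := by
    obtain ⟨A, _, hA⟩ := b.exists_bound
    obtain ⟨B, _, hB⟩ := c.exists_bound
    obtain ⟨p, h1, h2, h3⟩ : ∃ p, A ≤ p ∧ B ≤ p ∧ Wr < p :=
      ⟨max A (max B (Wr + 1)), le_max_left _ _, (le_max_left _ _).trans (le_max_right _ _),
        lt_of_lt_of_le (by omega) ((le_max_right B (Wr + 1)).trans (le_max_right _ _))⟩
    have hp : b.partner p = p := by rw [hb, hr p h3]; simp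
    have := idx hp
    rw [hr p h3, b.rayIndex_of_ge (fun q hq => (hA q hq).2) h1] at this
    dsimp only at this
    rw [c.rayIndex_of_ge (fun q hq => (hB q hq).2) h2] at this
    omega
  refine ⟨⟨b, c, hn⟩, funext fun v => ?_⟩
  rcases cas v with h | h
  · rw [h]
    by_cases hp : b.partner v.pos = v.pos
    · rw [lay_lo_ray _ hp, rb hp]
      exact Blk.ext rfl (c.rayAt_eq (bc hp) (idx hp))
    · rw [lay_lo_arc _ hp]
      rcases cas (O ⟨false, v.pos⟩) with h' | h'
      · rw [h']
        exact Blk.ext rfl (by change b.partner _ = _; rw [hb, h']; simp)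
      · exact absurd (by rw [hb, h']; simp) hp
  · rw [h]
    by_cases hp : c.partner v.pos = v.pos
    · rw [lay_hi_ray _ hp, rc hp]
      refine Blk.ext rfl (b.rayAt_eq (cb hp) ?_)
      rw [← idx (cb hp)]
      have i := inv ⟨true, v.pos⟩
      rw [rc hp] at i
      rw [i]
    · rw [lay_hi_arc _ hp]
      rcases cas (O ⟨true, v.pos⟩) with h' | h'
      · exact absurd (by rw [hc, h']; simp) hp
      · rw [h']
        exact Blk.ext rfl (by change c.partner _ = _; rw [hc, h']; simp)

theorem lay_injective : Function.Injective lay := by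
  intro t s h
  have hb : t.bot = s.bot := by
    refine CupDiagram.ext (funext fun p => ?_)
    have := congrFun h ⟨false, p⟩
    by_cases h1 : t.bot.partner p = p <;> by_cases h2 : s.bot.partner p = p
    · rw [h1, h2]
    · rw [lay_lo_ray t h1, lay_lo_arc s h2] at this; simp at this
    · rw [lay_lo_arc t h1, lay_lo_ray s h2] at this; simp at this
    · rw [lay_lo_arc t h1, lay_lo_arc s h2] at this; simpa using this
  have ht : t.top = s.top := by
    refine CupDiagram.ext (funext fun p => ?_)
    have := congrFun h ⟨true, p⟩
    by_cases h1 : t.top.partner p = p <;> by_cases h2 : s.top.partner p = p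
    · rw [h1, h2]
    · rw [lay_hi_ray t h1, lay_hi_arc s h2] at this; simp at this
    · rw [lay_hi_arc t h1, lay_hi_ray s h2] at this; simp at this
    · rw [lay_hi_arc t h1, lay_hi_arc s h2] at this; simpa using this
  exact Matching.ext hb ht

/-! ## Matchings as relations -/

/-- Two colourings of the boundary lines which are restrictions of a colouring of the curves. -/
structure Rel (t : Matching) (f g : ℤ → Prop) : Prop where
  bot : ∀ p, f (t.bot.partner p) = f p
  top : ∀ p, g (t.top.partner p) = g p
  ray : ∀ i, f (t.bot.rayAt i) = g (t.top.rayAt i)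

/-- A colouring of the boundary of a strip. -/
def glue (f g : ℤ → Prop) (v : Blk) : Prop := if v.hi then g v.pos else f v.pos

theorem glue_lo (f g : ℤ → Prop) (p : ℤ) : glue f g ⟨false, p⟩ = f p := by simp [glue]

theorem glue_hi (f g : ℤ → Prop) (p : ℤ) : glue f g ⟨true, p⟩ = g p := by simp [glue]

theorem glue_eta (F : Blk → Prop) : glue (fun p => F ⟨false, p⟩) (fun p => F ⟨true, p⟩) = F := by
  funext ⟨b, p⟩; cases b <;> simp [glue]

theorem rel_iff (t : Matching) (f g : ℤ → Prop) : t.Rel f g ↔ ArcInv (glue f g) t.lay Set.univ := by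
  constructor
  · rintro ⟨h1, h2, h3⟩ ⟨b, p⟩ -
    cases b
    · by_cases h : t.bot.partner p = p
      · rw [lay_lo_ray t h, glue_lo, glue_hi, ← h3, t.bot.rayAt_rayIndex h]
      · rw [lay_lo_arc t h, glue_lo, glue_lo, h1]
    · by_cases h : t.top.partner p = p
      · rw [lay_hi_ray t h, glue_lo, glue_hi, h3, t.top.rayAt_rayIndex h]
      · rw [lay_hi_arc t h, glue_hi, glue_hi, h2]
  · intro H
    refine ⟨fun p => ?_, fun p => ?_, fun i => ?_⟩
    · have := H ⟨false, p⟩ trivial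
      by_cases h : t.bot.partner p = p
      · rw [h]
      · rwa [lay_lo_arc t h, glue_lo, glue_lo] at this
    · have := H ⟨true, p⟩ trivial
      by_cases h : t.top.partner p = p
      · rw [h]
      · rwa [lay_hi_arc t h, glue_hi, glue_hi] at this
    · have := H ⟨false, t.bot.rayAt i⟩ trivial
      rw [lay_lo_ray t (t.bot.partner_rayAt i), glue_lo, glue_hi, t.bot.rayIndex_rayAt] at this
      exact this.symm

theorem Rel.joins {t : Matching} {f g : ℤ → Prop} (h : t.Rel f g) {p q : ℤ} (hpq : t.Joins p q) :
    f p = g q := by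
  have := h.ray (t.bot.rayIndex p)
  rwa [t.bot.rayAt_rayIndex hpq.1, t.top.rayAt_eq hpq.2.1 hpq.2.2.symm] at this

theorem rel_bot (t : Matching) : t.Rel ⊥ ⊥ := ⟨fun _ => rfl, fun _ => rfl, fun _ => rfl⟩

/-- The indicator of the two ends of a single piece of t is a colouring of t. Being also a colouring
of s, it forces s to join the same two points. -/
theorem rel_injective {t s : Matching} (h : ∀ f g, t.Rel f g → s.Rel f g) : t = s := by
  refine lay_injective (funext fun v => ?_)
  have ht := t.nc_lay
  have all : ∀ F : Blk → Prop, ArcInv F t.lay Set.univ → ArcInv F s.lay Set.univ := by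
    intro F hF
    rw [← glue_eta F] at hF ⊢
    exact (rel_iff s _ _).1 (h _ _ ((rel_iff t _ _).2 hF))
  have H : ArcInv (fun w => w = v ∨ w = t.lay v) t.lay Set.univ := by
    intro w _
    refine propext ⟨?_, ?_⟩
    · rintro (e | e)
      · exact Or.inr (by rw [← e, ht.inv w trivial])
      · exact Or.inl (ht.inj trivial trivial e)
    · rintro (rfl | rfl)
      · exact Or.inr rfl
      · exact Or.inl (ht.inv v trivial)
  have H' := all _ H
  have := (H' v trivial).symm.mp (Or.inl rfl)
  exact (this.resolve_left (s.nc_lay.ne v trivial)).symm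

/-- `R` is the composition of `t` (below) and `s` (above), and no circle occurs. -/
structure IsComp (t s R : Matching) : Prop where
  rel : ∀ f h, R.Rel f h ↔ ∃ g, t.Rel f g ∧ s.Rel g h
  noCircle : ∀ g, t.Rel ⊥ g → s.Rel g ⊥ → g = ⊥

theorem Blk.cas (v : Blk) : v = ⟨false, v.pos⟩ ∨ v = ⟨true, v.pos⟩ := by
  obtain ⟨b, p⟩ := v; cases b <;> simp

/-- The arcs of t are contracted along the caps of s (`exists_contraction`); the remaining points of
the middle line are moved up along the rays of s, and the cups of s are added. The result is
noncrossing and vertical far out, hence a matching by `exists_lay_eq`. -/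
theorem exists_isComp (t s : Matching) (hc : ∀ g, t.Rel ⊥ g → s.Rel g ⊥ → g = ⊥) :
    ∃ R, IsComp t s R := by
  classical
  -- The ends of the caps of s, regarded as points of the top line of t; τ below joins them by these
  -- caps.
  let T : Finset Blk := s.bot.endpoints.image fun p => ⟨true, p⟩
  have hTh : ∀ p, (⟨true, p⟩ : Blk) ∈ T ↔ s.bot.partner p ≠ p := fun p => by
    simp [T, CupDiagram.mem_endpoints]
  have hTl : ∀ p, (⟨false, p⟩ : Blk) ∉ T := fun p => by simp [T]
  let τ : Blk → Blk := fun v => ⟨true, s.bot.partner v.pos⟩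
  have hT : ∀ v ∈ T, v = ⟨true, v.pos⟩ ∧ s.bot.partner v.pos ≠ v.pos := by
    intro v hv
    rcases Blk.cas v with h | h
    · rw [h] at hv; exact absurd hv (hTl _)
    · rw [h] at hv; exact ⟨h, (hTh _).1 hv⟩
  have hτ : NC (↑T : Set Blk) τ := by
    refine ⟨?_, ?_, ?_, ?_⟩
    · intro v hv
      have := (hT v hv).2
      refine (hTh _).2 ?_
      rw [s.bot.partner_partner]; exact this.symm
    · intro v hv
      rw [(hT v hv).1]
      simp [τ, s.bot.partner_partner]
    · intro v hv e
      exact (hT v hv).2 (congrArg Blk.pos e)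
    · intro v hv w hw
      have n1 := s.bot.nested_iff v.pos w.pos
      have n2 := s.bot.nested_iff (s.bot.partner v.pos) w.pos
      have ib := s.bot.partner_partner
      rw [ib] at n2
      have h1 := (hT v hv).2
      have h2 := (hT w hw).2
      rw [(hT v hv).1, (hT w hw).1]
      generalize v.pos = p at *
      generalize w.pos = k at *
      simp only [τ]
      unfold Cyc
      simp only [Blk.hi_lt_hi]
      have : k = p ∨ k = s.bot.partner p ∨ (s.bot.partner k ≠ p ∧
          s.bot.partner k ≠ s.bot.partner p ∧ k ≠ p ∧ k ≠ s.bot.partner p) := by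
        by_cases e1 : k = p
        · exact Or.inl e1
        by_cases e2 : k = s.bot.partner p
        · exact Or.inr (Or.inl e2)
        exact Or.inr (Or.inr ⟨fun e => e2 (by rw [← e, ib]),
          fun e => e1 (s.bot.partner_inj e), e1, e2⟩)
      omega
  have hbelow : ∀ v ∈ T, ∀ w ∈ (Set.univ : Set Blk), v < w → w < τ v → w ∈ T := by
    intro v hv w _ h1 h2
    have hv' := hT v hv
    rw [hv'.1] at h1 h2
    have hw := Blk.hi_lt h1
    have hw1 : w = ⟨true, w.pos⟩ := Blk.ext hw.1 rfl
    rw [hw1] at h1 h2 ⊢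
    rw [hTh]
    have a1 := Blk.hi_lt_hi.1 h1
    have a2 := Blk.hi_lt_hi.1 h2
    dsimp only at a1 a2
    have := s.bot.nested (s.bot.partner v.pos) w.pos a2 (by rw [s.bot.partner_partner]; exact a1)
    exact this.1
  -- A colouring vanishing off T vanishes on the bottom line and on the rays of s, so it is
  -- supported on circles in the composition.
  have hcirc : ∀ F : Blk → Prop, ArcInv F t.lay Set.univ → ArcInv F τ ↑T →
      (∀ z ∈ Set.univ \ (↑T : Set Blk), F z = False) →
      ∀ z ∈ (Set.univ : Set Blk), F z = False := by
    intro F h1 h2 h3 v _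
    have e : (fun p => F ⟨true, p⟩) = ⊥ := by
      have hlo : (fun p => F ⟨false, p⟩) = ⊥ := funext fun p => h3 _ ⟨trivial, hTl p⟩
      refine hc _ ?_ ⟨fun p => ?_, fun _ => rfl, fun i => ?_⟩
      · rw [← hlo, rel_iff, glue_eta]; exact h1
      · by_cases hp : s.bot.partner p = p
        · rw [hp]
        · exact h2 ⟨true, p⟩ ((hTh p).2 hp)
      · exact h3 _ ⟨trivial, fun h => (hTh _).1 h (s.bot.partner_rayAt i)⟩
    rcases Blk.cas v with h | h
    · rw [h]; exact h3 _ ⟨trivial, hTl _⟩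
    · rw [h]; exact congrFun e _
  obtain ⟨y, hy, hy1, hy2⟩ := exists_contraction (S := Set.univ) (T := T) (x := t.lay) (τ := τ) rfl
    t.nc_lay (Set.subset_univ _) hτ hbelow hcirc
  -- Moves the points left over on the middle line up along the rays of s. Its values on T play no
  -- role. The map m' goes back from the points that are not ends of cups of s.
  let m : Blk → Blk := fun v =>
    if v.hi then ⟨true, s.top.rayAt (s.bot.rayIndex v.pos)⟩ else v
  let m' : Blk → Blk := fun v =>
    if v.hi then ⟨true, s.bot.rayAt (s.top.rayIndex v.pos)⟩ else v
  have mlo : ∀ p, m ⟨false, p⟩ = ⟨false, p⟩ := fun p => by simp [m]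
  have mhi : ∀ p, m ⟨true, p⟩ = ⟨true, s.top.rayAt (s.bot.rayIndex p)⟩ := fun p => by simp [m]
  have m'lo : ∀ p, m' ⟨false, p⟩ = ⟨false, p⟩ := fun p => by simp [m']
  have m'hi : ∀ p, m' ⟨true, p⟩ = ⟨true, s.bot.rayAt (s.top.rayIndex p)⟩ := fun p => by simp [m']
  let A : Set Blk := {v | v.hi = true ∧ s.top.partner v.pos ≠ v.pos}
  have hAlo : ∀ p, (⟨false, p⟩ : Blk) ∉ A := fun p h => by simp [A] at h
  have hAhi : ∀ p, (⟨true, p⟩ : Blk) ∈ A ↔ s.top.partner p ≠ p := fun p => by simp [A]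
  have hA : ∀ v ∈ A, v = ⟨true, v.pos⟩ := fun v h => Blk.ext h.1 rfl
  have mA : ∀ v, m v ∉ A := by
    intro v
    rcases Blk.cas v with h | h
    · rw [h, mlo]; exact hAlo _
    · rw [h, mhi, hAhi, not_not]; exact s.top.partner_rayAt _
  have m'T : ∀ v, m' v ∉ T := by
    intro v
    rcases Blk.cas v with h | h
    · rw [h, m'lo]; exact hTl _
    · rw [h, m'hi, hTh, not_not]; exact s.bot.partner_rayAt _
  have mm' : ∀ v, v ∉ A → m (m' v) = v := by
    intro v hv
    rcases Blk.cas v with h | h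
    · rw [h, m'lo, mlo]
    · rw [h] at hv ⊢
      rw [hAhi, not_not] at hv
      rw [m'hi, mhi, s.bot.rayIndex_rayAt, s.top.rayAt_rayIndex hv]
  have m'm : ∀ v, v ∉ T → m' (m v) = v := by
    intro v hv
    rcases Blk.cas v with h | h
    · rw [h, mlo, m'lo]
    · rw [h] at hv ⊢
      rw [hTh, not_not] at hv
      rw [mhi, m'hi, s.top.rayIndex_rayAt, s.bot.rayAt_rayIndex hv]
  have m_lt : ∀ v w, v ∉ T → w ∉ T → (m v < m w ↔ v < w) := by
    intro v w hv hw
    rcases Blk.cas v with h | h <;> rcases Blk.cas w with h' | h' <;> rw [h] at hv ⊢ <;>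
      rw [h'] at hw ⊢
    · rw [mlo, mlo]
    · rw [mlo, mhi]; simp only [Blk.lo_lt_hi]
    · rw [mlo, mhi]; simp only [Blk.hi_lt_lo]
    · rw [hTh, not_not] at hv hw
      rw [mhi, mhi, Blk.hi_lt_hi, Blk.hi_lt_hi, s.top.rayAt_lt_iff, s.bot.rayIndex_lt_iff hw hv]
  have m_cyc : ∀ u v w, u ∉ T → v ∉ T → w ∉ T → (Cyc (m u) (m v) (m w) ↔ Cyc u v w) := by
    intro u v w hu hv hw
    unfold Cyc
    rw [m_lt u v hu hv, m_lt v w hv hw, m_lt w u hw hu]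
  -- The composite: cups of s on the top line, and the contracted matching transported along m
  -- elsewhere.
  let O : Blk → Blk := fun v => if v ∈ A then ⟨true, s.top.partner v.pos⟩ else m (y (m' v))
  have OA : ∀ v ∈ A, O v = ⟨true, s.top.partner v.pos⟩ := fun v h => if_pos h
  have OnA : ∀ v, v ∉ A → O v = m (y (m' v)) := fun v h => if_neg h
  have OAA : ∀ v ∈ A, O v ∈ A := by
    intro v hv
    rw [OA v hv, hAhi, s.top.partner_partner]
    exact hv.2.symm
  have yT : ∀ v, v ∉ T → y v ∉ T := fun v hv => (hy.mem v ⟨trivial, hv⟩).2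
  have hO : NC Set.univ O := by
    refine ⟨fun _ _ => trivial, ?_, ?_, ?_⟩
    · intro v _
      by_cases hv : v ∈ A
      · rw [OA _ (OAA v hv), OA v hv]
        dsimp only
        rw [s.top.partner_partner, ← hA v hv]
      · rw [OnA v hv, OnA _ (mA _), m'm _ (yT _ (m'T v)), hy.inv _ ⟨trivial, m'T v⟩, mm' v hv]
    · intro v _ e
      by_cases hv : v ∈ A
      · rw [OA v hv] at e
        exact hv.2 (congrArg Blk.pos e)
      · rw [OnA v hv] at e
        have := congrArg m' e
        rw [m'm _ (yT _ (m'T v))] at this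
        exact hy.ne _ ⟨trivial, m'T v⟩ this
    · intro v _ w _
      -- points which are not ends of upper arcs lie outside all upper arcs
      have out : ∀ v ∈ A, ∀ z, z ∉ A → ¬ (v < z ∧ z < O v) := by
        rintro v hv z hz ⟨h1, h2⟩
        rw [hA v hv] at h1
        have hz1 : z = ⟨true, z.pos⟩ := Blk.ext (Blk.hi_lt h1).1 rfl
        rw [OA v hv] at h2
        rw [hz1] at h1 h2 hz
        rw [hAhi, not_not] at hz
        rw [Blk.hi_lt_hi] at h1 h2
        exact s.top.ray_not_below (p := s.top.partner v.pos) hz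
          ⟨h2, by rw [s.top.partner_partner]; exact h1⟩
      by_cases hv : v ∈ A <;> by_cases hw : w ∈ A
      · have n1 := s.top.nested_iff v.pos w.pos
        have n2 := s.top.nested_iff (s.top.partner v.pos) w.pos
        have ib := s.top.partner_partner
        rw [ib] at n2
        have h1 := hv.2
        have h2 := hw.2
        rw [OA v hv, OA w hw, hA v hv, hA w hw]
        dsimp only
        generalize v.pos = p at *
        generalize w.pos = k at *
        unfold Cyc
        simp only [Blk.hi_lt_hi]
        have : k = p ∨ k = s.top.partner p ∨ (s.top.partner k ≠ p ∧
            s.top.partner k ≠ s.top.partner p ∧ k ≠ p ∧ k ≠ s.top.partner p) := by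
          by_cases e1 : k = p
          · exact Or.inl e1
          by_cases e2 : k = s.top.partner p
          · exact Or.inr (Or.inl e2)
          exact Or.inr (Or.inr ⟨fun e => e2 (by rw [← e, ib]),
            fun e => e1 (s.top.partner_inj e), e1, e2⟩)
        omega
      · have hOw : O w ∉ A := by rw [OnA w hw]; exact mA _
        have hvO : O (O v) = v := by
          rw [OA _ (OAA v hv), OA v hv]
          dsimp only
          rw [s.top.partner_partner, ← hA v hv]
        have o1 := out v hv w hw
        have o2 := out v hv (O w) hOw
        have o3 := out _ (OAA v hv) w hw
        have o4 := out _ (OAA v hv) (O w) hOw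
        rw [hvO] at o3 o4
        have d1 : O w ≠ v := fun e => hOw (e ▸ hv)
        have d2 : O w ≠ O v := fun e => hOw (e ▸ OAA v hv)
        unfold Cyc
        grind
      · have hOv : O v ∉ A := by rw [OnA v hv]; exact mA _
        have hwO : O (O w) = w := by
          rw [OA _ (OAA w hw), OA w hw]
          dsimp only
          rw [s.top.partner_partner, ← hA w hw]
        have o1 := out w hw v hv
        have o2 := out w hw (O v) hOv
        have o3 := out _ (OAA w hw) v hv
        have o4 := out _ (OAA w hw) (O v) hOv
        rw [hwO] at o3 o4
        have d1 : O w ≠ v := fun e => hv (e ▸ OAA w hw)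
        have d2 : O w ≠ O v := fun e => hOv (e ▸ OAA w hw)
        unfold Cyc
        grind
      · rw [OnA v hv, OnA w hw]
        have e1 := m_cyc (m' v) (m' w) (y (m' v)) (m'T v) (m'T w) (yT _ (m'T v))
        have e2 := m_cyc (m' v) (y (m' w)) (y (m' v)) (m'T v) (yT _ (m'T w)) (yT _ (m'T v))
        rw [mm' v hv] at e1 e2
        rw [mm' w hw] at e1
        rw [e1, e2]
        exact hy.cross _ ⟨trivial, m'T v⟩ _ ⟨trivial, m'T w⟩
  have far : ∀ p, t.lay ⟨false, p⟩ = ⟨true, p⟩ → s.bot.partner p = p →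
      s.top.rayAt (s.bot.rayIndex p) = p → O ⟨false, p⟩ = ⟨true, p⟩ := by
    intro p h1 h2 h3
    have hpT : (⟨true, p⟩ : Blk) ∉ T := by rw [hTh, not_not]; exact h2
    have hyp : y ⟨false, p⟩ = ⟨true, p⟩ := by
      have hyl := hy.inv ⟨false, p⟩ ⟨trivial, hTl p⟩
      obtain ⟨g, hg1, hg2, -⟩ := hy2 (fun v => v = ⟨false, p⟩ ∨ v = y ⟨false, p⟩) (by
        intro w hw
        refine propext ⟨?_, ?_⟩
        · rintro (e | e)
          · exact Or.inr (by rw [← e, hy.inv w hw])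
          · exact Or.inl (hy.inj hw ⟨trivial, hTl p⟩ e)
        · rintro (rfl | rfl)
          · exact Or.inr rfl
          · exact Or.inl hyl)
      have := hg2 ⟨false, p⟩ trivial
      rw [h1, hg1 _ hpT, hg1 _ (hTl p)] at this
      have := this.symm.mp (Or.inl rfl)
      rcases this with e | e
      · simp at e
      · exact e.symm
    rw [OnA _ (hAlo p), m'lo, hyp, mhi, h3]
  obtain ⟨A1, _, hA1⟩ := t.bot.exists_bound
  obtain ⟨A2, _, hA2⟩ := t.top.exists_bound
  obtain ⟨A3, _, hA3⟩ := s.bot.exists_bound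
  obtain ⟨A4, _, hA4⟩ := s.top.exists_bound
  obtain ⟨R, hR⟩ := exists_lay_eq hO
    ⟨min (min (-A1) (-A2)) (min (-A3) (-A4)), fun p hp => by
      simp only [lt_min_iff] at hp
      obtain ⟨⟨p1, p2⟩, p3, p4⟩ := hp
      refine far p ?_ ?_ ?_
      · rw [lay_lo_ray t (by by_contra h; have := hA1 _ h; omega),
          t.bot.rayIndex_of_le (fun q hq => (hA1 q hq).1) p1.le,
          t.top.rayAt_of_le (fun q hq => (hA2 q hq).1) p2]
      · by_contra h; have := hA3 _ h; omega
      · rw [s.bot.rayIndex_of_le (fun q hq => (hA3 q hq).1) p3.le,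
          s.top.rayAt_of_le (fun q hq => (hA4 q hq).1) p4]⟩
    ⟨max (max A1 A2) (max A3 A4), fun p hp => by
      simp only [max_lt_iff] at hp
      obtain ⟨⟨p1, p2⟩, p3, p4⟩ := hp
      have nt := t.numCups_eq
      have ns := s.numCups_eq
      refine far p ?_ ?_ ?_
      · rw [lay_lo_ray t (by by_contra h; have := hA1 _ h; omega),
          t.bot.rayIndex_of_ge (fun q hq => (hA1 q hq).2) p1.le,
          t.top.rayAt_of_ge (fun q hq => (hA2 q hq).2) (by omega)]
        exact Blk.ext rfl (by dsimp only; omega)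
      · by_contra h; have := hA3 _ h; omega
      · rw [s.bot.rayIndex_of_ge (fun q hq => (hA3 q hq).2) p3.le,
          s.top.rayAt_of_ge (fun q hq => (hA4 q hq).2) (by omega)]
        omega⟩
  refine ⟨R, fun f h => ?_, hc⟩
  rw [rel_iff, hR]
  constructor
  · intro H
    obtain ⟨G, hG1, hG2, hG3⟩ := hy2 (fun v => glue f h (m v)) (by
      rintro v ⟨-, hv⟩
      have := H (m v) trivial
      rw [OnA _ (mA v), m'm v hv] at this
      exact this)
    refine ⟨fun p => G ⟨true, p⟩, ?_, ?_, ?_, ?_⟩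
    · have : f = fun p => G ⟨false, p⟩ := funext fun p => by
        rw [hG1 _ (hTl p), mlo, glue_lo]
      rw [this, rel_iff, glue_eta]
      exact hG2
    · intro p
      by_cases hp : s.bot.partner p = p
      · rw [hp]
      · exact hG3 ⟨true, p⟩ ((hTh p).2 hp)
    · intro p
      by_cases hp : s.top.partner p = p
      · rw [hp]
      · have := H ⟨true, p⟩ trivial
        rw [OA _ ((hAhi p).2 hp), glue_hi, glue_hi] at this
        exact this
    · intro i
      rw [hG1 _ (by rw [hTh, not_not]; exact s.bot.partner_rayAt i), mhi, glue_hi,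
        s.bot.rayIndex_rayAt]
  · rintro ⟨g, hg1, hg2⟩
    have key : ∀ z, z ∉ T → glue f h (m z) = glue f g z := by
      intro z hz
      rcases Blk.cas z with e | e
      · rw [e, mlo, glue_lo, glue_lo]
      · rw [e] at hz ⊢
        rw [hTh, not_not] at hz
        rw [mhi, glue_hi, glue_hi, ← hg2.ray, s.bot.rayAt_rayIndex hz]
    have H := hy1 (glue f g) ((rel_iff t f g).1 hg1) (by
      intro v hv
      rw [(hT v hv).1]
      simp only [τ]
      rw [glue_hi, glue_hi, hg2.bot])
    intro v _
    by_cases hv : v ∈ A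
    · rw [OA v hv, hA v hv, glue_hi, glue_hi, hg2.top]
    · rw [OnA v hv, key _ (yT _ (m'T v)), H _ ⟨trivial, m'T v⟩, ← key _ (m'T v), mm' v hv]

end Matching

/-! ## The monoid of crossingless matchings -/

/-- Crossingless matchings together with zero, the value of compositions containing a circle. -/
def TL : Type := Option Matching

namespace Matching

/-- A crossingless matching as an element of the monoid. -/
def toTL (t : Matching) : TL := some t

theorem toTL_injective : Function.Injective toTL := Option.some_injective _

theorem IsComp.unique {t s R R' : Matching} (h : IsComp t s R) (h' : IsComp t s R') : R = R' :=
  rel_injective fun f g hR => (h'.rel f g).2 ((h.rel f g).1 hR)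

open Classical in
/-- Composition, with value `none` if there is a circle. -/
noncomputable def comp (t s : Matching) : Option Matching :=
  if h : ∃ R, IsComp t s R then some h.choose else none

theorem comp_eq_some {t s R : Matching} : comp t s = some R ↔ IsComp t s R := by
  unfold comp
  split_ifs with h
  · rw [Option.some_inj]
    exact ⟨fun e => e ▸ h.choose_spec, fun h' => h.choose_spec.unique h'⟩
  · exact ⟨fun e => by simp at e, fun h' => (h ⟨R, h'⟩).elim⟩

/-- A nonzero colouring of the middle line vanishing on both outer lines is supported on circles;
without one, `exists_isComp` supplies the composite. -/
theorem comp_eq_none {t s : Matching} :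
    comp t s = none ↔ ∃ g, t.Rel ⊥ g ∧ s.Rel g ⊥ ∧ g ≠ ⊥ := by
  constructor
  · intro h
    by_contra hc
    push Not at hc
    obtain ⟨R, hR⟩ := exists_isComp t s hc
    rw [comp_eq_some.2 hR] at h
    exact Option.some_ne_none _ h
  · rintro ⟨g, h1, h2, h3⟩
    unfold comp
    rw [dif_neg]
    rintro ⟨R, hR⟩
    exact h3 (hR.noCircle g h1 h2)

end Matching

theorem CupDiagram.finite_moved_id : {p : ℤ | id p ≠ p}.Finite := by simp

/-- The cup diagram without cups. -/
def emptyCup : CupDiagram where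
  partner := id
  partner_partner _ := rfl
  finite_moved := CupDiagram.finite_moved_id
  nested p k h1 h2 := by simp only [id] at h2; omega

theorem emptyCup_partner (p : ℤ) : emptyCup.partner p = p := rfl

theorem emptyCup_rayAt (p : ℤ) : emptyCup.rayAt p = p :=
  emptyCup.rayAt_eq rfl (emptyCup.rayIndex_of_le (W := p) (fun q hq => absurd rfl hq) le_rfl)

/-- The crossingless matching consisting of vertical lines. -/
def idMatching : Matching := ⟨emptyCup, emptyCup, rfl⟩

open Matching

theorem rel_idMatching (f g : ℤ → Prop) : idMatching.Rel f g ↔ f = g := by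
  constructor
  · intro h
    funext i
    have := h.ray i
    simpa only [idMatching, emptyCup_rayAt] using this
  · rintro rfl
    exact ⟨fun _ => rfl, fun _ => rfl, fun _ => rfl⟩

theorem isComp_id_left (t : Matching) : IsComp idMatching t t :=
  ⟨fun f h => ⟨fun H => ⟨f, (rel_idMatching f f).2 rfl, H⟩, fun ⟨g, h1, h2⟩ => by
    rwa [(rel_idMatching f g).1 h1]⟩, fun g h1 h2 => ((rel_idMatching _ g).1 h1).symm⟩

theorem isComp_id_right (t : Matching) : IsComp t idMatching t :=
  ⟨fun f h => ⟨fun H => ⟨h, H, (rel_idMatching h h).2 rfl⟩, fun ⟨g, h1, h2⟩ => by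
    rwa [← (rel_idMatching g h).1 h2]⟩, fun g h1 h2 => (rel_idMatching g _).1 h2⟩

namespace TL

noncomputable instance : MonoidWithZero TL where
  one := idMatching.toTL
  zero := none
  mul x y := x.bind fun t => y.bind fun s => comp t s
  zero_mul x := rfl
  mul_zero x := by cases x <;> rfl
  one_mul x := by
    cases x with
    | none => rfl
    | some t => exact comp_eq_some.2 (isComp_id_left t)
  mul_one x := by
    cases x with
    | none => rfl
    | some t => exact comp_eq_some.2 (isComp_id_right t)
  mul_assoc x y z := by
    cases x with
    | none => rfl
    | some t =>
    cases y with
    | none => rfl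
    | some s =>
    cases z with
    | none =>
      change (comp t s).bind (fun _ => none) = none
      cases comp t s <;> rfl
    | some r =>
    change (comp t s).bind (fun R => comp R r) = (comp s r).bind fun R => comp t R
    cases hts : comp t s with
    | none =>
      cases hsr : comp s r with
      | none => rfl
      | some R' =>
        -- A circle between t and s persists after composing s with r: its colouring is continued by
        -- zero above.
        obtain ⟨g, h1, h2, h3⟩ := comp_eq_none.1 hts
        exact (comp_eq_none.2 ⟨g, h1, ((comp_eq_some.1 hsr).rel _ _).2 ⟨⊥, h2, rel_bot r⟩, h3⟩).symm
    | some R =>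
      have hR := comp_eq_some.1 hts
      cases hsr : comp s r with
      | none =>
        obtain ⟨g, h1, h2, h3⟩ := comp_eq_none.1 hsr
        exact comp_eq_none.2 ⟨g, (hR.rel _ _).2 ⟨⊥, rel_bot t, h1⟩, h2, h3⟩
      | some R' =>
        have hR' := comp_eq_some.1 hsr
        change comp R r = comp t R'
        refine Option.ext fun Q => ?_
        rw [comp_eq_some, comp_eq_some]
        have key : ∀ f h, (∃ g, R.Rel f g ∧ r.Rel g h) ↔ ∃ g, t.Rel f g ∧ R'.Rel g h := by
          intro f h
          constructor
          · rintro ⟨g, h1, h2⟩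
            obtain ⟨g', h3, h4⟩ := (hR.rel _ _).1 h1
            exact ⟨g', h3, (hR'.rel _ _).2 ⟨g, h4, h2⟩⟩
          · rintro ⟨g, h1, h2⟩
            obtain ⟨g', h3, h4⟩ := (hR'.rel _ _).1 h2
            exact ⟨g', (hR.rel _ _).2 ⟨g, h1, h3⟩, h4⟩
        constructor
        · intro hQ
          refine ⟨fun f h => (hQ.rel f h).trans (key f h), fun g h1 h2 => ?_⟩
          obtain ⟨g', h3, h4⟩ := (hR'.rel _ _).1 h2
          have := hQ.noCircle g' ((hR.rel _ _).2 ⟨g, h1, h3⟩) h4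
          subst this
          exact hR.noCircle g h1 h3
        · intro hQ
          refine ⟨fun f h => (hQ.rel f h).trans (key f h).symm, fun g h1 h2 => ?_⟩
          obtain ⟨g', h3, h4⟩ := (hR.rel _ _).1 h1
          have := hQ.noCircle g' h3 ((hR'.rel _ _).2 ⟨g, h4, h2⟩)
          subst this
          exact hR'.noCircle g h4 h2

theorem mul_eq_toTL {t s R : Matching} : t.toTL * s.toTL = R.toTL ↔ IsComp t s R := comp_eq_some

theorem mul_eq_zero_iff {t s : Matching} :
    t.toTL * s.toTL = 0 ↔ ∃ g, t.Rel ⊥ g ∧ s.Rel g ⊥ ∧ g ≠ ⊥ := comp_eq_none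

theorem toTL_ne_zero (t : Matching) : t.toTL ≠ 0 := Option.some_ne_none t

theorem eq_zero_or (x : TL) : x = 0 ∨ ∃ t : Matching, x = t.toTL := by
  cases x with
  | none => exact Or.inl rfl
  | some t => exact Or.inr ⟨t, rfl⟩

theorem one_def : (1 : TL) = idMatching.toTL := rfl

/-- The product of a list of crossingless matchings. -/
noncomputable def prod (ts : List Matching) : TL := (ts.map toTL).prod

@[simp] theorem prod_nil : prod [] = 1 := rfl

@[simp] theorem prod_cons (t : Matching) (ts : List Matching) :
    prod (t :: ts) = t.toTL * prod ts := by simp [prod]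

@[simp] theorem prod_append (us ts : List Matching) : prod (us ++ ts) = prod us * prod ts := by
  simp [prod]

end TL

/-! ### Colourings of stacks of layers -/

/-- Colourings of the horizontal lines of a diagram which are restrictions of a colouring of the
curves of the layers. -/
def Col (ts : List Matching) (F : ℕ → ℤ → Prop) : Prop :=
  ∀ (i : ℕ) (t : Matching), ts[i]? = some t → t.Rel (F i) (F (i + 1))

theorem col_nil (F : ℕ → ℤ → Prop) : Col [] F := fun i t h => by simp at h

theorem col_cons {t : Matching} {ts : List Matching} {F : ℕ → ℤ → Prop} :
    Col (t :: ts) F ↔ t.Rel (F 0) (F 1) ∧ Col ts fun i => F (i + 1) := by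
  constructor
  · intro h
    exact ⟨h 0 t rfl, fun i s hs => h (i + 1) s (by simpa using hs)⟩
  · rintro ⟨h1, h2⟩ i s hs
    cases i with
    | zero => simp only [List.getElem?_cons_zero, Option.some_inj] at hs; subst hs; exact h1
    | succ i => exact h2 i s (by simpa using hs)

/-- Translates a nonzero product into colourings: its relation is extendability to all lines of the
stack, and the absence of circles says that a colouring is zero once it vanishes on both outer
lines. -/
theorem TL.prod_eq_toTL {ts : List Matching} {R : Matching} (h : TL.prod ts = R.toTL) :
    (∀ f g, R.Rel f g ↔ ∃ F, Col ts F ∧ F 0 = f ∧ F ts.length = g) ∧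
      ∀ F, Col ts F → F 0 = ⊥ → F ts.length = ⊥ → ∀ i ≤ ts.length, F i = ⊥ := by
  induction ts generalizing R with
  | nil =>
    have hR : R = idMatching := (toTL_injective h).symm
    subst hR
    refine ⟨fun f g => ?_, fun F _ h0 _ i hi => ?_⟩
    · rw [rel_idMatching]
      exact ⟨fun e => ⟨fun _ => f, col_nil _, rfl, e⟩, fun ⟨F, _, h1, h2⟩ => h1.symm.trans h2⟩
    · rw [List.length_nil, Nat.le_zero] at hi
      rw [hi, h0]
  | cons t ts ih =>
    rw [TL.prod_cons] at h
    rcases TL.eq_zero_or (TL.prod ts) with e | ⟨S, e⟩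
    · rw [e, mul_zero] at h; exact (TL.toTL_ne_zero R h.symm).elim
    rw [e] at h
    have hc := TL.mul_eq_toTL.1 h
    obtain ⟨ih1, ih2⟩ := ih e
    refine ⟨fun f g => ?_, fun F hF h0 hl => ?_⟩
    · rw [hc.rel]
      constructor
      · rintro ⟨k, h1, h2⟩
        obtain ⟨F, hF, rfl, rfl⟩ := (ih1 _ _).1 h2
        refine ⟨fun i => Nat.casesOn i f F, ?_, rfl, rfl⟩
        rw [col_cons]
        exact ⟨h1, hF⟩
      · rintro ⟨F, hF, rfl, rfl⟩
        rw [col_cons] at hF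
        exact ⟨F 1, hF.1, (ih1 _ _).2 ⟨fun i => F (i + 1), hF.2, rfl, rfl⟩⟩
    · rw [col_cons] at hF
      have h1 : F 1 = ⊥ := by
        refine hc.noCircle _ (h0 ▸ hF.1) ?_
        rw [← hl]
        exact (ih1 _ _).2 ⟨fun i => F (i + 1), hF.2, rfl, rfl⟩
      intro i hi
      cases i with
      | zero => exact h0
      | succ i => exact ih2 _ hF.2 h1 hl i (by simpa using hi)

theorem TL.exists_circle {ts : List Matching} (h : TL.prod ts = 0) :
    ∃ F, Col ts F ∧ F 0 = ⊥ ∧ F ts.length = ⊥ ∧ ∃ i ≤ ts.length, F i ≠ ⊥ := by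
  induction ts with
  | nil => exact (TL.toTL_ne_zero _ h).elim
  | cons t ts ih =>
    rw [TL.prod_cons] at h
    rcases TL.eq_zero_or (TL.prod ts) with e | ⟨S, e⟩
    · obtain ⟨F, hF, h0, hl, i, hi, hne⟩ := ih e
      refine ⟨fun i => Nat.casesOn i ⊥ F, ?_, rfl, hl, i + 1, by simpa using hi, hne⟩
      rw [col_cons]
      refine ⟨?_, hF⟩
      change t.Rel ⊥ (F 0)
      rw [h0]; exact rel_bot t
    · rw [e, TL.mul_eq_zero_iff] at h
      obtain ⟨g, h1, h2, h3⟩ := h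
      obtain ⟨F, hF, rfl, hl⟩ := ((TL.prod_eq_toTL e).1 _ _).1 h2
      refine ⟨fun i => Nat.casesOn i ⊥ F, ?_, rfl, hl, 1, by simp, h3⟩
      rw [col_cons]
      exact ⟨h1, hF⟩

namespace Matching

/-- Two boundary points with the same colour in every colouring are ends of one piece; the indicator
of the piece at v shows it. -/
theorem lay_eq_of_rel {t : Matching} {v w : Blk}
    (h : ∀ f g, t.Rel f g → glue f g v = glue f g w) : w = v ∨ w = t.lay v := by
  have ht := t.nc_lay
  have H : ArcInv (fun w => w = v ∨ w = t.lay v) t.lay Set.univ := by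
    intro w _
    refine propext ⟨?_, ?_⟩
    · rintro (e | e)
      · exact Or.inr (by rw [← e, ht.inv w trivial])
      · exact Or.inl (ht.inj trivial trivial e)
    · rintro (rfl | rfl)
      · exact Or.inr rfl
      · exact Or.inl (ht.inv v trivial)
  have all : ∀ F : Blk → Prop, ArcInv F t.lay Set.univ → F v = F w := by
    intro F hF
    rw [← glue_eta F] at hF ⊢
    exact h _ _ ((rel_iff t _ _).2 hF)
  exact (all _ H).mp (Or.inl rfl)

theorem bot_partner_of_rel {t : Matching} {p q : ℤ} (hpq : p ≠ q)
    (h : ∀ f g, t.Rel f g → f p = f q) : t.bot.partner p = q := by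
  have := lay_eq_of_rel (t := t) (v := ⟨false, p⟩) (w := ⟨false, q⟩) fun f g hfg => by
    rw [glue_lo, glue_lo]; exact h f g hfg
  rcases this with e | e
  · exact absurd (congrArg Blk.pos e).symm hpq
  · by_cases hp : t.bot.partner p = p
    · rw [lay_lo_ray t hp] at e; simp at e
    · rw [lay_lo_arc t hp] at e; exact (congrArg Blk.pos e).symm

theorem top_partner_of_rel {t : Matching} {p q : ℤ} (hpq : p ≠ q)
    (h : ∀ f g, t.Rel f g → g p = g q) : t.top.partner p = q := by
  have := lay_eq_of_rel (t := t) (v := ⟨true, p⟩) (w := ⟨true, q⟩) fun f g hfg => by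
    rw [glue_hi, glue_hi]; exact h f g hfg
  rcases this with e | e
  · exact absurd (congrArg Blk.pos e).symm hpq
  · by_cases hp : t.top.partner p = p
    · rw [lay_hi_ray t hp] at e; simp at e
    · rw [lay_hi_arc t hp] at e; exact (congrArg Blk.pos e).symm

/-- A colouring of the top line respecting the arcs there extends to the bottom line. -/
theorem exists_rel_of_top (t : Matching) {g : ℤ → Prop} (hg : ∀ p, g (t.top.partner p) = g p) :
    ∃ f, t.Rel f g ∧ ∀ p, t.bot.partner p ≠ p → ¬ f p := by
  refine ⟨fun p => t.bot.partner p = p ∧ g (t.top.rayAt (t.bot.rayIndex p)), ⟨fun p => ?_, hg,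
    fun i => ?_⟩, fun p hp h => hp h.1⟩
  · by_cases hp : t.bot.partner p = p
    · simp only [hp]
    · have : ¬ t.bot.partner (t.bot.partner p) = t.bot.partner p := by
        rw [t.bot.partner_partner]; exact Ne.symm hp
      simp only [hp, this, false_and]
  · simp only [t.bot.partner_rayAt, t.bot.rayIndex_rayAt, true_and]

/-- A colouring of the bottom line respecting the arcs there extends to the top line. -/
theorem exists_rel_of_bot (t : Matching) {f : ℤ → Prop} (hf : ∀ p, f (t.bot.partner p) = f p) :
    ∃ g, t.Rel f g ∧ ∀ p, t.top.partner p ≠ p → ¬ g p := by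
  refine ⟨fun p => t.top.partner p = p ∧ f (t.bot.rayAt (t.top.rayIndex p)), ⟨hf, fun p => ?_,
    fun i => ?_⟩, fun p hp h => hp h.1⟩
  · by_cases hp : t.top.partner p = p
    · simp only [hp]
    · have : ¬ t.top.partner (t.top.partner p) = t.top.partner p := by
        rw [t.top.partner_partner]; exact Ne.symm hp
      simp only [hp, this, false_and]
  · simp only [t.top.partner_rayAt, t.top.rayIndex_rayAt, true_and]

end Matching

/-! ## Nested cups -/

/-- The diagram of `N` nested cups around the middle of `m` and `m + 1`. -/
def nest (m : ℤ) (N : ℕ) : CupDiagram where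
  partner p := if m + 1 - N ≤ p ∧ p ≤ m + N then 2 * m + 1 - p else p
  partner_partner p := by split_ifs <;> omega
  finite_moved := by
    refine (Set.finite_Icc (m + 1 - N) (m + N)).subset fun p hp => ?_
    by_contra h
    rw [Set.mem_Icc] at h
    exact hp (if_neg h)
  nested p k h1 h2 := by split_ifs at h2 ⊢ <;> omega

theorem nest_partner (m : ℤ) (N : ℕ) (p : ℤ) :
    (nest m N).partner p = if m + 1 - N ≤ p ∧ p ≤ m + N then 2 * m + 1 - p else p := rfl

theorem nest_moved {m : ℤ} {N : ℕ} {p : ℤ} :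
    (nest m N).partner p ≠ p ↔ m + 1 - N ≤ p ∧ p ≤ m + N := by
  rw [nest_partner]; split_ifs <;> omega

theorem nest_numCups (m : ℤ) (N : ℕ) : (nest m N).numCups = N := by
  have h : (nest m N).endpoints = Finset.Icc (m + 1 - N) (m + N) := by
    ext p
    rw [CupDiagram.mem_endpoints, nest_moved, Finset.mem_Icc]
  have := (nest m N).card_endpoints
  rw [h, Int.card_Icc] at this
  omega

theorem nest_shift (m : ℤ) (N : ℕ) : (nest m N).shift = nest (m + 1) N := by
  refine CupDiagram.ext (funext fun p => ?_)
  rw [CupDiagram.shift_partner, nest_partner, nest_partner]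
  split_ifs <;> omega

theorem nest_rayAt_left {m : ℤ} {N : ℕ} {i : ℤ} (h : i < m + 1 - N) : (nest m N).rayAt i = i :=
  CupDiagram.rayAt_of_le _ (fun q hq => (nest_moved.1 hq).1) h

theorem nest_rayAt_right {m : ℤ} {N : ℕ} {i : ℤ} (h : m + 1 - N ≤ i) :
    (nest m N).rayAt i = i + 2 * N := by
  have := CupDiagram.rayAt_of_ge (nest m N) (W := m + N + 1) (i := i)
    (fun q hq => by have := (nest_moved.1 hq).2; omega) (by rw [nest_numCups]; omega)
  rwa [nest_numCups] at this

/-- All cups are around the middle of `m` and `m + 1`. -/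
def CupDiagram.Straddles (c : CupDiagram) (m : ℤ) : Prop :=
  ∀ p, c.partner p ≠ p → (p ≤ m ↔ ¬ c.partner p ≤ m)

theorem nest_straddles (m : ℤ) (N : ℕ) : (nest m N).Straddles m := by
  intro p hp
  have := nest_moved.1 hp
  rw [nest_partner, if_pos this]
  omega

/-- Arcs that all pass over the same middle, with no rays below them, must be nested symmetrically
about it. -/
theorem CupDiagram.Straddles.eq_nest {c : CupDiagram} {m : ℤ} (h : c.Straddles m) :
    c = nest m c.numCups := by
  have val : ∀ p, p ≤ m → c.partner p ≠ p → c.partner p = 2 * m + 1 - p := by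
    intro p hpm hp
    have hq := (h p hp).1 hpm
    have mem : ∀ k, p < k → k < c.partner p → p < c.partner k ∧ c.partner k < c.partner p ∧
        (k ≤ m ↔ ¬ c.partner k ≤ m) := fun k h1 h2 =>
      have := c.nested p k h1 h2
      ⟨this.2.1, this.2.2, h k this.1⟩
    -- Below the cup at p, taking partners exchanges the points to the left of the middle with those
    -- to the right; the equal counts make the cup symmetric.
    have hc : (Finset.Ioc p m).card = (Finset.Ioo m (c.partner p)).card := by
      refine Finset.card_bij' (fun k _ => c.partner k) (fun k _ => c.partner k) ?_ ?_ ?_ ?_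
      · intro k hk
        rw [Finset.mem_Ioc] at hk
        rw [Finset.mem_Ioo]
        have := mem k hk.1 (by omega)
        omega
      · intro k hk
        rw [Finset.mem_Ioo] at hk
        rw [Finset.mem_Ioc]
        have := mem k (by omega) hk.2
        omega
      · intro k _; exact c.partner_partner k
      · intro k _; exact c.partner_partner k
    rw [Int.card_Ioc, Int.card_Ioo] at hc
    omega
  have val' : ∀ p, c.partner p ≠ p → c.partner p = 2 * m + 1 - p := by
    intro p hp
    by_cases hpm : p ≤ m
    · exact val p hpm hp
    · have h1 := (h p hp)
      have h2 := val (c.partner p) (by omega) (by rw [c.partner_partner]; exact hp.symm)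
      rw [c.partner_partner] at h2
      omega
  have ex : ∃ N : ℕ, ∀ p, c.partner p ≠ p ↔ m + 1 - N ≤ p ∧ p ≤ m + N := by
    by_cases hne : c.endpoints.Nonempty
    · obtain ⟨y, hy, hmax⟩ := c.endpoints.exists_max_image id hne
      simp only [id, mem_endpoints] at hy hmax
      have vy := val' y hy
      have h2 := hmax (c.partner y) (by rw [c.partner_partner]; exact hy.symm)
      have hsy := h y hy
      refine ⟨(y - m).toNat, fun p => ⟨fun hp => ?_, fun hp => ?_⟩⟩
      · have h3 := hmax p hp
        have h4 := hmax (c.partner p) (by rw [c.partner_partner]; exact hp.symm)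
        rw [val' p hp] at h4
        omega
      · by_cases e : p = y
        · rw [e]; exact hy
        by_cases e' : p = c.partner y
        · rw [e', c.partner_partner]; exact hy.symm
        refine (c.nested (c.partner y) p (by omega) ?_).1
        rw [c.partner_partner]; omega
    · refine ⟨0, fun p => ⟨fun hp => (hne ⟨p, (c.mem_endpoints p).2 hp⟩).elim, fun hp => ?_⟩⟩
      omega
  obtain ⟨N, hN⟩ := ex
  have e : c = nest m N := by
    refine CupDiagram.ext (funext fun p => ?_)
    rw [nest_partner]
    split_ifs with h'
    · exact val' p ((hN p).2 h')
    · by_contra h2; exact h' ((hN p).1 h2)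
  rw [e, nest_numCups]

/-! ### Closing diagrams by nested arcs -/

namespace CupDiagram

/-- The cup diagram on top of nested caps which avoid its rays. -/
noncomputable def lower (a : CupDiagram) : Matching := ⟨nest (-2) a.numCups, a, nest_numCups _ _⟩

/-- The cap diagram below nested cups which avoid its rays. -/
noncomputable def upper (a : CupDiagram) : Matching :=
  ⟨a.shift, nest (-1) a.numCups, by rw [numCups_shift, nest_numCups]⟩

theorem lower_ddagger (a : CupDiagram) : a.lower.ddagger = a.upper := by
  refine Matching.ext rfl ?_
  exact nest_shift _ _

/-- Redrawing the rays so as to avoid the gap is the same as following them to the rays of the nest;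
the gap is centred at -1, between the integers -2 and -1, which stand for -3/2 and -1/2. -/
theorem bottomLeft_iff (c : CupDiagram) {p : ℤ} :
    c.BottomLeft p ↔ (nest (-2) c.numCups).rayAt (c.rayIndex p) ≤ -2 := by
  unfold BottomLeft
  rcases lt_or_ge (c.rayIndex p) (-2 + 1 - (c.numCups : ℤ)) with h | h
  · rw [nest_rayAt_left h]; omega
  · rw [nest_rayAt_right h]; omega

theorem topLeft_iff (c : CupDiagram) {p : ℤ} :
    c.TopLeft p ↔ (nest (-1) c.numCups).rayAt (c.shift.rayIndex p) ≤ -1 := by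
  unfold TopLeft
  rcases lt_or_ge (c.shift.rayIndex p) (-1 + 1 - (c.numCups : ℤ)) with h | h
  · rw [nest_rayAt_left h]; omega
  · rw [nest_rayAt_right h]; omega

end CupDiagram

/-- Nested caps below nested cups. -/
def sigma (N : ℕ) : Matching := ⟨nest (-2) N, nest (-1) N, by rw [nest_numCups, nest_numCups]⟩

theorem sigma_injective : Function.Injective sigma := fun M N h => by
  have := congrArg (fun t => t.bot.numCups) h
  simpa [sigma, nest_numCups] using this

open Matching

/-- The element represented by a generalized circle diagram. -/
noncomputable def diagTL (a : CupDiagram) (ts : List Matching) (b : CupDiagram) : TL :=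
  a.lower.toTL * TL.prod ts * b.upper.toTL

theorem diagTL_eq_prod (a : CupDiagram) (ts : List Matching) (b : CupDiagram) :
    diagTL a ts b = TL.prod (a.lower :: (ts ++ [b.upper])) := by
  simp [diagTL, mul_assoc]

/-- Colourings of the vertices which are constant along strands. -/
def StrandInv (a : CupDiagram) (ts : List Matching) (b : CupDiagram) (G : ℕ → ℤ → Prop) : Prop :=
  ∀ v w, Strand a ts b v w → G v.1 v.2 = G w.1 w.2

theorem StrandInv.sameLine {a : CupDiagram} {ts : List Matching} {b : CupDiagram}
    {G : ℕ → ℤ → Prop} (h : StrandInv a ts b G) {v w : ℕ × ℤ} (H : SameLine a ts b v w) :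
    G v.1 v.2 = G w.1 w.2 := by
  induction H with
  | rel v w h' => exact h v w h'
  | refl v => rfl
  | symm v w _ ih => exact ih.symm
  | trans u v w _ _ ih1 ih2 => exact ih1.trans ih2

theorem strandInv_sameLine (a : CupDiagram) (ts : List Matching) (b : CupDiagram) (v : ℕ × ℤ) :
    StrandInv a ts b fun l p => SameLine a ts b v (l, p) := by
  intro u w h
  have h' : SameLine a ts b u w := Relation.EqvGen.rel _ _ h
  exact propext ⟨fun H => H.trans _ _ _ h', fun H => H.trans _ _ _ (h'.symm _ _)⟩

/-- Links the connectivity of the strands of a diagram with the layerwise colourings that describe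
products in `TL`. -/
theorem strandInv_iff (a : CupDiagram) (ts : List Matching) (b : CupDiagram) (G : ℕ → ℤ → Prop) :
    StrandInv a ts b G ↔ (∀ p, G 0 (a.partner p) = G 0 p) ∧ Col ts G ∧
      ∀ p, G ts.length (b.shift.partner p) = G ts.length p := by
  constructor
  · intro h
    refine ⟨fun p => (h _ _ (.cup p)).symm, fun i t ht => ⟨fun p => (h _ _ (.layerCap i t ht p)).symm,
      fun p => (h _ _ (.layerCup i t ht p)).symm, fun j => ?_⟩, fun p => (h _ _ (.cap p)).symm⟩
    refine h _ _ (.layerLine i t ht (t.bot.rayAt j) (t.top.rayAt j) ⟨t.bot.partner_rayAt j,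
      t.top.partner_rayAt j, ?_⟩)
    rw [t.bot.rayIndex_rayAt, t.top.rayIndex_rayAt]
  · rintro ⟨h1, h2, h3⟩ v w h
    cases h with
    | cup p => exact (h1 p).symm
    | cap p => exact (h3 p).symm
    | layerCap i t ht p => exact ((h2 i t ht).bot p).symm
    | layerCup i t ht p => exact ((h2 i t ht).top p).symm
    | layerLine i t ht p q hpq => exact (h2 i t ht).joins hpq

theorem col_append_singleton {ts : List Matching} {s : Matching} {F : ℕ → ℤ → Prop} :
    Col (ts ++ [s]) F ↔ Col ts F ∧ s.Rel (F ts.length) (F (ts.length + 1)) := by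
  constructor
  · intro h
    refine ⟨fun i t ht => h i t ?_, h _ s ?_⟩
    · rw [List.getElem?_append_left]
      · exact ht
      · exact (List.getElem?_eq_some_iff.1 ht).1
    · simp
  · rintro ⟨h1, h2⟩ i t ht
    rcases lt_or_ge i ts.length with hi | hi
    · rw [List.getElem?_append_left hi] at ht
      exact h1 i t ht
    · rw [List.getElem?_append_right hi] at ht
      have : i = ts.length := by
        have := (List.getElem?_eq_some_iff.1 ht).1
        simp at this
        omega
      subst this
      simp at ht
      subst ht
      exact h2

theorem col_diagram {a : CupDiagram} {ts : List Matching} {b : CupDiagram} {F : ℕ → ℤ → Prop} :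
    Col (a.lower :: (ts ++ [b.upper])) F ↔ a.lower.Rel (F 0) (F 1) ∧
      StrandInv a ts b (fun i => F (i + 1)) ∧
        b.upper.Rel (F (ts.length + 1)) (F (ts.length + 2)) := by
  rw [col_cons, col_append_singleton, strandInv_iff]
  constructor
  · rintro ⟨h1, h2, h3⟩
    exact ⟨h1, ⟨h1.top, h2, h3.bot⟩, h3⟩
  · rintro ⟨h1, ⟨-, h2, -⟩, h3⟩
    exact ⟨h1, h2, h3⟩

/-- Colourings of the curves extend colourings of the middle part. -/
theorem StrandInv.exists_col {a : CupDiagram} {ts : List Matching} {b : CupDiagram}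
    {G : ℕ → ℤ → Prop} (h : StrandInv a ts b G) : ∃ f g,
      Col (a.lower :: (ts ++ [b.upper])) (fun i => Nat.casesOn i f fun i =>
        if i = ts.length + 1 then g else G i) ∧
      (∀ i, f ((nest (-2) a.numCups).rayAt i) = G 0 (a.rayAt i)) ∧
      (∀ i, g ((nest (-1) b.numCups).rayAt i) = G ts.length (b.shift.rayAt i)) ∧
      (∀ p, (nest (-2) a.numCups).partner p ≠ p → ¬ f p) ∧
      ∀ p, (nest (-1) b.numCups).partner p ≠ p → ¬ g p := by
  obtain ⟨h1, h2, h3⟩ := (strandInv_iff a ts b G).1 h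
  obtain ⟨f, hf, hf'⟩ := a.lower.exists_rel_of_top (g := G 0) h1
  obtain ⟨g, hg, hg'⟩ := b.upper.exists_rel_of_bot (f := G ts.length) h3
  -- The closing layers add a line below, coloured by f, and a line above, coloured by g; the old
  -- line i is now line i + 1.
  refine ⟨f, g, col_diagram.2 ⟨?_, ?_, ?_⟩, hf.ray, fun i => (hg.ray i).symm, hf', hg'⟩
  · change a.lower.Rel f (if 0 = ts.length + 1 then g else G 0)
    rw [if_neg (by omega)]; exact hf
  · refine (strandInv_iff _ _ _ _).2 ⟨?_, ?_, ?_⟩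
    · intro p
      change (if 0 = ts.length + 1 then g else G 0) _ = (if 0 = ts.length + 1 then g else G 0) _
      rw [if_neg (by omega)]; exact h1 p
    · intro i t ht
      have hi := (List.getElem?_eq_some_iff.1 ht).1
      change t.Rel (if i = ts.length + 1 then g else G i)
        (if i + 1 = ts.length + 1 then g else G (i + 1))
      rw [if_neg (by omega), if_neg (by omega)]
      exact h2 i t ht
    · intro p
      change (if ts.length = ts.length + 1 then g else G ts.length) _ =
        (if ts.length = ts.length + 1 then g else G ts.length) _
      rw [if_neg (by omega)]; exact h3 p
  · change b.upper.Rel (if ts.length = ts.length + 1 then g else G ts.length)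
      (if ts.length + 1 = ts.length + 1 then g else G (ts.length + 1))
    rw [if_neg (by omega), if_pos rfl]; exact hg

theorem diagram_length (a : CupDiagram) (ts : List Matching) (b : CupDiagram) :
    (a.lower :: (ts ++ [b.upper])).length = ts.length + 2 := by simp

/-- Orientable diagrams are those which represent nested caps below nested cups. -/
theorem orientable_iff (a : CupDiagram) (ts : List Matching) (b : CupDiagram) :
    Orientable a ts b ↔ ∃ N, diagTL a ts b = (sigma N).toTL := by
  rw [diagTL_eq_prod]
  have len := diagram_length a ts b
  constructor
  · intro h
    rcases TL.eq_zero_or (TL.prod (a.lower :: (ts ++ [b.upper]))) with e | ⟨R, e⟩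
    · exfalso
      -- This colouring vanishes on both outer lines, hence on all rays of the diagram. Every
      -- component contains a ray, so the colouring vanishes everywhere.
      obtain ⟨F, hF, h0, hl, i, hi, hne⟩ := TL.exists_circle e
      rw [len] at hl hi
      obtain ⟨c1, c2, c3⟩ := col_diagram.1 hF
      rw [h0] at c1
      rw [hl] at c3
      have all : ∀ l ≤ ts.length, ∀ p, ¬ F (l + 1) p := by
        intro l hl p hp
        rcases h.no_circle l hl p with ⟨q, hq, hs⟩ | ⟨q, hq, hs⟩
        · have := c2.sameLine hs
          dsimp only at this
          rw [this] at hp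
          have := c1.ray (a.rayIndex q)
          change (⊥ : ℤ → Prop) _ = F 1 (a.rayAt _) at this
          rw [a.rayAt_rayIndex hq] at this
          rw [zero_add, ← this] at hp
          exact hp
        · have := c2.sameLine hs
          dsimp only at this
          rw [this] at hp
          have := c3.ray (b.shift.rayIndex q)
          change F _ (b.shift.rayAt _) = _ at this
          rw [b.shift.rayAt_rayIndex hq] at this
          rw [this] at hp
          exact hp
      apply hne
      rcases Nat.eq_zero_or_pos i with e | e
      · rw [e, h0]
      rcases Nat.lt_or_ge i (ts.length + 2) with e' | e'
      · funext p
        have := all (i - 1) (by omega) p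
        rw [Nat.sub_add_cancel e] at this
        exact eq_false this
      · rw [show i = ts.length + 2 by omega, hl]
    · obtain ⟨hR, -⟩ := TL.prod_eq_toTL e
      rw [len] at hR
      have hb : R.bot.Straddles (-2) := by
        intro p hp
        -- Either p is the end of a ray of the diagram, and the cap comes from a non-propagating
        -- line, or the cap belongs to the nest closing the diagram.
        by_cases hk : (nest (-2) a.numCups).partner p = p
        · set q := R.bot.partner p with hq
          have hcol : ∀ f g, R.Rel f g → f p = f q := fun f g hfg => (hfg.bot p).symm
          have hkq : (nest (-2) a.numCups).partner q = q := by
            by_contra hkq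
            have h1 : R.bot.partner q = (nest (-2) a.numCups).partner q := by
              refine R.bot_partner_of_rel (Ne.symm hkq) fun f g hfg => ?_
              obtain ⟨F, hF, rfl, rfl⟩ := (hR _ _).1 hfg
              exact ((col_diagram.1 hF).1.bot q).symm
            rw [hq, R.bot.partner_partner, ← hq] at h1
            rw [h1, (nest (-2) a.numCups).partner_partner] at hk
            exact hkq hk.symm
          -- The colouring is the indicator of the component of the ray ending at p; its value at q
          -- shows that the ray ending at q is on the same line.
          obtain ⟨f, g, hF, hf, -⟩ :=
            (strandInv_sameLine a ts b (0, a.rayAt ((nest (-2) a.numCups).rayIndex p))).exists_col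
          have hfpq := hcol f g ((hR _ _).2 ⟨_, hF, rfl, by simp⟩)
          have f1 := hf ((nest (-2) a.numCups).rayIndex p)
          have f2 := hf ((nest (-2) a.numCups).rayIndex q)
          rw [CupDiagram.rayAt_rayIndex _ hk] at f1
          rw [CupDiagram.rayAt_rayIndex _ hkq] at f2
          have same : SameLine a ts b (0, a.rayAt ((nest (-2) a.numCups).rayIndex p))
              (0, a.rayAt ((nest (-2) a.numCups).rayIndex q)) := by
            rw [← f2, ← hfpq, f1]
            exact Relation.EqvGen.refl _
          have := h.bottom _ _ ⟨a.partner_rayAt _, a.partner_rayAt _, fun e => hp ?_, same⟩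
          · rw [a.bottomLeft_iff, a.bottomLeft_iff, a.rayIndex_rayAt, a.rayIndex_rayAt,
              CupDiagram.rayAt_rayIndex _ hk, CupDiagram.rayAt_rayIndex _ hkq] at this
            exact this
          · have := congrArg a.rayIndex e
            rw [a.rayIndex_rayAt, a.rayIndex_rayAt] at this
            exact (CupDiagram.rayIndex_inj _ hk hkq this).symm
        · have h1 : R.bot.partner p = (nest (-2) a.numCups).partner p := by
            refine R.bot_partner_of_rel (Ne.symm hk) fun f g hfg => ?_
            obtain ⟨F, hF, rfl, rfl⟩ := (hR _ _).1 hfg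
            exact ((col_diagram.1 hF).1.bot p).symm
          rw [h1]
          exact nest_straddles _ _ _ hk
      have ht : R.top.Straddles (-1) := by
        intro p hp
        by_cases hk : (nest (-1) b.numCups).partner p = p
        · set q := R.top.partner p with hq
          have hcol : ∀ f g, R.Rel f g → g p = g q := fun f g hfg => (hfg.top p).symm
          have hkq : (nest (-1) b.numCups).partner q = q := by
            by_contra hkq
            have h1 : R.top.partner q = (nest (-1) b.numCups).partner q := by
              refine R.top_partner_of_rel (Ne.symm hkq) fun f g hfg => ?_
              obtain ⟨F, hF, rfl, rfl⟩ := (hR _ _).1 hfg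
              exact ((col_diagram.1 hF).2.2.top q).symm
            rw [hq, R.top.partner_partner, ← hq] at h1
            rw [h1, (nest (-1) b.numCups).partner_partner] at hk
            exact hkq hk.symm
          obtain ⟨f, g, hF, -, hg, -⟩ := (strandInv_sameLine a ts b
            (ts.length, b.shift.rayAt ((nest (-1) b.numCups).rayIndex p))).exists_col
          have hfpq := hcol f g ((hR _ _).2 ⟨_, hF, rfl, by simp⟩)
          have f1 := hg ((nest (-1) b.numCups).rayIndex p)
          have f2 := hg ((nest (-1) b.numCups).rayIndex q)
          rw [CupDiagram.rayAt_rayIndex _ hk] at f1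
          rw [CupDiagram.rayAt_rayIndex _ hkq] at f2
          have same : SameLine a ts b
              (ts.length, b.shift.rayAt ((nest (-1) b.numCups).rayIndex p))
              (ts.length, b.shift.rayAt ((nest (-1) b.numCups).rayIndex q)) := by
            rw [← f2, ← hfpq, f1]
            exact Relation.EqvGen.refl _
          have := h.top _ _ ⟨b.shift.partner_rayAt _, b.shift.partner_rayAt _, fun e => hp ?_, same⟩
          · rw [b.topLeft_iff, b.topLeft_iff, b.shift.rayIndex_rayAt, b.shift.rayIndex_rayAt,
              CupDiagram.rayAt_rayIndex _ hk, CupDiagram.rayAt_rayIndex _ hkq] at this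
            exact this
          · have := congrArg b.shift.rayIndex e
            rw [b.shift.rayIndex_rayAt, b.shift.rayIndex_rayAt] at this
            exact (CupDiagram.rayIndex_inj _ hk hkq this).symm
        · have h1 : R.top.partner p = (nest (-1) b.numCups).partner p := by
            refine R.top_partner_of_rel (Ne.symm hk) fun f g hfg => ?_
            obtain ⟨F, hF, rfl, rfl⟩ := (hR _ _).1 hfg
            exact ((col_diagram.1 hF).2.2.top p).symm
          rw [h1]
          exact nest_straddles _ _ _ hk
      refine ⟨R.bot.numCups, ?_⟩
      rw [e]
      refine congrArg toTL (Matching.ext hb.eq_nest ?_)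
      rw [R.numCups_eq]
      exact ht.eq_nest
  · rintro ⟨N, e⟩
    obtain ⟨hR, hR0⟩ := TL.prod_eq_toTL e
    rw [len] at hR hR0
    constructor
    · intro l hl p
      by_contra hc
      push Not at hc
      -- The indicator of a component without rays would vanish on both outer lines without being
      -- zero.
      obtain ⟨f, g, hF, hf, hg, hf', hg'⟩ := (strandInv_sameLine a ts b (l, p)).exists_col
      have z1 : f = ⊥ := by
        funext q
        refine eq_false fun h' => ?_
        by_cases hq : (nest (-2) a.numCups).partner q = q
        · have := hf ((nest (-2) a.numCups).rayIndex q)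
          rw [CupDiagram.rayAt_rayIndex _ hq] at this
          rw [this] at h'
          exact hc.1 _ (a.partner_rayAt _) h'
        · exact hf' q hq h'
      have z2 : g = ⊥ := by
        funext q
        refine eq_false fun h' => ?_
        by_cases hq : (nest (-1) b.numCups).partner q = q
        · have := hg ((nest (-1) b.numCups).rayIndex q)
          rw [CupDiagram.rayAt_rayIndex _ hq] at this
          rw [this] at h'
          exact hc.2 _ (b.shift.partner_rayAt _) h'
        · exact hg' q hq h'
      have := hR0 _ hF z1 (by simpa using z2) (l + 1) (by omega)
      change (if l = ts.length + 1 then g else _) = ⊥ at this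
      rw [if_neg (by omega)] at this
      exact (congrFun this p).mp (Relation.EqvGen.refl _)
    · rintro p q ⟨hp, hq, hpq, hs⟩
      rw [a.bottomLeft_iff, a.bottomLeft_iff]
      set P := (nest (-2) a.numCups).rayAt (a.rayIndex p) with hP
      set Q := (nest (-2) a.numCups).rayAt (a.rayIndex q) with hQ
      have hPQ : P ≠ Q := by
        intro e
        have := congrArg (nest (-2) a.numCups).rayIndex e
        rw [hP, hQ, CupDiagram.rayIndex_rayAt, CupDiagram.rayIndex_rayAt] at this
        exact hpq (a.rayIndex_inj hp hq this)
      have := (sigma N).bot_partner_of_rel hPQ fun f g hfg => by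
        obtain ⟨F, hF, rfl, rfl⟩ := (hR _ _).1 hfg
        obtain ⟨c1, c2, c3⟩ := col_diagram.1 hF
        have e1 := c1.ray (a.rayIndex p)
        have e2 := c1.ray (a.rayIndex q)
        change F 0 P = F 1 (a.rayAt _) at e1
        change F 0 Q = F 1 (a.rayAt _) at e2
        rw [a.rayAt_rayIndex hp] at e1
        rw [a.rayAt_rayIndex hq] at e2
        rw [e1, e2]
        exact c2.sameLine hs
      have h2 := nest_straddles (-2) N P (by
        change (sigma N).bot.partner P ≠ P
        rw [this]; exact hPQ.symm)
      change (P ≤ -2 ↔ ¬ (sigma N).bot.partner P ≤ -2) at h2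
      rwa [this] at h2
    · rintro p q ⟨hp, hq, hpq, hs⟩
      rw [b.topLeft_iff, b.topLeft_iff]
      set P := (nest (-1) b.numCups).rayAt (b.shift.rayIndex p) with hP
      set Q := (nest (-1) b.numCups).rayAt (b.shift.rayIndex q) with hQ
      have hPQ : P ≠ Q := by
        intro e
        have := congrArg (nest (-1) b.numCups).rayIndex e
        rw [hP, hQ, CupDiagram.rayIndex_rayAt, CupDiagram.rayIndex_rayAt] at this
        exact hpq (b.shift.rayIndex_inj hp hq this)
      have := (sigma N).top_partner_of_rel hPQ fun f g hfg => by
        obtain ⟨F, hF, rfl, rfl⟩ := (hR _ _).1 hfg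
        obtain ⟨c1, c2, c3⟩ := col_diagram.1 hF
        have e1 := c3.ray (b.shift.rayIndex p)
        have e2 := c3.ray (b.shift.rayIndex q)
        change F _ (b.shift.rayAt _) = F _ P at e1
        change F _ (b.shift.rayAt _) = F _ Q at e2
        rw [b.shift.rayAt_rayIndex hp] at e1
        rw [b.shift.rayAt_rayIndex hq] at e2
        rw [← e1, ← e2]
        exact c2.sameLine hs
      have h2 := nest_straddles (-1) N P (by
        change (sigma N).top.partner P ≠ P
        rw [this]; exact hPQ.symm)
      change (P ≤ -1 ↔ ¬ (sigma N).top.partner P ≤ -1) at h2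
      rwa [this] at h2

/-! ## Unfolding a diagram into two noncrossing matchings -/

/-- Points of the horizontal lines of a diagram. -/
@[ext]
structure Vert where
  lvl : ℕ
  pos : ℤ

namespace Vert

/-- Even lines are traversed from left to right, odd lines from right to left. -/
def key (v : Vert) : ℕ ×ₗ ℤ := toLex (v.lvl, if v.lvl % 2 = 0 then v.pos else -v.pos)

theorem key_inj : Function.Injective key := by
  rintro ⟨a, p⟩ ⟨b, q⟩ h
  have h' := toLex.injective h
  rw [Prod.mk.injEq] at h'
  obtain ⟨h1, h2⟩ := h'
  dsimp only at h1 h2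
  subst h1
  refine Vert.ext rfl ?_
  split_ifs at h2 <;> simpa using h2

noncomputable instance : LinearOrder Vert := LinearOrder.lift' key key_inj

theorem lt_iff {v w : Vert} : v < w ↔ v.lvl < w.lvl ∨ v.lvl = w.lvl ∧
    (if v.lvl % 2 = 0 then v.pos else -v.pos) < (if w.lvl % 2 = 0 then w.pos else -w.pos) := by
  change key v < key w ↔ _
  unfold key
  rw [Prod.Lex.toLex_lt_toLex]

/-- Putting the boundary of a layer on the lines `b` and `b + 1`. -/
def place (b : ℕ) (x : Blk) : Vert := ⟨if x.hi then b + 1 else b, x.pos⟩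

theorem place_injective (b : ℕ) : Function.Injective (place b) := by
  rintro ⟨x, p⟩ ⟨y, q⟩ h
  have h1 := congrArg lvl h
  have h2 := congrArg pos h
  cases x <;> cases y <;> simp [place] at h1 h2 <;> rw [h2]

theorem cyc_place_even {b : ℕ} (hb : b % 2 = 0) (x y z : Blk) :
    Cyc (place b x) (place b y) (place b z) ↔ Cyc x y z := by
  have key : ∀ x y, place b x < place b y ↔ x < y := by
    rintro ⟨x, p⟩ ⟨y, q⟩
    have hb1 : ¬ (b + 1) % 2 = 0 := by omega
    cases x <;> cases y <;>
      simp [lt_iff, place, hb, hb1, Blk.lo_lt_lo, Blk.lo_lt_hi, Blk.hi_lt_lo, Blk.hi_lt_hi]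
  unfold Cyc
  simp only [key]

/-- For odd b the lower line is traversed from right to left and the upper one from left to right,
which reverses the cyclic orientation of the layer. -/
theorem cyc_place_odd {b : ℕ} (hb : b % 2 = 1) (x y z : Blk) :
    Cyc (place b x) (place b y) (place b z) ↔ Cyc z y x := by
  have hb0 : ¬ b % 2 = 0 := by omega
  have hb1 : (b + 1) % 2 = 0 := by omega
  have h00 : ∀ p q : ℤ, place b ⟨false, p⟩ < place b ⟨false, q⟩ ↔ q < p := fun p q => by
    simp [lt_iff, place, hb0, hb1]
  have h11 : ∀ p q : ℤ, place b ⟨true, p⟩ < place b ⟨true, q⟩ ↔ p < q := fun p q => by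
    simp [lt_iff, place, hb0, hb1]
  have h01 : ∀ p q : ℤ, place b ⟨false, p⟩ < place b ⟨true, q⟩ := fun p q => by
    simp [lt_iff, place, hb0, hb1]
  have h10 : ∀ p q : ℤ, ¬ place b ⟨true, p⟩ < place b ⟨false, q⟩ := fun p q => by
    simp [lt_iff, place, hb0, hb1]
  obtain ⟨x, p⟩ := x
  obtain ⟨y, q⟩ := y
  obtain ⟨z, r⟩ := z
  unfold Cyc
  cases x <;> cases y <;> cases z <;>
    simp only [h00, h11, h01, h10, Blk.lo_lt_lo, Blk.lo_lt_hi, Blk.hi_lt_lo, Blk.hi_lt_hi, true_and,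
      and_true, false_and, and_false, or_false, false_or] <;> omega

/-- The bottom line of the layer of the given parity containing a point. -/
def base (par : ℕ) (v : Vert) : ℕ := if v.lvl % 2 = par then v.lvl else v.lvl - 1

/-- The position of a point in the boundary of its layer. -/
def unplace (par : ℕ) (v : Vert) : Blk := ⟨!decide (v.lvl % 2 = par), v.pos⟩

theorem place_unplace {par : ℕ} {v : Vert} (hv : 1 ≤ v.lvl) : place (base par v) (unplace par v) = v := by
  refine Vert.ext ?_ rfl
  unfold place base unplace
  by_cases h : v.lvl % 2 = par
  · simp [h]
  · simp [h]; omega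

theorem base_mod {par : ℕ} (hp : par < 2) {v : Vert} (hv : 1 ≤ v.lvl) : base par v % 2 = par := by
  unfold base; split_ifs <;> omega

theorem base_place {par b : ℕ} (hb : b % 2 = par) (x : Blk) : base par (place b x) = b := by
  obtain ⟨x, p⟩ := x
  cases x <;> simp [base, place] <;> omega

theorem unplace_place {par b : ℕ} (hb : b % 2 = par) (x : Blk) : unplace par (place b x) = x := by
  obtain ⟨x, p⟩ := x
  cases x <;> simp [unplace, place] <;> omega

end Vert

open Vert Matching

/-- The arcs in all layers of the given parity. -/
noncomputable def fold (L : ℕ → Matching) (par : ℕ) (v : Vert) : Vert :=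
  place (base par v) ((L (base par v)).lay (unplace par v))

theorem fold_place (L : ℕ → Matching) {par b : ℕ} (hb : b % 2 = par) (x : Blk) :
    fold L par (place b x) = place b ((L b).lay x) := by
  unfold fold; rw [base_place hb, unplace_place hb]

theorem fold_congr {L L' : ℕ → Matching} {par : ℕ} (hp : par < 2) {v : Vert} (hv : 1 ≤ v.lvl)
    (h : L (base par v) = L' (base par v)) : fold L par v = fold L' par v := by
  unfold fold; rw [h]

/-- Layers of one parity occupy disjoint intervals of the serpentine order, so only arcs in the same
layer could cross, and there `nc_lay` applies up to orientation. -/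
theorem nc_fold (L : ℕ → Matching) {par : ℕ} (hp : par < 2) {S : Set Vert}
    (h1 : ∀ v ∈ S, 1 ≤ v.lvl) (hS : ∀ v ∈ S, fold L par v ∈ S) : NC S (fold L par) := by
  have bm : ∀ v ∈ S, base par v % 2 = par := fun v hv => base_mod hp (h1 v hv)
  refine ⟨hS, ?_, ?_, ?_⟩
  · intro v hv
    have : fold L par v = place (base par v) ((L (base par v)).lay (unplace par v)) := rfl
    rw [this, fold_place L (bm v hv), (nc_lay _).inv _ trivial]
    exact place_unplace (h1 v hv)
  · intro v hv e
    conv_rhs at e => rw [← place_unplace (par := par) (h1 v hv)]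
    exact (nc_lay _).ne _ trivial (place_injective _ e)
  · intro v hv w hw
    obtain ⟨b, x, hbx, hb⟩ : ∃ b x, v = place b x ∧ b % 2 = par :=
      ⟨_, _, (place_unplace (h1 v hv)).symm, bm v hv⟩
    obtain ⟨c, y, hcy, hc⟩ : ∃ b x, w = place b x ∧ b % 2 = par :=
      ⟨_, _, (place_unplace (h1 w hw)).symm, bm w hw⟩
    rw [hbx, hcy, fold_place L hb, fold_place L hc]
    have far : ∀ (b c : ℕ) (x y : Blk), b + 1 < c → place b x < place c y := by
      intro b c x y h
      rw [Vert.lt_iff]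
      left
      unfold place
      dsimp only
      split_ifs <;> omega
    rcases lt_trichotomy b c with h | h | h
    · have e1 := far b c x y (by omega)
      have e2 := far b c x ((L c).lay y) (by omega)
      have e3 := far b c ((L b).lay x) y (by omega)
      have e4 := far b c ((L b).lay x) ((L c).lay y) (by omega)
      unfold Cyc
      grind
    · subst h
      rcases Nat.mod_two_eq_zero_or_one b with h | h
      · rw [cyc_place_even h, cyc_place_even h]
        exact (nc_lay _).cross _ trivial _ trivial
      · rw [cyc_place_odd h, cyc_place_odd h]
        -- Because of the reversed orientation, the noncrossing condition is read from the other end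
        -- of the arc.
        have := (nc_lay (L b)).cross ((L b).lay x) trivial y trivial
        rwa [(nc_lay (L b)).inv x trivial] at this
    · have e1 := far c b y x (by omega)
      have e2 := far c b ((L c).lay y) x (by omega)
      have e3 := far c b y ((L b).lay x) (by omega)
      have e4 := far c b ((L c).lay y) ((L b).lay x) (by omega)
      unfold Cyc
      grind

/-! ## Windows -/

/-- All arcs are at positions between `-n` and `n - 1`. -/
def Matching.Within (t : Matching) (n : ℕ) : Prop :=
  ∀ p : ℤ, ¬ (-n ≤ p ∧ p < n) → t.bot.partner p = p ∧ t.top.partner p = p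

theorem Matching.Within.mono {t : Matching} {m n : ℕ} (h : t.Within m) (hmn : m ≤ n) :
    t.Within n := fun p hp => h p (by omega)

theorem Matching.exists_within (t : Matching) : ∃ n, t.Within n := by
  obtain ⟨A, _, hA⟩ := t.bot.exists_bound
  obtain ⟨B, _, hB⟩ := t.top.exists_bound
  refine ⟨(A + B).toNat, fun p hp => ⟨?_, ?_⟩⟩
  · by_contra h; have := hA p h; omega
  · by_contra h; have := hB p h; omega

theorem Matching.Within.lay_lo {t : Matching} {n : ℕ} (h : t.Within n) {p : ℤ}
    (hp : ¬ (-n ≤ p ∧ p < n)) : t.lay ⟨false, p⟩ = ⟨true, p⟩ := by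
  have hb : ∀ q, t.bot.partner q ≠ q → -(n : ℤ) ≤ q ∧ q < n := fun q hq => by
    by_contra h'; exact hq (h q h').1
  have ht : ∀ q, t.top.partner q ≠ q → -(n : ℤ) ≤ q ∧ q < n := fun q hq => by
    by_contra h'; exact hq (h q h').2
  rw [lay_lo_ray t (h p hp).1]
  refine Blk.ext rfl ?_
  rcases lt_or_ge p (-n) with h1 | h1
  · dsimp only
    rw [t.bot.rayIndex_of_le (fun q hq => (hb q hq).1) h1.le,
      t.top.rayAt_of_le (fun q hq => (ht q hq).1) h1]
  · have h2 : (n : ℤ) ≤ p := by omega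
    have := t.numCups_eq
    dsimp only
    rw [t.bot.rayIndex_of_ge (fun q hq => (hb q hq).2) h2,
      t.top.rayAt_of_ge (fun q hq => (ht q hq).2) (by omega)]
    omega

theorem Matching.Within.lay_hi {t : Matching} {n : ℕ} (h : t.Within n) {p : ℤ}
    (hp : ¬ (-n ≤ p ∧ p < n)) : t.lay ⟨true, p⟩ = ⟨false, p⟩ := by
  have := t.nc_lay.inv ⟨false, p⟩ trivial
  rwa [h.lay_lo hp] at this

theorem Matching.Within.lay_pos {t : Matching} {n : ℕ} (h : t.Within n) {x : Blk}
    (hx : ¬ (-n ≤ x.pos ∧ x.pos < n)) : (t.lay x).pos = x.pos := by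
  obtain ⟨b, p⟩ := x
  cases b
  · rw [h.lay_lo hx]
  · rw [h.lay_hi hx]

theorem Matching.Within.lay_mem {t : Matching} {n : ℕ} (h : t.Within n) {x : Blk}
    (hx : -n ≤ x.pos ∧ x.pos < n) : -n ≤ (t.lay x).pos ∧ (t.lay x).pos < n := by
  by_contra h'
  have := h.lay_pos h'
  rw [t.nc_lay.inv x trivial] at this
  rw [← this] at h'
  exact h' hx

/-- Every position between `-n` and `n - 1` is the end of a cup, and there are no other cups. -/
def CupDiagram.Fills (c : CupDiagram) (n : ℕ) : Prop := ∀ p, c.partner p ≠ p ↔ -n ≤ p ∧ p < n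

/-- The matching with the same caps and cups. -/
def CupDiagram.double (c : CupDiagram) : Matching := ⟨c, c, rfl⟩

theorem CupDiagram.Fills.partner_mem {c : CupDiagram} {n : ℕ} (h : c.Fills n) {p : ℤ}
    (hp : -n ≤ p ∧ p < n) : -n ≤ c.partner p ∧ c.partner p < n :=
  (h _).1 (by rw [c.partner_partner]; exact ((h p).2 hp).symm)

theorem CupDiagram.Fills.lay {c : CupDiagram} {n : ℕ} (h : c.Fills n) {x : Blk}
    (hx : -n ≤ x.pos ∧ x.pos < n) : c.double.lay x = ⟨x.hi, c.partner x.pos⟩ := by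
  obtain ⟨b, p⟩ := x
  have := (h p).2 hx
  cases b
  · exact lay_lo_arc c.double this
  · exact lay_hi_arc c.double this

/-- After closing the diagram with `c` and `c'` there is only one circle in the window. -/
def Test (n : ℕ) (c c' : CupDiagram) (ts : List Matching) : Prop :=
  ∀ F, Col ts F → (∀ p, F 0 (c.partner p) = F 0 p) →
    (∀ p, F ts.length (c'.partner p) = F ts.length p) →
    ∀ i ≤ ts.length, ∀ j ≤ ts.length, ∀ p q : ℤ, -n ≤ p ∧ p < n → -n ≤ q ∧ q < n → F i p = F j q

/-- The layers of a diagram closed with `c` and `c'`. -/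
def layers (c : CupDiagram) (ts : List Matching) (c' : CupDiagram) (i : ℕ) : Matching :=
  if i = 0 then c.double else (ts[i - 1]?).getD c'.double

/-- The points on the lines `1, …, m` in a window. -/
def window (n m : ℕ) : Set Vert := {v | 1 ≤ v.lvl ∧ v.lvl ≤ m ∧ -n ≤ v.pos ∧ v.pos < n}

theorem window_finite (n m : ℕ) : (window n m).Finite := by
  have : window n m ⊆ (fun x : ℕ × ℤ => (⟨x.1, x.2⟩ : Vert)) ''
      ((Finset.Icc 1 m ×ˢ Finset.Ico (-n : ℤ) n : Finset (ℕ × ℤ)) : Set (ℕ × ℤ)) := by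
    rintro v ⟨h1, h2, h3, h4⟩
    refine ⟨(v.lvl, v.pos), ?_, rfl⟩
    simp only [Finset.coe_product, Set.mem_prod, Finset.coe_Icc, Finset.coe_Ico, Set.mem_Icc,
      Set.mem_Ico]
    exact ⟨⟨h1, h2⟩, h3, h4⟩
  exact ((Finset.finite_toSet _).image _).subset this

section

variable {n : ℕ} {c c' : CupDiagram} {ts : List Matching}

/-- The arc starting at a point of the window, in a layer or in one of the two closures. -/
theorem fold_cases (hts : ∀ t ∈ ts, t.Within n) (hc : c.Fills n) (hc' : c'.Fills n) {par : ℕ}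
    (hp : par < 2) {v : Vert} (hv : v ∈ window n (ts.length + 1)) :
    (v.lvl = 1 ∧ fold (layers c ts c') par v = ⟨1, c.partner v.pos⟩) ∨
    (v.lvl = ts.length + 1 ∧ fold (layers c ts c') par v = ⟨ts.length + 1, c'.partner v.pos⟩) ∨
    ∃ i t x, ts[i]? = some t ∧ v = place (i + 1) x ∧ -n ≤ x.pos ∧ x.pos < n ∧
      fold (layers c ts c') par v = place (i + 1) (t.lay x) := by
  obtain ⟨h1, h2, h3⟩ := hv
  have hpl := place_unplace (par := par) h1
  set b := base par v with hb
  set x := unplace par v with hx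
  have hbm : b % 2 = par := base_mod hp h1
  have hpos : x.pos = v.pos := rfl
  have hl : v.lvl = if x.hi then b + 1 else b := by
    conv_lhs => rw [← hpl]
    rfl
  have hf : fold (layers c ts c') par v = place b ((layers c ts c' b).lay x) := rfl
  rcases Nat.eq_zero_or_pos b with e | e
  · left
    have hxh : x.hi = true := by
      by_contra h'; rw [if_neg h'] at hl; omega
    rw [if_pos hxh] at hl
    refine ⟨by omega, ?_⟩
    rw [hf, layers, if_pos e, hc.lay (by rw [hpos]; exact h3), hxh, e]
    simp [place, hpos]
  rcases Nat.lt_or_ge ts.length b with e' | e'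
  · right; left
    have hxh : x.hi = false := by
      by_contra h'
      rw [Bool.not_eq_false] at h'
      rw [if_pos h'] at hl; omega
    rw [if_neg (by simp [hxh])] at hl
    refine ⟨by omega, ?_⟩
    rw [hf, layers, if_neg (by omega), List.getElem?_eq_none (by omega), Option.getD_none,
      hc'.lay (by rw [hpos]; exact h3), hxh]
    refine Vert.ext ?_ rfl
    simp [place]; omega
  · right; right
    have hlt : b - 1 < ts.length := by omega
    refine ⟨b - 1, ts[b - 1], x, List.getElem?_eq_getElem hlt, ?_, ?_, ?_, ?_⟩
    · rw [Nat.sub_add_cancel e]; exact hpl.symm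
    · rw [hpos]; exact h3.1
    · rw [hpos]; exact h3.2
    · rw [hf, Nat.sub_add_cancel e, layers, if_neg (by omega), List.getElem?_eq_getElem hlt,
        Option.getD_some]

theorem fold_mem_window (hts : ∀ t ∈ ts, t.Within n) (hc : c.Fills n) (hc' : c'.Fills n) {par : ℕ}
    (hp : par < 2) {v : Vert} (hv : v ∈ window n (ts.length + 1)) :
    fold (layers c ts c') par v ∈ window n (ts.length + 1) := by
  rcases fold_cases hts hc hc' hp hv with ⟨h, e⟩ | ⟨h, e⟩ | ⟨i, t, x, hi, hx, h1, h2, e⟩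
  · rw [e]
    exact ⟨le_rfl, by dsimp only; omega, hc.partner_mem hv.2.2⟩
  · rw [e]
    exact ⟨by dsimp only; omega, le_rfl, hc'.partner_mem hv.2.2⟩
  · rw [e]
    have hil := (List.getElem?_eq_some_iff.1 hi).1
    refine ⟨?_, ?_, (hts t (List.mem_of_getElem? hi)).lay_mem ⟨h1, h2⟩⟩ <;>
    · unfold place
      dsimp only
      split_ifs <;> omega

theorem nc_fold_layers (hts : ∀ t ∈ ts, t.Within n) (hc : c.Fills n) (hc' : c'.Fills n) {par : ℕ}
    (hp : par < 2) : NC (window n (ts.length + 1)) (fold (layers c ts c') par) :=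
  nc_fold _ hp (fun _ hv => hv.1) fun _ hv => fold_mem_window hts hc hc' hp hv

/-- Functions constant on the even and on the odd arcs are exactly the colourings of the closed
stack in the window; line i of the stack is level i + 1. -/
theorem conn_iff_test (hts : ∀ t ∈ ts, t.Within n) (hc : c.Fills n) (hc' : c'.Fills n) :
    Conn (window n (ts.length + 1)) (fold (layers c ts c') 0) (fold (layers c ts c') 1) ↔
      Test n c c' ts := by
  constructor
  · intro H F hF hF0 hFl i hi j hj p q hp hq
    have inv : ∀ par < 2, ArcInv (fun v : Vert => F (v.lvl - 1) v.pos)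
        (fold (layers c ts c') par) (window n (ts.length + 1)) := by
      intro par hpar v hv
      rcases fold_cases hts hc hc' hpar hv with ⟨h, e⟩ | ⟨h, e⟩ | ⟨i, t, x, hi, hx, h1, h2, e⟩
      · change F _ _ = F _ _
        rw [e, h]; exact hF0 _
      · change F _ _ = F _ _
        rw [e, h]; exact hFl _
      · change F _ _ = F _ _
        rw [e, hx]
        have hg : ∀ y : Blk, F ((place (i + 1) y).lvl - 1) (place (i + 1) y).pos =
            glue (F i) (F (i + 1)) y := by
          rintro ⟨b, p⟩
          cases b <;> simp [place, glue]
        rw [hg, hg]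
        exact (rel_iff t _ _).1 (hF i t hi) x trivial
    have := H _ (inv 0 (by omega)) (inv 1 (by omega)) ⟨i + 1, p⟩
      ⟨by dsimp only; omega, by dsimp only; omega, hp⟩ ⟨j + 1, q⟩
      ⟨by dsimp only; omega, by dsimp only; omega, hq⟩
    exact this
  · intro H G hG0 hG1 v hv w hw
    have inv : ∀ par < 2, ArcInv G (fold (layers c ts c') par) (window n (ts.length + 1)) := by
      intro par hpar
      interval_cases par
      · exact hG0
      · exact hG1
    classical
    -- Outside the window all layers are vertical, so the colour `False` is consistent there.
    let F : ℕ → ℤ → Prop := fun i p => (-(n : ℤ) ≤ p ∧ p < n) ∧ G ⟨i + 1, p⟩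
    have hF : ∀ i p, (-(n : ℤ) ≤ p ∧ p < n) → F i p = G ⟨i + 1, p⟩ := fun i p hp =>
      propext ⟨fun h => h.2, fun h => ⟨hp, h⟩⟩
    have hF' : ∀ i p, ¬ (-(n : ℤ) ≤ p ∧ p < n) → F i p = False := fun i p hp => eq_false fun h => hp h.1
    have := H F ?_ ?_ ?_ (v.lvl - 1) (by have := hv.2.1; omega) (w.lvl - 1)
      (by have := hw.2.1; omega) v.pos w.pos hv.2.2 hw.2.2
    · rw [hF _ _ hv.2.2, hF _ _ hw.2.2, Nat.sub_add_cancel hv.1, Nat.sub_add_cancel hw.1] at this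
      exact this
    · intro i t hi
      have hil := (List.getElem?_eq_some_iff.1 hi).1
      have ht := hts t (List.mem_of_getElem? hi)
      rw [rel_iff]
      intro x _
      by_cases hx : -n ≤ x.pos ∧ x.pos < n
      · have hg : ∀ y : Blk, (-n ≤ y.pos ∧ y.pos < n) →
            glue (F i) (F (i + 1)) y = G (place (i + 1) y) := by
          rintro ⟨b, p⟩ hy
          cases b
          · rw [glue_lo, hF i p hy]; rfl
          · rw [glue_hi, hF _ p hy]; rfl
        rw [hg _ hx, hg _ (ht.lay_mem hx)]
        have hpl : place (i + 1) x ∈ window n (ts.length + 1) := by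
          refine ⟨?_, ?_, hx⟩ <;>
          · unfold place
            dsimp only
            split_ifs <;> omega
        have := inv ((i + 1) % 2) (Nat.mod_lt _ (by omega)) _ hpl
        rw [fold_place _ rfl] at this
        have hL : layers c ts c' (i + 1) = t := by
          rw [layers, if_neg (by omega), Nat.add_sub_cancel, hi, Option.getD_some]
        rwa [hL] at this
      · have hx' := ht.lay_pos hx
        have hg : ∀ y : Blk, ¬ (-n ≤ y.pos ∧ y.pos < n) → glue (F i) (F (i + 1)) y = False := by
          rintro ⟨b, p⟩ hy
          cases b
          · rw [glue_lo, hF' i p hy]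
          · rw [glue_hi, hF' _ p hy]
        rw [hg _ hx, hg _ (by rw [hx']; exact hx)]
    · intro p
      by_cases hp : -n ≤ p ∧ p < n
      · rw [hF _ _ hp, hF _ _ (hc.partner_mem hp)]
        have hm : (⟨1, p⟩ : Vert) ∈ window n (ts.length + 1) :=
          ⟨le_rfl, by dsimp only; omega, hp⟩
        have := inv 0 (by omega) _ hm
        rw [show (⟨1, p⟩ : Vert) = place 0 ⟨true, p⟩ by rfl, fold_place (par := 0) (b := 0) _ rfl, layers,
          if_pos rfl,
          hc.lay hp] at this
        exact this
      · have : c.partner p = p := by by_contra h; exact hp ((hc p).1 h)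
        rw [this]
    · intro p
      by_cases hp : -n ≤ p ∧ p < n
      · rw [hF _ _ hp, hF _ _ (hc'.partner_mem hp)]
        have hm : (⟨ts.length + 1, p⟩ : Vert) ∈ window n (ts.length + 1) :=
          ⟨by dsimp only; omega, le_rfl, hp⟩
        have := inv ((ts.length + 1) % 2) (Nat.mod_lt _ (by omega)) _ hm
        rw [show (⟨ts.length + 1, p⟩ : Vert) = place (ts.length + 1) ⟨false, p⟩ by rfl,
          fold_place _ rfl, layers, if_neg (by omega), List.getElem?_eq_none (by omega),
          Option.getD_none, hc'.lay hp] at this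
        exact this
      · have : c'.partner p = p := by by_contra h; exact hp ((hc' p).1 h)
        rw [this]

end

/-! ### Placing a rotated layer in the serpentine order -/

/-- Two matchings which differ by a rotation of three arcs. -/
def HexM (A B : Matching) : Prop := ∃ h, Hex Set.univ A.lay B.lay h

theorem Hex.place_even {A B : Matching} {h : Fin 6 → Blk} (H : Hex Set.univ A.lay B.lay h)
    {L L' : ℕ → Matching} {j : ℕ} (hj : j % 2 = 0) (hL : L j = A) (hL' : L' j = B)
    (hLL : ∀ i, i ≠ j → L i = L' i) {S : Set Vert} (hS : ∀ v ∈ S, 1 ≤ v.lvl)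
    (hm : ∀ i, place j (h i) ∈ S) : Hex S (fold L 0) (fold L' 0) fun i => place j (h i) := by
  refine ⟨hm, fun i => ?_, fun i => ?_, fun a b c habc => ?_, fun v hv hne => ?_⟩
  · rw [fold_place _ hj, hL, H.left]
  · rw [fold_place _ hj, hL', H.right]
  · rw [cyc_place_even hj]; exact H.cyc _ _ _ habc
  · by_cases hb : base 0 v = j
    · have hx := place_unplace (par := 0) (hS v hv)
      rw [hb] at hx
      have : ∀ i, unplace 0 v ≠ h i := fun i e => hne i (by rw [← hx, e])
      rw [← hx, fold_place _ hj, fold_place _ hj, hL, hL', H.other _ trivial this]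
    · exact fold_congr (by omega) (hS v hv) (hLL _ hb)

/-- An odd layer is traversed backwards. The reflection i ↦ 4 - i of the corners restores the
orientation and exchanges `hexA` with `hexB`, hence the roles of A and B. -/
theorem Hex.place_odd {A B : Matching} {h : Fin 6 → Blk} (H : Hex Set.univ A.lay B.lay h)
    {L L' : ℕ → Matching} {j : ℕ} (hj : j % 2 = 1) (hL : L j = A) (hL' : L' j = B)
    (hLL : ∀ i, i ≠ j → L i = L' i) {S : Set Vert} (hS : ∀ v ∈ S, 1 ≤ v.lvl)
    (hm : ∀ i, place j (h i) ∈ S) : Hex S (fold L' 1) (fold L 1) fun i => place j (h (4 - i)) := by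
  refine ⟨fun i => hm _, fun i => ?_, fun i => ?_, fun a b c habc => ?_, fun v hv hne => ?_⟩
  · rw [fold_place _ hj, hL', H.right]
    fin_cases i <;> rfl
  · rw [fold_place _ hj, hL, H.left]
    fin_cases i <;> rfl
  · rw [cyc_place_odd hj]
    refine H.cyc _ _ _ ?_
    revert a b c
    decide
  · by_cases hb : base 1 v = j
    · have hx := place_unplace (par := 1) (hS v hv)
      rw [hb] at hx
      have : ∀ i, unplace 1 v ≠ h i := fun i e => hne (4 - i) (by rw [← hx, e]; simp)
      rw [← hx, fold_place _ hj, fold_place _ hj, hL, hL', H.other _ trivial this]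
    · exact (fold_congr (by omega) (hS v hv) (hLL _ hb)).symm

/-! ## Closures detecting nested diagrams -/

/-- The rotations of the nested diagram filling a window. -/
def rainbow (n : ℕ) (i : ℤ) (hi : -n ≤ i ∧ i < n) : CupDiagram where
  partner p := if -n ≤ p ∧ p < n then
      if n ≤ 2 * i + 1 - p then 2 * i + 1 - p - 2 * n
      else if 2 * i + 1 - p < -n then 2 * i + 1 - p + 2 * n else 2 * i + 1 - p
    else p
  partner_partner p := by split_ifs <;> omega
  finite_moved := by
    refine (Set.finite_Ico (-n : ℤ) n).subset fun p hp => ?_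
    by_contra h
    rw [Set.mem_Ico] at h
    exact hp (if_neg h)
  nested p k h1 h2 := by split_ifs at h2 ⊢ <;> omega

section

variable {n : ℕ} {i : ℤ} {hi : -n ≤ i ∧ i < n}

theorem rainbow_partner (p : ℤ) : (rainbow n i hi).partner p = if -n ≤ p ∧ p < n then
      if n ≤ 2 * i + 1 - p then 2 * i + 1 - p - 2 * n
      else if 2 * i + 1 - p < -n then 2 * i + 1 - p + 2 * n else 2 * i + 1 - p
    else p := rfl

/-- Modulo 2n the partner of p is 2i + 1 - p, a reflection without fixed points because 2i + 1 is
odd. -/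
theorem rainbow_fills : (rainbow n i hi).Fills n := by
  intro p
  rw [rainbow_partner]
  split_ifs <;> omega

end

/-- Steps of length two link positions of equal parity, and the reflection links the two parities
since a + b is odd. -/
theorem const_of_two_reflections {h : ℤ → Prop} {a b : ℤ} (hab : (a + b) % 2 = 1)
    (h1 : ∀ p, a ≤ p → p ≤ b → h (a + b - p) = h p) (h2 : ∀ p, a + 2 ≤ p → p ≤ b → h (p - 2) = h p)
    {p q : ℤ} (hp : a ≤ p ∧ p ≤ b) (hq : a ≤ q ∧ q ≤ b) : h p = h q := by
  have up : ∀ k : ℕ, a + 2 * k ≤ b → h (a + 2 * k) = h a := by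
    intro k
    induction k with
    | zero => intro _; simp
    | succ k ih =>
      intro hk
      push_cast at hk
      rw [← ih (by omega), ← h2 (a + 2 * ↑(k + 1)) (by push_cast; omega) (by push_cast; omega)]
      congr 1; push_cast; ring
  have even : ∀ p, a ≤ p → p ≤ b → (p - a) % 2 = 0 → h p = h a := by
    intro p h3 h4 h5
    have := up ((p - a) / 2).toNat (by omega)
    rwa [show a + 2 * (((p - a) / 2).toNat : ℤ) = p by omega] at this
  have all : ∀ p, a ≤ p → p ≤ b → h p = h a := by
    intro p h3 h4
    rcases Int.emod_two_eq_zero_or_one (p - a) with h5 | h5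
    · exact even p h3 h4 h5
    · rw [← h1 p h3 h4]
      exact even _ (by omega) (by omega) (by omega)
  rw [all p hp.1 hp.2, all q hq.1 hq.2]

/-- The two reflections modulo 2n compose to a translation by 2(i - j). As i - j is prime to n, its
multiples contain the translation by 2, and a reflection changes the parity; so the two rainbows
form a single circle. -/
theorem const_of_rainbows {n : ℕ} {i j : ℤ} (hi : -n ≤ i ∧ i < n) (hj : -n ≤ j ∧ j < n)
    (hg : Int.gcd (i - j) n = 1) {g : ℤ → Prop} (h1 : ∀ p, g ((rainbow n i hi).partner p) = g p)
    (h2 : ∀ p, g ((rainbow n j hj).partner p) = g p) {p q : ℤ} (hp : -n ≤ p ∧ p < n)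
    (hq : -n ≤ q ∧ q < n) : g p = g q := by
  have hn : (0 : ℤ) < 2 * n := by omega
  -- The representative of x modulo 2n inside the window.
  let red : ℤ → ℤ := fun x => (x + n) % (2 * n) - n
  have hred : ∀ x, -n ≤ red x ∧ red x < n ∧ ∃ k, red x = x + 2 * n * k := by
    intro x
    have e1 := Int.emod_nonneg (x + n) (ne_of_gt hn)
    have e2 := Int.emod_lt_of_pos (x + n) hn
    have e3 := Int.emod_add_mul_ediv (x + n) (2 * n)
    refine ⟨by simp only [red]; omega, by simp only [red]; omega, -((x + n) / (2 * n)), ?_⟩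
    simp only [red]
    linarith
  have uniq : ∀ x y k : ℤ, -n ≤ x ∧ x < n → -n ≤ y ∧ y < n → x = y + 2 * n * k → x = y := by
    intro x y k hx hy h
    have h1 : 2 * (n : ℤ) * k < 2 * n * 1 := by linarith
    have h2 : 2 * (n : ℤ) * (-1) < 2 * n * k := by linarith
    have h3 := lt_of_mul_lt_mul_left h1 hn.le
    have h4 := lt_of_mul_lt_mul_left h2 hn.le
    have : k = 0 := by omega
    rw [h, this]; ring
  have refl : ∀ (i : ℤ) (hi : -n ≤ i ∧ i < n), (∀ p, g ((rainbow n i hi).partner p) = g p) →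
      ∀ x, g (red (2 * i + 1 - x)) = g (red x) := by
    intro i hi h x
    rw [← h (red x)]
    congr 1
    obtain ⟨a1, a2, k, hk⟩ := hred x
    obtain ⟨b1, b2, l, hl⟩ := hred (2 * i + 1 - x)
    have hm := (rainbow_fills (hi := hi)).partner_mem ⟨a1, a2⟩
    have hex : ∃ e, (rainbow n i hi).partner (red x) = 2 * i + 1 - red x + 2 * n * e := by
      rw [rainbow_partner, if_pos ⟨a1, a2⟩]
      split_ifs
      · exact ⟨-1, by ring⟩
      · exact ⟨1, by ring⟩
      · exact ⟨0, by ring⟩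
    obtain ⟨e, he⟩ := hex
    refine uniq _ _ (l + k - e) ⟨b1, b2⟩ hm ?_
    rw [he, hl, hk]; ring
  have r1 := refl i hi h1
  have r2 := refl j hj h2
  let h : ℤ → Prop := fun x => g (red x)
  have per : ∀ x, h (x + 2 * n) = h x := by
    intro x
    simp only [h, red]
    congr 2
    rw [show x + 2 * (n : ℤ) + n = x + n + 2 * n by ring, Int.add_emod_right]
  have tr : ∀ x, h (x + 2 * (i - j)) = h x := by
    intro x
    calc h (x + 2 * (i - j)) = h (2 * i + 1 - (2 * j + 1 - x)) := by congr 1; ring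
      _ = h (2 * j + 1 - x) := r1 _
      _ = h x := r2 x
  have pow : ∀ (d : ℤ), (∀ x, h (x + d) = h x) → ∀ (k : ℤ) x, h (x + k * d) = h x := by
    intro d hd k
    induction k with
    | zero => intro x; simp
    | succ k ih => intro x; rw [← ih x, ← hd (x + k * d)]; congr 1; ring
    | pred k ih => intro x; rw [← ih x, ← hd (x + (-k - 1) * d)]; congr 1; ring
  have two : ∀ x, h (x + 2) = h x := by
    intro x
    have hb := Int.gcd_eq_gcd_ab (i - j) n
    rw [hg] at hb
    push_cast at hb
    have e : x + 2 = x + (Int.gcdA (i - j) n) * (2 * (i - j)) + (Int.gcdB (i - j) n) * (2 * n) := by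
      linear_combination 2 * hb
    rw [e, pow _ per, pow _ tr]
  have even := pow 2 two
  have all : ∀ x, h x = h 0 := by
    intro x
    rcases Int.emod_two_eq_zero_or_one x with hx | hx
    · have := even (x / 2) 0
      rwa [show 0 + x / 2 * 2 = x by omega] at this
    · have : h (2 * i + 1 - x) = h x := r1 x
      rw [← this]
      have := even ((2 * i + 1 - x) / 2) 0
      rwa [show 0 + (2 * i + 1 - x) / 2 * 2 = 2 * i + 1 - x by omega] at this
  have val : ∀ p : ℤ, -n ≤ p ∧ p < n → h p = g p := by
    intro p hp
    obtain ⟨a1, a2, k, hk⟩ := hred p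
    simp only [h]
    rw [uniq _ _ k ⟨a1, a2⟩ hp hk]
  rw [← val p hp, ← val q hq, all p, all q]

/-- The relation of nested caps below nested cups on rays. -/
theorem rel_sigma {N : ℕ} {f g : ℤ → Prop} (h : (sigma N).Rel f g) :
    (∀ p : ℤ, -N - 1 ≤ p → p ≤ N - 2 → f (-3 - p) = f p) ∧
      (∀ p : ℤ, -N ≤ p → p ≤ N - 1 → g (-1 - p) = g p) ∧
      (∀ p : ℤ, p ≤ -N - 2 → f p = g p) ∧ (∀ p : ℤ, N ≤ p → f p = g p) ∧ f (N - 1) = g (-N - 1) := by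
  refine ⟨fun p h1 h2 => ?_, fun p h1 h2 => ?_, fun p hp => ?_, fun p hp => ?_, ?_⟩
  · have := h.bot p
    rw [sigma, nest_partner, if_pos (by omega)] at this
    rw [← this]; congr 1
  · have := h.top p
    rw [sigma, nest_partner, if_pos (by omega)] at this
    rw [← this]; congr 1
  · have := h.ray p
    rwa [sigma, nest_rayAt_left (by omega), nest_rayAt_left (by omega)] at this
  · have := h.ray (p - 2 * N)
    rw [sigma, nest_rayAt_right (by omega), nest_rayAt_right (by omega)] at this
    rwa [sub_add_cancel] at this
  -- This is the only ray that passes to the right of the lower nest and to the left of the upper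
  -- one.
  · have := h.ray (-N - 1)
    rw [sigma, nest_rayAt_right (by omega), nest_rayAt_left (by omega)] at this
    rw [← this]; congr 1; ring

/-- The pairs of closures used to detect nested diagrams. -/
def IsTest (n : ℕ) (c c' : CupDiagram) : Prop :=
  (∃ i h h', Int.gcd (i + 1) n = 1 ∧ c = rainbow n (-1) h ∧ c' = rainbow n i h') ∨
    ∃ i h h', Int.gcd (i + 2) n = 1 ∧ c = rainbow n i h ∧ c' = rainbow n (-2) h'

theorem IsTest.fills {n : ℕ} {c c' : CupDiagram} (h : IsTest n c c') : c.Fills n ∧ c'.Fills n := by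
  rcases h with ⟨i, h, h', -, rfl, rfl⟩ | ⟨i, h, h', -, rfl, rfl⟩ <;>
    exact ⟨rainbow_fills, rainbow_fills⟩

/-- One closure is centred at the middle of the opposite nest of `sigma N`. Its symmetry passes
through `sigma N` to the other line, where together with the second closure it forms two rainbows
with coprime offset, so `const_of_rainbows` applies. The margin N + 2 ≤ n keeps the nests and the
bent ray in the window. -/
theorem const_of_rel_sigma {n N : ℕ} (hN : N + 2 ≤ n) {c c' : CupDiagram} (h : IsTest n c c')
    {f g : ℤ → Prop} (hr : (sigma N).Rel f g) (hf : ∀ p, f (c.partner p) = f p)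
    (hg : ∀ p, g (c'.partner p) = g p) : ∃ k, ∀ p : ℤ, -n ≤ p ∧ p < n → f p = k ∧ g p = k := by
  obtain ⟨r1, r2, r3, r4, r5⟩ := rel_sigma hr
  rcases h with ⟨i, h, h', hgcd, rfl, rfl⟩ | ⟨i, h, h', hgcd, rfl, rfl⟩
  · have f1 : ∀ p, -(n : ℤ) ≤ p → p < n → f (-1 - p) = f p := by
      intro p h1 h2
      have := hf p
      rw [rainbow_partner, if_pos ⟨h1, h2⟩, if_neg (by omega), if_neg (by omega)] at this
      rw [← this]; congr 1
    -- The nest reflects p to -3 - p and the closure reflects p to -1 - p; their composition is a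
    -- step of length two.
    have fc : ∀ p q : ℤ, (-N - 1 ≤ p ∧ p ≤ N) → (-N - 1 ≤ q ∧ q ≤ N) → f p = f q := by
      intro p q hp hq
      refine const_of_two_reflections (a := -N - 1) (b := N) (by omega) ?_ ?_ hp hq
      · intro p h1 h2
        rw [← f1 p (by omega) (by omega)]; congr 1; ring
      · intro p h1 h2
        rw [← f1 p (by omega) (by omega), ← r1 (-1 - p) (by omega) (by omega)]
        congr 1; ring
    have gf : ∀ p : ℤ, -n ≤ p ∧ p < n → g p = if p ≤ -N - 2 ∨ N ≤ p then f p else g p := by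
      intro p hp
      split_ifs with h
      · rcases h with h | h
        · exact (r3 p h).symm
        · exact (r4 p h).symm
      · rfl
    -- Inside the upper nest this is its own symmetry; outside, it is the symmetry of the closure
    -- carried over by the rays, where the bent ray needs `fc`.
    have g1 : ∀ p, -(n : ℤ) ≤ p → p < n → g (-1 - p) = g p := by
      intro p h1 h2
      by_cases hp : -N ≤ p ∧ p ≤ N - 1
      · exact r2 p hp.1 hp.2
      by_cases hp1 : p = -N - 1
      · rw [hp1, ← r5, show -1 - (-(N : ℤ) - 1) = N by ring, ← r4 N le_rfl]
        exact fc _ _ (by omega) (by omega)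
      by_cases hp2 : p = N
      · rw [hp2, show -1 - (N : ℤ) = -N - 1 by ring, ← r5, ← r4 N le_rfl]
        exact fc _ _ (by omega) (by omega)
      rcases (show p ≤ -N - 2 ∨ (N : ℤ) + 1 ≤ p by omega) with h3 | h3
      · rw [← r3 p h3, ← r4 (-1 - p) (by omega), f1 p h1 h2]
      · rw [← r4 p (by omega), ← r3 (-1 - p) (by omega), f1 p h1 h2]
    have gc : ∀ p q : ℤ, (-n ≤ p ∧ p < n) → (-n ≤ q ∧ q < n) → g p = g q := by
      intro p q hp hq
      refine const_of_rainbows (i := i) (j := -1) h' h ?_ hg ?_ hp hq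
      · rwa [sub_neg_eq_add]
      · intro p
        rw [rainbow_partner]
        split_ifs with h1 h2 h3
        · omega
        · omega
        · rw [← g1 p h1.1 h1.2]; congr 1
        · rfl
    refine ⟨g 0, fun p hp => ⟨?_, gc p 0 hp (by omega)⟩⟩
    rcases (show p ≤ -N - 2 ∨ (N : ℤ) ≤ p ∨ (-N - 1 ≤ p ∧ p ≤ N) by omega) with h3 | h3 | h3
    · rw [r3 p h3, gc p 0 hp (by omega)]
    · rw [r4 p h3, gc p 0 hp (by omega)]
    · rw [fc p N h3 (by omega), r4 N le_rfl, gc N 0 (by omega) (by omega)]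
  · have g1 : ∀ p, -(n : ℤ) ≤ p → p < n - 2 → g (-3 - p) = g p := by
      intro p h1 h2
      have := hg p
      rw [rainbow_partner, if_pos (by omega), if_neg (by omega), if_neg (by omega)] at this
      rw [← this]; congr 1
    have g2 : g (n - 2) = g (n - 1) := by
      have := hg (n - 1)
      rw [rainbow_partner, if_pos (by omega), if_neg (by omega), if_pos (by omega)] at this
      rw [← this]; congr 1; ring
    have gc : ∀ p q : ℤ, (-N - 2 ≤ p ∧ p ≤ N - 1) → (-N - 2 ≤ q ∧ q ≤ N - 1) → g p = g q := by
      intro p q hp hq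
      refine const_of_two_reflections (a := -N - 2) (b := N - 1) (by omega) ?_ ?_ hp hq
      · intro p h1 h2
        rw [← g1 p (by omega) (by omega)]; congr 1; ring
      · intro p h1 h2
        rw [← r2 p (by omega) (by omega), ← g1 (-1 - p) (by omega) (by omega)]
        congr 1; ring
    have f1 : ∀ p, -(n : ℤ) ≤ p → p < n - 2 → f (-3 - p) = f p := by
      intro p h1 h2
      by_cases hp : -N - 1 ≤ p ∧ p ≤ N - 2
      · exact r1 p hp.1 hp.2
      by_cases hp1 : p = -N - 2
      · rw [hp1, show -3 - (-(N : ℤ) - 2) = N - 1 by ring, r5, r3 _ le_rfl]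
        exact gc _ _ (by omega) (by omega)
      by_cases hp2 : p = N - 1
      · rw [hp2, show -3 - ((N : ℤ) - 1) = -N - 2 by ring, r5, r3 _ le_rfl]
        exact gc _ _ (by omega) (by omega)
      rcases (show p ≤ -N - 3 ∨ (N : ℤ) ≤ p by omega) with h3 | h3
      · rw [r3 p (by omega), r4 (-3 - p) (by omega), g1 p h1 h2]
      · rw [r4 p (by omega), r3 (-3 - p) (by omega), g1 p h1 h2]
    have f2 : f (n - 2) = f (n - 1) := by
      rw [r4 _ (by omega), r4 _ (by omega), g2]
    have fc : ∀ p q : ℤ, (-n ≤ p ∧ p < n) → (-n ≤ q ∧ q < n) → f p = f q := by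
      intro p q hp hq
      refine const_of_rainbows (i := i) (j := -2) h h' ?_ hf ?_ hp hq
      · rwa [sub_neg_eq_add]
      · intro p
        rw [rainbow_partner]
        split_ifs with h1 h2 h3
        · omega
        · rcases (show p = n - 1 ∨ p = n - 2 by omega) with e | e
          · rw [e, ← f2]; congr 1; ring
          · rw [e, f2]; congr 1; ring
        · rw [← f1 p h1.1 (by omega)]; congr 1
        · rfl
    refine ⟨f 0, fun p hp => ⟨fc p 0 hp (by omega), ?_⟩⟩
    rcases (show p ≤ -N - 2 ∨ (N : ℤ) ≤ p ∨ (-N - 2 ≤ p ∧ p ≤ N - 1) by omega) with h3 | h3 | h3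
    · rw [← r3 p h3, fc p 0 hp (by omega)]
    · rw [← r4 p h3, fc p 0 hp (by omega)]
    · rw [gc p (-N - 2) h3 (by omega), ← r3 _ le_rfl, fc _ 0 (by omega) (by omega)]

theorem Col.outside {ts : List Matching} {n : ℕ} (hts : ∀ t ∈ ts, t.Within n) {F : ℕ → ℤ → Prop}
    (hF : Col ts F) {p : ℤ} (hp : ¬ (-n ≤ p ∧ p < n)) {i : ℕ} (hi : i ≤ ts.length) :
    F i p = F 0 p := by
  induction i with
  | zero => rfl
  | succ i ih =>
    rw [← ih (by omega)]
    have hlt : i < ts.length := hi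
    have h := hF i _ (List.getElem?_eq_getElem hlt)
    have := (rel_iff _ _ _).1 h ⟨false, p⟩ trivial
    rw [(hts _ (List.getElem_mem hlt)).lay_lo hp, glue_lo, glue_hi] at this
    exact this

theorem Matching.Within.rel_const {t : Matching} {n : ℕ} (h : t.Within n) {e : ℤ → Prop} {k : Prop}
    (he : ∀ p : ℤ, -n ≤ p ∧ p < n → e p = k) : t.Rel e e := by
  rw [rel_iff]
  intro x _
  have hg : ∀ y, glue e e y = e y.pos := by
    rintro ⟨b, p⟩; cases b <;> simp [glue]
  rw [hg, hg]
  by_cases hx : -n ≤ x.pos ∧ x.pos < n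
  · rw [he _ hx, he _ (h.lay_mem hx)]
  · rw [h.lay_pos hx]

/-- Colourings form a vector space over the field with two elements; this is their difference. -/
theorem Matching.Rel.xor {t : Matching} {f g f' g' : ℤ → Prop} (h : t.Rel f g) (h' : t.Rel f' g') :
    t.Rel (fun p => ¬ (f p ↔ f' p)) fun p => ¬ (g p ↔ g' p) :=
  ⟨fun p => by rw [h.bot, h'.bot], fun p => by rw [h.top, h'.top], fun i => by
    rw [h.ray, h'.ray]⟩

/-- By `const_of_rel_sigma` a colouring of the closed stack has one value k on the window parts of
both outer lines. Subtracting the colouring that equals k in the window on every line leaves one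
that vanishes on both outer lines, hence everywhere, as there are no circles. -/
theorem test_of_sigma {ts : List Matching} {n N : ℕ} (hts : ∀ t ∈ ts, t.Within n)
    (h : TL.prod ts = (sigma N).toTL) (hN : N + 2 ≤ n) {c c' : CupDiagram} (hc : IsTest n c c') :
    Test n c c' ts := by
  intro F hF h0 hl
  obtain ⟨hR, hR0⟩ := TL.prod_eq_toTL h
  obtain ⟨k, hk⟩ := const_of_rel_sigma hN hc ((hR _ _).2 ⟨F, hF, rfl, rfl⟩) h0 hl
  classical
  let e : ℤ → Prop := fun p => if -(n : ℤ) ≤ p ∧ p < n then k else F 0 p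
  have e1 : ∀ p : ℤ, -n ≤ p ∧ p < n → e p = k := fun p hp => if_pos hp
  have e2 : ∀ p : ℤ, ¬ (-n ≤ p ∧ p < n) → e p = F 0 p := fun p hp => if_neg hp
  have key := hR0 (fun i p => ¬ (F i p ↔ e p))
    (fun i t ht => (hF i t ht).xor ((hts t (List.mem_of_getElem? ht)).rel_const e1))
    (funext fun p => by
      refine eq_false (not_not.2 (iff_of_eq ?_))
      by_cases hp : -(n : ℤ) ≤ p ∧ p < n
      · rw [e1 p hp, (hk p hp).1]
      · rw [e2 p hp])
    (funext fun p => by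
      refine eq_false (not_not.2 (iff_of_eq ?_))
      by_cases hp : -(n : ℤ) ≤ p ∧ p < n
      · rw [e1 p hp, (hk p hp).2]
      · rw [e2 p hp, hF.outside hts hp le_rfl])
  have val : ∀ i ≤ ts.length, ∀ p : ℤ, -n ≤ p ∧ p < n → F i p = k := by
    intro i hi p hp
    have := congrFun (key i hi) p
    have := not_not.1 (of_eq_false this)
    rw [e1 p hp] at this
    exact propext this
  intro i hi j hj p q hp hq
  rw [val i hi p hp, val j hj q hq]

theorem CupDiagram.exists_adjacent (c : CupDiagram) : ∀ (k : ℕ) (p : ℤ), p < c.partner p →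
    c.partner p - p ≤ k → ∃ j, p ≤ j ∧ j + 1 ≤ c.partner p ∧ c.partner j = j + 1 := by
  intro k
  induction k with
  | zero => intro p h1 h2; omega
  | succ k ih =>
    intro p h1 h2
    by_cases e : c.partner p = p + 1
    · exact ⟨p, le_rfl, e.ge, e⟩
    · have h3 := c.nested p (p + 1) (by omega) (by omega)
      obtain ⟨j, hj1, hj2, hj3⟩ := ih (p + 1) (by omega) (by push_cast at h2; omega)
      exact ⟨j, by omega, by omega, hj3⟩

/-- Every cup contains or is a cup joining adjacent positions; if these are all in the middle, every
cup passes over the middle. -/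
theorem CupDiagram.straddles_of_adjacent {c : CupDiagram} {m : ℤ}
    (h : ∀ j, c.partner j = j + 1 → j = m) : c.Straddles m := by
  have key : ∀ p, p < c.partner p → (p ≤ m ∧ ¬ c.partner p ≤ m) := by
    intro p hp
    obtain ⟨j, h1, h2, h3⟩ := c.exists_adjacent (c.partner p - p).toNat p hp (by omega)
    have := h j h3
    omega
  intro p hp
  rcases lt_or_gt_of_ne hp with h1 | h1
  · have := key (c.partner p) (by rw [c.partner_partner]; exact h1)
    rw [c.partner_partner] at this
    tauto
  · have := key p h1
    tauto

theorem gcd_prime_eq_one {n : ℕ} (hn : n.Prime) {a : ℤ} (h0 : a ≠ 0) (h1 : -n < a) (h2 : a < n) :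
    Int.gcd a n = 1 := by
  rw [Int.gcd, Int.natAbs_natCast]
  have : a.natAbs.Coprime n := by
    rw [Nat.coprime_comm, hn.coprime_iff_not_dvd]
    intro h
    have := Nat.le_of_dvd (by omega) h
    omega
  exact this

/-- A small arc of the product at a wrong place is closed to a small separate circle by the rainbow
rotated to that place, so the test fails. Taking n to be a large prime makes this rainbow
admissible. -/
theorem sigma_of_tests {ts : List Matching} {n₀ : ℕ} (hts : ∀ t ∈ ts, t.Within n₀)
    (H : ∀ n ≥ n₀, ∀ c c', IsTest n c c' → Test n c c' ts) :
    ∃ N, TL.prod ts = (sigma N).toTL := by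
  rcases TL.eq_zero_or (TL.prod ts) with e | ⟨R, e⟩
  · exfalso
    obtain ⟨F, hF, h0, hl, i, hi, hne⟩ := TL.exists_circle e
    -- The offset of these two rainbows is 1, which is prime to every n. A circle already present in
    -- the stack contradicts this one test.
    have T := H (n₀ + 1) (by omega) (rainbow _ (-1) (by push_cast; omega))
      (rainbow _ 0 (by push_cast; omega)) (Or.inl ⟨0, _, _, by simp, rfl, rfl⟩) F hF
      (fun p => by rw [h0]; rfl) (fun p => by rw [hl]; rfl)
    apply hne
    funext p
    by_cases hp : -((n₀ + 1 : ℕ) : ℤ) ≤ p ∧ p < (n₀ + 1 : ℕ)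
    · rw [T i hi 0 (by omega) p 0 hp (by push_cast; omega), h0]
      rfl
    · rw [hF.outside (fun t ht => (hts t ht).mono (Nat.le_succ n₀)) hp hi, h0]
  · obtain ⟨hR, -⟩ := TL.prod_eq_toTL e
    have hb : R.bot.Straddles (-2) := by
      refine CupDiagram.straddles_of_adjacent fun j hj => ?_
      by_contra hne
      obtain ⟨n, hn1, hn⟩ := Nat.exists_infinite_primes (n₀ + j.natAbs + 3)
      have T := H n (by omega) (rainbow n j (by omega)) (rainbow n (-2) (by omega))
        (Or.inr ⟨j, _, _, gcd_prime_eq_one hn (by omega) (by omega) (by omega), rfl, rfl⟩)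
      -- The colouring of the circle formed by the cap of R at j and the innermost cup of the
      -- rainbow.
      have hrel : R.Rel (fun p => p = j ∨ p = j + 1) ⊥ := by
        have hj' : R.bot.partner (j + 1) = j := by rw [← hj, R.bot.partner_partner]
        refine ⟨fun p => propext ⟨?_, ?_⟩, fun _ => rfl, fun i => eq_false ?_⟩
        · rintro (h | h)
          · right; rw [← R.bot.partner_partner p, h, hj]
          · left; rw [← R.bot.partner_partner p, h, hj']
        · rintro (h | h)
          · right; rw [h, hj]
          · left; rw [h, hj']
        · have := R.bot.partner_rayAt i
          rintro (h | h)
          · rw [h, hj] at this; omega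
          · rw [h, hj'] at this; omega
      obtain ⟨F, hF, h0, hl⟩ := (hR _ _).1 hrel
      have := T F hF (fun p => by
        rw [h0, rainbow_partner]
        apply propext
        split_ifs <;> omega) (fun p => by rw [hl]; rfl) 0 (by omega) ts.length le_rfl j j
        (by omega) (by omega)
      rw [h0, hl] at this
      exact this.mp (Or.inl rfl)
    have ht : R.top.Straddles (-1) := by
      refine CupDiagram.straddles_of_adjacent fun j hj => ?_
      by_contra hne
      obtain ⟨n, hn1, hn⟩ := Nat.exists_infinite_primes (n₀ + j.natAbs + 3)
      have T := H n (by omega) (rainbow n (-1) (by omega)) (rainbow n j (by omega))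
        (Or.inl ⟨j, _, _, gcd_prime_eq_one hn (by omega) (by omega) (by omega), rfl, rfl⟩)
      have hrel : R.Rel ⊥ (fun p => p = j ∨ p = j + 1) := by
        have hj' : R.top.partner (j + 1) = j := by rw [← hj, R.top.partner_partner]
        refine ⟨fun _ => rfl, fun p => propext ⟨?_, ?_⟩, fun i => (eq_false ?_).symm⟩
        · rintro (h | h)
          · right; rw [← R.top.partner_partner p, h, hj]
          · left; rw [← R.top.partner_partner p, h, hj']
        · rintro (h | h)
          · right; rw [h, hj]
          · left; rw [h, hj']
        · have := R.top.partner_rayAt i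
          rintro (h | h)
          · rw [h, hj] at this; omega
          · rw [h, hj'] at this; omega
      obtain ⟨F, hF, h0, hl⟩ := (hR _ _).1 hrel
      have := T F hF (fun p => by rw [h0]; rfl) (fun p => by
        rw [hl, rainbow_partner]
        apply propext
        split_ifs <;> omega) 0 (by omega) ts.length le_rfl j j
        (by omega) (by omega)
      rw [h0, hl] at this
      exact this.mpr (Or.inl rfl)
    refine ⟨R.bot.numCups, ?_⟩
    rw [e]
    refine congrArg toTL (Matching.ext hb.eq_nest ?_)
    rw [R.numCups_eq]
    exact ht.eq_nest

/-! ## The square property -/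

/-- The elements given by nested caps below nested cups. -/
def InSigma (x : TL) : Prop := ∃ N, x = (sigma N).toTL

/-- The identity layer makes the two rotations occur in layers of different parity (2 and 5,
counting the lower closure as layer 0). Changing A then affects only the even arcs and changing B
only the odd ones, so `Hex.square` decides each test. -/
theorem square_aux {A₀ A₁ B₀ B₁ : Matching} (hA : HexM A₀ A₁) (hB : HexM B₀ B₁) (X Y Z : Matching)
    {a b a' b' : Matching} (hab : (a = A₀ ∧ a' = A₁ ∧ b = B₁ ∧ b' = B₀) ∨
      (a = A₁ ∧ a' = A₀ ∧ b = B₀ ∧ b' = B₁))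
    (h0 : InSigma (TL.prod [X, A₀, Y, idMatching, B₀, Z]))
    (h1 : InSigma (TL.prod [X, A₁, Y, idMatching, B₁, Z]))
    (h : InSigma (TL.prod [X, a, Y, idMatching, b, Z])) :
    InSigma (TL.prod [X, a', Y, idMatching, b', Z]) := by
  obtain ⟨hh, hhex⟩ := hA
  obtain ⟨kk, khex⟩ := hB
  obtain ⟨N0, h0⟩ := h0
  obtain ⟨N1, h1⟩ := h1
  obtain ⟨N, h⟩ := h
  obtain ⟨nX, hX⟩ := X.exists_within
  obtain ⟨nY, hY⟩ := Y.exists_within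
  obtain ⟨nZ, hZ⟩ := Z.exists_within
  obtain ⟨nA0, hA0⟩ := A₀.exists_within
  obtain ⟨nA1, hA1⟩ := A₁.exists_within
  obtain ⟨nB0, hB0⟩ := B₀.exists_within
  obtain ⟨nB1, hB1⟩ := B₁.exists_within
  have bound : ∀ h : Fin 6 → Blk, ∃ m : ℕ, ∀ i, -m ≤ (h i).pos ∧ (h i).pos < m := by
    intro h
    refine ⟨∑ i, ((h i).pos.natAbs + 1), fun i => ?_⟩
    have := Finset.single_le_sum (f := fun i => (h i).pos.natAbs + 1) (fun _ _ => Nat.zero_le _)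
      (Finset.mem_univ i)
    omega
  obtain ⟨mh, hmh⟩ := bound hh
  obtain ⟨mk, hmk⟩ := bound kk
  -- Large enough for all arcs, for the corners of both hexagons and for the margin in
  -- `test_of_sigma`.
  set n₀ := N0 + N1 + N + 2 + nX + nY + nZ + nA0 + nA1 + nB0 + nB1 + mh + mk with hn₀
  have wid : ∀ n, idMatching.Within n := fun n p _ => ⟨rfl, rfl⟩
  have within : ∀ n ≥ n₀, ∀ a b, (a = A₀ ∨ a = A₁) → (b = B₀ ∨ b = B₁) →
      ∀ t ∈ [X, a, Y, idMatching, b, Z], t.Within n := by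
    intro n hn a b ha hb t ht
    have wa : a.Within n := by
      rcases ha with rfl | rfl
      · exact hA0.mono (by omega)
      · exact hA1.mono (by omega)
    have wb : b.Within n := by
      rcases hb with rfl | rfl
      · exact hB0.mono (by omega)
      · exact hB1.mono (by omega)
    simp only [List.mem_cons, List.not_mem_nil, or_false] at ht
    rcases ht with rfl | rfl | rfl | rfl | rfl | rfl
    · exact hX.mono (by omega)
    · exact wa
    · exact hY.mono (by omega)
    · exact wid n
    · exact wb
    · exact hZ.mono (by omega)
  refine sigma_of_tests (n₀ := n₀) (within n₀ le_rfl a' b' (by tauto) (by tauto)) ?_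
  intro n hn c c' hc
  obtain ⟨hf, hf'⟩ := hc.fills
  let S := window n 7
  let y : Matching → Vert → Vert := fun a => fold (layers c [X, a, Y, idMatching, B₀, Z] c') 0
  let w : Matching → Vert → Vert := fun b => fold (layers c [X, A₀, Y, idMatching, b, Z] c') 1
  have lay_ne : ∀ a b a' b' i, (i ≠ 2 ∨ a = a') → (i ≠ 5 ∨ b = b') →
      layers c [X, a, Y, idMatching, b, Z] c' i = layers c [X, a', Y, idMatching, b', Z] c' i := by
    intro a b a' b' i h2 h5
    match i with
    | 0 => rfl
    | 1 => rfl
    | 2 => rcases h2 with h2 | rfl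
           · exact absurd rfl h2
           · rfl
    | 3 => rfl
    | 4 => rfl
    | 5 => rcases h5 with h5 | rfl
           · exact absurd rfl h5
           · rfl
    | 6 => rfl
    | i + 7 => rfl
  have cong : ∀ (x x' u u' : Vert → Vert), (∀ v ∈ S, x v = x' v) → (∀ v ∈ S, u v = u' v) →
      (Conn S x u ↔ Conn S x' u') := by
    intro x x' u u' hx hu
    have : ∀ f, (ArcInv f x S ↔ ArcInv f x' S) ∧ (ArcInv f u S ↔ ArcInv f u' S) := fun f =>
      ⟨forall₂_congr fun v hv => by rw [hx v hv], forall₂_congr fun v hv => by rw [hu v hv]⟩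
    exact forall_congr' fun f => by rw [(this f).1, (this f).2]
  have conn : ∀ a b, (a = A₀ ∨ a = A₁) → (b = B₀ ∨ b = B₁) →
      (Conn S (y a) (w b) ↔ Test n c c' [X, a, Y, idMatching, b, Z]) := by
    intro a b ha hb
    rw [← conn_iff_test (within n hn a b ha hb) hf hf']
    refine cong _ _ _ _ (fun v hv => ?_) fun v hv => ?_
    · refine fold_congr (by omega) hv.1 (lay_ne _ _ _ _ _ (Or.inr rfl) (Or.inl ?_))
      have := base_mod (par := 0) (by omega) hv.1
      omega
    · refine fold_congr (by omega) hv.1 (lay_ne _ _ _ _ _ (Or.inl ?_) (Or.inr rfl))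
      have := base_mod (par := 1) (by omega) hv.1
      omega
  have hplace : ∀ j, 1 ≤ j → j ≤ 6 → ∀ x : Blk, -n ≤ x.pos ∧ x.pos < n → place j x ∈ S := by
    intro j h1 h2 x hx
    refine ⟨?_, ?_, hx⟩ <;>
    · unfold place
      dsimp only
      split_ifs <;> omega
  have hexy : Hex S (y A₀) (y A₁) fun i => place 2 (hh i) :=
    hhex.place_even rfl rfl rfl (fun i hi => lay_ne _ _ _ _ _ (Or.inl hi) (Or.inr rfl))
      (fun v hv => hv.1) fun i => hplace 2 (by omega) (by omega) _ (by have := hmh i; omega)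
  have hexw : Hex S (w B₁) (w B₀) fun i => place 5 (kk (4 - i)) :=
    khex.place_odd rfl rfl rfl (fun i hi => lay_ne _ _ _ _ _ (Or.inr rfl) (Or.inl hi))
      (fun v hv => hv.1) fun i => hplace 5 (by omega) (by omega) _ (by have := hmk i; omega)
  have ncy : ∀ a, (a = A₀ ∨ a = A₁) → NC S (y a) := fun a ha =>
    nc_fold_layers (within n hn a B₀ ha (Or.inl rfl)) hf hf' (by omega)
  have ncw : ∀ b, (b = B₀ ∨ b = B₁) → NC S (w b) := fun b hb =>
    nc_fold_layers (within n hn A₀ b (Or.inl rfl) hb) hf hf' (by omega)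
  -- In the odd layer B₁ comes first because the orientation is reversed. Hence the two given
  -- choices (A₁, B₁) and (A₀, B₀) are the hypotheses, and the mixed choices form the conclusion.
  have sq := Hex.square (window_finite n 7) rfl (ncw B₁ (Or.inr rfl)) (ncw B₀ (Or.inl rfl))
    (ncy A₀ (Or.inl rfl)) (ncy A₁ (Or.inr rfl)) hexw hexy
    ((conn A₁ B₁ (Or.inr rfl) (Or.inr rfl)).2 (test_of_sigma
      (within n hn _ _ (Or.inr rfl) (Or.inr rfl)) h1 (by omega) hc))
    ((conn A₀ B₀ (Or.inl rfl) (Or.inl rfl)).2 (test_of_sigma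
      (within n hn _ _ (Or.inl rfl) (Or.inl rfl)) h0 (by omega) hc))
  have ht := test_of_sigma (within n hn a b (by tauto) (by tauto)) h (by omega) hc
  rcases hab with ⟨rfl, rfl, rfl, rfl⟩ | ⟨rfl, rfl, rfl, rfl⟩
  · exact (conn _ _ (Or.inr rfl) (Or.inl rfl)).1
      (sq.1 ((conn _ _ (Or.inl rfl) (Or.inr rfl)).2 ht))
  · exact (conn _ _ (Or.inl rfl) (Or.inr rfl)).1
      (sq.2 ((conn _ _ (Or.inr rfl) (Or.inl rfl)).2 ht))

theorem square {A₀ A₁ B₀ B₁ : Matching} (hA : HexM A₀ A₁) (hB : HexM B₀ B₁) (X Y Z : TL)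
    (h0 : InSigma (X * A₀.toTL * Y * B₀.toTL * Z)) (h1 : InSigma (X * A₁.toTL * Y * B₁.toTL * Z)) :
    InSigma (X * A₀.toTL * Y * B₁.toTL * Z) ↔ InSigma (X * A₁.toTL * Y * B₀.toTL * Z) := by
  obtain rfl | ⟨X, rfl⟩ := TL.eq_zero_or X
  · simp
  obtain rfl | ⟨Y, rfl⟩ := TL.eq_zero_or Y
  · simp
  obtain rfl | ⟨Z, rfl⟩ := TL.eq_zero_or Z
  · simp
  have e : ∀ a b : Matching, X.toTL * a.toTL * Y.toTL * b.toTL * Z.toTL =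
      TL.prod [X, a, Y, idMatching, b, Z] := by
    intro a b
    simp only [TL.prod_cons, TL.prod_nil, ← TL.one_def, one_mul, mul_one, mul_assoc]
  rw [e] at h0 h1
  rw [e, e]
  exact ⟨square_aux hA hB X Y Z (Or.inl ⟨rfl, rfl, rfl, rfl⟩) h0 h1,
    square_aux hA hB X Y Z (Or.inr ⟨rfl, rfl, rfl, rfl⟩) h0 h1⟩

/-! ## Straightening -/

namespace CupDiagram

theorem rayIndex_succ_of_ne (c : CupDiagram) {p : ℤ} (h : c.partner p ≠ p) :
    c.rayIndex (p + 1) = c.rayIndex p := by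
  rw [rayIndex_succ, if_neg h, add_zero]

theorem rayIndex_partner (c : CupDiagram) (p : ℤ) : c.rayIndex (c.partner p) = c.rayIndex p := by
  have key : ∀ p, p < c.partner p → c.rayIndex (c.partner p) = c.rayIndex p := by
    intro p hp
    have : ∀ k, p ≤ k → k ≤ c.partner p → c.rayIndex k = c.rayIndex p := by
      intro k hk
      induction k, hk using Int.leInduction with
      | base => intro _; rfl
      | succ k hk ih =>
        intro h
        rw [c.rayIndex_succ_of_ne, ih (by omega)]
        rcases hk.eq_or_lt with e | e
        · rw [← e]; omega
        · exact (c.nested p k e (by omega)).1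
    exact this _ hp.le le_rfl
  rcases lt_trichotomy p (c.partner p) with h | h | h
  · exact key p h
  · rw [← h]
  · have := key (c.partner p) (by rw [c.partner_partner]; exact h)
    rw [c.partner_partner] at this
    exact this.symm

theorem rayIndex_partner_add_one (c : CupDiagram) (p : ℤ) :
    c.rayIndex (c.partner p + 1) = c.rayIndex (p + 1) := by
  by_cases h : c.partner p = p
  · rw [h]
  · rw [c.rayIndex_succ_of_ne h, c.rayIndex_succ_of_ne, c.rayIndex_partner]
    rw [c.partner_partner]; exact Ne.symm h

theorem shift_rayAt (c : CupDiagram) (i : ℤ) : c.shift.rayAt i = c.rayAt (i - 1) + 1 := by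
  refine c.shift.rayAt_eq ?_ ?_
  · rw [shift_partner, add_sub_cancel_right, c.partner_rayAt]
  · rw [rayIndex_shift, add_sub_cancel_right, c.rayIndex_rayAt]; ring

theorem rayIndex_rayAt_add_one (c : CupDiagram) (i : ℤ) : c.rayIndex (c.rayAt i + 1) = i + 1 := by
  rw [rayIndex_succ, if_pos (c.partner_rayAt i), c.rayIndex_rayAt]

/-- A colouring which is constant on all cups and on all shifted cups is constant between rays. -/
theorem eq_of_rayIndex_eq (c : CupDiagram) {g : ℤ → Prop} (h1 : ∀ p, g (c.partner p) = g p)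
    (h2 : ∀ p, g (c.shift.partner p) = g p) {x y : ℤ} (hxy : c.rayIndex x = c.rayIndex y) :
    g x = g y := by
  -- Induction on the length of a cup: the shorter cups below it make the colour constant from p + 1
  -- to the partner of p, and the cup together with its shift adds p and the point after the
  -- partner.
  have step : ∀ (n : ℕ) (p : ℤ), p < c.partner p → c.partner p - p ≤ n →
      g p = g (p + 1) ∧ g (c.partner p) = g (c.partner p + 1) := by
    intro n
    induction n with
    | zero => intro p h3 h4; omega
    | succ n ih =>
      intro p h3 h4
      have inner : ∀ k, p + 1 ≤ k → k ≤ c.partner p → g k = g (p + 1) := by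
        intro k hk
        induction k, hk using Int.leInduction with
        | base => intro _; rfl
        | succ k hk ih' =>
          intro h
          rw [← ih' (by omega)]
          have hn := c.nested p k (by omega) (by omega)
          rcases lt_or_gt_of_ne hn.1 with h5 | h5
          · have := (ih (c.partner k) (by rw [c.partner_partner]; exact h5)
              (by rw [c.partner_partner]; push_cast at h4; omega)).2
            rw [c.partner_partner] at this
            exact this.symm
          · exact (ih k h5 (by push_cast at h4; omega)).1.symm
      have e1 := inner (c.partner p) (by omega) le_rfl
      have e2 := h2 (p + 1)
      rw [shift_partner, add_sub_cancel_right] at e2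
      exact ⟨by rw [← e1, h1], by rw [e1, e2]⟩
  have step' : ∀ p, c.partner p ≠ p → g p = g (p + 1) := by
    intro p hp
    rcases lt_or_gt_of_ne hp with h | h
    · have := (step _ (c.partner p) (by rw [c.partner_partner]; exact h)
        (Int.self_le_toNat _)).2
      rwa [c.partner_partner] at this
    · exact (step _ p h (Int.self_le_toNat _)).1
  have main : ∀ x y, x ≤ y → c.rayIndex x = c.rayIndex y → g x = g y := by
    intro x y hxy
    induction y, hxy using Int.leInduction with
    | base => intro _; rfl
    | succ y hy ih =>
      intro h
      have h3 := c.rayIndex_mono hy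
      have h4 := c.rayIndex_succ y
      by_cases hp : c.partner y = y
      · rw [if_pos hp] at h4; omega
      · rw [if_neg hp] at h4
        rw [ih (by omega), step' y hp]
  rcases le_total x y with h | h
  · exact main x y h hxy
  · exact (main y x h hxy.symm).symm

/-- The cups of `c` are cups of `a`. -/
def Sub (c a : CupDiagram) : Prop := ∀ p, c.partner p ≠ p → a.partner p = c.partner p

theorem Sub.ray {c a : CupDiagram} (h : c.Sub a) {p : ℤ} (hp : a.partner p = p) :
    c.partner p = p := by
  by_contra h'
  exact h' ((h p h').symm.trans hp)

theorem Sub.inv {c a : CupDiagram} (h : c.Sub a) {g : ℤ → Prop} (hg : ∀ p, g (a.partner p) = g p)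
    (p : ℤ) : g (c.partner p) = g p := by
  by_cases hp : c.partner p = p
  · rw [hp]
  · rw [← h p hp, hg]

theorem Sub.shift {c a : CupDiagram} (h : c.Sub a) : c.shift.Sub a.shift := by
  intro p hp
  rw [shift_partner] at hp ⊢
  rw [shift_partner, h (p - 1) (by omega)]

/-- Outside the smaller diagram, arcs of the larger one join rays of the smaller one. -/
theorem Sub.partner_ray {c a : CupDiagram} (h : c.Sub a) {p : ℤ} (hp : c.partner p = p) :
    c.partner (a.partner p) = a.partner p := by
  by_contra h'
  have := h _ h'
  rw [a.partner_partner] at this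
  rw [← this] at h'
  have e := congrArg c.partner this
  rw [c.partner_partner, hp] at e
  exact h' e

end CupDiagram

namespace Matching

/-- Exchanging bottom and top. -/
def flip (t : Matching) : Matching := ⟨t.top, t.bot, t.numCups_eq.symm⟩

theorem rel_flip {t : Matching} {f g : ℤ → Prop} : t.flip.Rel f g ↔ t.Rel g f :=
  ⟨fun h => ⟨h.top, h.bot, fun i => (h.ray i).symm⟩, fun h => ⟨h.top, h.bot, fun i => (h.ray i).symm⟩⟩

theorem IsComp.flip {t s R : Matching} (h : IsComp t s R) : IsComp s.flip t.flip R.flip :=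
  ⟨fun f k => by
    rw [rel_flip, h.rel]
    exact exists_congr fun g => by rw [rel_flip, rel_flip, and_comm],
    fun g h1 h2 => h.noCircle g (rel_flip.1 h2) (rel_flip.1 h1)⟩

theorem mul_flip {t s R : Matching} (h : t.toTL * s.toTL = R.toTL) :
    s.flip.toTL * t.flip.toTL = R.flip.toTL :=
  TL.mul_eq_toTL.2 (TL.mul_eq_toTL.1 h).flip

end Matching

/-! ### Straightening a diagram against the shift of its arcs -/

section Zigzag

variable {m a c n : CupDiagram}

/-- The cups of a belonging to c, followed by the caps of `c.shift`, form zigzags that straighten to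
the rays of c and contain no circle; the cups of c are then restored on top. In colourings this is
`eq_of_rayIndex_eq`: the colour of the middle line is constant between rays. -/
theorem zigzag_lower (h : c.Sub a) (h1 : m.numCups = a.numCups) (h2 : c.shift.numCups = c.numCups) :
    (⟨m, a, h1⟩ : Matching).toTL * (⟨c.shift, c, h2⟩ : Matching).toTL =
      (⟨m, a, h1⟩ : Matching).toTL := by
  have key : ∀ g h' : ℤ → Prop, (∀ p, g (a.partner p) = g p) →
      (⟨c.shift, c, h2⟩ : Matching).Rel g h' → ∀ i, g (c.rayAt i) = h' (c.rayAt i) := by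
    intro g h' hg hr i
    have := hr.ray i
    dsimp only at this
    rw [← this, CupDiagram.shift_rayAt]
    refine c.eq_of_rayIndex_eq (h.inv hg) hr.bot ?_
    rw [c.rayIndex_rayAt, c.rayIndex_rayAt_add_one]; ring
  refine TL.mul_eq_toTL.2 ⟨fun f k => ⟨fun hr => ?_, ?_⟩, ?_⟩
  · have hk := hr.top
    dsimp only at hk
    -- Each position of the middle line gets the colour of the first ray of c at or to the right of
    -- it.
    refine ⟨fun x => k (c.rayAt (c.rayIndex x)), ⟨hr.bot, fun p => ?_, fun i => ?_⟩,
      ⟨fun p => ?_, h.inv hk, fun i => ?_⟩⟩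
    · dsimp only
      by_cases hp : c.partner p = p
      · rw [c.rayAt_rayIndex hp, c.rayAt_rayIndex (h.partner_ray hp), hk]
      · rw [h p hp, c.rayIndex_partner]
    · have := hr.ray i
      dsimp only at this ⊢
      rw [c.rayAt_rayIndex (h.ray (a.partner_rayAt i)), this]
    · dsimp only
      rw [CupDiagram.shift_partner, c.rayIndex_partner_add_one, sub_add_cancel]
    · dsimp only
      rw [CupDiagram.shift_rayAt, c.rayIndex_rayAt_add_one, sub_add_cancel]
  · rintro ⟨g, hr, hr'⟩
    have hk := key g k hr.top hr'
    have hk' : ∀ p, c.partner p = p → g p = k p := fun p hp => by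
      have := hk (c.rayIndex p)
      rwa [c.rayAt_rayIndex hp] at this
    refine ⟨hr.bot, fun p => ?_, fun i => ?_⟩
    · dsimp only
      by_cases hp : c.partner p = p
      · have e := hr.top p
        dsimp only at e
        rw [← hk' p hp, ← hk' _ (h.partner_ray hp), e]
      · rw [h p hp]; exact hr'.top p
    · have e := hr.ray i
      dsimp only at e ⊢
      rw [e, hk' _ (h.ray (a.partner_rayAt i))]
  · intro g hr hr'
    funext x
    have e := key g ⊥ hr.top hr' (c.rayIndex x)
    have : g x = g (c.rayAt (c.rayIndex x)) :=
      c.eq_of_rayIndex_eq (h.inv hr.top) hr'.bot (c.rayIndex_rayAt _).symm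
    rw [this, e]; rfl

theorem zigzag_lower_shift (h : c.Sub a) (h1 : m.numCups = a.shift.numCups)
    (h2 : c.numCups = c.shift.numCups) :
    (⟨m, a.shift, h1⟩ : Matching).toTL * (⟨c, c.shift, h2⟩ : Matching).toTL =
      (⟨m, a.shift, h1⟩ : Matching).toTL := by
  have key : ∀ g h' : ℤ → Prop, (∀ p, g (a.shift.partner p) = g p) →
      (⟨c, c.shift, h2⟩ : Matching).Rel g h' → ∀ i, g (c.shift.rayAt i) = h' (c.shift.rayAt i) := by
    intro g h' hg hr i
    have := hr.ray i
    dsimp only at this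
    rw [← this, CupDiagram.shift_rayAt]
    refine c.eq_of_rayIndex_eq hr.bot (h.shift.inv hg) ?_
    rw [c.rayIndex_rayAt, c.rayIndex_rayAt_add_one]; ring
  have hsub := h.shift
  set b := a.shift with hb
  -- the last shifted ray to the left
  let ψ : ℤ → ℤ := fun x => c.shift.rayAt (c.rayIndex x)
  have ψray : ∀ p, c.shift.partner p = p → ψ p = p := by
    intro p hp
    have hp' : c.partner (p - 1) = p - 1 := by rw [CupDiagram.shift_partner] at hp; omega
    have := c.rayIndex_succ (p - 1)
    rw [if_pos hp', sub_add_cancel] at this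
    simp only [ψ]
    rw [CupDiagram.shift_rayAt, this, add_sub_cancel_right, c.rayAt_rayIndex hp']
    ring
  refine TL.mul_eq_toTL.2 ⟨fun f k => ⟨fun hr => ?_, ?_⟩, ?_⟩
  · have hk := hr.top
    dsimp only at hk
    refine ⟨fun x => k (ψ x), ⟨hr.bot, fun p => ?_, fun i => ?_⟩,
      ⟨fun p => ?_, hsub.inv hk, fun i => ?_⟩⟩
    · dsimp only
      by_cases hp : c.shift.partner p = p
      · rw [ψray p hp, ψray _ (hsub.partner_ray hp), hk]
      · rw [hsub p hp, CupDiagram.shift_partner]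
        simp only [ψ]
        rw [c.rayIndex_partner_add_one, sub_add_cancel]
    · have := hr.ray i
      dsimp only at this ⊢
      rw [ψray _ (hsub.ray (b.partner_rayAt i)), this]
    · simp only [ψ]
      rw [c.rayIndex_partner]
    · simp only [ψ]
      rw [c.rayIndex_rayAt]
  · rintro ⟨g, hr, hr'⟩
    have hk := key g k hr.top hr'
    have hk' : ∀ p, c.shift.partner p = p → g p = k p := fun p hp => by
      have := hk (c.shift.rayIndex p)
      rwa [c.shift.rayAt_rayIndex hp] at this
    refine ⟨hr.bot, fun p => ?_, fun i => ?_⟩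
    · dsimp only
      by_cases hp : c.shift.partner p = p
      · have e := hr.top p
        dsimp only at e
        rw [← hk' p hp, ← hk' _ (hsub.partner_ray hp), e]
      · rw [hsub p hp]; exact hr'.top p
    · have e := hr.ray i
      dsimp only at e ⊢
      rw [e, hk' _ (hsub.ray (b.partner_rayAt i))]
  · intro g hr hr'
    funext x
    have e := hr'.ray (c.rayIndex x)
    have : g x = g (c.rayAt (c.rayIndex x)) :=
      c.eq_of_rayIndex_eq hr'.bot (hsub.inv hr.top) (c.rayIndex_rayAt _).symm
    rw [this]; exact e

/-- All cups of a meet the caps of its shift, so only zigzags remain in the middle, and these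
straighten to a bijection of rays. -/
theorem zigzag_cancel (h1 : m.numCups = a.numCups) (h2 : a.shift.numCups = n.numCups) :
    (⟨m, a, h1⟩ : Matching).toTL * (⟨a.shift, n, h2⟩ : Matching).toTL =
      (⟨m, n, by rw [h1, ← h2, CupDiagram.numCups_shift]⟩ : Matching).toTL := by
  have key : ∀ g : ℤ → Prop, (∀ p, g (a.partner p) = g p) → (∀ p, g (a.shift.partner p) = g p) →
      ∀ i, g (a.rayAt i) = g (a.shift.rayAt i) := by
    intro g h1 h2 i
    refine a.eq_of_rayIndex_eq h1 h2 ?_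
    rw [CupDiagram.shift_rayAt, a.rayIndex_rayAt, a.rayIndex_rayAt_add_one]; ring
  refine TL.mul_eq_toTL.2 ⟨fun f k => ⟨fun hr => ?_, ?_⟩, ?_⟩
  · refine ⟨fun x => f (m.rayAt (a.rayIndex x)), ⟨hr.bot, fun p => ?_, fun i => ?_⟩,
      ⟨fun p => ?_, hr.top, fun i => ?_⟩⟩
    · dsimp only; rw [a.rayIndex_partner]
    · dsimp only; rw [a.rayIndex_rayAt]
    · dsimp only; rw [CupDiagram.shift_partner, a.rayIndex_partner_add_one, sub_add_cancel]
    · have := hr.ray i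
      dsimp only at this ⊢
      rw [CupDiagram.shift_rayAt, a.rayIndex_rayAt_add_one, sub_add_cancel, this]
  · rintro ⟨g, hr, hr'⟩
    refine ⟨hr.bot, hr'.top, fun i => ?_⟩
    have e1 := hr.ray i
    have e2 := hr'.ray i
    dsimp only at e1 e2 ⊢
    rw [e1, ← e2]
    exact key g hr.top hr'.bot i
  · intro g hr hr'
    funext x
    have : g x = g (a.rayAt (a.rayIndex x)) :=
      a.eq_of_rayIndex_eq hr.top hr'.bot (a.rayIndex_rayAt _).symm
    rw [this]
    exact (hr.ray _).symm

theorem zigzag_upper_shift (h : c.Sub a) (h1 : a.shift.numCups = n.numCups)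
    (h2 : c.shift.numCups = c.numCups) :
    (⟨c.shift, c, h2⟩ : Matching).toTL * (⟨a.shift, n, h1⟩ : Matching).toTL =
      (⟨a.shift, n, h1⟩ : Matching).toTL :=
  mul_flip (zigzag_lower_shift h h1.symm h2.symm)

theorem zigzag_upper (h : c.Sub a) (h1 : a.numCups = n.numCups)
    (h2 : c.numCups = c.shift.numCups) :
    (⟨c, c.shift, h2⟩ : Matching).toTL * (⟨a, n, h1⟩ : Matching).toTL =
      (⟨a, n, h1⟩ : Matching).toTL :=
  mul_flip (zigzag_lower h h1.symm h2.symm)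

theorem zigzag_cancel_shift (h1 : m.numCups = a.shift.numCups) (h2 : a.numCups = n.numCups) :
    (⟨m, a.shift, h1⟩ : Matching).toTL * (⟨a, n, h2⟩ : Matching).toTL =
      (⟨m, n, by rw [h1, ← h2, CupDiagram.numCups_shift]⟩ : Matching).toTL :=
  mul_flip (zigzag_cancel h2.symm h1.symm)

end Zigzag

/-! ### Products of nested diagrams and of surgery stages -/

theorem nest_sub {m : ℤ} {i j : ℕ} (h : i ≤ j) : (nest m i).Sub (nest m j) := by
  intro p hp
  have := nest_moved.1 hp
  rw [nest_partner, nest_partner, if_pos (by omega), if_pos (by omega)]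

theorem nest_shift_two (N : ℕ) : (nest (-2) N).shift = nest (-1) N := nest_shift _ _

theorem Matching.toTL_congr {t s : Matching} (h1 : t.bot = s.bot) (h2 : t.top = s.top) :
    t.toTL = s.toTL := congrArg toTL (Matching.ext h1 h2)

theorem sigma_mul_sigma_of_le {i j : ℕ} (h : i ≤ j) :
    (sigma i).toTL * (sigma j).toTL = (sigma j).toTL := by
  have := zigzag_upper (c := nest (-2) i) (a := nest (-2) j) (n := nest (-1) j) (nest_sub h)
    (sigma j).numCups_eq (CupDiagram.numCups_shift _).symm
  simp only [nest_shift_two] at this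
  exact this

theorem sigma_mul_sigma_of_ge {i j : ℕ} (h : j ≤ i) :
    (sigma i).toTL * (sigma j).toTL = (sigma i).toTL := by
  have := zigzag_lower_shift (m := nest (-2) i) (c := nest (-2) j) (a := nest (-2) i) (nest_sub h)
    (CupDiagram.numCups_shift _).symm (CupDiagram.numCups_shift _).symm
  simp only [nest_shift_two] at this
  exact this

/-- The lower and upper nests are shifts of each other, so the smaller nest is absorbed by
straightening. -/
theorem sigma_mul_sigma (i j : ℕ) : (sigma i).toTL * (sigma j).toTL = (sigma (max i j)).toTL := by
  rcases le_total i j with h | h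
  · rw [sigma_mul_sigma_of_le h, max_eq_right h]
  · rw [sigma_mul_sigma_of_ge h, max_eq_left h]

theorem sigma_zero : (sigma 0).toTL = 1 := by
  have : ∀ m, nest m 0 = emptyCup := fun m => CupDiagram.ext (funext fun p => by
    rw [nest_partner, if_neg (by omega)]; rfl)
  exact toTL_congr (this _) (this _)

namespace CupDiagram

/-- Placing two closed diagrams on top of each other produces the full middle section, from which
the surgery starts. -/
theorem upper_mul_lower (b : CupDiagram) :
    b.upper.toTL * b.lower.toTL = (⟨b.shift, b, b.numCups_shift⟩ : Matching).toTL := by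
  have := zigzag_cancel_shift (m := b.shift) (a := nest (-2) b.numCups) (n := b)
    (by rw [numCups_shift, numCups_shift, nest_numCups]) (nest_numCups _ _)
  simp only [nest_shift_two] at this
  exact this

theorem lower_mul_upper (b : CupDiagram) :
    b.lower.toTL * b.upper.toTL = (sigma b.numCups).toTL :=
  zigzag_cancel (m := nest (-2) b.numCups) (a := b) (n := nest (-1) b.numCups) (nest_numCups _ _)
    (by rw [numCups_shift, nest_numCups])

theorem tail_partner (c : CupDiagram) (x p : ℤ) :
    (c.tail x).partner p = if x ≤ p ∧ x ≤ c.partner p then c.partner p else p := rfl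

theorem tail_sub (c : CupDiagram) (x : ℤ) : (c.tail x).Sub c := by
  intro p hp
  rw [tail_partner] at hp ⊢
  split_ifs at hp ⊢ with h
  · rfl
  · exact (hp rfl).elim

/-- Every middle section is absorbed by a cup diagram containing its cups; this is why the
idempotents act as units. -/
theorem lower_mul_stage (b : CupDiagram) (x : ℤ) :
    b.lower.toTL * (surgeryStage b x).toTL = b.lower.toTL :=
  zigzag_lower (b.tail_sub x) _ _

theorem stage_mul_upper (b : CupDiagram) (x : ℤ) :
    (surgeryStage b x).toTL * b.upper.toTL = b.upper.toTL :=
  zigzag_upper_shift (b.tail_sub x) _ _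

/-- The surgery interpolates between the product of the two closed diagrams and the stack with the
middle section removed. -/
theorem exists_stage_eq (b : CupDiagram) : ∃ W : ℤ,
    (∀ x ≤ -W, (surgeryStage b x).toTL = b.upper.toTL * b.lower.toTL) ∧
      ∀ x, W ≤ x → (surgeryStage b x).toTL = 1 := by
  obtain ⟨W, _, hW⟩ := b.exists_bound
  refine ⟨W, fun x hx => ?_, fun x hx => ?_⟩
  · rw [upper_mul_lower]
    have : b.tail x = b := by
      refine CupDiagram.ext (funext fun p => ?_)
      rw [tail_partner]
      split_ifs with h
      · rfl
      · by_contra hp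
        have h1 := hW p (Ne.symm hp)
        have h2 := hW (b.partner p) (by rw [b.partner_partner]; exact hp)
        omega
    exact toTL_congr (congrArg shift this) this
  · have : b.tail x = emptyCup := by
      refine CupDiagram.ext (funext fun p => ?_)
      rw [tail_partner]
      split_ifs with h
      · by_contra hp
        have h1 := hW p hp
        omega
      · rfl
    refine toTL_congr ?_ this
    change (b.tail x).shift = emptyCup
    rw [this]
    refine CupDiagram.ext (funext fun p => ?_)
    rw [shift_partner, emptyCup_partner, emptyCup_partner]; ring

end CupDiagram

/-! ## Examples of hexagonal pairs -/

/-- The diagram `d` arises from `c` by joining the rays with numbers `i` and `i + 1`. -/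
structure AddArc (c d : CupDiagram) (i : ℤ) : Prop where
  left : d.partner (c.rayAt i) = c.rayAt (i + 1)
  other : ∀ p, p ≠ c.rayAt i → p ≠ c.rayAt (i + 1) → d.partner p = c.partner p

namespace AddArc

variable {c d : CupDiagram} {i : ℤ}

theorem right (h : AddArc c d i) : d.partner (c.rayAt (i + 1)) = c.rayAt i := by
  rw [← h.left, d.partner_partner]

theorem lt (c : CupDiagram) (i : ℤ) : c.rayAt i < c.rayAt (i + 1) := c.rayAt_lt_iff.2 (by omega)

theorem endpoints (h : AddArc c d i) :
    d.endpoints = insert (c.rayAt i) (insert (c.rayAt (i + 1)) c.endpoints) := by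
  have hlt := lt c i
  ext p
  rw [Finset.mem_insert, Finset.mem_insert, CupDiagram.mem_endpoints, CupDiagram.mem_endpoints]
  by_cases h1 : p = c.rayAt i
  · rw [h1, h.left]; simp; omega
  by_cases h2 : p = c.rayAt (i + 1)
  · rw [h2, h.right]; simp; omega
  rw [h.other p h1 h2]
  simp [h1, h2]

theorem rayIndex (h : AddArc c d i) (p : ℤ) : d.rayIndex p =
    c.rayIndex p - (if c.rayAt i < p then 1 else 0) - if c.rayAt (i + 1) < p then 1 else 0 := by
  have hlt := lt c i
  have n1 : c.rayAt i ∉ c.endpoints := by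
    rw [CupDiagram.mem_endpoints, not_not]; exact c.partner_rayAt i
  have n2 : c.rayAt (i + 1) ∉ c.endpoints := by
    rw [CupDiagram.mem_endpoints, not_not]; exact c.partner_rayAt _
  unfold CupDiagram.rayIndex
  rw [h.endpoints, Finset.filter_insert, Finset.filter_insert]
  have n3 : ∀ q, q ∉ c.endpoints → q ∉ c.endpoints.filter fun q => q < p := fun q hq hq' =>
    hq (Finset.mem_filter.1 hq').1
  split_ifs with h1 h2
  · rw [Finset.card_insert_of_notMem, Finset.card_insert_of_notMem (n3 _ n2)]
    · push_cast; ring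
    · rw [Finset.mem_insert, not_or]; exact ⟨hlt.ne, n3 _ n1⟩
  · rw [Finset.card_insert_of_notMem (n3 _ n1)]
    push_cast; ring
  · omega
  · ring

theorem ray (h : AddArc c d i) {j : ℤ} (h1 : j ≠ i) (h2 : j ≠ i + 1) :
    d.partner (c.rayAt j) = c.rayAt j := by
  have inj : ∀ {j k}, c.rayAt j = c.rayAt k → j = k := fun {j k} e => by
    rw [← c.rayIndex_rayAt j, e, c.rayIndex_rayAt]
  rw [h.other _ (fun e => h1 (inj e)) (fun e => h2 (inj e)), c.partner_rayAt]

theorem rayAt_left (h : AddArc c d i) {j : ℤ} (hj : j < i) : d.rayAt j = c.rayAt j := by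
  refine d.rayAt_eq (h.ray (by omega) (by omega)) ?_
  rw [h.rayIndex, c.rayIndex_rayAt, if_neg, if_neg]
  · ring
  · rw [c.rayAt_lt_iff]; omega
  · rw [c.rayAt_lt_iff]; omega

theorem rayAt_right (h : AddArc c d i) {j : ℤ} (hj : i ≤ j) : d.rayAt j = c.rayAt (j + 2) := by
  refine d.rayAt_eq (h.ray (by omega) (by omega)) ?_
  rw [h.rayIndex, c.rayIndex_rayAt, if_pos, if_pos]
  · ring
  · rw [c.rayAt_lt_iff]; omega
  · rw [c.rayAt_lt_iff]; omega

end AddArc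

namespace Matching

theorem lay_lo_rayAt (t : Matching) (j : ℤ) : t.lay ⟨false, t.bot.rayAt j⟩ = ⟨true, t.top.rayAt j⟩ := by
  rw [lay_lo_ray t (t.bot.partner_rayAt j), t.bot.rayIndex_rayAt]

theorem lay_hi_rayAt (t : Matching) (j : ℤ) : t.lay ⟨true, t.top.rayAt j⟩ = ⟨false, t.bot.rayAt j⟩ := by
  rw [lay_hi_ray t (t.top.partner_rayAt j), t.top.rayIndex_rayAt]

end Matching

/-- In B the rays i, i + 1, i + 2 are three parallel strands. In A the ends i + 1 and i + 2 are
joined at the bottom, i and i + 1 at the top, and the third strand runs from i at the bottom to i +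
2 at the top. Going around the six ends, this is a turn by one sixth. -/
theorem hexM_of_addArc {A B : Matching} {i : ℤ} (hb : AddArc B.bot A.bot (i + 1))
    (ht : AddArc B.top A.top i) : HexM A B := by
  have lb := fun {j k} => B.bot.rayAt_lt_iff (i := j) (j := k)
  have lt := fun {j k} => B.top.rayAt_lt_iff (i := j) (j := k)
  have h1 : i + 1 + 1 = i + 2 := by ring
  let h : Fin 6 → Blk := ![⟨false, B.bot.rayAt i⟩, ⟨false, B.bot.rayAt (i + 1)⟩,
    ⟨false, B.bot.rayAt (i + 2)⟩, ⟨true, B.top.rayAt (i + 2)⟩, ⟨true, B.top.rayAt (i + 1)⟩,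
    ⟨true, B.top.rayAt i⟩]
  have mono : StrictMono h := by
    refine Fin.strictMono_iff_lt_succ.2 fun j => ?_
    fin_cases j
    · exact Blk.lo_lt_lo.2 (lb.2 (by omega))
    · exact Blk.lo_lt_lo.2 (lb.2 (by omega))
    · exact Blk.lo_lt_hi.2 trivial
    · exact Blk.hi_lt_hi.2 (lt.2 (by omega))
    · exact Blk.hi_lt_hi.2 (lt.2 (by omega))
  have b0 : A.bot.rayAt i = B.bot.rayAt i := hb.rayAt_left (by omega)
  have t0 : A.top.rayAt i = B.top.rayAt (i + 2) := ht.rayAt_right le_rfl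
  refine ⟨h, fun _ => trivial, fun j => ?_, fun j => ?_, fun a b c habc => ?_, ?_⟩
  · fin_cases j
    · change A.lay ⟨false, B.bot.rayAt i⟩ = ⟨true, B.top.rayAt (i + 2)⟩
      rw [← b0, ← t0, lay_lo_rayAt]
    · change A.lay ⟨false, B.bot.rayAt (i + 1)⟩ = ⟨false, B.bot.rayAt (i + 2)⟩
      have := hb.left
      rw [h1] at this
      rw [lay_lo_arc _ (by rw [this]; exact (lb.2 (by omega)).ne'), this]
    · change A.lay ⟨false, B.bot.rayAt (i + 2)⟩ = ⟨false, B.bot.rayAt (i + 1)⟩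
      have := hb.right
      rw [h1] at this
      rw [lay_lo_arc _ (by rw [this]; exact (lb.2 (by omega)).ne), this]
    · change A.lay ⟨true, B.top.rayAt (i + 2)⟩ = ⟨false, B.bot.rayAt i⟩
      rw [← b0, ← t0, lay_hi_rayAt]
    · change A.lay ⟨true, B.top.rayAt (i + 1)⟩ = ⟨true, B.top.rayAt i⟩
      rw [lay_hi_arc _ (by rw [ht.right]; exact (lt.2 (by omega)).ne), ht.right]
    · change A.lay ⟨true, B.top.rayAt i⟩ = ⟨true, B.top.rayAt (i + 1)⟩
      rw [lay_hi_arc _ (by rw [ht.left]; exact (lt.2 (by omega)).ne'), ht.left]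
  · fin_cases j
    · exact lay_lo_rayAt _ _
    · exact lay_lo_rayAt _ _
    · exact lay_lo_rayAt _ _
    · exact lay_hi_rayAt _ _
    · exact lay_hi_rayAt _ _
    · exact lay_hi_rayAt _ _
  · unfold Cyc at habc ⊢
    simpa only [mono.lt_iff_lt] using habc
  · intro z _ hz
    have ne : ∀ j k, j ≠ k → B.bot.rayAt j ≠ B.bot.rayAt k := fun j k hjk e => hjk (by
      rw [← B.bot.rayIndex_rayAt j, e, B.bot.rayIndex_rayAt])
    have z0 : z ≠ ⟨false, B.bot.rayAt i⟩ := hz 0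
    have z1 : z ≠ ⟨false, B.bot.rayAt (i + 1)⟩ := hz 1
    have z2 : z ≠ ⟨false, B.bot.rayAt (i + 2)⟩ := hz 2
    have z3 : z ≠ ⟨true, B.top.rayAt (i + 2)⟩ := hz 3
    have z4 : z ≠ ⟨true, B.top.rayAt (i + 1)⟩ := hz 4
    have z5 : z ≠ ⟨true, B.top.rayAt i⟩ := hz 5
    rcases Blk.cas z with e | e
    · rw [e] at z0 z1 z2 ⊢
      generalize z.pos = p at *
      have y0 : p ≠ B.bot.rayAt i := fun e => z0 (by rw [e])
      have y1 : p ≠ B.bot.rayAt (i + 1) := fun e => z1 (by rw [e])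
      have y2 : p ≠ B.bot.rayAt (i + 2) := fun e => z2 (by rw [e])
      by_cases hp : B.bot.partner p = p
      · rw [← B.bot.rayAt_rayIndex hp] at y0 y1 y2 ⊢
        generalize B.bot.rayIndex p = j at *
        rw [lay_lo_rayAt]
        rcases lt_or_ge j i with hj | hj
        · rw [← hb.rayAt_left (j := j) (by omega), lay_lo_rayAt, ht.rayAt_left hj]
        · have : i + 3 ≤ j := by
            have : j ≠ i := fun e => y0 (by rw [e])
            have : j ≠ i + 1 := fun e => y1 (by rw [e])
            have : j ≠ i + 2 := fun e => y2 (by rw [e])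
            omega
          have e1 := hb.rayAt_right (j := j - 2) (by omega)
          have e2 := ht.rayAt_right (j := j - 2) (by omega)
          rw [sub_add_cancel] at e1 e2
          rw [← e1, lay_lo_rayAt, e2]
      · have : A.bot.partner p = B.bot.partner p := hb.other p y1 (by rw [h1]; exact y2)
        rw [lay_lo_arc _ hp, lay_lo_arc _ (by rw [this]; exact hp), this]
    · rw [e] at z3 z4 z5 ⊢
      generalize z.pos = p at *
      have y0 : p ≠ B.top.rayAt i := fun e => z5 (by rw [e])
      have y1 : p ≠ B.top.rayAt (i + 1) := fun e => z4 (by rw [e])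
      have y2 : p ≠ B.top.rayAt (i + 2) := fun e => z3 (by rw [e])
      by_cases hp : B.top.partner p = p
      · rw [← B.top.rayAt_rayIndex hp] at y0 y1 y2 ⊢
        generalize B.top.rayIndex p = j at *
        rw [lay_hi_rayAt]
        rcases lt_or_ge j i with hj | hj
        · rw [← ht.rayAt_left (j := j) hj, lay_hi_rayAt, hb.rayAt_left (by omega)]
        · have : i + 3 ≤ j := by
            have : j ≠ i := fun e => y0 (by rw [e])
            have : j ≠ i + 1 := fun e => y1 (by rw [e])
            have : j ≠ i + 2 := fun e => y2 (by rw [e])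
            omega
          have e1 := hb.rayAt_right (j := j - 2) (by omega)
          have e2 := ht.rayAt_right (j := j - 2) (by omega)
          rw [sub_add_cancel] at e1 e2
          rw [← e2, lay_hi_rayAt, e1]
      · have : A.top.partner p = B.top.partner p := ht.other p y0 y1
        rw [lay_hi_arc _ hp, lay_hi_arc _ (by rw [this]; exact hp), this]

/-- Exchanging the two boundary lines. -/
def Blk.swap (v : Blk) : Blk := ⟨!v.hi, v.pos⟩

theorem Blk.swap_swap (v : Blk) : v.swap.swap = v := by
  obtain ⟨b, p⟩ := v; cases b <;> rfl

theorem Blk.swap_lt {v w : Blk} : v.swap < w.swap ↔ w < v := by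
  obtain ⟨b, p⟩ := v
  obtain ⟨c, q⟩ := w
  cases b <;> cases c <;>
    simp [Blk.swap, Blk.lo_lt_lo, Blk.lo_lt_hi, Blk.hi_lt_lo, Blk.hi_lt_hi]

theorem Matching.lay_flip (t : Matching) (v : Blk) : t.flip.lay v.swap = (t.lay v).swap := by
  obtain ⟨b, p⟩ := v
  cases b
  · change t.flip.lay ⟨true, p⟩ = _
    by_cases h : t.bot.partner p = p
    · rw [lay_lo_ray t h, lay_hi_ray t.flip h]; rfl
    · rw [lay_lo_arc t h, lay_hi_arc t.flip h]; rfl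
  · change t.flip.lay ⟨false, p⟩ = _
    by_cases h : t.top.partner p = p
    · rw [lay_hi_ray t h, lay_lo_ray t.flip h]; rfl
    · rw [lay_hi_arc t h, lay_lo_arc t.flip h]; rfl

/-- Reflecting the strip reverses the orientation, which turns the rotation into its inverse. -/
theorem HexM.flip {A B : Matching} (H : HexM A B) : HexM B.flip A.flip := by
  obtain ⟨h, H⟩ := H
  refine ⟨fun i => (h (4 - i)).swap, fun _ => trivial, fun i => ?_, fun i => ?_,
    fun a b c habc => ?_, fun z _ hz => ?_⟩
  · rw [lay_flip, H.right]
    fin_cases i <;> rfl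
  · rw [lay_flip, H.left]
    fin_cases i <;> rfl
  · have : Cyc (4 - c) (4 - b) (4 - a) := by
      revert a b c
      decide
    have := H.cyc _ _ _ this
    unfold Cyc at this ⊢
    simp only [Blk.swap_lt]
    tauto
  · rw [← z.swap_swap, lay_flip, lay_flip, H.other _ trivial]
    intro i e
    apply hz (4 - i)
    rw [sub_sub_cancel, ← e, z.swap_swap]

theorem addArc_nest (m : ℤ) (N : ℕ) : AddArc (nest m N) (nest m (N + 1)) (m - N) := by
  have e1 : (nest m N).rayAt (m - N) = m - N := nest_rayAt_left (by omega)
  have e2 : (nest m N).rayAt (m - N + 1) = m + 1 + N := by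
    rw [nest_rayAt_right (by omega)]; ring
  refine ⟨?_, fun p h1 h2 => ?_⟩
  · rw [e1, e2, nest_partner, if_pos (by push_cast; omega)]; ring
  · rw [e1] at h1
    rw [e2] at h2
    rw [nest_partner, nest_partner]
    split_ifs <;> omega

/-- The next outer arcs of the two nests are offset by one, as in `hexM_of_addArc`, but in the
opposite direction; hence the reflection. -/
theorem hexM_sigma (N : ℕ) : HexM (sigma N) (sigma (N + 1)) := by
  have : HexM (sigma (N + 1)).flip (sigma N).flip := by
    refine hexM_of_addArc (i := -2 - N) ?_ (addArc_nest (-2) N)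
    have := addArc_nest (-1) N
    rwa [show -1 - (N : ℤ) = -2 - N + 1 by ring] at this
  exact this.flip

/-- Everything strictly below the cup at x is matched by cups that begin at x + 1 or later, so the
two ends of that cup are consecutive rays of `b.tail (x + 1)`. -/
theorem addArc_tail (b : CupDiagram) {x : ℤ} (hx : x < b.partner x) :
    AddArc (b.tail (x + 1)) (b.tail x) ((b.tail (x + 1)).rayIndex x) := by
  set c := b.tail (x + 1) with hc
  have p1 : c.partner x = x := by rw [hc, CupDiagram.tail_partner, if_neg (by omega)]
  have p2 : c.partner (b.partner x) = b.partner x := by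
    rw [hc, CupDiagram.tail_partner, if_neg]
    rw [b.partner_partner]; omega
  have inner : ∀ k, x + 1 ≤ k → k ≤ b.partner x → c.rayIndex k = c.rayIndex x + 1 := by
    intro k hk
    induction k, hk using Int.leInduction with
    | base => intro _; rw [c.rayIndex_succ, if_pos p1]
    | succ k hk ih =>
      intro h
      have hn := b.nested x k (by omega) (by omega)
      rw [c.rayIndex_succ_of_ne, ih (by omega)]
      rw [hc, CupDiagram.tail_partner, if_pos ⟨by omega, by omega⟩]
      exact hn.1
  have r1 : c.rayAt (c.rayIndex x) = x := c.rayAt_rayIndex p1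
  have r2 : c.rayAt (c.rayIndex x + 1) = b.partner x :=
    c.rayAt_eq p2 (inner _ (by omega) le_rfl)
  refine ⟨?_, fun p h1 h2 => ?_⟩
  · rw [r1, r2, CupDiagram.tail_partner, if_pos ⟨le_rfl, hx.le⟩]
  · rw [r1] at h1
    rw [r2] at h2
    have h3 : b.partner p ≠ x := fun e => h2 (by rw [← e, b.partner_partner])
    rw [hc, CupDiagram.tail_partner, CupDiagram.tail_partner]
    split_ifs <;> omega

theorem AddArc.shift {c d : CupDiagram} {i : ℤ} (h : AddArc c d i) :
    AddArc c.shift d.shift (i + 1) := by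
  have e1 : c.shift.rayAt (i + 1) = c.rayAt i + 1 := by
    rw [CupDiagram.shift_rayAt, add_sub_cancel_right]
  have e2 : c.shift.rayAt (i + 1 + 1) = c.rayAt (i + 1) + 1 := by
    rw [CupDiagram.shift_rayAt, add_sub_cancel_right]
  refine ⟨?_, fun p h1 h2 => ?_⟩
  · rw [e1, e2, CupDiagram.shift_partner, add_sub_cancel_right, h.left]
  · rw [e1] at h1
    rw [e2] at h2
    rw [CupDiagram.shift_partner, CupDiagram.shift_partner, h.other] <;> omega

/-- One step either performs the surgery at the cup starting at x, on this cup and its shifted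
mirror image, or does nothing. -/
theorem stage_eq_or_hexM (b : CupDiagram) (x : ℤ) :
    surgeryStage b x = surgeryStage b (x + 1) ∨ HexM (surgeryStage b x) (surgeryStage b (x + 1)) := by
  by_cases hx : x < b.partner x
  · right
    exact hexM_of_addArc (addArc_tail b hx).shift (addArc_tail b hx)
  · left
    have : b.tail x = b.tail (x + 1) := by
      refine CupDiagram.ext (funext fun p => ?_)
      rw [CupDiagram.tail_partner, CupDiagram.tail_partner]
      by_cases h1 : p = x
      · rw [h1]; split_ifs <;> omega
      by_cases h2 : b.partner p = x
      · have : b.partner x = p := by rw [← h2, b.partner_partner]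
        split_ifs <;> omega
      · split_ifs <;> omega
    exact Matching.ext (congrArg CupDiagram.shift this) this

/-! ## Consequences of the square property -/

theorem InSigma.sigma (N : ℕ) : InSigma (_root_.sigma N).toTL := ⟨N, rfl⟩

theorem InSigma.mul {x y : TL} (hx : InSigma x) (hy : InSigma y) : InSigma (x * y) := by
  obtain ⟨i, rfl⟩ := hx
  obtain ⟨j, rfl⟩ := hy
  exact ⟨_, sigma_mul_sigma i j⟩

theorem square_of {A₀ A₁ B₀ B₁ : Matching} (hA : A₀ = A₁ ∨ HexM A₀ A₁) (hB : B₀ = B₁ ∨ HexM B₀ B₁)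
    (X Y Z : TL) (h0 : InSigma (X * A₀.toTL * Y * B₀.toTL * Z))
    (h1 : InSigma (X * A₁.toTL * Y * B₁.toTL * Z)) :
    InSigma (X * A₀.toTL * Y * B₁.toTL * Z) ↔ InSigma (X * A₁.toTL * Y * B₀.toTL * Z) := by
  rcases hA with rfl | hA
  · exact iff_of_true h1 h0
  rcases hB with rfl | hB
  · exact iff_of_true h0 h1
  exact square hA hB X Y Z h0 h1

/-- The factor `sigma N` is removed one nested arc at a time, using the square formed by A₀, A₁ and
two consecutive `sigma`. -/
theorem inSigma_of_mul_sigma {A₀ A₁ : Matching} (hA : A₀ = A₁ ∨ HexM A₀ A₁) {X Y : TL}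
    (h0 : InSigma (X * A₀.toTL * Y)) {N : ℕ} (h1 : InSigma (X * A₁.toTL * Y * (sigma N).toTL)) :
    InSigma (X * A₁.toTL * Y) := by
  induction N with
  | zero => rwa [sigma_zero, mul_one] at h1
  | succ N ih =>
    refine ih ?_
    have := square_of hA (Or.inr (hexM_sigma N)) X Y 1 (by rw [mul_one]; exact h0.mul (.sigma N))
      (by rwa [mul_one])
    rw [mul_one, mul_one] at this
    exact this.1 (h0.mul (.sigma _))

theorem inSigma_of_sigma_mul {A₀ A₁ : Matching} (hA : A₀ = A₁ ∨ HexM A₀ A₁) {X Y : TL}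
    (h0 : InSigma (X * A₀.toTL * Y)) {N : ℕ} (h1 : InSigma ((sigma N).toTL * (X * A₁.toTL * Y))) :
    InSigma (X * A₁.toTL * Y) := by
  induction N with
  | zero => rwa [sigma_zero, one_mul] at h1
  | succ N ih =>
    refine ih ?_
    have := square_of (Or.inr (hexM_sigma N)) hA 1 X Y
      (by simpa only [one_mul, mul_assoc] using (InSigma.sigma N).mul h0)
      (by simpa only [one_mul, mul_assoc] using h1)
    simp only [one_mul, mul_assoc] at this h0 ⊢
    exact this.2 ((InSigma.sigma (N + 1)).mul h0)

/-- A matching detecting the number of nested arcs. -/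
noncomputable def detectMatching (n : ℕ) : Matching :=
  ⟨nest (-2) n, nest (-3) n, by rw [nest_numCups, nest_numCups]⟩

theorem hexM_detector (n : ℕ) : HexM (detectMatching (n + 1)) (detectMatching n) := by
  refine hexM_of_addArc (i := -3 - n) ?_ (addArc_nest (-3) n)
  have := addArc_nest (-2) n
  rwa [show -2 - (n : ℤ) = -3 - n + 1 by ring] at this

/-- A small detector is absorbed by straightening against the larger lower nest. -/
theorem detector_mul_sigma {n N : ℕ} (h : n ≤ N) :
    (detectMatching n).toTL * (sigma N).toTL = (sigma N).toTL := by
  have e : ∀ N, (nest (-3) N).shift = nest (-2) N := fun N => nest_shift _ _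
  have := zigzag_upper_shift (c := nest (-3) n) (a := nest (-3) N) (n := nest (-1) N) (nest_sub h)
    (by rw [CupDiagram.numCups_shift, nest_numCups, nest_numCups]) (CupDiagram.numCups_shift _)
  simp only [e] at this
  exact this

/-- A detector with one arc too many creates a cup on the top line joining -n - 3 and -n - 2, which
lies entirely on one side. -/
theorem not_inSigma_detector (n : ℕ) : ¬ InSigma ((detectMatching (n + 1)).toTL * (sigma n).toTL) := by
  rintro ⟨M, hM⟩
  have hc := TL.mul_eq_toTL.1 hM
  -- The block of all cups of the detector. It contains the lower nest of `sigma n` and two more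
  -- points on its left, whose rays carry the colour to the top line.
  have h1 : (detectMatching (n + 1)).Rel ⊥ fun p => -(n : ℤ) - 3 ≤ p ∧ p ≤ n - 2 := by
    refine ⟨fun _ => rfl, fun p => ?_, fun i => (eq_false fun h => ?_).symm⟩
    · dsimp only [detectMatching]
      rw [nest_partner]
      apply propext
      push_cast
      split_ifs <;> omega
    · dsimp only [detectMatching] at h
      rcases lt_or_ge i (-3 + 1 - ((n + 1 : ℕ) : ℤ)) with hi | hi
      · rw [nest_rayAt_left hi] at h; omega
      · rw [nest_rayAt_right hi] at h; omega
  have h2 : (sigma n).Rel (fun p => -(n : ℤ) - 3 ≤ p ∧ p ≤ n - 2)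
      fun p => -(n : ℤ) - 3 ≤ p ∧ p ≤ -n - 2 := by
    refine ⟨fun p => ?_, fun p => ?_, fun i => propext ?_⟩
    · dsimp only [sigma]
      rw [nest_partner]
      apply propext
      split_ifs <;> omega
    · dsimp only [sigma]
      rw [nest_partner]
      apply propext
      split_ifs <;> omega
    · dsimp only [sigma]
      rcases lt_or_ge i (-2 + 1 - (n : ℤ)) with hi | hi
      · rw [nest_rayAt_left hi, nest_rayAt_left (by omega)]; omega
      · rw [nest_rayAt_right hi]
        rcases lt_or_ge i (-1 + 1 - (n : ℤ)) with hi' | hi'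
        · rw [nest_rayAt_left hi']; omega
        · rw [nest_rayAt_right hi']; omega
  have h3 := (hc.rel _ _).2 ⟨_, h1, h2⟩
  obtain ⟨-, r2, r3, r4, r5⟩ := rel_sigma h3
  have e3 : ¬ (-(n : ℤ) - 3 ≤ -M - 2) := fun h => by
    have := r3 (-n - 3) (by omega)
    exact this.mpr (by omega)
  have e5 : -(n : ℤ) - 3 ≠ -M - 1 := fun h => by
    rw [← h] at r5
    exact r5.mpr (by omega)
  have := r2 (-n - 3) (by omega) (by omega)
  have := this.mpr (by omega)
  omega

/-- If n < N, the detector with n + 1 arcs is absorbed by `sigma N` and the one with n arcs by both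
`sigma n` and `sigma N`. The square property would then make `not_inSigma_detector` false. -/
theorem sigma_le_of_hexM {A₀ A₁ : Matching} (hA : HexM A₀ A₁) {X Y : TL} {N n : ℕ}
    (h0 : X * A₀.toTL * Y = (sigma N).toTL) (h1 : X * A₁.toTL * Y = (sigma n).toTL) : N ≤ n := by
  by_contra h
  have sq := square (hexM_detector n) hA 1 X Y
    (by simp only [one_mul, mul_assoc] at h0 ⊢; rw [h0, detector_mul_sigma (by omega)]; exact .sigma N)
    (by simp only [one_mul, mul_assoc] at h1 ⊢; rw [h1, detector_mul_sigma le_rfl]; exact .sigma n)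
  simp only [one_mul, mul_assoc] at h0 h1 sq
  rw [h0, h1] at sq
  exact not_inSigma_detector n (sq.2 ⟨N, detector_mul_sigma (by omega)⟩)

/-! ## Surgeries -/

/-- The stages of the surgery. -/
noncomputable def stage (b : CupDiagram) (s : ℤ) : TL := (surgeryStage b s).toTL

/-! ### Filling a grid of stages square by square -/

section Grid

variable {A B : ℤ → Matching} {P Q R : TL}

theorem grid_aux (hA : ∀ s, A s = A (s + 1) ∨ HexM (A s) (A (s + 1)))
    (hB : ∀ t, B t = B (t + 1) ∨ HexM (B t) (B (t + 1))) (P Q R : TL) (s t : ℤ)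
    (h0 : InSigma (P * (A s).toTL * Q * (B t).toTL * R))
    (h1 : InSigma (P * (A (s + 1)).toTL * Q * (B (t + 1)).toTL * R)) :
    InSigma (P * (A s).toTL * Q * (B (t + 1)).toTL * R) ↔
      InSigma (P * (A (s + 1)).toTL * Q * (B t).toTL * R) :=
  square_of (hA s) (hB t) P Q R h0 h1

/-- Starting from the edges with s small and with t large, the square property yields the remaining
corner of each square. -/
theorem grid_left (hA : ∀ s, A s = A (s + 1) ∨ HexM (A s) (A (s + 1)))
    (hB : ∀ t, B t = B (t + 1) ∨ HexM (B t) (B (t + 1)))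
    (hl : ∃ W, ∀ s ≤ W, ∀ t, InSigma (P * (A s).toTL * Q * (B t).toTL * R))
    (ht : ∃ W, ∀ t ≥ W, ∀ s, InSigma (P * (A s).toTL * Q * (B t).toTL * R)) (s t : ℤ) :
    InSigma (P * (A s).toTL * Q * (B t).toTL * R) := by
  obtain ⟨W, hl⟩ := hl
  obtain ⟨W', ht⟩ := ht
  rcases le_total s W with h | h
  · exact hl s h t
  · induction s, h using Int.leInduction generalizing t with
    | base => exact hl W le_rfl t
    | succ s hs ih =>
      rcases le_total W' t with h | h
      · exact ht t h _
      · induction t, h using Int.leInductionDown with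
        | base => exact ht W' le_rfl _
        | pred t hst iht =>
          -- The corners (s, t - 1), (s + 1, t) and (s, t) are known; the square gives (s + 1, t -
          -- 1).
          have := grid_aux hA hB P Q R s (t - 1) (ih _) (by rw [sub_add_cancel]; exact iht)
          rw [sub_add_cancel] at this
          exact this.1 (ih t)

/-- The mirrored version, starting from the edges with s large and with t small. -/
theorem grid_right (hA : ∀ s, A s = A (s + 1) ∨ HexM (A s) (A (s + 1)))
    (hB : ∀ t, B t = B (t + 1) ∨ HexM (B t) (B (t + 1)))
    (hl : ∃ W, ∀ s ≥ W, ∀ t, InSigma (P * (A s).toTL * Q * (B t).toTL * R))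
    (ht : ∃ W, ∀ t ≤ W, ∀ s, InSigma (P * (A s).toTL * Q * (B t).toTL * R)) (s t : ℤ) :
    InSigma (P * (A s).toTL * Q * (B t).toTL * R) := by
  obtain ⟨W, hl⟩ := hl
  obtain ⟨W', ht⟩ := ht
  rcases le_total t W' with h | h
  · exact ht t h s
  · induction t, h using Int.leInduction generalizing s with
    | base => exact ht W' le_rfl s
    | succ t hst ih =>
      rcases le_total W s with h | h
      · exact hl s h _
      · induction s, h using Int.leInductionDown with
        | base => exact hl W le_rfl _
        | pred s hs ihs =>
          have := grid_aux hA hB P Q R (s - 1) t (ih _) (by rw [sub_add_cancel]; exact ihs)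
          rw [sub_add_cancel] at this
          exact this.2 (ih s)

end Grid

/-- Orientability is propagated from stage to stage, the factor `sigma N` being cancelled at each of
them. -/
theorem stage_all_of_mul_sigma {b : CupDiagram} {P Q : TL} (hl : ∃ W, ∀ s ≤ W, InSigma (P * stage b s * Q))
    {N : ℕ} (h : ∀ s, InSigma (P * stage b s * Q * (sigma N).toTL)) (s : ℤ) :
    InSigma (P * stage b s * Q) := by
  obtain ⟨W, hl⟩ := hl
  rcases le_total s W with hs | hs
  · exact hl s hs
  · induction s, hs using Int.leInduction with
    | base => exact hl W le_rfl
    | succ s hs ih => exact inSigma_of_mul_sigma (stage_eq_or_hexM b s) ih (h (s + 1))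

theorem stage_all_of_sigma_mul {b : CupDiagram} {P Q : TL} (hl : ∃ W, ∀ s ≤ W, InSigma (P * stage b s * Q))
    {N : ℕ} (h : ∀ s, InSigma ((sigma N).toTL * (P * stage b s * Q))) (s : ℤ) :
    InSigma (P * stage b s * Q) := by
  obtain ⟨W, hl⟩ := hl
  rcases le_total s W with hs | hs
  · exact hl s hs
  · induction s, hs using Int.leInduction with
    | base => exact hl W le_rfl
    | succ s hs ih => exact inSigma_of_sigma_mul (stage_eq_or_hexM b s) ih (h (s + 1))

/-- All diagrams of the surgery are orientable. -/
def SurgeryGood (us ts : List Matching) (a b d : CupDiagram) : Prop :=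
  ∀ s, InSigma (a.lower.toTL * TL.prod us * stage b s * (TL.prod ts * d.upper.toTL))

theorem orientable_iff_inSigma (a : CupDiagram) (ts : List Matching) (b : CupDiagram) :
    Orientable a ts b ↔ InSigma (a.lower.toTL * TL.prod ts * b.upper.toTL) := orientable_iff a ts b

theorem orientable_stage_iff (us ts : List Matching) (a b d : CupDiagram) (s : ℤ) :
    Orientable a (us ++ surgeryStage b s :: ts) d ↔
      InSigma (a.lower.toTL * TL.prod us * stage b s * (TL.prod ts * d.upper.toTL)) := by
  rw [orientable_iff_inSigma, TL.prod_append, TL.prod_cons]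
  simp only [mul_assoc, stage]

theorem SurgeryGood.orientable {us ts : List Matching} {a b d : CupDiagram}
    (h : SurgeryGood us ts a b d) : Orientable a (us ++ ts) d := by
  obtain ⟨W, -, hW⟩ := b.exists_stage_eq
  have := h W
  rw [stage, hW W le_rfl, mul_one] at this
  rw [orientable_iff_inSigma, TL.prod_append]
  simpa only [mul_assoc] using this

open Classical in
theorem surgery_diag_eq (us ts : List Matching) (a b d : CupDiagram) :
    surgery us ts (diag a b) (diag b d) = if SurgeryGood us ts a b d then diag a d else 0 := by
  rw [surgery_diag, surgeryBasis]
  refine if_congr ⟨fun h s => (orientable_stage_iff us ts a b d s).1 (h.2.1 s), fun h =>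
    ⟨rfl, fun s => (orientable_stage_iff us ts a b d s).2 (h s), h.orientable⟩⟩ rfl rfl

theorem exists_stage_left {b : CupDiagram} {P Q : TL} (h1 : InSigma (P * b.upper.toTL))
    (h2 : InSigma (b.lower.toTL * Q)) : ∃ W, ∀ s ≤ W, InSigma (P * stage b s * Q) := by
  obtain ⟨W, hW, -⟩ := b.exists_stage_eq
  refine ⟨-W, fun s hs => ?_⟩
  rw [stage, hW s hs]
  simpa only [mul_assoc] using h1.mul h2

/-! ### Associativity of the surgery product -/

section Assoc

variable {us ts rs : List Matching} {a b c d : CupDiagram}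

/-- For small t the middle section at c is intact and the third diagram splits off as a factor
`sigma k`, so this edge of the grid is the first product. For large s the section at b is gone, and
that edge is the second product. These two edges determine the grid by `grid_right`. -/
theorem surgeryGood_left_iff (hx : Orientable a us b) (hy : Orientable b ts c)
    (hz : Orientable c rs d) : (SurgeryGood us ts a b c ∧ SurgeryGood (us ++ ts) rs a c d) ↔
      ∀ s t, InSigma (a.lower.toTL * TL.prod us * stage b s * TL.prod ts * stage c t *
        (TL.prod rs * d.upper.toTL)) := by
  rw [orientable_iff_inSigma] at hx hy hz
  obtain ⟨k, hk⟩ := hz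
  rw [mul_assoc] at hk
  obtain ⟨Wc, hc, -⟩ := c.exists_stage_eq
  obtain ⟨Wb, -, hb⟩ := b.exists_stage_eq
  have left : ∀ t ≤ -Wc, ∀ s, a.lower.toTL * TL.prod us * stage b s * TL.prod ts * stage c t *
      (TL.prod rs * d.upper.toTL) =
      a.lower.toTL * TL.prod us * stage b s * (TL.prod ts * c.upper.toTL) * (sigma k).toTL := by
    intro t ht s
    rw [stage, stage, hc t ht, ← hk]
    simp only [mul_assoc]
  have right : ∀ s ≥ Wb, ∀ t, a.lower.toTL * TL.prod us * stage b s * TL.prod ts * stage c t *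
      (TL.prod rs * d.upper.toTL) =
      a.lower.toTL * TL.prod (us ++ ts) * stage c t * (TL.prod rs * d.upper.toTL) := by
    intro s hs t
    rw [stage, stage, hb s hs, TL.prod_append, mul_one]
    simp only [mul_assoc]
  constructor
  · rintro ⟨h1, h2⟩
    refine grid_right (stage_eq_or_hexM b) (stage_eq_or_hexM c) ⟨Wb, fun s hs t => ?_⟩ ⟨-Wc, fun t ht s => ?_⟩
    · exact (congrArg InSigma (right s hs t)).mpr (h2 t)
    · exact (congrArg InSigma (left t ht s)).mpr ((h1 s).mul (.sigma k))
  · intro h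
    refine ⟨stage_all_of_mul_sigma (N := k) (exists_stage_left hx (by rwa [← mul_assoc])) fun s => ?_,
      fun t => ?_⟩
    · rw [← left _ le_rfl s]; exact h _ _
    · rw [← right _ le_rfl t]; exact h _ _

/-- The other bracketing performs the surgeries along the opposite two edges of the same grid, which
is filled by `grid_left`. -/
theorem surgeryGood_right_iff (hx : Orientable a us b) (hy : Orientable b ts c)
    (hz : Orientable c rs d) : (SurgeryGood ts rs b c d ∧ SurgeryGood us (ts ++ rs) a b d) ↔
      ∀ s t, InSigma (a.lower.toTL * TL.prod us * stage b s * TL.prod ts * stage c t *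
        (TL.prod rs * d.upper.toTL)) := by
  rw [orientable_iff_inSigma] at hx hy hz
  obtain ⟨k, hk⟩ := hx
  obtain ⟨Wc, -, hc⟩ := c.exists_stage_eq
  obtain ⟨Wb, hb, -⟩ := b.exists_stage_eq
  have left : ∀ s ≤ -Wb, ∀ t, a.lower.toTL * TL.prod us * stage b s * TL.prod ts * stage c t *
      (TL.prod rs * d.upper.toTL) =
      (sigma k).toTL * (b.lower.toTL * TL.prod ts * stage c t * (TL.prod rs * d.upper.toTL)) := by
    intro s hs t
    rw [stage, stage, hb s hs, ← hk]
    simp only [mul_assoc]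
  have right : ∀ t ≥ Wc, ∀ s, a.lower.toTL * TL.prod us * stage b s * TL.prod ts * stage c t *
      (TL.prod rs * d.upper.toTL) =
      a.lower.toTL * TL.prod us * stage b s * (TL.prod (ts ++ rs) * d.upper.toTL) := by
    intro t ht s
    rw [stage, stage, hc t ht, TL.prod_append, mul_one]
    simp only [mul_assoc]
  constructor
  · rintro ⟨h1, h2⟩
    refine grid_left (stage_eq_or_hexM b) (stage_eq_or_hexM c) ⟨-Wb, fun s hs t => ?_⟩ ⟨Wc, fun t ht s => ?_⟩
    · exact (congrArg InSigma (left s hs t)).mpr ((InSigma.sigma k).mul (h1 t))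
    · exact (congrArg InSigma (right t ht s)).mpr (h2 s)
  · intro h
    refine ⟨stage_all_of_sigma_mul (N := k) (exists_stage_left hy (by rwa [← mul_assoc])) fun t => ?_,
      fun s => ?_⟩
    · rw [← left _ le_rfl t]; exact h _ _
    · rw [← right _ le_rfl s]; exact h _ _

end Assoc

theorem GHat_induction {ts : List Matching} {p : DiagramSpace → Prop} (h0 : p 0)
    (hadd : ∀ x y, p x → p y → p (x + y)) (hsmul : ∀ (c : ℂ) x, p x → p (c • x))
    (hd : ∀ a b, Orientable a ts b → p (diag a b)) : ∀ x ∈ GHat ts, p x := by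
  intro x hx
  rw [GHat, Finsupp.supported_eq_span_single] at hx
  refine Submodule.span_induction ?_ h0 (fun x y _ _ => hadd x y) (fun c x _ => hsmul c x) hx
  rintro _ ⟨⟨a, b⟩, hab, rfl⟩
  exact hd a b hab

/-- On composable basis vectors each side is `diag a d` or zero, and both are nonzero under the same
condition on the grid of stages. -/
theorem surgery_assoc (us ts rs : List Matching) : ∀ x ∈ GHat us, ∀ y ∈ GHat ts, ∀ z ∈ GHat rs,
    surgery (us ++ ts) rs (surgery us ts x y) z = surgery us (ts ++ rs) x (surgery ts rs y z) := by
  intro x hx y hy z hz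
  refine GHat_induction (p := fun x => surgery (us ++ ts) rs (surgery us ts x y) z =
    surgery us (ts ++ rs) x (surgery ts rs y z)) (by simp)
    (fun x x' h h' => by simp only [map_add, LinearMap.add_apply, h, h'])
    (fun k x h => by simp only [map_smul, LinearMap.smul_apply, h]) (fun a b hab => ?_) x hx
  refine GHat_induction (p := fun y => surgery (us ++ ts) rs (surgery us ts (diag a b) y) z =
    surgery us (ts ++ rs) (diag a b) (surgery ts rs y z)) (by simp)
    (fun x x' h h' => by simp only [map_add, LinearMap.add_apply, h, h'])
    (fun k x h => by simp only [map_smul, LinearMap.smul_apply, h]) (fun b' c hbc => ?_) y hy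
  refine GHat_induction (p := fun z => surgery (us ++ ts) rs (surgery us ts (diag a b) (diag b' c)) z =
    surgery us (ts ++ rs) (diag a b) (surgery ts rs (diag b' c) z)) (by simp)
    (fun x x' h h' => by simp only [map_add, LinearMap.add_apply, h, h'])
    (fun k x h => by simp only [map_smul, LinearMap.smul_apply, h]) (fun c' d hcd => ?_) z hz
  classical
  by_cases hb : b = b'
  · subst hb
    by_cases hc : c = c'
    · subst hc
      have key := (surgeryGood_left_iff hab hbc hcd).trans (surgeryGood_right_iff hab hbc hcd).symm
      rw [surgery_diag_eq, surgery_diag_eq]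
      have e1 : surgery (us ++ ts) rs (if SurgeryGood us ts a b c then diag a c else 0) (diag c d) =
          if SurgeryGood us ts a b c ∧ SurgeryGood (us ++ ts) rs a c d then diag a d else 0 := by
        by_cases h : SurgeryGood us ts a b c
        · simp only [h, if_true, true_and, surgery_diag_eq]
        · simp only [h, if_false, false_and, map_zero, LinearMap.zero_apply]
      have e2 : surgery us (ts ++ rs) (diag a b) (if SurgeryGood ts rs b c d then diag b d else 0) =
          if SurgeryGood ts rs b c d ∧ SurgeryGood us (ts ++ rs) a b d then diag a d else 0 := by
        by_cases h : SurgeryGood ts rs b c d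
        · simp only [h, if_true, true_and, surgery_diag_eq]
        · simp only [h, if_false, false_and, map_zero]
      rw [e1, e2]
      exact if_congr key rfl rfl
    · rw [surgery_diag_ne ts rs b c c' d hc, surgery_diag_eq, map_zero]
      split_ifs
      · exact surgery_diag_ne _ _ _ _ _ _ hc
      · simp
  · rw [surgery_diag_ne us ts a b b' c hb, map_zero, LinearMap.zero_apply]
    by_cases hc : c = c'
    · subst hc
      rw [surgery_diag_eq]
      split_ifs
      · exact (surgery_diag_ne _ _ _ _ _ _ hb).symm
      · simp
    · rw [surgery_diag_ne ts rs b' c c' d hc, map_zero]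

/-! ## Non-propagating lines -/

/-- Among the N nested caps of the closed diagram, those of the closing nest account for the cups of
`a`; each further cap is a non-propagating line. The same holds at the top. -/
theorem hasNonPropagating_iff {a : CupDiagram} {ts : List Matching} {b : CupDiagram} {N : ℕ}
    (h : a.lower.toTL * TL.prod ts * b.upper.toTL = (sigma N).toTL) :
    HasNonPropagating a ts b ↔ a.numCups < N ∨ b.numCups < N := by
  have e : TL.prod (a.lower :: (ts ++ [b.upper])) = (sigma N).toTL := by
    rw [← diagTL_eq_prod]; exact h
  obtain ⟨hR, hR0⟩ := TL.prod_eq_toTL e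
  rw [diagram_length] at hR hR0
  constructor
  · rintro (⟨p, q, hp, hq, hpq, hs⟩ | ⟨p, q, hp, hq, hpq, hs⟩)
    · left
      set P := (nest (-2) a.numCups).rayAt (a.rayIndex p) with hP
      set Q := (nest (-2) a.numCups).rayAt (a.rayIndex q) with hQ
      have hPQ : P ≠ Q := by
        intro e
        have := congrArg (nest (-2) a.numCups).rayIndex e
        rw [hP, hQ, CupDiagram.rayIndex_rayAt, CupDiagram.rayIndex_rayAt] at this
        exact hpq (a.rayIndex_inj hp hq this)
      have := (sigma N).bot_partner_of_rel hPQ fun f g hfg => by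
        obtain ⟨F, hF, rfl, rfl⟩ := (hR _ _).1 hfg
        obtain ⟨c1, c2, c3⟩ := col_diagram.1 hF
        have e1 := c1.ray (a.rayIndex p)
        have e2 := c1.ray (a.rayIndex q)
        change F 0 P = F 1 (a.rayAt _) at e1
        change F 0 Q = F 1 (a.rayAt _) at e2
        rw [a.rayAt_rayIndex hp] at e1
        rw [a.rayAt_rayIndex hq] at e2
        rw [e1, e2]
        exact c2.sameLine hs
      have h1 : (nest (-2) N).partner P ≠ P := by
        change (sigma N).bot.partner P ≠ P
        rw [this]; exact hPQ.symm
      rw [nest_moved] at h1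
      have h2 : ¬ ((nest (-2) a.numCups).partner P ≠ P) := not_not.2 (CupDiagram.partner_rayAt _ _)
      rw [nest_moved] at h2
      omega
    · right
      set P := (nest (-1) b.numCups).rayAt (b.shift.rayIndex p) with hP
      set Q := (nest (-1) b.numCups).rayAt (b.shift.rayIndex q) with hQ
      have hPQ : P ≠ Q := by
        intro e
        have := congrArg (nest (-1) b.numCups).rayIndex e
        rw [hP, hQ, CupDiagram.rayIndex_rayAt, CupDiagram.rayIndex_rayAt] at this
        exact hpq (b.shift.rayIndex_inj hp hq this)
      have := (sigma N).top_partner_of_rel hPQ fun f g hfg => by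
        obtain ⟨F, hF, rfl, rfl⟩ := (hR _ _).1 hfg
        obtain ⟨c1, c2, c3⟩ := col_diagram.1 hF
        have e1 := c3.ray (b.shift.rayIndex p)
        have e2 := c3.ray (b.shift.rayIndex q)
        change F _ (b.shift.rayAt _) = F _ P at e1
        change F _ (b.shift.rayAt _) = F _ Q at e2
        rw [b.shift.rayAt_rayIndex hp] at e1
        rw [b.shift.rayAt_rayIndex hq] at e2
        rw [← e1, ← e2]
        exact c2.sameLine hs
      have h1 : (nest (-1) N).partner P ≠ P := by
        change (sigma N).top.partner P ≠ P
        rw [this]; exact hPQ.symm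
      rw [nest_moved] at h1
      have h2 : ¬ ((nest (-1) b.numCups).partner P ≠ P) := not_not.2 (CupDiagram.partner_rayAt _ _)
      rw [nest_moved] at h2
      omega
  · rintro (hN | hN)
    · left
      have ray : ∀ p : ℤ, ¬ (-2 + 1 - a.numCups ≤ p ∧ p ≤ -2 + a.numCups) →
          (nest (-2) a.numCups).partner p = p := fun p hp => by
        by_contra h'; exact hp (nest_moved.1 h')
      -- The ends of the outermost cap of `sigma N`; they lie outside the closing nest, so rays of
      -- the diagram end there.
      have rP := ray (-1 - N) (by omega)
      have rQ := ray (N - 2) (by omega)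
      refine ⟨a.rayAt ((nest (-2) a.numCups).rayIndex (-1 - N)),
        a.rayAt ((nest (-2) a.numCups).rayIndex (N - 2)), a.partner_rayAt _, a.partner_rayAt _, ?_, ?_⟩
      · intro e
        have := congrArg a.rayIndex e
        rw [a.rayIndex_rayAt, a.rayIndex_rayAt] at this
        have := CupDiagram.rayIndex_inj _ rP rQ this
        omega
      · obtain ⟨f, g, hF, hf, -⟩ :=
          (strandInv_sameLine a ts b (0, a.rayAt ((nest (-2) a.numCups).rayIndex (-1 - N)))).exists_col
        have hfg := (rel_sigma ((hR f g).2 ⟨_, hF, rfl, by simp⟩)).1 (-1 - N) (by omega) (by omega)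
        have f1 := hf ((nest (-2) a.numCups).rayIndex (-1 - N))
        have f2 := hf ((nest (-2) a.numCups).rayIndex (N - 2))
        rw [CupDiagram.rayAt_rayIndex _ rP] at f1
        rw [CupDiagram.rayAt_rayIndex _ rQ] at f2
        rw [show -3 - (-1 - (N : ℤ)) = N - 2 by ring, f1, f2] at hfg
        exact hfg.mpr (Relation.EqvGen.refl _)
    · right
      have ray : ∀ p : ℤ, ¬ (-1 + 1 - b.numCups ≤ p ∧ p ≤ -1 + b.numCups) →
          (nest (-1) b.numCups).partner p = p := fun p hp => by
        by_contra h'; exact hp (nest_moved.1 h')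
      have rP := ray (-N) (by omega)
      have rQ := ray (N - 1) (by omega)
      refine ⟨b.shift.rayAt ((nest (-1) b.numCups).rayIndex (-N)),
        b.shift.rayAt ((nest (-1) b.numCups).rayIndex (N - 1)), b.shift.partner_rayAt _,
        b.shift.partner_rayAt _, ?_, ?_⟩
      · intro e
        have := congrArg b.shift.rayIndex e
        rw [b.shift.rayIndex_rayAt, b.shift.rayIndex_rayAt] at this
        have := CupDiagram.rayIndex_inj _ rP rQ this
        omega
      · obtain ⟨f, g, hF, -, hg, -⟩ := (strandInv_sameLine a ts b
          (ts.length, b.shift.rayAt ((nest (-1) b.numCups).rayIndex (-N)))).exists_col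
        have hfg := (rel_sigma ((hR f g).2 ⟨_, hF, rfl, by simp⟩)).2.1 (-N) (by omega) (by omega)
        have f1 := hg ((nest (-1) b.numCups).rayIndex (-N))
        have f2 := hg ((nest (-1) b.numCups).rayIndex (N - 1))
        rw [CupDiagram.rayAt_rayIndex _ rP] at f1
        rw [CupDiagram.rayAt_rayIndex _ rQ] at f2
        rw [show -1 - (-(N : ℤ)) = N - 1 by ring, f1, f2] at hfg
        exact hfg.mpr (Relation.EqvGen.refl _)

theorem sigma_toTL_injective {i j : ℕ} (h : (sigma i).toTL = (sigma j).toTL) : i = j :=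
  sigma_injective (toTL_injective h)

/-- The number of nested arcs does not decrease under surgery. -/
theorem SurgeryGood.exists_le {us ts : List Matching} {a b d : CupDiagram} {i j : ℕ}
    (h : SurgeryGood us ts a b d) (hi : a.lower.toTL * TL.prod us * b.upper.toTL = (sigma i).toTL)
    (hj : b.lower.toTL * TL.prod ts * d.upper.toTL = (sigma j).toTL) :
    ∃ N, a.lower.toTL * TL.prod (us ++ ts) * d.upper.toTL = (sigma N).toTL ∧ max i j ≤ N := by
  obtain ⟨W, h1, h2⟩ := b.exists_stage_eq
  -- The number of nested arcs at each stage; it is monotone in the stage, and at the beginning it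
  -- is the maximum of i and j.
  choose N hN using h
  have mono : Monotone N := by
    refine monotone_int_of_le_succ fun s => ?_
    rcases stage_eq_or_hexM b s with e | e
    · refine (sigma_toTL_injective ?_).le
      rw [← hN, ← hN, stage, stage, e]
    · exact sigma_le_of_hexM e (hN s) (hN (s + 1))
  have hl : N (-W) = max i j := by
    refine sigma_toTL_injective ?_
    rw [← hN, stage, h1 _ le_rfl, ← sigma_mul_sigma, ← hi, ← hj]
    simp only [mul_assoc]
  refine ⟨N (max W (-W)), ?_, hl ▸ mono (le_max_right W (-W))⟩
  rw [← hN, stage, h2 _ (le_max_left _ _), TL.prod_append, mul_one]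
  simp only [mul_assoc]

/-- Non-propagating lines persist under surgery. -/
theorem SurgeryGood.hasNonPropagating {us ts : List Matching} {a b d : CupDiagram} {n : ℕ}
    (h : SurgeryGood us ts a b d) (hx : Orientable a us b) (hy : Orientable b ts d)
    (ha : a.numCups = n) (hb : b.numCups = n) (hd : d.numCups = n)
    (hn : HasNonPropagating a us b ∨ HasNonPropagating b ts d) : HasNonPropagating a (us ++ ts) d := by
  obtain ⟨i, hi⟩ := (orientable_iff_inSigma _ _ _).1 hx
  obtain ⟨j, hj⟩ := (orientable_iff_inSigma _ _ _).1 hy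
  obtain ⟨N, hN, hle⟩ := h.exists_le hi hj
  rw [hasNonPropagating_iff hi, hasNonPropagating_iff hj] at hn
  rw [hasNonPropagating_iff hN]
  omega

/-! ### The algebras and bimodules are well defined -/

theorem surgeryWellDefined : SurgeryWellDefined where
  idem_orientable a := by
    rw [orientable_iff_inSigma, TL.prod_nil, mul_one, a.lower_mul_upper]
    exact .sigma _
  idem_mul ts a b hab := by
    classical
    rw [surgery_diag_eq, if_pos]
    intro s
    rw [TL.prod_nil, mul_one, stage, a.lower_mul_stage, ← mul_assoc]
    exact (orientable_iff_inSigma a ts b).1 hab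
  mul_idem ts a b hab := by
    classical
    rw [surgery_diag_eq, if_pos]
    intro s
    rw [TL.prod_nil, one_mul, stage, mul_assoc, b.stage_mul_upper]
    exact (orientable_iff_inSigma a ts b).1 hab
  assoc_left ts := surgery_assoc [] [] ts
  assoc_mid ts x hx y hy z hz := by
    have := surgery_assoc [] ts [] x hx y hy z hz
    rwa [List.append_nil] at this
  assoc_right ts x hx y hy z hz := by
    have := surgery_assoc ts [] [] x hx y hy z hz
    rwa [List.append_nil] at this
  ideal_left n ts x hx y hy h := by
    have key : ∀ P Q : Set (CupDiagram × CupDiagram),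
        (∀ z ∈ P, Orientable z.1 [] z.2 ∧ z.1.numCups = n ∧ z.2.numCups = n) →
        (∀ z ∈ Q, Orientable z.1 ts z.2 ∧ z.1.numCups = n ∧ z.2.numCups = n) →
        ((∀ z ∈ P, HasNonPropagating z.1 [] z.2) ∨ ∀ z ∈ Q, HasNonPropagating z.1 ts z.2) →
        ∀ x ∈ Finsupp.supported ℂ ℂ P, ∀ y ∈ Finsupp.supported ℂ ℂ Q,
          surgery [] ts x y ∈ INonProp n ts := by
      intro P Q hP hQ hPQ x hx y hy
      refine surgery_mem_of (fun i hi j hj => ?_) hx hy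
      unfold surgeryBasis
      split_ifs with h
      · obtain ⟨a, b⟩ := i
        obtain ⟨b', d⟩ := j
        obtain ⟨rfl, h1, h2⟩ := h
        have hi' := hP _ hi
        have hj' := hQ _ hj
        refine Finsupp.single_mem_supported ℂ _ ⟨⟨h2, hi'.2.1, hj'.2.2⟩, ?_⟩
        exact SurgeryGood.hasNonPropagating (fun s => (orientable_stage_iff [] ts a b d s).1 (h1 s))
          hi'.1 hj'.1 hi'.2.1 hi'.2.2 hj'.2.2 (hPQ.imp (fun h => h _ hi) fun h => h _ hj)
      · exact Submodule.zero_mem _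
    rcases h with h | h
    · exact key _ _ (fun z hz => hz.1) (fun z hz => hz) (Or.inl fun z hz => hz.2) x h y hy
    · exact key _ _ (fun z hz => hz) (fun z hz => hz.1) (Or.inr fun z hz => hz.2) x hx y h
  ideal_right n ts x hx y hy h := by
    have key : ∀ P Q : Set (CupDiagram × CupDiagram),
        (∀ z ∈ P, Orientable z.1 ts z.2 ∧ z.1.numCups = n ∧ z.2.numCups = n) →
        (∀ z ∈ Q, Orientable z.1 [] z.2 ∧ z.1.numCups = n ∧ z.2.numCups = n) →
        ((∀ z ∈ P, HasNonPropagating z.1 ts z.2) ∨ ∀ z ∈ Q, HasNonPropagating z.1 [] z.2) →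
        ∀ x ∈ Finsupp.supported ℂ ℂ P, ∀ y ∈ Finsupp.supported ℂ ℂ Q,
          surgery ts [] x y ∈ INonProp n ts := by
      intro P Q hP hQ hPQ x hx y hy
      refine surgery_mem_of (fun i hi j hj => ?_) hx hy
      unfold surgeryBasis
      split_ifs with h
      · obtain ⟨a, b⟩ := i
        obtain ⟨b', d⟩ := j
        obtain ⟨rfl, h1, h2⟩ := h
        have hi' := hP _ hi
        have hj' := hQ _ hj
        have h2' := h2
        rw [List.append_nil] at h2'
        refine Finsupp.single_mem_supported ℂ _ ⟨⟨h2', hi'.2.1, hj'.2.2⟩, ?_⟩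
        have := SurgeryGood.hasNonPropagating
          (fun s => (orientable_stage_iff ts [] a b d s).1 (h1 s))
          hi'.1 hj'.1 hi'.2.1 hi'.2.2 hj'.2.2 (hPQ.imp (fun h => h _ hi) fun h => h _ hj)
        rwa [List.append_nil] at this
      · exact Submodule.zero_mem _
    rcases h with h | h
    · exact key _ _ (fun z hz => hz.1) (fun z hz => hz) (Or.inl fun z hz => hz.2) x h y hy
    · exact key _ _ (fun z hz => hz) (fun z hz => hz.1) (Or.inr fun z hz => hz.2) x hx y h

/-! ## Mirror images of products -/

namespace Matching

theorem rel_ddagger {t : Matching} {f g : ℤ → Prop} :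
    t.ddagger.Rel f g ↔ t.Rel (fun p => g (p + 1)) fun p => f (p + 1) := by
  have key : ∀ (c : CupDiagram) (f : ℤ → Prop), (∀ p, f (c.shift.partner p) = f p) ↔
      ∀ p, f (c.partner p + 1) = f (p + 1) := by
    intro c f
    simp only [CupDiagram.shift_partner]
    refine ⟨fun h p => ?_, fun h p => ?_⟩
    · have := h (p + 1)
      rwa [add_sub_cancel_right] at this
    · have := h (p - 1)
      rwa [sub_add_cancel] at this
  constructor
  · rintro ⟨h1, h2, h3⟩
    refine ⟨(key _ _).1 h2, (key _ _).1 h1, fun i => ?_⟩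
    have := h3 (i + 1)
    dsimp only [ddagger] at this
    rw [CupDiagram.shift_rayAt, CupDiagram.shift_rayAt, add_sub_cancel_right] at this
    exact this.symm
  · rintro ⟨h1, h2, h3⟩
    refine ⟨(key _ _).2 h2, (key _ _).2 h1, fun i => ?_⟩
    dsimp only [ddagger]
    rw [CupDiagram.shift_rayAt, CupDiagram.shift_rayAt]
    exact (h3 (i - 1)).symm

theorem isComp_ddagger {t s R : Matching} :
    IsComp s.ddagger t.ddagger R.ddagger ↔ IsComp t s R := by
  have e : ∀ f : ℤ → Prop, (fun p => (fun q => f (q - 1)) (p + 1)) = f := fun f =>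
    funext fun p => by simp
  constructor
  · refine fun h => ⟨fun f k => ?_, fun g h1 h2 => ?_⟩
    · have := h.rel (fun p => k (p - 1)) fun p => f (p - 1)
      rw [rel_ddagger, e, e] at this
      rw [this]
      constructor
      · rintro ⟨g, h1, h2⟩
        rw [rel_ddagger, e] at h1 h2
        exact ⟨_, h2, h1⟩
      · rintro ⟨g, h1, h2⟩
        refine ⟨fun p => g (p - 1), ?_, ?_⟩
        · rw [rel_ddagger, e, e]; exact h2
        · rw [rel_ddagger, e, e]; exact h1
    · have := h.noCircle (fun p => g (p - 1)) (by rw [rel_ddagger, e]; exact h2)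
        (by rw [rel_ddagger, e]; exact h1)
      rw [← e g, this]
      rfl
  · refine fun h => ⟨fun f k => ?_, fun g h1 h2 => ?_⟩
    · rw [rel_ddagger, h.rel]
      constructor
      · rintro ⟨g, h1, h2⟩
        refine ⟨fun p => g (p - 1), ?_, ?_⟩
        · rw [rel_ddagger, e]; exact h2
        · rw [rel_ddagger, e]; exact h1
      · rintro ⟨g, h1, h2⟩
        exact ⟨_, rel_ddagger.1 h2, rel_ddagger.1 h1⟩
    · have := h.noCircle _ (rel_ddagger.1 h2) (rel_ddagger.1 h1)
      funext p
      have := congrFun this (p - 1)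
      simpa using this

/-- Used to turn statements about `lower` into statements about `upper`. -/
theorem ddagger_mul_ddagger {t s R : Matching} :
    s.ddagger.toTL * t.ddagger.toTL = R.ddagger.toTL ↔ t.toTL * s.toTL = R.toTL := by
  rw [TL.mul_eq_toTL, TL.mul_eq_toTL, isComp_ddagger]

theorem bot_sub_of_mul {X R : Matching} {y : TL} (h : X.toTL * y = R.toTL) : X.bot.Sub R.bot := by
  rcases TL.eq_zero_or y with rfl | ⟨Y, rfl⟩
  · rw [mul_zero] at h
    exact absurd h.symm (TL.toTL_ne_zero R)
  intro p hp
  refine R.bot_partner_of_rel (Ne.symm hp) fun f g hfg => ?_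
  obtain ⟨k, h1, -⟩ := ((TL.mul_eq_toTL.1 h).rel f g).1 hfg
  exact (h1.bot p).symm

theorem top_sub_of_mul {Y R : Matching} {x : TL} (h : x * Y.toTL = R.toTL) : Y.top.Sub R.top := by
  rcases TL.eq_zero_or x with rfl | ⟨X, rfl⟩
  · rw [zero_mul] at h
    exact absurd h.symm (TL.toTL_ne_zero R)
  intro p hp
  refine R.top_partner_of_rel (Ne.symm hp) fun f g hfg => ?_
  obtain ⟨k, -, h1⟩ := ((TL.mul_eq_toTL.1 h).rel f g).1 hfg
  exact (h1.top p).symm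

end Matching

namespace CupDiagram

theorem Sub.eq_nest {c : CupDiagram} {m : ℤ} {N : ℕ} (h : c.Sub (nest m N)) :
    c = nest m c.numCups := by
  refine Straddles.eq_nest fun p hp => ?_
  have := h p hp
  rw [← this]
  exact nest_straddles m N p (by rw [this]; exact hp)

theorem le_of_nest_sub {m : ℤ} {i j : ℕ} (h : (nest m i).Sub (nest m j)) : i ≤ j := by
  by_contra hij
  have h1 : (nest m i).partner (m + i) ≠ m + i := nest_moved.2 (by omega)
  have h2 : (nest m j).partner (m + i) ≠ m + i := by rw [h _ h1]; exact h1
  have := nest_moved.1 h2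
  omega

theorem exists_shift_eq (c : CupDiagram) : ∃ d : CupDiagram, d.shift = c := by
  refine ⟨⟨fun p => c.partner (p + 1) - 1, fun p => by simp [c.partner_partner], ?_,
    fun p k h1 h2 => ?_⟩, CupDiagram.ext (funext fun p => ?_)⟩
  · refine (c.finite_moved.image fun p => p - 1).subset fun p hp => ⟨p + 1, ?_, by simp⟩
    intro h
    exact hp (by rw [h]; ring)
  · have := c.nested (p + 1) (k + 1) (by omega) (by omega)
    exact ⟨fun h => this.1 (by omega), by omega, by omega⟩
  · rw [shift_partner]; simp

/-- Caps of the lowest factor remain caps of the product. If these are nested about the middle, so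
are the caps of X, which is therefore a closed cup diagram. -/
theorem exists_lower_of_mul {X : Matching} {y : TL} {R : Matching} {N : ℕ} (h : X.toTL * y = R.toTL)
    (hR : R.bot = nest (-2) N) : X.toTL = X.top.lower.toTL := by
  have h1 := (hR ▸ bot_sub_of_mul h : X.bot.Sub (nest (-2) N)).eq_nest
  exact toTL_congr (h1.trans (by rw [X.numCups_eq]; rfl)) rfl

theorem exists_upper_of_mul {x : TL} {Y : Matching} {R : Matching} {N : ℕ} (h : x * Y.toTL = R.toTL)
    (hR : R.top = nest (-1) N) : ∃ e : CupDiagram, Y.toTL = e.upper.toTL := by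
  have h1 := (hR ▸ top_sub_of_mul h : Y.top.Sub (nest (-1) N)).eq_nest
  obtain ⟨e, he⟩ := Y.bot.exists_shift_eq
  refine ⟨e, toTL_congr he.symm (h1.trans ?_)⟩
  rw [← Y.numCups_eq, ← he, numCups_shift]
  rfl

end CupDiagram

/-! ## The action of matchings on cup diagrams -/

/-- The matching `t`, drawn on top of the cup diagram `b`, gives the cup diagram `b'`. -/
def Moves (t : Matching) (b b' : CupDiagram) : Prop := b.lower.toTL * t.toTL = b'.lower.toTL

theorem Moves.unique {t : Matching} {b c d : CupDiagram} (h : Moves t b c) (h' : Moves t b d) : c = d :=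
  congrArg Matching.top (toTL_injective (h.symm.trans h'))

/-- The shifted mirror image of `b t = b'`; it makes the same `b'` control both Ĝ_t on the left and
Ĝ_{t‡} on the right. -/
theorem moves_iff_upper {t : Matching} {b b' : CupDiagram} :
    Moves t b b' ↔ t.ddagger.toTL * b.upper.toTL = b'.upper.toTL := by
  rw [← b.lower_ddagger, ← b'.lower_ddagger, ddagger_mul_ddagger]
  rfl

theorem Moves.numCups_le {t : Matching} {b b' : CupDiagram} (h : Moves t b b') :
    b.numCups ≤ b'.numCups := CupDiagram.le_of_nest_sub (bot_sub_of_mul h)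

theorem lower_numCups_le {b : CupDiagram} {y : TL} {N : ℕ} (h : b.lower.toTL * y = (sigma N).toTL) :
    b.numCups ≤ N := CupDiagram.le_of_nest_sub (bot_sub_of_mul h)

theorem upper_numCups_le {b : CupDiagram} {x : TL} {N : ℕ} (h : x * b.upper.toTL = (sigma N).toTL) :
    b.numCups ≤ N := CupDiagram.le_of_nest_sub (top_sub_of_mul h)

/-- If the whole product has nested caps, then so has its lower part `b t`, which is thus again a
closed cup diagram. In particular orientability of `b t d̄` suffices. -/
theorem exists_moves_of_mul {b : CupDiagram} {t : Matching} {y : TL} {R : Matching} {N : ℕ}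
    (h : b.lower.toTL * t.toTL * y = R.toTL) (hR : R.bot = nest (-2) N) : ∃ b', Moves t b b' := by
  rcases TL.eq_zero_or (b.lower.toTL * t.toTL) with e | ⟨X, e⟩
  · rw [e, zero_mul] at h
    exact absurd h.symm (TL.toTL_ne_zero R)
  · exact ⟨_, e.trans (CupDiagram.exists_lower_of_mul (e ▸ h) hR)⟩

theorem exists_upper_of_orientable {a b : CupDiagram} {t : Matching} (h : Orientable a [t] b) :
    ∃ e : CupDiagram, t.toTL * b.upper.toTL = e.upper.toTL := by
  obtain ⟨N, h⟩ := (orientable_iff_inSigma _ _ _).1 h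
  rw [TL.prod_cons, TL.prod_nil, mul_one, mul_assoc] at h
  rcases TL.eq_zero_or (t.toTL * b.upper.toTL) with e | ⟨X, e⟩
  · rw [e, mul_zero] at h
    exact absurd h.symm (TL.toTL_ne_zero _)
  · rw [e] at h ⊢
    exact CupDiagram.exists_upper_of_mul h rfl

theorem exists_moves_left {b d : CupDiagram} {t : Matching} (h : Orientable b [t] d) :
    ∃ b', Moves t b b' := by
  obtain ⟨N, h⟩ := (orientable_iff_inSigma _ _ _).1 h
  rw [TL.prod_cons, TL.prod_nil, mul_one] at h
  exact exists_moves_of_mul h rfl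

theorem exists_moves_right {a b : CupDiagram} {t : Matching} (h : Orientable a [t.ddagger] b) :
    ∃ b', Moves t b b' := by
  obtain ⟨e, h⟩ := exists_upper_of_orientable h
  exact ⟨e, moves_iff_upper.2 h⟩

/-! ## Opposite surgeries -/

/-- Reflecting the strips and reversing the order of the surgeries keeps a path of rotations. -/
theorem costage_eq_or_hexM (c : CupDiagram) (x : ℤ) :
    (surgeryStage c (-x)).flip = (surgeryStage c (-(x + 1))).flip ∨
      HexM (surgeryStage c (-x)).flip (surgeryStage c (-(x + 1))).flip := by
  have := stage_eq_or_hexM c (-(x + 1))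
  rw [show -(x + 1) + 1 = -x by ring] at this
  exact this.imp (fun h => by rw [h]) HexM.flip

/-- The reversed path opens vertical lines to `t t‡`: by straightening, this product consists of the
caps of t and, above them, their shifts as cups. -/
theorem exists_costage_eq (t : Matching) : ∃ W : ℤ,
    (∀ x ≤ -W, (surgeryStage t.bot (-x)).flip.toTL = 1) ∧
      ∀ x, W ≤ x → (surgeryStage t.bot (-x)).flip.toTL = t.toTL * t.ddagger.toTL := by
  obtain ⟨W, h1, h2⟩ := t.bot.exists_stage_eq
  refine ⟨W, fun x hx => ?_, fun x hx => ?_⟩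
  · have := toTL_injective ((h2 (-x) (by omega)).trans TL.one_def)
    rw [this]
    rfl
  · have := h1 (-x) (by omega)
    rw [CupDiagram.upper_mul_lower] at this
    rw [toTL_injective this]
    exact (zigzag_cancel (m := t.bot) (a := t.top) (n := t.bot.shift) t.numCups_eq
      (by rw [CupDiagram.numCups_shift, CupDiagram.numCups_shift, t.numCups_eq])).symm

/-- A stage U satisfies U t = t and U U‡ = U. By the first identity `b U` is again a cup diagram e;
by the second `b U b̄` is `e ē`, which is orientable. -/
theorem inSigma_costage {t : Matching} {b b' : CupDiagram} (h : Moves t b b') (x : ℤ) :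
    InSigma (b.lower.toTL * (surgeryStage t.bot (-x)).flip.toTL * b.upper.toTL) := by
  set U := (surgeryStage t.bot (-x)).flip with hU
  have h1 : U.toTL * t.toTL = t.toTL :=
    zigzag_upper (t.bot.tail_sub (-x)) t.numCups_eq (CupDiagram.numCups_shift _).symm
  have h2 : U.toTL * U.ddagger.toTL = U.toTL :=
    zigzag_cancel (m := t.bot.tail (-x)) (a := (t.bot.tail (-x)).shift) (n := (t.bot.tail (-x)).shift)
      (CupDiagram.numCups_shift _).symm (CupDiagram.numCups_shift _)
  obtain ⟨e, he⟩ := exists_moves_of_mul (t := U) (y := t.toTL) (R := b'.lower)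
    (by rw [mul_assoc, h1]; exact h) rfl
  rw [← h2, mul_assoc, mul_assoc, moves_iff_upper.1 he, ← mul_assoc, he, e.lower_mul_upper]
  exact .sigma _

section Balance

variable {t : Matching} {b b' c c' : CupDiagram}

/-- Consider the grid of costages of t and stages of b. The edge where the costage is 1 and the edge
where the stage is `b̄ b` are always orientable, so orientability on one of the other two edges
implies it on the last. These edges are the two sides of the equivalence. -/
theorem surgeryGood_moves_left_iff (hb : Moves t b b') (hbc : Orientable b [] c) :
    SurgeryGood [t.ddagger] [] b' b c ↔
      ∀ x, InSigma (b.lower.toTL * (surgeryStage t.bot (-x)).flip.toTL * c.upper.toTL) := by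
  rw [orientable_iff_inSigma, TL.prod_nil, mul_one] at hbc
  obtain ⟨W, h1, h2⟩ := exists_costage_eq t
  obtain ⟨W', h1', h2'⟩ := b.exists_stage_eq
  have e0 : ∀ s, b'.lower.toTL * TL.prod [t.ddagger] * stage b s * (TL.prod [] * c.upper.toTL) =
      b.lower.toTL * (t.toTL * t.ddagger.toTL) * 1 * (surgeryStage b s).toTL * c.upper.toTL := by
    intro s
    rw [← show b.lower.toTL * t.toTL = b'.lower.toTL from hb, TL.prod_cons, TL.prod_nil]
    simp only [mul_assoc, mul_one, one_mul, stage]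
  have low1 : ∀ x ≤ -W, ∀ s, InSigma (b.lower.toTL * (surgeryStage t.bot (-x)).flip.toTL * 1 *
      (surgeryStage b s).toTL * c.upper.toTL) := by
    intro x hx s
    rw [h1 x hx, mul_one, mul_one, b.lower_mul_stage]
    exact hbc
  have low2 : ∀ s ≤ -W', ∀ x, InSigma (b.lower.toTL * (surgeryStage t.bot (-x)).flip.toTL * 1 *
      (surgeryStage b s).toTL * c.upper.toTL) := by
    intro s hs x
    rw [h1' s hs, mul_one]
    have := (inSigma_costage hb x).mul hbc
    simpa only [mul_assoc] using this
  constructor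
  · intro h x
    have := grid_right (costage_eq_or_hexM t.bot) (stage_eq_or_hexM b)
      ⟨W, fun x hx s => by rw [h2 x hx, ← e0]; exact h s⟩ ⟨-W', low2⟩ x W'
    rwa [h2' W' le_rfl, mul_one, mul_one] at this
  · intro h s
    have := grid_left (costage_eq_or_hexM t.bot) (stage_eq_or_hexM b) ⟨-W, low1⟩
      ⟨W', fun s hs x => by rw [h2' s hs, mul_one, mul_one]; exact h x⟩ W s
    rwa [e0, ← h2 W le_rfl]

/-- The same argument with the surgery at c below the costage of t. The resulting condition agrees
with that of `surgeryGood_moves_left_iff`, which is what makes the pairing balanced. -/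
theorem surgeryGood_moves_right_iff (hc : Moves t c c') (hbc : Orientable b [] c) :
    SurgeryGood [] [t] b c c' ↔
      ∀ x, InSigma (b.lower.toTL * (surgeryStage t.bot (-x)).flip.toTL * c.upper.toTL) := by
  rw [orientable_iff_inSigma, TL.prod_nil, mul_one] at hbc
  obtain ⟨W, h1, h2⟩ := exists_costage_eq t
  obtain ⟨W', h1', h2'⟩ := c.exists_stage_eq
  have e0 : ∀ s, b.lower.toTL * TL.prod [] * stage c s * (TL.prod [t] * c'.upper.toTL) =
      b.lower.toTL * (surgeryStage c s).toTL * 1 * (t.toTL * t.ddagger.toTL) * c.upper.toTL := by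
    intro s
    rw [← moves_iff_upper.1 hc, TL.prod_cons, TL.prod_nil]
    simp only [mul_assoc, mul_one, one_mul, stage]
  have low1 : ∀ x ≤ -W, ∀ s, InSigma (b.lower.toTL * (surgeryStage c s).toTL * 1 *
      (surgeryStage t.bot (-x)).flip.toTL * c.upper.toTL) := by
    intro x hx s
    rw [h1 x hx, mul_one, mul_one, mul_assoc, c.stage_mul_upper]
    exact hbc
  have low2 : ∀ s ≤ -W', ∀ x, InSigma (b.lower.toTL * (surgeryStage c s).toTL * 1 *
      (surgeryStage t.bot (-x)).flip.toTL * c.upper.toTL) := by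
    intro s hs x
    rw [h1' s hs, mul_one]
    have := hbc.mul (inSigma_costage hc x)
    simpa only [mul_assoc] using this
  constructor
  · intro h x
    have := grid_left (stage_eq_or_hexM c) (costage_eq_or_hexM t.bot) ⟨-W', low2⟩
      ⟨W, fun x hx s => by rw [h2 x hx, ← e0]; exact h s⟩ W' x
    rwa [h2' W' le_rfl, mul_one, mul_one] at this
  · intro h s
    have := grid_right (stage_eq_or_hexM c) (costage_eq_or_hexM t.bot)
      ⟨W', fun s hs x => by rw [h2' s hs, mul_one, mul_one]; exact h x⟩ ⟨-W, low1⟩ s W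
    rwa [e0, ← h2 W le_rfl]

end Balance

/-! ## Adjunctions between tensor functors -/

section Abstract

variable {ι A G G' : Type} [AddCommGroup A] [Module ℂ A] [AddCommGroup G] [Module ℂ G]
  [AddCommGroup G'] [Module ℂ G'] {R : LocUnitalAlgebra ι A}

namespace LUModule

theorem act_e_self (M : LUModule.{u} R) (i : ι) (m : M.carrier) :
    M.act (R.e i) (M.act (R.e i) m) = M.act (R.e i) m := by
  rw [← M.act_mul, R.e_mul_self]

theorem linearMap_ext (M : LUModule.{u} R) {X : Type*} [AddCommGroup X] [Module ℂ X]
    {F F' : M.carrier →ₗ[ℂ] X} (h : ∀ i m, F (M.act (R.e i) m) = F' (M.act (R.e i) m)) : F = F' := by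
  have : (⊤ : Submodule ℂ M.carrier) ≤ LinearMap.eqLocus F F' := by
    rw [← M.unital]
    refine iSup_le fun i => ?_
    rintro _ ⟨m, rfl⟩
    exact h i m
  exact LinearMap.ext fun m => this (x := m) trivial

theorem exists_glue (M : LUModule.{u} R) {X : Type*} [AddCommGroup X] [Module ℂ X]
    (φ : ι → M.carrier →ₗ[ℂ] X) :
    ∃ F : M.carrier →ₗ[ℂ] X, ∀ i m, F (M.act (R.e i) m) = φ i (M.act (R.e i) m) := by
  classical
  let E := LinearEquiv.ofBijective
    (DirectSum.coeLinearMap fun i => LinearMap.range (M.act (R.e i))) M.isInternal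
  refine ⟨DirectSum.toModule ℂ ι X (fun i => φ i ∘ₗ Submodule.subtype _) ∘ₗ E.symm.toLinearMap,
    fun i m => ?_⟩
  have : E.symm (M.act (R.e i) m) = DirectSum.lof ℂ ι (fun i => LinearMap.range (M.act (R.e i))) i
      ⟨M.act (R.e i) m, m, rfl⟩ := by
    rw [LinearEquiv.symm_apply_eq]
    exact (DirectSum.coeLinearMap_lof (fun i => LinearMap.range (M.act (R.e i))) i
      ⟨M.act (R.e i) m, m, rfl⟩).symm
  rw [LinearMap.comp_apply, LinearEquiv.coe_coe, this, DirectSum.toModule_lof]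
  rfl

end LUModule

theorem LocUnitalAlgebra.induction (R : LocUnitalAlgebra ι A) {S : Submodule ℂ A}
    (h : ∀ i a j, R.mul (R.e i) (R.mul a (R.e j)) ∈ S) (a : A) : a ∈ S := by
  have : (⊤ : Submodule ℂ A) ≤ S := by
    rw [← R.complete]
    refine iSup_le fun i => iSup_le fun j => ?_
    rintro _ ⟨a, rfl⟩
    exact h i a j
  exact this trivial

namespace LUBimodule

/-- The class of an elementary tensor. -/
noncomputable def tmk (B : LUBimodule R G) (M : LUModule.{u} R) :
    G →ₗ[ℂ] M.carrier →ₗ[ℂ] (B.tensorObj M).carrier :=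
  (TensorProduct.mk ℂ G M.carrier).compr₂ (B.balanced M).mkQ

theorem tmk_right (B : LUBimodule R G) (M : LUModule.{u} R) (a : A) (g : G) (m : M.carrier) :
    B.tmk M (B.right a g) m = B.tmk M g (M.act a m) :=
  (Submodule.Quotient.eq _).2 (Submodule.subset_span ⟨a, g, m, rfl⟩)

theorem act_tmk (B : LUBimodule R G) (M : LUModule.{u} R) (a : A) (g : G) (m : M.carrier) :
    (B.tensorObj M).act a (B.tmk M g m) = B.tmk M (B.left a g) m := rfl

theorem tensorCarrier_ext (B : LUBimodule R G) (M : LUModule.{u} R) {X : Type*} [AddCommGroup X]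
    [Module ℂ X] {F F' : (B.tensorObj M).carrier →ₗ[ℂ] X} (h : ∀ g m, F (B.tmk M g m) = F' (B.tmk M g m)) :
    F = F' :=
  Submodule.linearMap_qext _ (TensorProduct.ext' h)

/-- The linear map out of a tensor product given by a balanced bilinear map. -/
noncomputable def lift (B : LUBimodule R G) (M : LUModule.{u} R) {X : Type*} [AddCommGroup X]
    [Module ℂ X] (f : G →ₗ[ℂ] M.carrier →ₗ[ℂ] X)
    (h : ∀ a g m, f (B.right a g) m = f g (M.act a m)) : (B.tensorObj M).carrier →ₗ[ℂ] X :=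
  (B.balanced M).liftQ (TensorProduct.lift f) (by
    refine Submodule.span_le.2 ?_
    rintro _ ⟨a, g, m, rfl⟩
    simp [h])

theorem lift_tmk (B : LUBimodule R G) (M : LUModule.{u} R) {X : Type*} [AddCommGroup X]
    [Module ℂ X] (f : G →ₗ[ℂ] M.carrier →ₗ[ℂ] X)
    (h : ∀ a g m, f (B.right a g) m = f g (M.act a m)) (g : G) (m : M.carrier) :
    B.lift M f h (B.tmk M g m) = f g m := rfl

theorem span_tmk (B : LUBimodule R G) (M : LUModule.{u} R) :
    Submodule.span ℂ {z | ∃ g m, B.tmk M g m = z} = ⊤ := by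
  rw [eq_top_iff]
  rintro z -
  obtain ⟨w, rfl⟩ := Submodule.Quotient.mk_surjective _ z
  induction w with
  | zero => exact Submodule.zero_mem _
  | add x y hx hy => exact Submodule.add_mem _ hx hy
  | tmul g m => exact Submodule.subset_span ⟨g, m, rfl⟩

end LUBimodule

/-- A bimodule `G'` dual to the bimodule `G`: a balanced pairing with values in the algebra together
with, for every idempotent, the component of the coevaluation. -/
structure DualPair (B' : LUBimodule R G') (B : LUBimodule R G) where
  pair : G' →ₗ[ℂ] G →ₗ[ℂ] A
  left : ∀ a x y, pair (B'.left a x) y = R.mul a (pair x y)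
  right : ∀ a x y, pair x (B.right a y) = R.mul (pair x y) a
  bal : ∀ a x y, pair (B'.right a x) y = pair x (B.left a y)
  h : ι → G
  g : ι → G'
  tri : ∀ i y, B.right (pair (g i) y) (h i) = B.left (R.e i) y
  tri' : ∀ i x, B'.left (pair x (h i)) (g i) = B'.right (R.e i) x

namespace DualPair

variable {B' : LUBimodule R G'} {B : LUBimodule R G} (D : DualPair B' B)

/-- The map `y ⊗ m ↦ ⟨x, y⟩ m`. -/
noncomputable def evalAux (M : LUModule.{u} R) : G' →ₗ[ℂ] (B.tensorObj M).carrier →ₗ[ℂ] M.carrier where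
  toFun x := B.lift M (M.act ∘ₗ D.pair x) fun a g m => by
    simp only [LinearMap.comp_apply, D.right, M.act_mul]
  map_add' x x' := B.tensorCarrier_ext M fun g m => by simp [LUBimodule.lift_tmk]
  map_smul' c x := B.tensorCarrier_ext M fun g m => by simp [LUBimodule.lift_tmk]

theorem evalAux_tmk (M : LUModule.{u} R) (x : G') (y : G) (m : M.carrier) :
    D.evalAux M x (B.tmk M y m) = M.act (D.pair x y) m := rfl

theorem evalAux_bal (M : LUModule.{u} R) (a : A) (x : G') (z : (B.tensorObj M).carrier) :
    D.evalAux M (B'.right a x) z = D.evalAux M x ((B.tensorObj M).act a z) := by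
  refine LinearMap.congr_fun (f := D.evalAux M (B'.right a x))
    (g := D.evalAux M x ∘ₗ (B.tensorObj M).act a) (B.tensorCarrier_ext M fun y m => ?_) z
  rw [LinearMap.comp_apply, B.act_tmk, evalAux_tmk, evalAux_tmk, D.bal]

/-- The evaluation `x ⊗ y ⊗ m ↦ ⟨x, y⟩ m`. -/
noncomputable def eval (M : LUModule.{u} R) : LUModule.Hom (B'.tensorObj (B.tensorObj M)) M where
  toLin := B'.lift (B.tensorObj M) (D.evalAux M) (D.evalAux_bal M)
  map_act a z := by
    refine LinearMap.congr_fun (f := B'.lift (B.tensorObj M) (D.evalAux M) (D.evalAux_bal M) ∘ₗ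
      (B'.tensorObj (B.tensorObj M)).act a)
      (g := M.act a ∘ₗ B'.lift (B.tensorObj M) (D.evalAux M) (D.evalAux_bal M))
      (B'.tensorCarrier_ext _ fun x w => ?_) z
    rw [LinearMap.comp_apply, LinearMap.comp_apply, B'.act_tmk, B'.lift_tmk, B'.lift_tmk]
    refine LinearMap.congr_fun (f := D.evalAux M (B'.left a x)) (g := M.act a ∘ₗ D.evalAux M x)
      (B.tensorCarrier_ext M fun y m => ?_) w
    rw [LinearMap.comp_apply, evalAux_tmk, evalAux_tmk, D.left, M.act_mul]

theorem eval_tmk (M : LUModule.{u} R) (x : G') (y : G) (m : M.carrier) :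
    (D.eval M).toLin (B'.tmk (B.tensorObj M) x (B.tmk M y m)) = M.act (D.pair x y) m := rfl

/-- The underlying map of the coevaluation `m ↦ h_i ⊗ g_i ⊗ m` for `m ∈ e_i M`. -/
noncomputable def coevAux (M : LUModule.{u} R) :
    M.carrier →ₗ[ℂ] (B.tensorObj (B'.tensorObj M)).carrier :=
  (M.exists_glue fun i => B.tmk (B'.tensorObj M) (D.h i) ∘ₗ B'.tmk M (D.g i)).choose

theorem coevAux_e (M : LUModule.{u} R) (i : ι) (m : M.carrier) :
    D.coevAux M (M.act (R.e i) m) =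
      B.tmk (B'.tensorObj M) (D.h i) (B'.tmk M (D.g i) (M.act (R.e i) m)) :=
  (M.exists_glue fun i => B.tmk (B'.tensorObj M) (D.h i) ∘ₗ B'.tmk M (D.g i)).choose_spec i m

/-- Put b = e_i a. The identity `tri` writes b h_j as h_i times ⟨g_i b, h_j⟩; this scalar of the
algebra crosses the tensor sign, and `tri'` turns it into g_i b e_j. -/
theorem coevAux_act (M : LUModule.{u} R) (i : ι) (a : A) (j : ι) (m : M.carrier) :
    D.coevAux M (M.act (R.mul (R.e i) a) (M.act (R.e j) m)) =
      (B.tensorObj (B'.tensorObj M)).act (R.mul (R.e i) a) (D.coevAux M (M.act (R.e j) m)) := by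
  set b := R.mul (R.e i) a with hb
  have h1 : M.act b (M.act (R.e j) m) = M.act (R.e i) (M.act b (M.act (R.e j) m)) := by
    rw [← M.act_mul (R.e i), hb, ← R.mul_assoc, R.e_mul_self]
  have h2 : B.left b (D.h j) = B.right (D.pair (B'.right b (D.g i)) (D.h j)) (D.h i) := by
    rw [D.bal, D.tri, ← B.left_mul, hb, ← R.mul_assoc, R.e_mul_self]
  rw [h1, D.coevAux_e, ← h1, D.coevAux_e, B.act_tmk, h2, B.tmk_right, B'.act_tmk, D.tri',
    B'.tmk_right, B'.tmk_right, M.act_e_self]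

/-- The coevaluation. -/
noncomputable def coev (M : LUModule.{u} R) : LUModule.Hom M (B.tensorObj (B'.tensorObj M)) where
  toLin := D.coevAux M
  map_act a m := by
    have key : ∀ a, D.coevAux M ∘ₗ M.act a =
        (B.tensorObj (B'.tensorObj M)).act a ∘ₗ D.coevAux M := by
      -- Both sides are linear in a, so it suffices to treat the spanning elements e_i a e_k.
      refine fun a => R.induction (S := LinearMap.eqLocus
        ((LinearMap.llcomp ℂ M.carrier M.carrier ((B.tensorObj (B'.tensorObj M)).carrier)
          (D.coevAux M)) ∘ₗ M.act)
        ((LinearMap.lcomp ℂ ((B.tensorObj (B'.tensorObj M)).carrier) (D.coevAux M)) ∘ₗ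
          (B.tensorObj (B'.tensorObj M)).act)) (fun i a k => ?_) a
      exact M.linearMap_ext fun j m => D.coevAux_act M i _ j m
    exact LinearMap.congr_fun (key a) m

theorem coev_e (M : LUModule.{u} R) (i : ι) (m : M.carrier) :
    (D.coev M).toLin (M.act (R.e i) m) =
      B.tmk (B'.tensorObj M) (D.h i) (B'.tmk M (D.g i) (M.act (R.e i) m)) := D.coevAux_e M i m

/-- Tensoring with a dual bimodule is left adjoint to tensoring. -/
noncomputable def adjunction : B'.tensorFunctor.{u} ⊣ B.tensorFunctor.{u} :=
  Adjunction.mkOfUnitCounit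
    { unit :=
        { app := fun M => D.coev M
          naturality := fun M N f => by
            refine LUModule.Hom.ext (M.linearMap_ext fun i m => ?_)
            change (D.coev N).toLin (LUModule.Hom.toLin f (M.act (R.e i) m)) =
              (B.tensorMap (B'.tensorMap f)).toLin ((D.coev M).toLin (M.act (R.e i) m))
            rw [f.map_act, coev_e, coev_e, ← f.map_act]
            rfl }
      counit :=
        { app := fun M => D.eval M
          naturality := fun M N f => by
            refine LUModule.Hom.ext (B'.tensorCarrier_ext _ fun x z => ?_)
            refine LinearMap.congr_fun (f := D.evalAux N x ∘ₗ (B.tensorMap f).toLin)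
              (g := f.toLin ∘ₗ D.evalAux M x) (B.tensorCarrier_ext M fun y m => ?_) z
            exact (f.map_act _ _).symm }
      left_triangle := by
        ext M : 2
        refine LUModule.Hom.ext (B'.tensorCarrier_ext _ fun x m => ?_)
        change (D.eval (B'.tensorObj M)).toLin (B'.tmk _ x ((D.coev M).toLin m)) = B'.tmk M x m
        refine LinearMap.congr_fun (f := (D.eval (B'.tensorObj M)).toLin ∘ₗ B'.tmk _ x ∘ₗ
          (D.coev M).toLin) (g := B'.tmk M x) (M.linearMap_ext fun i m => ?_) m
        rw [LinearMap.comp_apply, LinearMap.comp_apply, coev_e, eval_tmk, B'.act_tmk, D.tri',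
          B'.tmk_right, M.act_e_self]
      right_triangle := by
        ext M : 2
        refine LUModule.Hom.ext ((B.tensorObj M).linearMap_ext fun i z => ?_)
        change (B.tensorMap (D.eval M)).toLin ((D.coev (B.tensorObj M)).toLin
          ((B.tensorObj M).act (R.e i) z)) = (B.tensorObj M).act (R.e i) z
        rw [coev_e]
        refine LinearMap.congr_fun (f := (B.tensorMap (D.eval M)).toLin ∘ₗ
          B.tmk (B'.tensorObj (B.tensorObj M)) (D.h i) ∘ₗ B'.tmk (B.tensorObj M) (D.g i) ∘ₗ
          (B.tensorObj M).act (R.e i)) (g := (B.tensorObj M).act (R.e i))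
          (B.tensorCarrier_ext M fun y m => ?_) z
        -- After the coevaluation and the evaluation the value of the pairing crosses the tensor
        -- sign, and `tri` finishes.
        change B.tmk M (D.h i) (M.act (D.pair (D.g i) (B.left (R.e i) y)) m) =
          B.tmk M (B.left (R.e i) y) m
        rw [← B.tmk_right, D.tri, ← B.left_mul, R.e_mul_self] }

end DualPair

end Abstract

/-! ## The pairing between `Ĝ_{t‡}` and `Ĝ_t` -/

open Classical in
/-- The pairing of basis vectors: if `t` moves `b` to `b'`, the diagrams `a t‡ b̄` and `b t d̄` are
identified with `a b̄'` and `b' d̄` and multiplied in `K`. -/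
noncomputable def pairBasis (t : Matching) (x y : CupDiagram × CupDiagram) : DiagramSpace :=
  if h : x.2 = y.1 ∧ ∃ b', Moves t x.2 b' then
    surgery [] [] (diag x.1 h.2.choose) (diag h.2.choose y.2) else 0

/-- The bilinear extension of `pairBasis`. -/
noncomputable def pairing (t : Matching) : DiagramSpace →ₗ[ℂ] DiagramSpace →ₗ[ℂ] DiagramSpace :=
  Finsupp.linearCombination ℂ fun x => Finsupp.linearCombination ℂ fun y => pairBasis t x y

theorem pairing_diag_ne (t : Matching) (a : CupDiagram) {b c : CupDiagram} (d : CupDiagram)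
    (h : b ≠ c) : pairing t (diag a b) (diag c d) = 0 := by
  simp [pairing, diag, pairBasis, h]

theorem pairing_diag {t : Matching} {b b' : CupDiagram} (h : Moves t b b') (a d : CupDiagram) :
    pairing t (diag a b) (diag b d) = surgery [] [] (diag a b') (diag b' d) := by
  have e : ∃ b', Moves t b b' := ⟨b', h⟩
  have : pairing t (diag a b) (diag b d) = pairBasis t (a, b) (b, d) := by simp [pairing, diag]
  rw [this, pairBasis, dif_pos ⟨rfl, e⟩, e.choose_spec.unique h]

theorem diag_mem_GHat {a b : CupDiagram} {ts : List Matching} (h : Orientable a ts b) :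
    diag a b ∈ GHat ts := Finsupp.single_mem_supported ℂ _ h

section Moves

variable {t : Matching} {a b b' c d : CupDiagram}

theorem Moves.orientable_left (h : Moves t b b') : Orientable b [t] d ↔ Orientable b' [] d := by
  rw [orientable_iff_inSigma, orientable_iff_inSigma, TL.prod_cons, TL.prod_nil, mul_one, mul_one,
    show b.lower.toTL * t.toTL = b'.lower.toTL from h]

theorem Moves.orientable_right (h : Moves t b b') : Orientable a [t.ddagger] b ↔ Orientable a [] b' := by
  rw [orientable_iff_inSigma, orientable_iff_inSigma, TL.prod_cons, TL.prod_nil, mul_one, mul_one,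
    ← moves_iff_upper.1 h, mul_assoc]

theorem Moves.surgeryGood_left (h : Moves t b b') :
    SurgeryGood [t] [] b c d ↔ SurgeryGood [] [] b' c d := by
  refine forall_congr' fun s => ?_
  rw [TL.prod_cons, TL.prod_nil, mul_one, mul_one,
    show b.lower.toTL * t.toTL = b'.lower.toTL from h]

theorem Moves.surgeryGood_right (h : Moves t b b') :
    SurgeryGood [] [t.ddagger] c d b ↔ SurgeryGood [] [] c d b' := by
  refine forall_congr' fun s => ?_
  rw [TL.prod_cons, TL.prod_nil, mul_one, mul_one, one_mul, ← moves_iff_upper.1 h]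

theorem surgeryGood_idem_left (h : Orientable a [] b) : SurgeryGood [] [] a a b := fun s => by
  rw [TL.prod_nil, mul_one, one_mul, stage, a.lower_mul_stage]
  simpa [TL.prod_nil] using (orientable_iff_inSigma a [] b).1 h

theorem surgeryGood_idem_right (h : Orientable a [] b) : SurgeryGood [] [] a b b := fun s => by
  rw [TL.prod_nil, mul_one, one_mul, stage, mul_assoc, b.stage_mul_upper]
  simpa [TL.prod_nil] using (orientable_iff_inSigma a [] b).1 h

theorem Moves.surgery_left (h : Moves t b b') (hd : Orientable b [t] d) :
    surgery [t] [] (diag b b') (diag b' d) = diag b d := by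
  classical
  rw [surgery_diag_eq, if_pos]
  exact h.surgeryGood_left.2 (surgeryGood_idem_left (h.orientable_left.1 hd))

theorem Moves.surgery_right (h : Moves t b b') (ha : Orientable a [t.ddagger] b) :
    surgery [] [t.ddagger] (diag a b') (diag b' b) = diag a b := by
  classical
  rw [surgery_diag_eq, if_pos]
  exact h.surgeryGood_right.2 (surgeryGood_idem_right (h.orientable_right.1 ha))

theorem Moves.orientable_self_left (h : Moves t b b') : Orientable b [t] b' :=
  h.orientable_left.2 (surgeryWellDefined.idem_orientable b')

theorem Moves.orientable_self_right (h : Moves t b b') : Orientable b' [t.ddagger] b :=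
  h.orientable_right.2 (surgeryWellDefined.idem_orientable b')

end Moves

theorem GHat_induction₂ {ts us : List Matching} {V : Type*} [AddCommGroup V] [Module ℂ V]
    {F F' : DiagramSpace →ₗ[ℂ] DiagramSpace →ₗ[ℂ] V}
    (h : ∀ a b c d, Orientable a ts b → Orientable c us d →
      F (diag a b) (diag c d) = F' (diag a b) (diag c d)) {x y : DiagramSpace} (hx : x ∈ GHat ts)
    (hy : y ∈ GHat us) : F x y = F' x y := by
  refine GHat_induction (p := fun x => F x y = F' x y) (by simp)
    (fun x x' h h' => by simp only [map_add, LinearMap.add_apply, h, h'])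
    (fun k x h => by simp only [map_smul, LinearMap.smul_apply, h]) (fun a b hab => ?_) x hx
  refine GHat_induction (p := fun y => F (diag a b) y = F' (diag a b) y) (by simp)
    (fun x x' h h' => by simp only [map_add, h, h'])
    (fun k x h => by simp only [map_smul, h]) (fun c d hcd => h a b c d hab hcd) y hy

theorem surgery_diag_mem (us ts : List Matching) (a b c d : CupDiagram) :
    surgery us ts (diag a b) (diag c d) = diag a d ∨ surgery us ts (diag a b) (diag c d) = 0 := by
  classical
  by_cases h : b = c
  · subst h
    rw [surgery_diag_eq]
    split_ifs
    · exact Or.inl rfl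
    · exact Or.inr rfl
  · exact Or.inr (surgery_diag_ne _ _ _ _ _ _ h)

theorem pairing_mem_GHat (t : Matching) {x y : DiagramSpace} (hx : x ∈ GHat [t.ddagger])
    (hy : y ∈ GHat [t]) : pairing t x y ∈ GHat [] := by
  -- Membership in `GHat []` is expressed as vanishing in the quotient, so that it can be checked on
  -- basis vectors.
  have := GHat_induction₂ (F := (pairing t).compr₂ (GHat []).mkQ) (F' := 0)
    (fun a b c d hab hcd => ?_) hx hy
  · exact (Submodule.Quotient.mk_eq_zero _).1 this
  refine (Submodule.Quotient.mk_eq_zero _).2 ?_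
  obtain ⟨b', hb⟩ := exists_moves_right hab
  by_cases h : b = c
  · subst h
    rw [pairing_diag hb]
    exact surgery_mem_GHat rfl (diag_mem_GHat (hb.orientable_right.1 hab))
      (diag_mem_GHat (hb.orientable_left.1 hcd))
  · rw [pairing_diag_ne t a d h]
    exact Submodule.zero_mem _

/-- After identifying Ĝ_{t‡} e_b with K e_{b'}, this is associativity in K. -/
theorem pairing_left (t : Matching) {k x y : DiagramSpace} (hk : k ∈ GHat []) (hx : x ∈ GHat [t.ddagger])
    (hy : y ∈ GHat [t]) :
    pairing t (surgery [] [t.ddagger] k x) y = surgery [] [] k (pairing t x y) := by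
  classical
  refine GHat_induction (p := fun k => pairing t (surgery [] [t.ddagger] k x) y =
    surgery [] [] k (pairing t x y)) (by simp)
    (fun x x' h h' => by simp only [map_add, LinearMap.add_apply, h, h'])
    (fun k x h => by simp only [map_smul, LinearMap.smul_apply, h]) (fun a₀ a₁ ha => ?_) k hk
  refine GHat_induction₂ (F := pairing t ∘ₗ surgery [] [t.ddagger] (diag a₀ a₁))
    (F' := (pairing t).compr₂ (surgery [] [] (diag a₀ a₁))) (fun a b c d hab hcd => ?_) hx hy
  simp only [LinearMap.comp_apply, LinearMap.compr₂_apply]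
  obtain ⟨b', hb⟩ := exists_moves_right hab
  have hab' := hb.orientable_right.1 hab
  by_cases h : b = c
  · subst h
    have hbd := hb.orientable_left.1 hcd
    rw [pairing_diag hb, ← surgeryWellDefined.assoc_left [] _ (diag_mem_GHat ha) _
      (diag_mem_GHat hab') _ (diag_mem_GHat hbd)]
    by_cases e : a₁ = a
    · subst e
      rw [surgery_diag_eq, surgery_diag_eq, hb.surgeryGood_right]
      split_ifs
      · exact pairing_diag hb _ _
      · simp
    · rw [surgery_diag_ne _ _ _ _ _ _ e, surgery_diag_ne _ _ _ _ _ _ e]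
      simp
  · rw [pairing_diag_ne t a d h, map_zero]
    rcases surgery_diag_mem [] [t.ddagger] a₀ a₁ a b with e | e
    · rw [e, pairing_diag_ne t _ d h]
    · rw [e, map_zero, LinearMap.zero_apply]

theorem pairing_right (t : Matching) {k x y : DiagramSpace} (hk : k ∈ GHat []) (hx : x ∈ GHat [t.ddagger])
    (hy : y ∈ GHat [t]) :
    pairing t x (surgery [t] [] y k) = surgery [] [] (pairing t x y) k := by
  classical
  refine GHat_induction (p := fun k => pairing t x (surgery [t] [] y k) =
    surgery [] [] (pairing t x y) k) (by simp)
    (fun x x' h h' => by simp only [map_add, h, h'])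
    (fun k x h => by simp only [map_smul, h]) (fun d₀ d₁ hd => ?_) k hk
  refine GHat_induction₂ (F := (pairing t).compl₂ ((surgery [t] []).flip (diag d₀ d₁)))
    (F' := (pairing t).compr₂ ((surgery [] []).flip (diag d₀ d₁))) (fun a b c d hab hcd => ?_) hx hy
  simp only [LinearMap.compl₂_apply, LinearMap.compr₂_apply, LinearMap.flip_apply]
  obtain ⟨b', hb⟩ := exists_moves_right hab
  have hab' := hb.orientable_right.1 hab
  by_cases h : b = c
  · subst h
    have hbd := hb.orientable_left.1 hcd
    rw [pairing_diag hb, surgeryWellDefined.assoc_left [] _ (diag_mem_GHat hab') _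
      (diag_mem_GHat hbd) _ (diag_mem_GHat hd)]
    by_cases e : d = d₀
    · subst e
      rw [surgery_diag_eq, surgery_diag_eq, hb.surgeryGood_left]
      split_ifs
      · exact pairing_diag hb _ _
      · simp
    · rw [surgery_diag_ne _ _ _ _ _ _ e, surgery_diag_ne _ _ _ _ _ _ e]
      simp
  · rw [pairing_diag_ne t a d h, map_zero, LinearMap.zero_apply]
    rcases surgery_diag_mem [t] [] c d d₀ d₁ with e | e
    · rw [e, pairing_diag_ne t _ _ h]
    · rw [e, map_zero]

/-- By linearity over K on the outer sides it suffices to take the generators `b' b̄` and `c c̄'`.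
For these both sides are `b' c̄'` or zero, according to the same condition on the costages of t. -/
theorem pairing_bal (t : Matching) {k x y : DiagramSpace} (hk : k ∈ GHat []) (hx : x ∈ GHat [t.ddagger])
    (hy : y ∈ GHat [t]) :
    pairing t (surgery [t.ddagger] [] x k) y = pairing t x (surgery [] [t] k y) := by
  classical
  refine GHat_induction (p := fun k => pairing t (surgery [t.ddagger] [] x k) y =
    pairing t x (surgery [] [t] k y)) (by simp)
    (fun x x' h h' => by simp only [map_add, LinearMap.add_apply, h, h'])
    (fun k x h => by simp only [map_smul, LinearMap.smul_apply, h]) (fun b c₀ hbc => ?_) k hk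
  refine GHat_induction₂ (F := pairing t ∘ₗ (surgery [t.ddagger] []).flip (diag b c₀))
    (F' := (pairing t).compl₂ (surgery [] [t] (diag b c₀))) (fun a b₀ c d hab hcd => ?_) hx hy
  simp only [LinearMap.compl₂_apply, LinearMap.comp_apply, LinearMap.flip_apply]
  by_cases e : b₀ = b
  swap
  · rw [surgery_diag_ne _ _ _ _ _ _ e, map_zero, LinearMap.zero_apply]
    rcases surgery_diag_mem [] [t] b c₀ c d with h | h
    · rw [h, pairing_diag_ne t _ _ e]
    · rw [h, map_zero]
  by_cases e' : c₀ = c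
  swap
  · rw [surgery_diag_ne _ _ _ _ _ _ e', map_zero]
    rcases surgery_diag_mem [t.ddagger] [] a b₀ b c₀ with h | h
    · rw [h, pairing_diag_ne t _ _ e']
    · rw [h, map_zero, LinearMap.zero_apply]
  subst e e'
  obtain ⟨b', hb⟩ := exists_moves_right hab
  obtain ⟨c', hc⟩ := exists_moves_left hcd
  have hab' := diag_mem_GHat (hb.orientable_right.1 hab)
  have hcd' := diag_mem_GHat (hc.orientable_left.1 hcd)
  have hbb := diag_mem_GHat hb.orientable_self_right
  have hcc := diag_mem_GHat hc.orientable_self_left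
  have hk := diag_mem_GHat hbc
  -- The only place where the comparison of the two opposite surgeries enters.
  have key : pairing t (surgery [t.ddagger] [] (diag b' b₀) (diag b₀ c₀)) (diag c₀ c') =
      pairing t (diag b' b₀) (surgery [] [t] (diag b₀ c₀) (diag c₀ c')) := by
    rw [surgery_diag_eq, surgery_diag_eq, surgeryGood_moves_left_iff hb hbc,
      ← surgeryGood_moves_right_iff hc hbc]
    split_ifs with h
    · have hg := h
      rw [surgeryGood_moves_right_iff hc hbc, ← surgeryGood_moves_left_iff hb hbc] at hg
      have ho : Orientable b' [] c' := hc.orientable_right.1 (by simpa using hg.orientable)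
      rw [pairing_diag hb, pairing_diag hc, surgery_diag_eq, surgery_diag_eq,
        if_pos (surgeryGood_idem_left ho), if_pos (surgeryGood_idem_right ho)]
    · simp
  have m1 := surgery_mem_GHat (rs := [t.ddagger]) rfl hbb hk
  have m2 := surgery_mem_GHat (rs := [t]) rfl hk hcc
  -- The given vectors are multiples of the generators by `a b̄'` on the left and `c' d̄` on the
  -- right.
  calc pairing t (surgery [t.ddagger] [] (diag a b₀) (diag b₀ c₀)) (diag c₀ d)
      = surgery [] [] (diag a b') (pairing t (surgery [t.ddagger] [] (diag b' b₀) (diag b₀ c₀))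
          (surgery [t] [] (diag c₀ c') (diag c' d))) := by
        rw [← pairing_left t hab' m1 (surgery_mem_GHat rfl hcc hcd'),
          ← surgeryWellDefined.assoc_mid _ _ hab' _ hbb _ hk, hb.surgery_right hab,
          hc.surgery_left hcd]
    _ = surgery [] [] (diag a b') (pairing t (diag b' b₀)
          (surgery [t] [] (surgery [] [t] (diag b₀ c₀) (diag c₀ c')) (diag c' d))) := by
        rw [pairing_right t hcd' m1 hcc, key, pairing_right t hcd' hbb m2]
    _ = _ := by
        rw [← pairing_left t hab' hbb (surgery_mem_GHat rfl m2 hcd'), hb.surgery_right hab,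
          surgeryWellDefined.assoc_mid _ _ hk _ hcc _ hcd', hc.surgery_left hcd]

theorem pairing_tri {t : Matching} {b b' : CupDiagram} (h : Moves t b b') {y : DiagramSpace}
    (hy : y ∈ GHat [t]) :
    surgery [t] [] (diag b b') (pairing t (diag b' b) y) = surgery [] [t] (diag b b) y := by
  refine GHat_induction (p := fun y => surgery [t] [] (diag b b') (pairing t (diag b' b) y) =
    surgery [] [t] (diag b b) y) (by simp)
    (fun x x' h h' => by simp only [map_add, h, h'])
    (fun k x h => by simp only [map_smul, h]) (fun c d hcd => ?_) y hy
  by_cases e : b = c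
  · subst e
    rw [surgeryWellDefined.idem_mul _ _ _ hcd, pairing_diag h,
      surgeryWellDefined.idem_mul _ _ _ (h.orientable_left.1 hcd), h.surgery_left hcd]
  · rw [pairing_diag_ne t _ _ e, surgery_diag_ne _ _ _ _ _ _ e, map_zero]

theorem pairing_tri' {t : Matching} {b b' : CupDiagram} (h : Moves t b b') {x : DiagramSpace}
    (hx : x ∈ GHat [t.ddagger]) :
    surgery [] [t.ddagger] (pairing t x (diag b b')) (diag b' b) =
      surgery [t.ddagger] [] x (diag b b) := by
  refine GHat_induction (p := fun x => surgery [] [t.ddagger] (pairing t x (diag b b')) (diag b' b) =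
    surgery [t.ddagger] [] x (diag b b)) (by simp)
    (fun x x' h h' => by simp only [map_add, LinearMap.add_apply, h, h'])
    (fun k x h => by simp only [map_smul, LinearMap.smul_apply, h]) (fun a c hac => ?_) x hx
  by_cases e : c = b
  · subst e
    rw [surgeryWellDefined.mul_idem _ _ _ hac, pairing_diag h,
      surgeryWellDefined.mul_idem _ _ _ (h.orientable_right.1 hac), h.surgery_right hac]
  · rw [pairing_diag_ne t _ _ e, surgery_diag_ne _ _ _ _ _ _ e, map_zero, LinearMap.zero_apply]

/-! ## The dual pairs -/

/-- No diagram `b t d̄` is orientable in this case, so e_b Ĝ_t is zero. -/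
theorem surgery_eq_zero_left {t : Matching} {b : CupDiagram} (h : ¬ ∃ b', Moves t b b')
    {y : DiagramSpace} (hy : y ∈ GHat [t]) : surgery [] [t] (diag b b) y = 0 := by
  refine GHat_induction (p := fun y => surgery [] [t] (diag b b) y = 0) (by simp)
    (fun x x' h h' => by simp only [map_add, h, h', add_zero])
    (fun k x h => by simp only [map_smul, h, smul_zero]) (fun c d hcd => ?_) y hy
  refine surgery_diag_ne _ _ _ _ _ _ fun e => h ?_
  rw [e]
  exact exists_moves_left hcd

theorem surgery_eq_zero_right {t : Matching} {b : CupDiagram} (h : ¬ ∃ b', Moves t b b')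
    {x : DiagramSpace} (hx : x ∈ GHat [t.ddagger]) : surgery [t.ddagger] [] x (diag b b) = 0 := by
  refine GHat_induction (p := fun x => surgery [t.ddagger] [] x (diag b b) = 0) (by simp)
    (fun x x' h h' => by simp only [map_add, LinearMap.add_apply, h, h', add_zero])
    (fun k x h => by simp only [map_smul, LinearMap.smul_apply, h, smul_zero]) (fun a c hac => ?_) x hx
  refine surgery_diag_ne _ _ _ _ _ _ fun e => h ?_
  rw [← e]
  exact exists_moves_right hac

open Classical in
/-- The bimodule `Ĝ_{t‡}` is dual to `Ĝ_t`. -/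
noncomputable def dualPairHat (hw : SurgeryWellDefined) (t : Matching) :
    DualPair (geomBimoduleHat hw [t.ddagger]) (geomBimoduleHat hw [t]) where
  pair := restrictBilin (pairing t) (GHat [t.ddagger]) (GHat [t]) (GHat [])
    fun _ hx _ hy => pairing_mem_GHat t hx hy
  left a x y := Subtype.ext (pairing_left t a.2 x.2 y.2)
  right a x y := Subtype.ext (pairing_right t a.2 x.2 y.2)
  bal a x y := Subtype.ext (pairing_bal t a.2 x.2 y.2)
  -- If `t` does not carry b to a cup diagram, then e_b Ĝ_t and Ĝ_{t‡} e_b vanish, so zero is the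
  -- correct coevaluation.
  h b := if h : ∃ b', Moves t b b' then
    ⟨diag b h.choose, diag_mem_GHat h.choose_spec.orientable_self_left⟩ else 0
  g b := if h : ∃ b', Moves t b b' then
    ⟨diag h.choose b, diag_mem_GHat h.choose_spec.orientable_self_right⟩ else 0
  tri b y := by
    by_cases h : ∃ b', Moves t b b'
    · rw [dif_pos h, dif_pos h]
      exact Subtype.ext (pairing_tri h.choose_spec y.2)
    · rw [dif_neg h, dif_neg h]
      exact (map_zero _).trans (Subtype.ext (surgery_eq_zero_left h y.2).symm)
  tri' b x := by
    by_cases h : ∃ b', Moves t b b'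
    · rw [dif_pos h, dif_pos h]
      exact Subtype.ext (pairing_tri' h.choose_spec x.2)
    · rw [dif_neg h, dif_neg h]
      exact (map_zero _).trans (Subtype.ext (surgery_eq_zero_right h x.2).symm)

theorem pairing_mem_of {t : Matching} {P Q R : Set (CupDiagram × CupDiagram)}
    (h : ∀ x ∈ P, ∀ y ∈ Q, pairBasis t x y ∈ Finsupp.supported ℂ ℂ R)
    {x y : DiagramSpace} (hx : x ∈ Finsupp.supported ℂ ℂ P) (hy : y ∈ Finsupp.supported ℂ ℂ Q) :
    pairing t x y ∈ Finsupp.supported ℂ ℂ R := by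
  rw [pairing, Finsupp.linearCombination_apply, Finsupp.sum, LinearMap.sum_apply]
  refine Submodule.sum_mem _ fun i hi => ?_
  rw [LinearMap.smul_apply, Finsupp.linearCombination_apply, Finsupp.sum]
  refine Submodule.smul_mem _ _ (Submodule.sum_mem _ fun j hj => Submodule.smul_mem _ _ ?_)
  exact h i (hx hi) j (hy hj)

/-- Passing from `a t‡ b̄` to `a b̄'` and from `b t d̄` to `b' d̄` does not change the number of
nested arcs, and the product in K does not decrease it. -/
theorem pairBasis_mem {t : Matching} {x y : CupDiagram × CupDiagram}
    (hx : Orientable x.1 [t.ddagger] x.2) (hy : Orientable y.1 [t] y.2)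
    {R : Set (CupDiagram × CupDiagram)}
    (h : x.2 = y.1 → ∀ i j N : ℕ, x.1.lower.toTL * TL.prod [t.ddagger] * x.2.upper.toTL = (sigma i).toTL →
      y.1.lower.toTL * TL.prod [t] * y.2.upper.toTL = (sigma j).toTL →
      x.1.lower.toTL * TL.prod [] * y.2.upper.toTL = (sigma N).toTL → max i j ≤ N → (x.1, y.2) ∈ R) :
    pairBasis t x y ∈ Finsupp.supported ℂ ℂ R := by
  classical
  rw [pairBasis]
  split_ifs with e
  · have hb := e.2.choose_spec
    revert hb
    generalize e.2.choose = b'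
    intro hb
    have e1 := e.1
    rw [surgery_diag_eq]
    split_ifs with hg
    · obtain ⟨i, hi⟩ := (orientable_iff_inSigma _ _ _).1 (hb.orientable_right.1 hx)
      have hy' := hy
      rw [← e1] at hy'
      obtain ⟨j, hj⟩ := (orientable_iff_inSigma _ _ _).1 (hb.orientable_left.1 hy')
      obtain ⟨N, hN, hle⟩ := hg.exists_le hi hj
      refine Finsupp.single_mem_supported ℂ _ (h e1 i j N ?_ ?_ hN hle)
      · rw [← hi, TL.prod_cons, TL.prod_nil, mul_one, mul_one, ← moves_iff_upper.1 hb, mul_assoc]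
      · rw [← hj, TL.prod_cons, TL.prod_nil, mul_one, mul_one, ← e1,
          show x.2.lower.toTL * t.toTL = b'.lower.toTL from hb]
    · exact Submodule.zero_mem _
  · exact Submodule.zero_mem _

theorem pairing_mem_GTrunc (n : ℕ) (t : Matching) {x y : DiagramSpace}
    (hx : x ∈ GTrunc n [t.ddagger]) (hy : y ∈ GTrunc n [t]) : pairing t x y ∈ GTrunc n [] := by
  refine pairing_mem_of (fun x hx y hy => pairBasis_mem hx.1 hy.1 fun _ i j N _ _ hN _ => ?_) hx hy
  exact ⟨(orientable_iff_inSigma _ _ _).2 ⟨N, hN⟩, hx.2.1, hy.2.2⟩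

theorem pairing_mem_INonProp (n : ℕ) (t : Matching) {x y : DiagramSpace}
    (hx : x ∈ GTrunc n [t.ddagger]) (hy : y ∈ GTrunc n [t])
    (h : x ∈ INonProp n [t.ddagger] ∨ y ∈ INonProp n [t]) : pairing t x y ∈ INonProp n [] := by
  rcases h with h | h
  · refine pairing_mem_of (fun x hx y hy => pairBasis_mem hx.1.1 hy.1 fun e i j N hi hj hN hle => ?_) h hy
    refine ⟨⟨(orientable_iff_inSigma _ _ _).2 ⟨N, hN⟩, hx.1.2.1, hy.2.2⟩, ?_⟩
    have hn := hx.2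
    rw [hasNonPropagating_iff hi, hx.1.2.1, hx.1.2.2] at hn
    rw [hasNonPropagating_iff hN, hx.1.2.1]
    omega
  · refine pairing_mem_of (fun x hx y hy => pairBasis_mem hx.1 hy.1.1 fun e i j N hi hj hN hle => ?_) hx h
    refine ⟨⟨(orientable_iff_inSigma _ _ _).2 ⟨N, hN⟩, hx.2.1, hy.1.2.2⟩, ?_⟩
    have hn := hy.2
    rw [hasNonPropagating_iff hj, hy.1.2.1, hy.1.2.2] at hn
    rw [hasNonPropagating_iff hN, hx.2.1]
    omega

/-! ### Duality for the truncated quotients -/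

section Truncated

variable {n : ℕ} {t : Matching} {b b' : CupDiagram}

theorem Moves.diag_mem_GTrunc_left (h : Moves t b b') (hb : b.numCups = n) (hb' : b'.numCups = n) :
    diag b b' ∈ GTrunc n [t] := Finsupp.single_mem_supported ℂ _ ⟨h.orientable_self_left, hb, hb'⟩

theorem Moves.diag_mem_GTrunc_right (h : Moves t b b') (hb : b.numCups = n) (hb' : b'.numCups = n) :
    diag b' b ∈ GTrunc n [t.ddagger] :=
  Finsupp.single_mem_supported ℂ _ ⟨h.orientable_self_right, hb', hb⟩

/-- Drawing t on top of b never loses cups. If `b'` exists, it has more than n cups, which forces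
more than n nested arcs in every diagram `b t d̄` and hence a non-propagating line. -/
theorem surgery_mem_INonProp_left (hb : b.numCups = n) (h : ¬ ∃ b', Moves t b b' ∧ b'.numCups = n)
    {y : DiagramSpace} (hy : y ∈ GTrunc n [t]) : surgery [] [t] (diag b b) y ∈ INonProp n [t] := by
  refine surgery_mem_of (P := {(b, b)}) (fun i hi j hj => ?_)
    (Finsupp.single_mem_supported ℂ _ rfl) hy
  obtain rfl : i = (b, b) := hi
  unfold surgeryBasis
  split_ifs with e
  · obtain ⟨c, d⟩ := j
    obtain ⟨rfl, -, -⟩ := e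
    refine Finsupp.single_mem_supported ℂ _ ⟨hj, ?_⟩
    obtain ⟨b', hb'⟩ := exists_moves_left hj.1
    obtain ⟨N, hN⟩ := (orientable_iff_inSigma _ _ _).1 (hb'.orientable_left.1 hj.1)
    obtain ⟨M, hM⟩ := (orientable_iff_inSigma _ _ _).1 hj.1
    have h1 := hb'.numCups_le
    have h2 : b'.numCups ≠ n := fun e => h ⟨b', hb', e⟩
    rw [TL.prod_cons, TL.prod_nil, mul_one, show _ * t.toTL = _ from hb'] at hM
    have h3 := lower_numCups_le hM
    refine (hasNonPropagating_iff (N := M) ?_).2 ?_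
    · rw [TL.prod_cons, TL.prod_nil, mul_one, show _ * t.toTL = _ from hb', hM]
    · left
      dsimp only at h1 hb ⊢
      omega
  · exact Submodule.zero_mem _

theorem surgery_mem_INonProp_right (hb : b.numCups = n) (h : ¬ ∃ b', Moves t b b' ∧ b'.numCups = n)
    {x : DiagramSpace} (hx : x ∈ GTrunc n [t.ddagger]) :
    surgery [t.ddagger] [] x (diag b b) ∈ INonProp n [t.ddagger] := by
  refine surgery_mem_of (Q := {(b, b)}) (fun i hi j hj => ?_) hx
    (Finsupp.single_mem_supported ℂ _ rfl)
  obtain rfl : j = (b, b) := hj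
  unfold surgeryBasis
  split_ifs with e
  · obtain ⟨a, c⟩ := i
    obtain ⟨rfl, -, -⟩ := e
    refine Finsupp.single_mem_supported ℂ _ ⟨hi, ?_⟩
    obtain ⟨b', hb'⟩ := exists_moves_right hi.1
    obtain ⟨M, hM⟩ := (orientable_iff_inSigma _ _ _).1 hi.1
    have h1 := hb'.numCups_le
    have h2 : b'.numCups ≠ n := fun e => h ⟨b', hb', e⟩
    have hM' := hM
    rw [TL.prod_cons, TL.prod_nil, mul_one, mul_assoc, moves_iff_upper.1 hb'] at hM
    have h3 := upper_numCups_le hM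
    refine (hasNonPropagating_iff hM').2 ?_
    right
    dsimp only at h1 hb ⊢
    omega
  · exact Submodule.zero_mem _

end Truncated

open Classical in
/-- The bimodule `G_{t‡}` is dual to `G_t`. -/
noncomputable def dualPair (hw : SurgeryWellDefined) (n : ℕ) (t : Matching) :
    DualPair (geomBimodule hw n [t.ddagger]) (geomBimodule hw n [t]) where
  pair := quotBilin (pairing t) (GTrunc n [t.ddagger]) (GTrunc n [t]) (GTrunc n [])
    (INonProp n [t.ddagger]) (INonProp n [t]) (INonProp n [])
    (fun _ hx _ hy => pairing_mem_GTrunc n t hx hy) fun _ hx _ hy => pairing_mem_INonProp n t hx hy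
  left a x y := by
    obtain ⟨a, rfl⟩ := Submodule.Quotient.mk_surjective _ a
    obtain ⟨x, rfl⟩ := Submodule.Quotient.mk_surjective _ x
    obtain ⟨y, rfl⟩ := Submodule.Quotient.mk_surjective _ y
    exact congrArg Submodule.Quotient.mk (Subtype.ext (pairing_left t (GTrunc_le_GHat n _ a.2)
      (GTrunc_le_GHat n _ x.2) (GTrunc_le_GHat n _ y.2)))
  right a x y := by
    obtain ⟨a, rfl⟩ := Submodule.Quotient.mk_surjective _ a
    obtain ⟨x, rfl⟩ := Submodule.Quotient.mk_surjective _ x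
    obtain ⟨y, rfl⟩ := Submodule.Quotient.mk_surjective _ y
    exact congrArg Submodule.Quotient.mk (Subtype.ext (pairing_right t (GTrunc_le_GHat n _ a.2)
      (GTrunc_le_GHat n _ x.2) (GTrunc_le_GHat n _ y.2)))
  bal a x y := by
    obtain ⟨a, rfl⟩ := Submodule.Quotient.mk_surjective _ a
    obtain ⟨x, rfl⟩ := Submodule.Quotient.mk_surjective _ x
    obtain ⟨y, rfl⟩ := Submodule.Quotient.mk_surjective _ y
    exact congrArg Submodule.Quotient.mk (Subtype.ext (pairing_bal t (GTrunc_le_GHat n _ a.2)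
      (GTrunc_le_GHat n _ x.2) (GTrunc_le_GHat n _ y.2)))
  -- When `b'` is missing or has too many cups, e_b G_t and G_{t‡} e_b are zero in the quotients, so
  -- the component is zero.
  h b := if h : ∃ b', Moves t b.1 b' ∧ b'.numCups = n then Submodule.Quotient.mk
    ⟨diag b.1 h.choose, h.choose_spec.1.diag_mem_GTrunc_left b.2 h.choose_spec.2⟩ else 0
  g b := if h : ∃ b', Moves t b.1 b' ∧ b'.numCups = n then Submodule.Quotient.mk
    ⟨diag h.choose b.1, h.choose_spec.1.diag_mem_GTrunc_right b.2 h.choose_spec.2⟩ else 0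
  tri b y := by
    obtain ⟨y, rfl⟩ := Submodule.Quotient.mk_surjective _ y
    by_cases h : ∃ b', Moves t b.1 b' ∧ b'.numCups = n
    · rw [dif_pos h, dif_pos h]
      exact congrArg Submodule.Quotient.mk (Subtype.ext
        (pairing_tri h.choose_spec.1 (GTrunc_le_GHat n _ y.2)))
    · rw [dif_neg h, dif_neg h]
      exact (map_zero _).trans (Eq.symm ((Submodule.Quotient.mk_eq_zero
        ((INonProp n [t]).submoduleOf (GTrunc n [t]))).2 (surgery_mem_INonProp_left b.2 h y.2)))
  tri' b x := by
    obtain ⟨x, rfl⟩ := Submodule.Quotient.mk_surjective _ x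
    by_cases h : ∃ b', Moves t b.1 b' ∧ b'.numCups = n
    · rw [dif_pos h, dif_pos h]
      exact congrArg Submodule.Quotient.mk (Subtype.ext
        (pairing_tri' h.choose_spec.1 (GTrunc_le_GHat n _ x.2)))
    · rw [dif_neg h, dif_neg h]
      exact (map_zero _).trans (Eq.symm ((Submodule.Quotient.mk_eq_zero
        ((INonProp n [t.ddagger]).submoduleOf (GTrunc n [t.ddagger]))).2
        (surgery_mem_INonProp_right b.2 h x.2)))

theorem specialMatching_ddagger (i : ℤ) : (specialMatching i).ddagger = specialMatching (i + 1) := by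
  have : (singleCup i).shift = singleCup (i + 1) := by
    refine CupDiagram.ext (funext fun p => ?_)
    rw [CupDiagram.shift_partner]
    dsimp only [singleCup]
    split_ifs <;> omega
  exact Matching.ext this this

/-! ## Finite-dimensionality -/

section Abstract

variable {ι A G : Type} [AddCommGroup A] [Module ℂ A] [AddCommGroup G] [Module ℂ G]
  {R : LocUnitalAlgebra ι A}

/-- A finitely generated space is a compact element of the lattice of subspaces, so finitely many
idempotents suffice. -/
theorem LUModule.exists_finset_of_finiteDimensional (M : LUModule.{u} R)
    [FiniteDimensional ℂ M.carrier] :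
    ∃ s : Finset ι, ⨆ i ∈ s, LinearMap.range (M.act (R.e i)) = ⊤ := by
  have hc : IsCompactElement (⊤ : Submodule ℂ M.carrier) :=
    (Submodule.fg_iff_compact _).1 Module.Finite.fg_top
  obtain ⟨s, hs⟩ := CompleteLattice.IsCompactElement.exists_finset_of_le_iSup _ hc
    (fun i => LinearMap.range (M.act (R.e i))) M.unital.ge
  exact ⟨s, top_le_iff.1 hs⟩

/-- Finitely many idempotents e_i span M. Since g ⊗ e_i m = g e_i ⊗ m, the tensor product is the sum
of the images of the finite-dimensional spaces G e_i ⊗ M for these i. -/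
theorem LUBimodule.finiteDimensional_tensorObj (B : LUBimodule R G) (M : LUModule.{u} R)
    [FiniteDimensional ℂ M.carrier]
    (hB : ∀ i, FiniteDimensional ℂ (LinearMap.range (B.right (R.e i)))) :
    FiniteDimensional ℂ (B.tensorObj M).carrier := by
  obtain ⟨s, hs⟩ := M.exists_finset_of_finiteDimensional
  let W : ι → Submodule ℂ (B.tensorObj M).carrier := fun i => LinearMap.range
    (TensorProduct.lift ((B.tmk M).domRestrict (LinearMap.range (B.right (R.e i)))))
  have hW : ∀ i, FiniteDimensional ℂ (W i) := fun i => inferInstance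
  have htop : ⨆ i ∈ s, W i = ⊤ := by
    rw [eq_top_iff, ← B.span_tmk M]
    refine Submodule.span_le.2 ?_
    rintro _ ⟨g, m, rfl⟩
    have hle : ⨆ i ∈ s, LinearMap.range (M.act (R.e i)) ≤ (⨆ i ∈ s, W i).comap (B.tmk M g) := by
      refine iSup₂_le fun i hi => ?_
      rintro _ ⟨m, rfl⟩
      refine Submodule.mem_iSup_of_mem i (Submodule.mem_iSup_of_mem hi ?_)
      exact ⟨(⟨B.right (R.e i) g, g, rfl⟩ : LinearMap.range (B.right (R.e i))) ⊗ₜ m, B.tmk_right M _ g m⟩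
    exact hle (hs.ge trivial)
  have : FiniteDimensional ℂ (⨆ i ∈ s, W i : Submodule ℂ (B.tensorObj M).carrier) :=
    Finset.sup_eq_iSup s W ▸ Submodule.finiteDimensional_finset_sup s W
  rw [htop] at this
  exact Module.finite_def.2 ((Submodule.fg_top _).1 (Module.finite_def.1 this))

end Abstract

/-! ### Finiteness of the set of diagrams without non-propagating lines -/

namespace CupDiagram

/-- All positions below a cup are ends of cups, so the number of cups bounds the length of each. -/
theorem partner_sub_le (a : CupDiagram) (p : ℤ) : a.partner p ≤ p + 2 * a.numCups := by
  rcases le_or_gt (a.partner p) p with h | h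
  · omega
  have hsub : Finset.Icc p (a.partner p) ⊆ a.endpoints := by
    intro k hk
    rw [Finset.mem_Icc] at hk
    rw [mem_endpoints]
    rcases eq_or_lt_of_le hk.1 with rfl | h1
    · omega
    rcases eq_or_lt_of_le hk.2 with rfl | h2
    · rw [a.partner_partner]; omega
    · exact (a.nested p k h1 h2).1
  have := Finset.card_le_card hsub
  rw [Int.card_Icc, a.card_endpoints] at this
  omega

/-- Cups have bounded length and touch S, so all their ends lie in a finite set; the finite graph of
the partner map on the ends determines the diagram. -/
theorem finite_setOf_touching (n : ℕ) (S : Finset ℤ) :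
    {a : CupDiagram | a.numCups = n ∧ ∀ p, a.partner p ≠ p → p ∈ S ∨ a.partner p ∈ S}.Finite := by
  classical
  let T : Finset ℤ := S.biUnion fun p => Finset.Icc (p - 2 * n) (p + 2 * n)
  refine Set.Finite.of_finite_image (f := fun a => a.endpoints.image fun p => (p, a.partner p))
    ((T ×ˢ T).powerset.finite_toSet.subset ?_) ?_
  · rintro _ ⟨a, ⟨hn, ha⟩, rfl⟩
    rw [Finset.mem_coe, Finset.mem_powerset]
    intro x hx
    obtain ⟨p, hp, rfl⟩ := Finset.mem_image.1 hx
    rw [mem_endpoints] at hp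
    have h1 := a.partner_sub_le p
    have h2 := a.partner_sub_le (a.partner p)
    rw [a.partner_partner] at h2
    have hT : ∀ q ∈ S, ∀ r, q - 2 * n ≤ r → r ≤ q + 2 * n → r ∈ T := fun q hq r h1 h2 =>
      Finset.mem_biUnion.2 ⟨q, hq, Finset.mem_Icc.2 ⟨h1, h2⟩⟩
    rw [Finset.mem_product]
    dsimp only
    rcases ha p hp with h | h
    · exact ⟨hT p h _ (by omega) (by omega), hT p h _ (by omega) (by omega)⟩
    · exact ⟨hT _ h _ (by omega) (by omega), hT _ h _ (by omega) (by omega)⟩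
  · intro a _ b _ hab
    have mem : ∀ (c : CupDiagram) (p q : ℤ), (p, q) ∈ (c.endpoints.image fun p => (p, c.partner p)) ↔
        c.partner p ≠ p ∧ c.partner p = q := by
      intro c p q
      simp only [Finset.mem_image, Prod.mk.injEq, mem_endpoints]
      constructor
      · rintro ⟨r, h1, rfl, h2⟩
        exact ⟨h1, h2⟩
      · rintro ⟨h1, h2⟩
        exact ⟨p, h1, rfl, h2⟩
    dsimp only at hab
    refine CupDiagram.ext (funext fun p => ?_)
    by_cases hp : a.partner p = p
    · by_contra hne
      have h1 := (mem b p (b.partner p)).2 ⟨fun e => hne (hp.trans e.symm), rfl⟩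
      rw [← hab, mem] at h1
      exact h1.1 hp
    · have h1 := (mem a p (a.partner p)).2 ⟨hp, rfl⟩
      rw [hab, mem] at h1
      exact h1.2.symm

end CupDiagram

/-- Write `t b̄` as a cap diagram `ē`. A cup of a touching no cap of `ē` would be a non-propagating
line at the top of `a ē`, hence N would exceed n or the number of caps of `ē`. But N ≤ n, and `ē`
has at least n caps. So every cup of a touches the finitely many ends of caps of `ē`. -/
theorem finite_propagating (n : ℕ) (t : Matching) (b : CupDiagram) (hb : b.numCups = n) :
    {a : CupDiagram | Orientable a [t] b ∧ a.numCups = n ∧ ¬ HasNonPropagating a [t] b}.Finite := by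
  by_cases he : ∃ e : CupDiagram, t.toTL * b.upper.toTL = e.upper.toTL
  swap
  · refine Set.finite_empty.subset fun a ha => he (exists_upper_of_orientable ha.1)
  obtain ⟨e, he⟩ := he
  refine (CupDiagram.finite_setOf_touching n e.shift.endpoints).subset fun a ⟨ha, hn, hp⟩ => ?_
  refine ⟨hn, fun p hmoved => ?_⟩
  by_contra hcon
  push Not at hcon
  rw [CupDiagram.mem_endpoints, CupDiagram.mem_endpoints, not_not, not_not] at hcon
  obtain ⟨N, hN⟩ := (orientable_iff_inSigma _ _ _).1 ha
  rw [hasNonPropagating_iff hN] at hp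
  rw [TL.prod_cons, TL.prod_nil, mul_one, mul_assoc, he] at hN
  have h1 := upper_numCups_le hN
  have h2 : b.numCups ≤ e.numCups := CupDiagram.le_of_nest_sub (top_sub_of_mul he)
  refine absurd ((hasNonPropagating_iff (a := a) (ts := []) (b := e) (N := N)
    (by rw [TL.prod_nil, mul_one, hN])).1 (Or.inr ⟨p, a.partner p, hcon.1, hcon.2, hmoved.symm, ?_⟩)) ?_
  · exact Relation.EqvGen.rel _ _ (.cup p)
  · omega

theorem finiteDimensional_range_right (hw : SurgeryWellDefined) (n : ℕ) (t : Matching)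
    (b : {l : CupDiagram // l.numCups = n}) : FiniteDimensional ℂ
      (LinearMap.range ((geomBimodule hw n [t]).right ((khovanovQuotient hw n).e b))) := by
  classical
  -- The default value zero is not used for the diagrams that span the image, since those lie in the
  -- truncation.
  let f : CupDiagram → GQuot n [t] := fun a =>
    if h : diag a b.1 ∈ GTrunc n [t] then Submodule.Quotient.mk ⟨diag a b.1, h⟩ else 0
  have hfin := (finite_propagating n t b.1 b.2).image f
  have := FiniteDimensional.span_of_finite ℂ hfin
  refine Submodule.finiteDimensional_of_le (S₂ := Submodule.span ℂ (f '' {a | Orientable a [t] b.1 ∧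
    a.numCups = n ∧ ¬ HasNonPropagating a [t] b.1})) ?_
  rw [LinearMap.range_eq_map, Submodule.map_le_iff_le_comap]
  refine (eq_top_of_mk_diag_mem _ fun a c hac hd => ?_).ge
  have hmul : (geomBimodule hw n [t]).right ((khovanovQuotient hw n).e b)
      (Submodule.Quotient.mk ⟨diag a c, hd⟩) = Submodule.Quotient.mk
        ⟨surgery [t] [] (diag a c) (diag b.1 b.1),
          surgery_mem_GTrunc rfl hd (diag_mem_GTrunc hw b.2)⟩ := rfl
  rw [Submodule.mem_comap, hmul]
  by_cases hcb : c = b.1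
  · subst hcb
    have h1 : (⟨surgery [t] [] (diag a b.1) (diag b.1 b.1),
          surgery_mem_GTrunc rfl hd (diag_mem_GTrunc hw b.2)⟩ : ↥(GTrunc n [t])) = ⟨diag a b.1, hd⟩ :=
      Subtype.ext (hw.mul_idem _ _ _ hac.1)
    rw [h1]
    by_cases hp : HasNonPropagating a [t] b.1
    · have : (Submodule.Quotient.mk ⟨diag a b.1, hd⟩ : GQuot n [t]) = 0 :=
        (Submodule.Quotient.mk_eq_zero ((INonProp n [t]).submoduleOf (GTrunc n [t]))).2
          (Finsupp.single_mem_supported ℂ _ ⟨hac, hp⟩)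
      rw [this]
      exact Submodule.zero_mem _
    · refine Submodule.subset_span ⟨a, ⟨hac.1, hac.2.1, hp⟩, ?_⟩
      exact dif_pos hd
  · have h1 : (⟨surgery [t] [] (diag a c) (diag b.1 b.1),
          surgery_mem_GTrunc rfl hd (diag_mem_GTrunc hw b.2)⟩ : ↥(GTrunc n [t])) = 0 :=
      Subtype.ext (surgery_diag_ne _ _ _ _ _ _ hcb)
    rw [h1]
    exact Submodule.zero_mem _

/-! ### The adjunctions and their restriction to finite-dimensional modules -/

theorem mainTheorem9 :
    ∃ h : SurgeryWellDefined,
      (∀ t : Matching, Nonempty (thetaHat.{u} h t.ddagger ⊣ thetaHat.{u} h t)) ∧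
      (∀ i : ℤ, Nonempty (thetaHat.{u} h (specialMatching (i + 1)) ⊣
        thetaHat.{u} h (specialMatching i))) ∧
      (∀ (n : ℕ) (t : Matching), Nonempty (theta.{u} h n t.ddagger ⊣ theta.{u} h n t)) ∧
      (∀ (n : ℕ) (i : ℤ), Nonempty (theta.{u} h n (specialMatching (i + 1)) ⊣
        theta.{u} h n (specialMatching i))) ∧
      (∀ (n : ℕ) (t : Matching) (M : LUModule.{u} (khovanovQuotient h n)),
        FiniteDimensional ℂ M.carrier →
          FiniteDimensional ℂ ((theta.{u} h n t).obj M).carrier) := by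
  refine ⟨surgeryWellDefined, fun t => ⟨(dualPairHat _ t).adjunction⟩, fun i => ?_,
    fun n t => ⟨(dualPair _ n t).adjunction⟩, fun n i => ?_, fun n t M hM => ?_⟩
  · rw [← specialMatching_ddagger]
    exact ⟨(dualPairHat _ _).adjunction⟩
  · rw [← specialMatching_ddagger]
    exact ⟨(dualPair _ n _).adjunction⟩
  · exact (geomBimodule _ n [t]).finiteDimensional_tensorObj M
      (finiteDimensional_range_right _ n t)
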